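/- **Conventions.** Products of loops are read from right to left ($uv$ means: first $v$, then $u$), and $[u,v]=uvu^{-1}v^{-1}$. **The surfaces.** For $k\ge 1$ let $\Sigma_k$ be the closed oriented genus $k$ surface obtained from $k$ unit squares, indexed cyclically by $i=1,\dots,k$, with coordinates $(s,t)\in[0,1]^2$, by gluing (by translations) the right side of each square to its own left side, the part $s\ge\frac12$ of its top side to the same part of its own bottom side, and the part $s\le\frac12$ of its top side to the same part of the bottom side of the next square. (This is a connected sum of $k$ tori, glued cyclically along the slit $\{t=0,\ s\le \frac12\}$; it has $2$ vertices, $3k$ edges and $k$ faces.) Its area form is $ds\wedge dt$ away from the two vertices. The base point is the vertex $(\frac12,0)$, common to all squares. In the $i$-th square let $x_i=\{t=\frac14\}$, oriented by increasing $s$, and $y_i=\{s=\frac58\}$, oriented by increasing $t$, so $x_i\cap y_i=p_i=(\frac58,\frac14)$; these are standard symplectic generators. Let $X_i=\{t=\frac12\}$ and $X_i'=\{t=\frac34\}$ be parallel copies of $x_i$, and $Y_i=\{s=\frac34\}$ and $Y_i'=\{s=\frac78\}$ parallel copies of $y_i$. Let $\beta_i$ be the straight arc from the base point to $p_i$ in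 the $i$-th square, $\tilde x_i=\beta_i^{-1}x_i\beta_i$ and $\tilde y_i=\beta_i^{-1}y_i\beta_i$ (first $\beta_i$, then the curve, then back). Let $F=\Sigma_k$ with base point $f$. On $\Sigma_2$ (coordinates $(u,v)$) the corresponding objects are written $a_j,b_j,A_j,A_j',B_j,B_j',\tilde a_j,\tilde b_j$ instead of $x_j,y_j,X_j,X'_j,Y_j,Y_j',\tilde x_j,\tilde y_j$ ($j=1,2$). On the torus $\Sigma_1$ they are written $a,b,A,A'$ without indices. Products $F\times G$ carry the product symplectic form $ds\wedge dt+du\wedge dv$. A loop $\gamma$ of $F$ also denotes $\gamma\times\{g\}$, and a loop $\gamma$ of $G$ also denotes $\{f\}\times\gamma$. **Neighbourhoods.** Around a curve $C=\{t=c\}$ use coordinates $(\theta,r)=(s,t-c)$, and around $C=\{s=c\}$ use $(\theta,r)=(t,c-s)$; so $ds\wedge dt=d\theta\wedge dr$. For a product torus $C\times C'$ with coordinates $(\theta,r)$ and $(\varphi,q)$ and for $0<\varepsilon<\frac1{16}$, let its open tubular neighbourhood be $\{r^2+q^2<\varepsilon^2\}$. On the boundary $\{r^2+q^2=\varepsilon^2\}$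 consider, based at $\theta=\varphi=q=0$, $r=\varepsilon$, the meridian $\mu$ ($\theta=\varphi=0$, and $(r,q)$ runs once around the circle) and the Lagrangian push-offs of $C$ and of $C'$ ($\theta$, respectively $\varphi$, runs once from $0$ to $1$ with $(r,q)=(\varepsilon,0)$). Below, "$\mu=\cdot,\ m=\cdot,\ \ell=\cdot$" means that the neighbourhood boundary lies in the complement considered, that its fundamental group is generated by $\mu,m,\ell$, and that there is one path from $(f,g)$ to the boundary, inside the complement, along which $\mu,m,\ell$ represent the stated elements. **(1) Punctured torus.** Let $G$ be the torus $\Sigma_1$ minus the open round disc of radius $\frac1{16}$ about $(\frac14,\frac18)$, with base point $g=a\cap b$, and $\tilde a=\{f\}\times a$, $\tilde b=\{f\}\times b$. The closed tubular neighbourhoods of the tori $T_i=X_i\times A$ and $L_i=Y_i\times A'$ ($1\le i\le k$) are pairwise disjoint; these tori and their parallel copies ($r,q$ constant) are Lagrangian, and the symplectic form near them is $d\theta\wedge dr+d\varphi\wedge dq$. If $N$ is the union of the open neighbourhoods, then $\pi_1(F\times G-N,(f,g))$ is normally generated by $\tilde x_1,\tilde y_1,\dots,\tilde x_k,\tilde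 y_k,\tilde a,\tilde b$, and for all $i$ $$\mu_{T_i}=[\tilde b^{-1},\tilde y_i^{-1}],\quad m_{T_i}=\tilde x_i,\quad \ell_{T_i}=\tilde a,$$ $$\mu_{L_i}=[\tilde x_i^{-1},\tilde b],\quad m_{L_i}=\tilde y_i,\quad \ell_{L_i}=\tilde b\tilde a\tilde b^{-1}.$$ Here $m$ is the push-off of the curve in $F$ and $\ell$ that of the curve in $G$. **(2) Genus two.** Let $G=\Sigma_2$ with base point $g=(\frac12,0)$. The closed tubular neighbourhoods of the tori $$T_i=X_i\times A_1,\quad L_i=Y_i\times A_1'\quad(1\le i\le k),\quad J_1=Y_1\times A_2,\quad J_2=Y_1'\times B_2$$ are pairwise disjoint; these tori and their parallel copies are Lagrangian, and the symplectic form near them is $d\theta\wedge dr+d\varphi\wedge dq$. If $N$ is the union of the open neighbourhoods, then $\pi_1(F\times G-N,(f,g))$ is normally generated by $\tilde x_1,\tilde y_1,\dots,\tilde x_k,\tilde y_k,\tilde a_1,\tilde b_1,\tilde a_2,\tilde b_2$, and $$\mu_{T_i}=[\tilde b_1^{-1},\tilde y_i^{-1}],\quad m_{T_i}=\tilde x_i,\quad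 \ell_{T_i}=\tilde a_1,$$ $$\mu_{L_i}=[\tilde x_i^{-1},\tilde b_1],\quad m_{L_i}=\tilde y_i,\quad \ell_{L_i}=\tilde b_1\tilde a_1\tilde b_1^{-1},$$ $$\mu_{J_1}=[\tilde x_1^{-1},\tilde b_2^{-1}],\quad m_{J_1}=\tilde a_2,\quad \ell_{J_1}=\tilde y_1,$$ $$\mu_{J_2}=[\tilde a_2^{-1},\tilde x_1],\quad m_{J_2}=\tilde b_2,\quad \ell_{J_2}=\tilde x_1\tilde y_1\tilde x_1^{-1}.$$ Here $m$ is the push-off of the curve in $F$ and $\ell$ that of the curve in $G$ for $T_i,L_i$, and the other way round for $J_1,J_2$. Moreover $[\tilde b_2,\tilde y_i]=1$ for all $i$. In (1) and (2) the meridians of $T_i$ and $J_1$ run counterclockwise in the $(r,q)$-plane, those of $L_i$ and $J_2$ clockwise. -/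

import Mathlib

open scoped unitInterval commutatorElement

namespace SurfaceProduct

noncomputable section

/-! ### The closed surface of genus `k`

Take `k` unit squares, indexed cyclically by `ZMod k`, with coordinates `(s, t)`. Glue the right side
of every square to its own left side, the right half of its top side to the right half of its own
bottom side, and the left half of its top side to the left half of the bottom side of the next
square, always by translations. This is the connected sum of `k` tori glued cyclically along a
slit (the `k`-fold cyclic cover of a torus branched over the two end points of the slit).
It has 2 vertices, `3 k` edges and `k` faces, so Euler characteristic `2 - 2 k`, and it is oriented and
connected: for `k ≥ 1` it is the closed oriented surface of genus `k`. Away from the two vertices it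
carries the area form `ds ∧ dt`. -/

/-- The elementary side identifications. -/
inductive Glue (k : ℕ) : ZMod k × (I × I) → ZMod k × (I × I) → Prop
  | side (i : ZMod k) (t : I) : Glue k (i, (1, t)) (i, (0, t))
  | slit (i : ZMod k) (s : I) (h : (s : ℝ) ≤ 1 / 2) : Glue k (i, (s, 1)) (i + 1, (s, 0))
  | edge (i : ZMod k) (s : I) (h : 1 / 2 ≤ (s : ℝ)) : Glue k (i, (s, 1)) (i, (s, 0))

/-- The closed oriented surface of genus `k` (for `k ≥ 1`), with the quotient topology. -/
def Surface (k : ℕ) : Type := Quot (Glue k)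

instance (k : ℕ) : TopologicalSpace (Surface k) :=
  inferInstanceAs (TopologicalSpace (Quot (Glue k)))

variable {k m : ℕ}

/-- The point with coordinates `p` in the `i`-th square; used for `p` in the unit square
(other values of `p` are first projected to the square). -/
def pt (i : ZMod k) (p : ℝ × ℝ) : Surface k :=
  Quot.mk _ (i, (Set.projIcc 0 1 zero_le_one p.1, Set.projIcc 0 1 zero_le_one p.2))

@[fun_prop]
theorem continuous_pt (i : ZMod k) : Continuous (pt i) := by
  refine continuous_quot_mk.comp ?_
  have : Continuous (Set.projIcc (0 : ℝ) 1 zero_le_one) := continuous_projIcc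
  fun_prop

theorem pt_side (i : ZMod k) (t : ℝ) : pt i (1, t) = pt i (0, t) := by
  have : (Quot.mk _ _ : Surface k) = Quot.mk _ _ := Quot.sound (Glue.side i (Set.projIcc 0 1 zero_le_one t))
  simp only [Set.projIcc_left, Set.projIcc_right, pt]
  exact this

theorem pt_edge (i : ZMod k) {s : ℝ} (hs : 1 / 2 ≤ s) : pt i (s, 1) = pt i (s, 0) := by
  have h : 1 / 2 ≤ ((Set.projIcc 0 1 zero_le_one s : I) : ℝ) := by
    rw [Set.coe_projIcc]
    exact le_max_of_le_right (le_min (by norm_num) hs)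
  have : (Quot.mk _ _ : Surface k) = Quot.mk _ _ := Quot.sound (Glue.edge i _ h)
  simp only [Set.projIcc_left, Set.projIcc_right, pt]
  exact this

theorem pt_slit (i : ZMod k) {s : ℝ} (hs : s ≤ 1 / 2) : pt i (s, 1) = pt (i + 1) (s, 0) := by
  have h : ((Set.projIcc 0 1 zero_le_one s : I) : ℝ) ≤ 1 / 2 := by
    rw [Set.coe_projIcc]
    exact max_le (by norm_num) ((min_le_right _ _).trans hs)
  have : (Quot.mk _ _ : Surface k) = Quot.mk _ _ := Quot.sound (Glue.slit i _ h)
  simp only [Set.projIcc_left, Set.projIcc_right, pt]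
  exact this

/-- The base point: the end point `(1/2, 0)` of the slit, which is common to all squares. -/
def base (k : ℕ) : Surface k := pt 0 (1 / 2, 0)

theorem pt_base (i : ZMod k) : pt i (1 / 2, 0) = base k := by
  have step : ∀ j : ZMod k, pt (j + 1) (1 / 2, 0) = pt j (1 / 2, 0) := fun j => by
    rw [← pt_slit j le_rfl, pt_edge j le_rfl]
  obtain ⟨n, rfl⟩ := ZMod.intCast_surjective i
  induction n using Int.induction_on with
  | zero => simp [base]
  | succ n ih => rw [← ih]; push_cast; exact step _
  | pred n ih => rw [← ih, ← step]; push_cast; ring_nf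

/-! ### Loops on the surface -/

/-- The straight segment from `p` to `q` in the `i`-th square. -/
def seg (i : ZMod k) (p q : ℝ × ℝ) : Path (pt i p) (pt i q) where
  toFun τ := pt i (AffineMap.lineMap p q (τ : ℝ))
  continuous_toFun := by
    refine (continuous_pt i).comp ?_
    exact (AffineMap.lineMap_continuous).comp continuous_subtype_val
  source' := by simp
  target' := by simp

/-- The closed horizontal curve through `(s, t)`, run once in the direction of increasing `s`. -/
def hLoop (i : ZMod k) (s t : ℝ) : Path (pt i (s, t)) (pt i (s, t)) :=
  (seg i (s, t) (1, t)).trans ((seg i (0, t) (s, t)).cast (pt_side i t) rfl)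

/-- The closed vertical curve through `(s, t)`, off the slit, run once in the direction of
increasing `t`. -/
def vLoop (i : ZMod k) (s t : ℝ) (hs : 1 / 2 ≤ s) : Path (pt i (s, t)) (pt i (s, t)) :=
  (seg i (s, t) (s, 1)).trans ((seg i (s, 0) (s, t)).cast (pt_edge i hs) rfl)

/-- The simple closed curve `x_i` (or `a_i`): `t = 1/4`, based at `p_i = (5/8, 1/4)`. -/
def xLoop (i : ZMod k) : Path (pt i (5 / 8, 1 / 4)) (pt i (5 / 8, 1 / 4)) := hLoop i (5 / 8) (1 / 4)

/-- The simple closed curve `y_i` (or `b_i`): `s = 5/8`, based at `p_i = (5/8, 1/4)`. -/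
def yLoop (i : ZMod k) : Path (pt i (5 / 8, 1 / 4)) (pt i (5 / 8, 1 / 4)) :=
  vLoop i (5 / 8) (1 / 4) (by norm_num)

/-- The arc `β_i` (or `γ_i`) from the base point to `p_i = x_i ∩ y_i`. -/
def arc (i : ZMod k) : Path (base k) (pt i (5 / 8, 1 / 4)) :=
  (seg i (1 / 2, 0) (5 / 8, 1 / 4)).cast (pt_base i).symm rfl

/-- The loop `x̃_i`: first `β_i`, then `x_i`, then back along `β_i`. -/
def xTilde (i : ZMod k) : Path (base k) (base k) := (arc i).trans ((xLoop i).trans (arc i).symm)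

/-- The loop `ỹ_i`: first `β_i`, then `y_i`, then back along `β_i`. -/
def yTilde (i : ZMod k) : Path (base k) (base k) := (arc i).trans ((yLoop i).trans (arc i).symm)

/-! ### Curves, tori, tubular neighbourhoods -/

/-- Simple closed curves used to build tori: a horizontal curve `t = c` or a vertical curve `s = c`
(off the slit) in a square. They keep flat distance at least `1/16` from the horizontal, respectively
vertical, edges of the gluing pattern and from the slit. -/
inductive Curve (k : ℕ) : Type
  | horiz (i : ZMod k) (c : ℝ) (h : c ∈ Set.Icc (1 / 16 : ℝ) (15 / 16)) : Curve k
  | vert (i : ZMod k) (c : ℝ) (h : c ∈ Set.Icc (9 / 16 : ℝ) (15 / 16)) : Curve k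

namespace Curve

/-- The square that contains the curve. -/
def sheet : Curve k → ZMod k
  | horiz i _ _ => i
  | vert i _ _ => i

/-- Annular coordinates `(θ, r)` around the curve, expressed in the coordinates `(s, t)` of its square:
`θ` runs along the curve in the positive direction and `r` is the signed distance to the curve;
`ds ∧ dt = dθ ∧ dr`. -/
def coord : Curve k → ℝ × ℝ → ℝ × ℝ
  | horiz _ c _, x => (x.1, c + x.2)
  | vert _ c _, x => (c - x.2, x.1)

/-- The point with annular coordinates `(θ, r)`, for `0 ≤ θ ≤ 1` and `|r| ≤ 1/16`. For fixed `r` this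
runs through the parallel copy of the curve at signed distance `r`. -/
def point (C : Curve k) (θ r : ℝ) : Surface k := pt C.sheet (C.coord (θ, r))

@[fun_prop]
theorem continuous_coord (C : Curve k) : Continuous C.coord := by
  cases C <;> (unfold coord; fun_prop)

theorem continuous_point (C : Curve k) : Continuous fun x : ℝ × ℝ => C.point x.1 x.2 := by
  unfold point; fun_prop

theorem point_one (C : Curve k) {r : ℝ} (hr : r ≤ 1 / 16) : C.point 1 r = C.point 0 r := by
  cases C with
  | horiz i c h => exact pt_side i _
  | vert i c h => exact pt_edge i (by have := h.1; linarith)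

/-- Flat distance to the curve, truncated at `1/16` (an auxiliary function for the facts below). -/
def dist : Curve k → Surface k → ℝ
  | horiz i c h => Quot.lift (fun z => open Classical in
      if z.1 = i then min |(z.2.2 : ℝ) - c| (1 / 16) else 1 / 16) (by
        have h1 : (1 / 16 : ℝ) ≤ |1 - c| := le_abs.2 (Or.inl (by linarith [h.2]))
        have h0 : (1 / 16 : ℝ) ≤ |0 - c| := le_abs.2 (Or.inr (by linarith [h.1]))
        rintro _ _ (⟨j, t⟩ | ⟨j, s, -⟩ | ⟨j, s, -⟩)
        · rfl
        all_goals simp only [Set.Icc.coe_one, Set.Icc.coe_zero, min_eq_right h1, min_eq_right h0,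
          ite_self])
  | vert i c h => Quot.lift (fun z => open Classical in
      if z.1 = i then min |(z.2.1 : ℝ) - c| (1 / 16) else 1 / 16) (by
        have h1 : (1 / 16 : ℝ) ≤ |1 - c| := le_abs.2 (Or.inl (by linarith [h.2]))
        have h0 : (1 / 16 : ℝ) ≤ |0 - c| := le_abs.2 (Or.inr (by linarith [h.1]))
        rintro _ _ (⟨j, t⟩ | ⟨j, s, hs⟩ | ⟨j, s, -⟩)
        · simp only [Set.Icc.coe_one, Set.Icc.coe_zero, min_eq_right h1, min_eq_right h0]
        · have h2 : (1 / 16 : ℝ) ≤ |(s : ℝ) - c| := le_abs.2 (Or.inr (by linarith [h.1]))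
          simp only [min_eq_right h2, ite_self]
        · rfl)

theorem dist_point_le (C : Curve k) (θ r : ℝ) : C.dist (C.point θ r) ≤ |r| := by
  have key : ∀ c : ℝ, c ∈ Set.Icc (1 / 16 : ℝ) (15 / 16) → ∀ x : ℝ,
      |((Set.projIcc 0 1 zero_le_one (c + x) : I) : ℝ) - c| ≤ |x| := by
    intro c hc x
    have hc' : c = ((Set.projIcc 0 1 zero_le_one c : I) : ℝ) := by
      rw [Set.projIcc_of_mem zero_le_one ⟨by linarith [hc.1], by linarith [hc.2]⟩]
    calc _ = |((Set.projIcc 0 1 zero_le_one (c + x) : I) : ℝ)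
              - ((Set.projIcc 0 1 zero_le_one c : I) : ℝ)| := by rw [← hc']
      _ ≤ |c + x - c| := Set.abs_projIcc_sub_projIcc zero_le_one
      _ = |x| := by ring_nf
  cases C with
  | horiz i c h =>
    simpa [dist, point, pt, sheet, coord] using Or.inl (key c h r)
  | vert i c h =>
    have := key c ⟨by linarith [h.1], h.2⟩ (-r)
    rw [abs_neg, ← sub_eq_add_neg] at this
    simpa [dist, point, pt, sheet, coord] using Or.inl this

theorem dist_base (C : Curve k) : C.dist (base k) = 1 / 16 := by
  cases C with
  | horiz i c h =>
    have h0 : (1 / 16 : ℝ) ≤ |0 - c| := le_abs.2 (Or.inr (by linarith [h.1]))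
    have : (Set.projIcc (0 : ℝ) 1 zero_le_one 0 : ℝ) = 0 := by simp
    simp only [dist, base, pt, this, min_eq_right h0, ite_self]
  | vert i c h =>
    have h0 : (1 / 16 : ℝ) ≤ |1 / 2 - c| := le_abs.2 (Or.inr (by linarith [h.1]))
    have : (Set.projIcc (0 : ℝ) 1 zero_le_one (1 / 2) : ℝ) = 1 / 2 := by
      rw [Set.projIcc_of_mem zero_le_one ⟨by norm_num, by norm_num⟩]
    simp only [dist, base, pt, this, min_eq_right h0, ite_self]

end Curve

/-- The push-off `X_i` (or `A_i`) of `x_i`: the horizontal curve `t = 1/2`. -/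
def curveX (i : ZMod k) : Curve k := .horiz i (1 / 2) (by norm_num)

/-- A second push-off of `x_i` (used as `A'` and `A'_1`): the horizontal curve `t = 3/4`. -/
def curveX' (i : ZMod k) : Curve k := .horiz i (3 / 4) (by norm_num)

/-- The push-off `Y_i` (or `B_i`) of `y_i`: the vertical curve `s = 3/4`. -/
def curveY (i : ZMod k) : Curve k := .vert i (3 / 4) (by norm_num)

/-- A second push-off of `y_i` (used as `Y'_1`): the vertical curve `s = 7/8`. -/
def curveY' (i : ZMod k) : Curve k := .vert i (7 / 8) (by norm_num)

/-- The points of `F × G` with annular coordinates `(θ, r)` around `C`, `(φ, q)` around `C'` and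
`r² + q² ∈ S`. Thus `tube C C' {0}` is the product torus `C × C'`, `tube C C' (Set.Iio (ε ^ 2))` its open
tubular neighbourhood of radius `ε`, and `tube C C' {ε ^ 2}` the boundary of that neighbourhood. -/
def tube (C : Curve k) (C' : Curve m) (S : Set ℝ) : Set (Surface k × Surface m) :=
  {z | ∃ θ ∈ I, ∃ φ ∈ I, ∃ r q : ℝ, r ^ 2 + q ^ 2 ∈ S ∧ z = (C.point θ r, C'.point φ q)}

/-- The product symplectic form `ds ∧ dt + du ∧ dv` in the coordinates `((s, t), (u, v))`. -/
def flatForm (v w : (ℝ × ℝ) × (ℝ × ℝ)) : ℝ :=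
  (v.1.1 * w.1.2 - v.1.2 * w.1.1) + (v.2.1 * w.2.2 - v.2.2 * w.2.1)

/-- The coordinates `((θ, r), (φ, q))` of the tubular neighbourhood of `C × C'`, written in the flat
coordinates `((s, t), (u, v))` of `F × G`. -/
def tubeCoord (C : Curve k) (C' : Curve m) (x : (ℝ × ℝ) × (ℝ × ℝ)) : (ℝ × ℝ) × (ℝ × ℝ) :=
  (C.coord x.1, C'.coord x.2)

/-- `C × C'` and all its parallel copies (`r` and `q` constant) are Lagrangian tori: the tangent vectors
`∂θ`, `∂φ` are linearly independent and the symplectic form vanishes on them. -/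
def ParallelsLagrangian (C : Curve k) (C' : Curve m) : Prop :=
  ∀ x : (ℝ × ℝ) × (ℝ × ℝ),
    let vθ := fderiv ℝ (tubeCoord C C') x ((1, 0), (0, 0))
    let vφ := fderiv ℝ (tubeCoord C C') x ((0, 0), (1, 0))
    LinearIndependent ℝ ![vθ, vφ] ∧ flatForm vθ vφ = 0

/-- `((θ, r), (φ, q))` are Weinstein coordinates: the symplectic form is `dθ ∧ dr + dφ ∧ dq`.
Hence the parallel copies give the Lagrangian framing of `C × C'`. -/
def WeinsteinCoord (C : Curve k) (C' : Curve m) : Prop :=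
  ∀ x v w : (ℝ × ℝ) × (ℝ × ℝ),
    flatForm (fderiv ℝ (tubeCoord C C') x v) (fderiv ℝ (tubeCoord C C') x w) = flatForm v w

theorem not_mem_tube_left {C : Curve k} {C' : Curve m} {ε : ℝ} (hε : 0 < ε) (hε' : ε < 1 / 16)
    {P : Surface k} (hP : 1 / 16 ≤ C.dist P) (Q : Surface m) :
    (P, Q) ∉ tube C C' (Set.Iio (ε ^ 2)) := by
  rintro ⟨θ, -, φ, -, r, q, hrq, h⟩
  obtain ⟨rfl, rfl⟩ := Prod.ext_iff.1 h
  have h1 := C.dist_point_le θ r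
  have h2 : |r| < ε := abs_lt_of_sq_lt_sq (by nlinarith [sq_nonneg q, Set.mem_Iio.1 hrq]) hε.le
  simp only at hP
  linarith

theorem not_mem_tube_right {C : Curve k} {C' : Curve m} {ε : ℝ} (hε : 0 < ε) (hε' : ε < 1 / 16)
    (P : Surface k) {Q : Surface m} (hQ : 1 / 16 ≤ C'.dist Q) :
    (P, Q) ∉ tube C C' (Set.Iio (ε ^ 2)) := by
  rintro ⟨θ, -, φ, -, r, q, hrq, h⟩
  obtain ⟨rfl, rfl⟩ := Prod.ext_iff.1 h
  have h1 := C'.dist_point_le φ q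
  have h2 : |q| < ε := abs_lt_of_sq_lt_sq (by nlinarith [sq_nonneg r, Set.mem_Iio.1 hrq]) hε.le
  simp only at hQ
  linarith

/-! ### Elements of fundamental groups

Mathlib's product in `FundamentalGroup` is `p * q = q.trans p`: products of loops are read from right to
left, as in `x̃ = β⁻¹ x β`. -/

/-- The class, in the fundamental group of the subspace `M`, of a loop that stays in `M`. -/
def loopClass {Z : Type} [TopologicalSpace Z] {M : Set Z} {z : Z} (hz : z ∈ M) (γ : Path z z)
    (h : ∀ τ, γ τ ∈ M) : FundamentalGroup M ⟨z, hz⟩ :=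
  FundamentalGroup.fromPath (Path.Homotopic.Quotient.mk
    { toFun := fun τ => ⟨γ τ, h τ⟩
      continuous_toFun := by fun_prop
      source' := by simp
      target' := by simp })

/-- The homomorphism from the fundamental group of `B ⊆ M` to that of `M` given by the inclusion and
the change of base point along a path `δ` of `M`. -/
def pushHom {Z : Type} [TopologicalSpace Z] {B M : Set Z} (h : B ⊆ M) {z : M} {b : B}
    (δ : Path z (Set.inclusion h b)) : FundamentalGroup B b →* FundamentalGroup M z :=
  (FundamentalGroup.fundamentalGroupMulEquivOfPath δ.symm).toMonoidHom.comp
    (FundamentalGroup.map ⟨Set.inclusion h, continuous_inclusion h⟩ b)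

section Boundary

variable (C : Curve k) (C' : Curve m) (ε : ℝ)

/-- The base point of the boundary of the tubular neighbourhood. -/
def bdBase : Surface k × Surface m := (C.point 0 ε, C'.point 0 0)

theorem bdBase_mem : bdBase C C' ε ∈ tube C C' {ε ^ 2} :=
  ⟨0, by simp, 0, by simp, ε, 0, by simp, rfl⟩

/-- The meridian: a fibre `θ = φ = 0` of the boundary over the torus, run once, counterclockwise in the
coordinates `(r, q)`. -/
def meridianPath : Path (bdBase C C' ε) (bdBase C C' ε) where
  toFun τ := (C.point 0 (ε * Real.cos (2 * Real.pi * τ)), C'.point 0 (ε * Real.sin (2 * Real.pi * τ)))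
  continuous_toFun := by
    have h1 := C.continuous_point
    have h2 := C'.continuous_point
    exact (h1.comp (by fun_prop : Continuous fun τ : I =>
        ((0 : ℝ), ε * Real.cos (2 * Real.pi * τ)))).prodMk
      (h2.comp (by fun_prop : Continuous fun τ : I => ((0 : ℝ), ε * Real.sin (2 * Real.pi * τ))))
  source' := by simp [bdBase]
  target' := by simp [bdBase]

/-- The push-off of `C × pt`: the coordinate `θ` runs once from `0` to `1`, in the parallel Lagrangian
torus `r = ε`, `q = 0`. -/
def pushPathF (hε : ε < 1 / 16) : Path (bdBase C C' ε) (bdBase C C' ε) where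
  toFun τ := (C.point τ ε, C'.point 0 0)
  continuous_toFun := by
    have h1 := C.continuous_point
    exact (h1.comp (by fun_prop : Continuous fun τ : I => ((τ : ℝ), ε))).prodMk continuous_const
  source' := by simp [bdBase]
  target' := by simp [bdBase, C.point_one hε.le]

/-- The push-off of `pt × C'`: the coordinate `φ` runs once from `0` to `1`, in the parallel Lagrangian
torus `r = ε`, `q = 0`. -/
def pushPathG : Path (bdBase C C' ε) (bdBase C C' ε) where
  toFun τ := (C.point 0 ε, C'.point τ 0)
  continuous_toFun := by
    have h2 := C'.continuous_point
    exact continuous_const.prodMk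
      (h2.comp (by fun_prop : Continuous fun τ : I => ((τ : ℝ), (0 : ℝ))))
  source' := by simp [bdBase]
  target' := by simp [bdBase, C'.point_one (show (0 : ℝ) ≤ 1 / 16 by norm_num)]

/-- The class of the meridian in the fundamental group of the boundary. -/
def meridian : FundamentalGroup (tube C C' {ε ^ 2}) ⟨bdBase C C' ε, bdBase_mem C C' ε⟩ :=
  loopClass _ (meridianPath C C' ε) fun τ =>
    ⟨0, by simp, 0, by simp, _, _, by
      rw [Set.mem_singleton_iff]
      linear_combination ε ^ 2 * Real.cos_sq_add_sin_sq (2 * Real.pi * τ), rfl⟩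

/-- The class of the Lagrangian push-off of `C × pt` in the fundamental group of the boundary. -/
def pushF (hε : ε < 1 / 16) :
    FundamentalGroup (tube C C' {ε ^ 2}) ⟨bdBase C C' ε, bdBase_mem C C' ε⟩ :=
  loopClass _ (pushPathF C C' ε hε) fun τ => ⟨τ, τ.2, 0, by simp, ε, 0, by simp, rfl⟩

/-- The class of the Lagrangian push-off of `pt × C'` in the fundamental group of the boundary. -/
def pushG : FundamentalGroup (tube C C' {ε ^ 2}) ⟨bdBase C C' ε, bdBase_mem C C' ε⟩ :=
  loopClass _ (pushPathG C C' ε) fun τ => ⟨0, by simp, τ, τ.2, ε, 0, by simp, rfl⟩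

/-- The boundary of the tubular neighbourhood of `C × C'` lies in `M`, its fundamental group is
generated by the meridian and the two Lagrangian push-offs, and, for a suitable path `δ` in `M` from the
base point `z` to the boundary, these three loops represent `μ`, `lF`, `lG` in the fundamental
group of `M`. The meridian is counterclockwise in `(r, q)` if `o = 1` and clockwise if `o = -1`. -/
def BoundaryCurves (hε : ε < 1 / 16) {M : Set (Surface k × Surface m)} {z : M} (o : ℤˣ)
    (μ lF lG : FundamentalGroup M z) : Prop :=
  Subgroup.closure {meridian C C' ε, pushF C C' ε hε, pushG C C' ε} = ⊤ ∧
  ∃ (h : tube C C' {ε ^ 2} ⊆ M)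
    (δ : Path z (Set.inclusion h ⟨bdBase C C' ε, bdBase_mem C C' ε⟩)),
    pushHom h δ (meridian C C' ε ^ (o : ℤ)) = μ ∧
    pushHom h δ (pushF C C' ε hε) = lF ∧
    pushHom h δ (pushG C C' ε) = lG

end Boundary

/-! ### The tori in `Σ_k × (T² - D²)` -/

/-- Indices of the tori `T_i` and `L_i` in the product with a punctured torus. -/
inductive PuncturedIndex (k : ℕ) : Type
  | T (i : ZMod k)
  | L (i : ZMod k)

/-- `T_i = X_i × A`, `L_i = Y_i × A'`. -/
def puncturedTori : PuncturedIndex k → Curve k × Curve 1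
  | .T i => (curveX i, curveX (0 : ZMod 1))
  | .L i => (curveY i, curveX' (0 : ZMod 1))

/-- The open round disc of radius `1/16` about `(1/4, 1/8)` in the torus; the punctured torus `G` is its
complement. -/
def disc : Set (Surface 1) :=
  {Q | ∃ p : ℝ × ℝ, (p.1 - 1 / 4) ^ 2 + (p.2 - 1 / 8) ^ 2 < (1 / 16) ^ 2 ∧ Q = pt 0 p}

/-- `F × G - N`, where `F` has genus `k`, `G` is the punctured torus and `N` is the union of the open
tubular neighbourhoods of radius `ε` of the tori `T_i`, `L_i`. -/
def puncturedComplement (k : ℕ) (ε : ℝ) : Set (Surface k × Surface 1) :=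
  {z | z.2 ∉ disc ∧ ∀ j : PuncturedIndex k,
    z ∉ tube (puncturedTori j).1 (puncturedTori j).2 (Set.Iio (ε ^ 2))}

/-- Squared flat distance to the centre of the disc, truncated (auxiliary). -/
def discDist : Surface 1 → ℝ :=
  Quot.lift (fun z => min (((z.2.1 : ℝ) - 1 / 4) ^ 2 + ((z.2.2 : ℝ) - 1 / 8) ^ 2) ((1 / 16) ^ 2)) (by
    rintro _ _ (⟨j, t⟩ | ⟨j, s, -⟩ | ⟨j, s, -⟩)
    all_goals
      simp only [Set.Icc.coe_one, Set.Icc.coe_zero]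
      rw [min_eq_right, min_eq_right]
    · nlinarith [sq_nonneg ((t : ℝ) - 1 / 8)]
    · nlinarith [sq_nonneg ((t : ℝ) - 1 / 8)]
    · nlinarith [sq_nonneg ((s : ℝ) - 1 / 4)]
    · nlinarith [sq_nonneg ((s : ℝ) - 1 / 4)]
    · nlinarith [sq_nonneg ((s : ℝ) - 1 / 4)]
    · nlinarith [sq_nonneg ((s : ℝ) - 1 / 4)])

theorem discDist_lt {Q : Surface 1} (hQ : Q ∈ disc) : discDist Q < (1 / 16) ^ 2 := by
  obtain ⟨⟨s, t⟩, h, rfl⟩ := hQ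
  simp only at h
  have hs : |s - 1 / 4| < 1 / 16 :=
    abs_lt_of_sq_lt_sq (by nlinarith [sq_nonneg (t - 1 / 8)]) (by norm_num)
  have ht : |t - 1 / 8| < 1 / 16 :=
    abs_lt_of_sq_lt_sq (by nlinarith [sq_nonneg (s - 1 / 4)]) (by norm_num)
  rw [abs_lt] at hs ht
  simp only [discDist, pt]
  rw [Set.projIcc_of_mem zero_le_one (⟨by linarith, by linarith⟩ : s ∈ Set.Icc (0 : ℝ) 1),
    Set.projIcc_of_mem zero_le_one (⟨by linarith, by linarith⟩ : t ∈ Set.Icc (0 : ℝ) 1)]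
  exact (min_le_left _ _).trans_lt h

theorem pt_not_mem_disc {s t : ℝ} (h : 1 / 4 ≤ t ∨ 5 / 8 ≤ s) : pt 0 (s, t) ∉ disc := by
  intro hd
  have h1 := discDist_lt hd
  simp only [discDist, pt] at h1
  refine absurd h1 (not_lt.2 (le_min ?_ le_rfl))
  simp only [Set.coe_projIcc]
  rcases h with h | h
  · have : 1 / 4 ≤ max 0 (min 1 t) := le_max_of_le_right (le_min (by norm_num) h)
    nlinarith [sq_nonneg (max 0 (min 1 s) - 1 / 4)]
  · have : 5 / 8 ≤ max 0 (min 1 s) := le_max_of_le_right (le_min (by norm_num) h)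
    nlinarith [sq_nonneg (max 0 (min 1 t) - 1 / 8)]

theorem xLoop_not_mem_disc (τ : I) : xLoop (0 : ZMod 1) τ ∉ disc := by
  rw [xLoop, hLoop, Path.trans_apply]
  split_ifs <;>
    simp only [Path.cast_coe, seg, Path.coe_mk_mk, AffineMap.lineMap_apply, vsub_eq_sub,
      vadd_eq_add, Prod.mk_sub_mk, Prod.smul_mk, Prod.mk_add_mk] <;>
    exact pt_not_mem_disc (Or.inl (by simp))

theorem yLoop_not_mem_disc (τ : I) : yLoop (0 : ZMod 1) τ ∉ disc := by
  rw [yLoop, vLoop, Path.trans_apply]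
  split_ifs <;>
    simp only [Path.cast_coe, seg, Path.coe_mk_mk, AffineMap.lineMap_apply, vsub_eq_sub,
      vadd_eq_add, Prod.mk_sub_mk, Prod.smul_mk, Prod.mk_add_mk] <;>
    exact pt_not_mem_disc (Or.inr (by simp))

theorem puncturedTori_dist (j : PuncturedIndex k) :
    1 / 16 ≤ (puncturedTori j).2.dist (pt 0 (5 / 8, 1 / 4)) := by
  have h0 : (Set.projIcc (0 : ℝ) 1 zero_le_one (1 / 4) : ℝ) = 1 / 4 := by
    rw [Set.projIcc_of_mem zero_le_one ⟨by norm_num, by norm_num⟩]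
  have h1 : (1 / 16 : ℝ) ≤ |1 / 4 - 1 / 2| := le_abs.2 (Or.inr (by norm_num))
  have h2 : (1 / 16 : ℝ) ≤ |1 / 4 - 3 / 4| := le_abs.2 (Or.inr (by norm_num))
  cases j
  · simp only [puncturedTori, curveX, Curve.dist, pt, h0, min_eq_right h1, ite_self, le_refl]
  · simp only [puncturedTori, curveX', Curve.dist, pt, h0, min_eq_right h2, ite_self, le_refl]

section Punctured

variable {ε : ℝ}

theorem mem_puncturedComplement_F (hε : 0 < ε) (hε' : ε < 1 / 16) (P : Surface k) :
    ((P, pt 0 (5 / 8, 1 / 4)) : Surface k × Surface 1) ∈ puncturedComplement k ε :=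
  ⟨pt_not_mem_disc (Or.inl le_rfl), fun _ =>
    not_mem_tube_right hε hε' P (puncturedTori_dist _)⟩

theorem mem_puncturedComplement_G (hε : 0 < ε) (hε' : ε < 1 / 16) {Q : Surface 1} (hQ : Q ∉ disc) :
    (base k, Q) ∈ puncturedComplement k ε :=
  ⟨hQ, fun _ => not_mem_tube_left hε hε' (Curve.dist_base _).ge Q⟩

/-- The base point `(f, g)`, with `g = a ∩ b`. -/
def puncturedBase (k : ℕ) {ε : ℝ} (hε : 0 < ε) (hε' : ε < 1 / 16) : puncturedComplement k ε :=
  ⟨(base k, pt 0 (5 / 8, 1 / 4)), mem_puncturedComplement_F hε hε' _⟩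

/-- The loop `x̃_i × {g}`. -/
def pX (hε : 0 < ε) (hε' : ε < 1 / 16) (i : ZMod k) : FundamentalGroup (puncturedComplement k ε) (puncturedBase k hε hε') :=
  loopClass _ ((xTilde i).prod (Path.refl _)) fun _ => mem_puncturedComplement_F hε hε' _

/-- The loop `ỹ_i × {g}`. -/
def pY (hε : 0 < ε) (hε' : ε < 1 / 16) (i : ZMod k) : FundamentalGroup (puncturedComplement k ε) (puncturedBase k hε hε') :=
  loopClass _ ((yTilde i).prod (Path.refl _)) fun _ => mem_puncturedComplement_F hε hε' _

/-- The loop `ã = {f} × a`. -/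
def pA (k : ℕ) {ε : ℝ} (hε : 0 < ε) (hε' : ε < 1 / 16) :
    FundamentalGroup (puncturedComplement k ε) (puncturedBase k hε hε') :=
  loopClass _ ((Path.refl _).prod (xLoop 0)) fun τ =>
    mem_puncturedComplement_G hε hε' (xLoop_not_mem_disc τ)

/-- The loop `b̃ = {f} × b`. -/
def pB (k : ℕ) {ε : ℝ} (hε : 0 < ε) (hε' : ε < 1 / 16) :
    FundamentalGroup (puncturedComplement k ε) (puncturedBase k hε hε') :=
  loopClass _ ((Path.refl _).prod (yLoop 0)) fun τ =>
    mem_puncturedComplement_G hε hε' (yLoop_not_mem_disc τ)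

end Punctured

/-! ### The tori in `Σ_k × Σ_2` -/

/-- Indices of the tori `T_i`, `L_i`, `J_1`, `J_2`. -/
inductive TorusIndex (k : ℕ) : Type
  | T (i : ZMod k)
  | L (i : ZMod k)
  | J₁
  | J₂

/-- `T_i = X_i × A_1`, `L_i = Y_i × A'_1`, `J_1 = Y_1 × A_2`, `J_2 = Y'_1 × B_2`. The handles numbered
`1, …, k` of `F` are the squares `0, …, k - 1`, and the handles numbered `1, 2` of `G` are the
squares `0, 1`. -/
def tori : TorusIndex k → Curve k × Curve 2
  | .T i => (curveX i, curveX (0 : ZMod 2))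
  | .L i => (curveY i, curveX' (0 : ZMod 2))
  | .J₁ => (curveY (0 : ZMod k), curveX (1 : ZMod 2))
  | .J₂ => (curveY' (0 : ZMod k), curveY (1 : ZMod 2))

/-- `F × G - N`, where `F` has genus `k`, `G` has genus two and `N` is the union of the open tubular
neighbourhoods of radius `ε` of the tori `T_i`, `L_i`, `J_1`, `J_2`. -/
def toriComplement (k : ℕ) (ε : ℝ) : Set (Surface k × Surface 2) :=
  {z | ∀ j : TorusIndex k, z ∉ tube (tori j).1 (tori j).2 (Set.Iio (ε ^ 2))}

section Closed

variable {ε : ℝ}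

theorem mem_toriComplement_F (hε : 0 < ε) (hε' : ε < 1 / 16) (P : Surface k) : (P, base 2) ∈ toriComplement k ε :=
  fun _ => not_mem_tube_right hε hε' P (Curve.dist_base _).ge

theorem mem_toriComplement_G (hε : 0 < ε) (hε' : ε < 1 / 16) (Q : Surface 2) : (base k, Q) ∈ toriComplement k ε :=
  fun _ => not_mem_tube_left hε hε' (Curve.dist_base _).ge Q

/-- The base point `(f, g)`. -/
def toriBase (k : ℕ) {ε : ℝ} (hε : 0 < ε) (hε' : ε < 1 / 16) : toriComplement k ε :=
  ⟨(base k, base 2), mem_toriComplement_F hε hε' _⟩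

/-- The loop `x̃_i × {g}`. -/
def cX (hε : 0 < ε) (hε' : ε < 1 / 16) (i : ZMod k) : FundamentalGroup (toriComplement k ε) (toriBase k hε hε') :=
  loopClass _ ((xTilde i).prod (Path.refl _)) fun _ => mem_toriComplement_F hε hε' _

/-- The loop `ỹ_i × {g}`. -/
def cY (hε : 0 < ε) (hε' : ε < 1 / 16) (i : ZMod k) : FundamentalGroup (toriComplement k ε) (toriBase k hε hε') :=
  loopClass _ ((yTilde i).prod (Path.refl _)) fun _ => mem_toriComplement_F hε hε' _

/-- The loop `{f} × ã_j`. -/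
def cA (k : ℕ) {ε : ℝ} (hε : 0 < ε) (hε' : ε < 1 / 16) (j : ZMod 2) :
    FundamentalGroup (toriComplement k ε) (toriBase k hε hε') :=
  loopClass _ ((Path.refl _).prod (xTilde j)) fun _ => mem_toriComplement_G hε hε' _

/-- The loop `{f} × b̃_j`. -/
def cB (k : ℕ) {ε : ℝ} (hε : 0 < ε) (hε' : ε < 1 / 16) (j : ZMod 2) :
    FundamentalGroup (toriComplement k ε) (toriBase k hε hε') :=
  loopClass _ ((Path.refl _).prod (yTilde j)) fun _ => mem_toriComplement_G hε hε' _

end Closed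

end

end SurfaceProduct

/-! Everything is phrased through a `Holonomy`: a rule that gives each path in `M` an element of a
group and becomes a coboundary after pull-back to any simply connected space. The tautological
example `ofBase` takes values in the fundamental group itself. A potential (`FlatOn`) on `U` is a
function whose increments along paths in `U` are the holonomy; a holonomy with a potential is
trivial on loops. Potentials are unique up to a right constant on path connected sets and can be
glued over open sets, which plays the role of van Kampen's theorem.

Normal generation. Let `N` be the normal closure of the proposed generators and push `ofBase` to the
quotient by `N`. It suffices that this holonomy, which is trivial on the generators, has a global
potential (`eq_top_of_hol`). By a radial retraction (`exists_tube_retraction`) the open tubes may be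
replaced by the tori themselves, so that the space is a union of products of open sets. On a
product, potentials on two perpendicular slices determine one on the whole (`exists_flat_prod`), and
on a closed surface vanishing on the standard curves is enough (`exists_flat_surface`). All `T_i`
lie over one curve of `G` and all `L_i` over a parallel one. These two walls cut `G` into an outer
part and a strip. Over the first wall the curves `X_i` are missing from `F`, but `x_i` can be
carried through; over the second wall `y_i` can be carried through. Hence all generators of `F` are
trivial over the strip as well, and the potentials fit together because they agree over the base
point of `F` (`exists_flat_walls`). For genus two the same argument with the factors exchanged
handles `J_1` and `J_2`: the walls are the two vertical curves of `F`, and the fibre is the second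
handle of `G`.

Boundary curves. The boundary of a tube is covered by `ℝ³`, the deck translations being the two
push-offs and the meridian. Lifting loops gives generation (`closure_boundary`). To express the
three classes in the complement, take a closed curve `α` crossing `C` once and a closed curve `β`
crossing `C'` once. The torus `α × β` meets `C × C'` once, so that it becomes a rectangle with a
hole and identified sides, and the meridian is the commutator of the sides up to orientation
(`hol_meridian_eq`). The push-offs are carried through annuli to the standard curves. This is
assembled in `boundaryCurves_of_sweep`; what remains for each torus is to choose `α`, `β` and the
side from which it is approached so that the other tori are avoided. -/

namespace SurfaceProduct

/-! ### Holonomy -/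

/-- The class, based at `z`, of a path between two points joined to `z`. -/
noncomputable def basedClass {X : Type} [TopologicalSpace X] {z x y : X} (hx : Joined z x) (hy : Joined z y)
    (p : Path.Homotopic.Quotient x y) : FundamentalGroup X z :=
  FundamentalGroup.fromPath
    -- The chosen path from `z` to itself need not be constant. Dividing by it at both ends makes
    -- the class of a loop at `z` the loop itself.
    (((Path.Homotopic.Quotient.mk (Joined.refl z).somePath).symm.trans
      (Path.Homotopic.Quotient.mk hx.somePath)).trans
    (p.trans ((Path.Homotopic.Quotient.mk hy.somePath).symm.trans
      (Path.Homotopic.Quotient.mk (Joined.refl z).somePath))))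

section basedClass
variable {X : Type} [TopologicalSpace X] {z x y w : X}

/-- The reference path to the intermediate point is run back and forth and cancels. The factors
appear in reverse order because products are read from right to left. -/
theorem basedClass_trans (hx : Joined z x) (hy : Joined z y) (hw : Joined z w)
    (p : Path.Homotopic.Quotient x y) (q : Path.Homotopic.Quotient y w) :
    basedClass hx hw (p.trans q) = basedClass hy hw q * basedClass hx hy p := by
  rw [FundamentalGroup.mul_def]
  unfold basedClass FundamentalGroup.fromPath FundamentalGroup.fromArrow
  simp only [Path.Homotopic.Quotient.trans_assoc]
  congr 3
  rw [← Path.Homotopic.Quotient.trans_assoc (Path.Homotopic.Quotient.mk (Joined.refl z).somePath),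
    Path.Homotopic.Quotient.trans_symm, Path.Homotopic.Quotient.refl_trans,
    ← Path.Homotopic.Quotient.trans_assoc (Path.Homotopic.Quotient.symm _),
    Path.Homotopic.Quotient.symm_trans, Path.Homotopic.Quotient.refl_trans]

theorem basedClass_loop (hz : Joined z z) (p : Path.Homotopic.Quotient z z) :
    basedClass hz hz p = FundamentalGroup.fromPath p := by
  unfold basedClass
  rw [Path.Homotopic.Quotient.symm_trans, Path.Homotopic.Quotient.refl_trans,
    Path.Homotopic.Quotient.trans_refl]

end basedClass

/-- An assignment of group elements to the paths in a subset `M` of a space which becomes a coboundary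
after pull-back to every simply connected space. -/
structure Holonomy (Z : Type) [TopologicalSpace Z] (M : Set Z) (H : Type) [Group H] where
  hol : C(I, Z) → H
  exists_flat' : ∀ (T : Type) [TopologicalSpace T] [SimplyConnectedSpace T] (Ψ : C(T, Z)),
    (∀ x, Ψ x ∈ M) → ∃ f : T → H, ∀ γ : C(I, T), hol (Ψ.comp γ) = f (γ 1) * (f (γ 0))⁻¹

namespace Holonomy

variable {Z W : Type} [TopologicalSpace Z] [TopologicalSpace W] {M : Set Z} {N : Set W}
  {H K : Type} [Group H] [Group K]

/-- The path with values in the subtype. -/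
def codPath (γ : C(I, Z)) (h : ∀ τ, γ τ ∈ M) :
    Path (⟨γ 0, h 0⟩ : M) ⟨γ 1, h 1⟩ where
  toFun τ := ⟨γ τ, h τ⟩
  continuous_toFun := by fun_prop
  source' := rfl
  target' := rfl

open Classical in
/-- The tautological holonomy, with values in the fundamental group. -/
noncomputable def ofBase (M : Set Z) (z : M) : Holonomy Z M (FundamentalGroup M z) where
  hol γ := if h : ∀ τ, γ τ ∈ M then
      if hj : Joined z (⟨γ 0, h 0⟩ : M) then
        basedClass hj (hj.trans ⟨codPath γ h⟩) (.mk (codPath γ h))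
      else 1
    else 1
  exists_flat' T _ _ Ψ hΨ := by
    obtain ⟨t0⟩ : Nonempty T := inferInstance
    let Ψ' : C(T, M) := ⟨fun x => ⟨Ψ x, hΨ x⟩, by fun_prop⟩
    have hpc : ∀ a b : T, Joined (Ψ' a) (Ψ' b) := fun a b =>
      ⟨(PathConnectedSpace.somePath a b).map Ψ'.continuous⟩
    by_cases hj : Joined z (Ψ' t0)
    · have hja : ∀ a, Joined z (Ψ' a) := fun a => hj.trans (hpc t0 a)
      let q : ∀ a b : T, Path.Homotopic.Quotient (Ψ' a) (Ψ' b) := fun a b =>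
        .mk ((PathConnectedSpace.somePath a b).map Ψ'.continuous)
      have hq : ∀ a b (p : Path a b), Path.Homotopic.Quotient.mk (p.map Ψ'.continuous) = q a b :=
        fun a b p => Path.Homotopic.Quotient.eq.2
          ((SimplyConnectedSpace.paths_homotopic p (PathConnectedSpace.somePath a b)).map Ψ')
      -- In a simply connected space there is one homotopy class of paths from `t0` to each point;
      -- its image is the potential.
      refine ⟨fun a => basedClass hj (hja a) (q t0 a), fun γ => ?_⟩
      have hγ : ∀ τ, (Ψ.comp γ) τ ∈ M := fun τ => hΨ _
      have h0 : Joined z (⟨(Ψ.comp γ) 0, hγ 0⟩ : M) := hja (γ 0)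
      rw [dif_pos hγ, dif_pos h0, eq_mul_inv_iff_mul_eq]
      have key : Path.Homotopic.Quotient.mk (codPath (Ψ.comp γ) hγ) = q (γ 0) (γ 1) :=
        hq _ _ (⟨γ, rfl, rfl⟩ : Path (γ 0) (γ 1))
      rw [key]
      refine (basedClass_trans hj (hja (γ 0)) (hja (γ 1)) _ _).symm.trans ?_
      congr 1
      rw [← hq t0 (γ 1) ((PathConnectedSpace.somePath t0 (γ 0)).trans ⟨γ, rfl, rfl⟩),
        Path.map_trans, Path.Homotopic.Quotient.mk_trans, hq, hq]
    · refine ⟨fun _ => 1, fun γ => ?_⟩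
      have : ¬ Joined z (⟨(Ψ.comp γ) 0, hΨ _⟩ : M) := fun h => hj (h.trans (hpc _ _))
      have hγ : ∀ τ, (Ψ.comp γ) τ ∈ M := fun τ => hΨ _
      rw [dif_pos hγ, dif_neg this]
      simp

/-- On loops at the base point the auxiliary reference paths drop out. This is the bridge between
holonomies and the fundamental group. -/
theorem ofBase_loop {z : Z} (hz : z ∈ M) (γ : Path z z) (h : ∀ τ, γ τ ∈ M) :
    (ofBase M ⟨z, hz⟩).hol γ.toContinuousMap = loopClass hz γ h := by
  obtain ⟨⟨g, hg⟩, h0, h1⟩ := γ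
  simp only at h0 h1
  subst h0
  have hM : ∀ τ, g τ ∈ M := h
  have hj : Joined (⟨g 0, hz⟩ : M) ⟨g 0, hz⟩ := Joined.refl _
  have key : ∀ (y : M) (p : Path (⟨g 0, hz⟩ : M) y) (hy : y = ⟨g 0, hz⟩) (hj' : Joined (⟨g 0, hz⟩ : M) y),
      basedClass hj hj' (.mk p) = FundamentalGroup.fromPath (.mk (p.cast rfl hy.symm)) := by
    rintro y p rfl hj'
    exact basedClass_loop hj _
  refine (dif_pos hM).trans ((dif_pos hj).trans ?_)
  exact (key _ _ (Subtype.ext h1) _)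

/-- Composition with a group homomorphism. -/
def mapHom (h : Holonomy Z M H) (φ : H →* K) : Holonomy Z M K where
  hol γ := φ (h.hol γ)
  exists_flat' T _ _ Ψ hΨ := by
    obtain ⟨f, hf⟩ := h.exists_flat' T Ψ hΨ
    exact ⟨φ ∘ f, fun γ => by simp [hf]⟩

open Classical in
/-- Pull-back along a map that is continuous on the subset. -/
noncomputable def comapOn (h : Holonomy Z M H) (g : W → Z) (hg : ContinuousOn g N) (hm : Set.MapsTo g N M) :
    Holonomy W N H where
  hol γ := if hγ : ∀ τ, γ τ ∈ N then
      h.hol ⟨fun τ => g (γ τ), hg.comp_continuous γ.continuous hγ⟩ else 1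
  exists_flat' T _ _ Ψ hΨ := by
    obtain ⟨f, hf⟩ := h.exists_flat' T ⟨fun τ => g (Ψ τ), hg.comp_continuous Ψ.continuous hΨ⟩
      fun x => hm (hΨ x)
    refine ⟨f, fun γ => ?_⟩
    have hγ : ∀ τ, (Ψ.comp γ) τ ∈ N := fun τ => hΨ _
    rw [← hf, dif_pos hγ]
    rfl

theorem comapOn_hol (h : Holonomy Z M H) (g : W → Z) (hg : ContinuousOn g N) (hm : Set.MapsTo g N M)
    (γ : C(I, W)) (δ : C(I, Z)) (hγ : ∀ τ, γ τ ∈ N) (hδ : ∀ τ, δ τ = g (γ τ)) :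
    (h.comapOn g hg hm).hol γ = h.hol δ := by
  unfold comapOn
  simp only
  rw [dif_pos hγ]
  congr 1
  ext τ
  exact (hδ τ).symm

variable (h : Holonomy Z M H)

/-- `f` is a potential of the holonomy on `U`. -/
def FlatOn (f : Z → H) (U : Set Z) : Prop :=
  ∀ γ : C(I, Z), (∀ τ, γ τ ∈ U) → h.hol γ = f (γ 1) * (f (γ 0))⁻¹

variable {h}

theorem FlatOn.mono {f : Z → H} {U V : Set Z} (hf : h.FlatOn f U) (hVU : V ⊆ U) : h.FlatOn f V :=
  fun γ hγ => hf γ fun τ => hVU (hγ τ)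

theorem FlatOn.congr {f f' : Z → H} {U : Set Z} (hf : h.FlatOn f U) (hff : ∀ x ∈ U, f x = f' x) :
    h.FlatOn f' U := fun γ hγ => by rw [hf γ hγ, hff _ (hγ _), hff _ (hγ _)]

theorem FlatOn.mul_right {f : Z → H} {U : Set Z} (hf : h.FlatOn f U) (c : H) :
    h.FlatOn (fun x => f x * c) U := fun γ hγ => by rw [hf γ hγ]; group

/-- On a convex set the holonomy has a potential. -/
theorem exists_flat_convex (h : Holonomy Z M H) {E : Type} [NormedAddCommGroup E] [NormedSpace ℝ E] {D : Set E} (hD : Convex ℝ D)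
    {Ψ : E → Z} (hc : ContinuousOn Ψ D) (hm : ∀ x ∈ D, Ψ x ∈ M) :
    ∃ f : E → H, ∀ (γ : C(I, Z)) (p : C(I, E)), (∀ τ, p τ ∈ D) → (∀ τ, γ τ = Ψ (p τ)) →
      h.hol γ = f (p 1) * (f (p 0))⁻¹ := by
  classical
  rcases D.eq_empty_or_nonempty with rfl | hne
  · exact ⟨fun _ => 1, fun γ p hp => absurd (hp 0) (by simp)⟩
  -- A nonempty convex set is contractible, hence simply connected. The potential lives on the chart
  -- and not on its image, since `Ψ` need not be injective.
  have := hD.contractibleSpace hne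
  obtain ⟨f, hf⟩ := h.exists_flat' D ⟨fun x => Ψ x, hc.comp_continuous continuous_subtype_val fun x => x.2⟩
    fun x => hm x x.2
  refine ⟨fun x => if hx : x ∈ D then f ⟨x, hx⟩ else 1, fun γ p hp hγ => ?_⟩
  simp only [dif_pos (hp 1), dif_pos (hp 0)]
  have e := hf ⟨fun τ => ⟨p τ, hp τ⟩, by fun_prop⟩
  simp only [ContinuousMap.coe_mk] at e
  rw [← e]
  congr 1
  ext τ
  exact hγ τ

/-- Potentials on a path connected set are unique up to a constant. -/
theorem FlatOn.eqOn {f f' : Z → H} {U : Set Z} (hf : h.FlatOn f U) (hf' : h.FlatOn f' U)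
    (hU : IsPathConnected U) {x : Z} (hx : x ∈ U) (e : f x = f' x) : ∀ y ∈ U, f y = f' y := by
  intro y hy
  obtain ⟨p, hp⟩ := hU.joinedIn x hx y hy
  have h1 := hf p.toContinuousMap hp
  have h2 := hf' p.toContinuousMap hp
  rw [h1] at h2
  simp only [Path.coe_toContinuousMap, Path.source, Path.target] at h2
  rw [e] at h2
  exact mul_right_cancel h2

/-- A potential along a path. -/
theorem exists_flat_path (h : Holonomy Z M H) (γ : C(I, Z)) (hγ : ∀ τ, γ τ ∈ M) :
    ∃ g : I → H, ∀ p : C(I, I), h.hol (γ.comp p) = g (p 1) * (g (p 0))⁻¹ :=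
  have := (convex_Icc (0 : ℝ) 1).contractibleSpace ⟨0, by simp⟩
  h.exists_flat' I γ hγ

/-- Being a potential is a local property. -/
theorem FlatOn.of_local {f : Z → H} {U : Set Z} (hUM : U ⊆ M)
    (hloc : ∀ x ∈ U, ∃ V : Set Z, IsOpen V ∧ x ∈ V ∧ h.FlatOn f (V ∩ U)) : h.FlatOn f U := by
  intro γ hγ
  obtain ⟨g, hg⟩ := h.exists_flat_path γ fun τ => hUM (hγ τ)
  have hid := hg (ContinuousMap.id I)
  rw [ContinuousMap.comp_id] at hid
  simp only [ContinuousMap.id_apply] at hid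
  -- The local potentials are compared with the potential `g` along the whole path: locally both
  -- have the same increments, so the quotient is locally constant on the connected interval.
  have hlc : IsLocallyConstant fun τ => (f (γ τ))⁻¹ * g τ := by
    rw [IsLocallyConstant.iff_eventually_eq]
    intro τ
    obtain ⟨V, hV, hxV, hfV⟩ := hloc _ (hγ τ)
    have hn : γ ⁻¹' V ∈ nhds τ := γ.continuous.continuousAt (hV.mem_nhds hxV)
    obtain ⟨δ, hδ, hball⟩ := Metric.mem_nhds_iff.1 hn
    filter_upwards [Metric.ball_mem_nhds τ hδ] with υ hυ
    let p : C(I, I) := ⟨fun u => ⟨(1 - (u : ℝ)) * τ + u * υ,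
      (convex_Icc (0:ℝ) 1) τ.2 υ.2 (sub_nonneg.2 u.2.2) u.2.1 (by ring)⟩, by fun_prop⟩
    have hp : ∀ u, γ (p u) ∈ V := by
      intro u
      apply hball
      rw [Metric.mem_ball, Subtype.dist_eq, Real.dist_eq] at hυ ⊢
      have : ((p u : I) : ℝ) - τ = u * (υ - τ) := by simp only [p, ContinuousMap.coe_mk]; ring
      rw [this, abs_mul, abs_of_nonneg u.2.1]
      nlinarith [u.2.1, u.2.2, abs_nonneg ((υ:ℝ) - τ)]
    have e1 := hg p
    have e2 := hfV (γ.comp p) fun u => ⟨hp u, hγ _⟩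
    have p0 : p 0 = τ := by ext; simp [p]
    have p1 : p 1 = υ := by ext; simp [p]
    simp only [ContinuousMap.comp_apply, p0, p1] at e1 e2
    rw [e1] at e2
    rw [mul_inv_eq_iff_eq_mul.1 e2]
    group
  have := hlc.apply_eq_of_isPreconnected isPreconnected_univ (Set.mem_univ 0) (Set.mem_univ 1)
  rw [hid]
  have e : g 1 = f (γ 1) * ((f (γ 0))⁻¹ * g 0) := by rw [this]; group
  rw [e]; group

/-- Potentials on two open sets that agree on the intersection can be glued. -/
theorem FlatOn.union {f f' : Z → H} {U V : Set Z} (hf : h.FlatOn f U) (hf' : h.FlatOn f' V)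
    (hUM : U ⊆ M) (hVM : V ⊆ M) (hU : IsOpen U) (hV : IsOpen V) (e : ∀ x ∈ U ∩ V, f x = f' x) :
    ∃ f'' : Z → H, h.FlatOn f'' (U ∪ V) ∧ (∀ x ∈ U, f'' x = f x) ∧ ∀ x ∈ V, f'' x = f' x := by
  classical
  have h1 : ∀ x ∈ U, (if x ∈ U then f x else f' x) = f x := fun x hx => if_pos hx
  have h2 : ∀ x ∈ V, (if x ∈ U then f x else f' x) = f' x := fun x hx => by
    split_ifs with hxU
    · exact e x ⟨hxU, hx⟩
    · rfl
  refine ⟨fun x => if x ∈ U then f x else f' x, FlatOn.of_local (Set.union_subset hUM hVM) ?_, h1, h2⟩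
  rintro x (hx | hx)
  · exact ⟨U, hU, hx, (hf.mono Set.inter_subset_left).congr fun y hy => (h1 y hy.1).symm⟩
  · exact ⟨V, hV, hx, (hf'.mono Set.inter_subset_left).congr fun y hy => (h2 y hy.1).symm⟩

/-- On a path connected overlap the two potentials differ by a right constant, which is absorbed
into one of them. -/
theorem FlatOn.union_of_isPathConnected {f f' : Z → H} {U V : Set Z} (hf : h.FlatOn f U)
    (hf' : h.FlatOn f' V) (hUM : U ⊆ M) (hVM : V ⊆ M) (hU : IsOpen U) (hV : IsOpen V)
    (hUV : IsPathConnected (U ∩ V)) : ∃ f'' : Z → H, h.FlatOn f'' (U ∪ V) := by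
  obtain ⟨x, hx⟩ := hUV.nonempty
  obtain ⟨f'', h1, -⟩ := hf.union (hf'.mul_right ((f' x)⁻¹ * f x)) hUM hVM hU hV
    ((hf.mono Set.inter_subset_left).eqOn ((hf'.mul_right _).mono Set.inter_subset_right) hUV hx
      (by group))
  exact ⟨f'', h1⟩

/-! Calculus of paths. -/

/-- Both paths are reparametrized restrictions of the concatenation, so one potential along the
concatenation computes all three holonomies. -/
theorem hol_trans {x y w : Z} (p : Path x y) (q : Path y w) (hp : ∀ τ, p τ ∈ M) (hq : ∀ τ, q τ ∈ M) :
    h.hol (p.trans q).toContinuousMap = h.hol q.toContinuousMap * h.hol p.toContinuousMap := by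
  have hpq : ∀ τ, (p.trans q) τ ∈ M := by
    intro τ
    rw [Path.trans_apply]
    split_ifs
    · exact hp _
    · exact hq _
  obtain ⟨g, hg⟩ := h.exists_flat_path (p.trans q).toContinuousMap hpq
  let a : C(I, I) := ⟨fun u => ⟨u / 2, by constructor <;> linarith [u.2.1, u.2.2]⟩, by fun_prop⟩
  let b : C(I, I) := ⟨fun u => ⟨(u + 1) / 2, by constructor <;> linarith [u.2.1, u.2.2]⟩, by fun_prop⟩
  have ea : (p.trans q).toContinuousMap.comp a = p.toContinuousMap := by
    ext u
    have : ((a u : I) : ℝ) ≤ 1 / 2 := by simp only [a, ContinuousMap.coe_mk]; linarith [u.2.2]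
    simp only [ContinuousMap.comp_apply, Path.coe_toContinuousMap, Path.trans_apply, dif_pos this]
    congr 1
    exact Subtype.ext (by simp only [a, ContinuousMap.coe_mk]; ring)
  have eb : (p.trans q).toContinuousMap.comp b = q.toContinuousMap := by
    ext u
    simp only [ContinuousMap.comp_apply, Path.coe_toContinuousMap, Path.trans_apply]
    split_ifs with hh
    -- The second half meets the first only at its initial time, where both descriptions give the
    -- point `y`.
    · have hu : u = 0 := by
        simp only [b, ContinuousMap.coe_mk] at hh
        exact Subtype.ext (le_antisymm (by simp; linarith) u.2.1)
      subst hu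
      rw [Path.source]
      convert p.target
      simp [b]
    · congr 1
      exact Subtype.ext (by simp only [b, ContinuousMap.coe_mk]; ring)
  have h1 := hg (ContinuousMap.id I)
  have h2 := hg a
  have h3 := hg b
  rw [ContinuousMap.comp_id] at h1
  rw [ea] at h2
  rw [eb] at h3
  have ab : a 1 = b 0 := by ext; simp [a, b]
  have a0 : a 0 = 0 := by ext; simp [a]
  have b1 : b 1 = 1 := by ext; simp [b]
  rw [h1, h2, h3, ab, a0, b1]
  simp

theorem hol_refl {x : Z} (hx : x ∈ M) : h.hol (Path.refl x).toContinuousMap = 1 := by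
  obtain ⟨g, hg⟩ := h.exists_flat_path (Path.refl x).toContinuousMap fun _ => hx
  have := hg (ContinuousMap.const I 0)
  simp only [ContinuousMap.const_apply, mul_inv_cancel] at this
  rw [← this]
  rfl

theorem hol_symm {x y : Z} (p : Path x y) (hp : ∀ τ, p τ ∈ M) :
    h.hol p.symm.toContinuousMap = (h.hol p.toContinuousMap)⁻¹ := by
  obtain ⟨g, hg⟩ := h.exists_flat_path p.toContinuousMap hp
  have h1 := hg (ContinuousMap.id I)
  have h2 := hg ⟨unitInterval.symm, by fun_prop⟩
  rw [ContinuousMap.comp_id] at h1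
  rw [h1]
  have : p.toContinuousMap.comp ⟨unitInterval.symm, by fun_prop⟩ = p.symm.toContinuousMap := rfl
  rw [← this, h2]
  simp

/-- Change of base point in terms of holonomy. -/
theorem pushHom_eq {B : Set Z} (hB : B ⊆ M) {z : M} {b : Z} (hb : b ∈ B)
    (δ : Path z (Set.inclusion hB ⟨b, hb⟩)) (γ : Path b b) (hγ : ∀ τ, γ τ ∈ B) :
    pushHom hB δ (loopClass hb γ hγ) =
      ((ofBase M z).hol (δ.map continuous_subtype_val).toContinuousMap)⁻¹ *
        (ofBase M z).hol γ.toContinuousMap *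
        (ofBase M z).hol (δ.map continuous_subtype_val).toContinuousMap := by
  obtain ⟨z, hz⟩ := z
  let γ' : Path (Set.inclusion hB ⟨b, hb⟩) (Set.inclusion hB ⟨b, hb⟩) :=
    ⟨⟨fun τ => ⟨γ τ, hB (hγ τ)⟩, by fun_prop⟩, by simp, by simp⟩
  have hM : ∀ {x y : M} (p : Path x y) (τ : I), (p.map continuous_subtype_val) τ ∈ M :=
    fun p τ => (p τ).2
  have e1 : (ofBase M ⟨z, hz⟩).hol
      ((δ.trans (γ'.trans δ.symm)).map continuous_subtype_val).toContinuousMap =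
      pushHom hB δ (loopClass hb γ hγ) := by
    rw [ofBase_loop hz _ (hM _)]
    have e : pushHom hB δ (loopClass hb γ hγ) = FundamentalGroup.fromPath
        ((Path.Homotopic.Quotient.mk δ.symm.symm).trans
          ((Path.Homotopic.Quotient.mk γ').trans (Path.Homotopic.Quotient.mk δ.symm))) := rfl
    rw [e, Path.symm_symm, ← Path.Homotopic.Quotient.mk_trans, ← Path.Homotopic.Quotient.mk_trans]
    rfl
  rw [← e1, Path.map_trans, Path.map_trans, hol_trans _ _ (hM _), hol_trans _ _ (hM _) (hM _),
    ← Path.map_symm, hol_symm _ (hM _)]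
  · rfl
  · intro τ
    rw [← Path.map_trans]
    exact hM _ τ

/-- A square is simply connected. This is the only form of homotopy invariance used for exchanging
and transporting curves: the holonomy of any path in the square depends on its ends alone. -/
theorem exists_flat_square (h : Holonomy Z M H) (Ψ : C(I × I, Z)) (hΨ : ∀ x, Ψ x ∈ M) :
    ∃ u : I × I → H, ∀ (γ : C(I, Z)) (p : C(I, I × I)), (∀ τ, γ τ = Ψ (p τ)) →
      h.hol γ = u (p 1) * (u (p 0))⁻¹ := by
  have := (convex_Icc (0 : ℝ) 1).contractibleSpace ⟨0, by simp⟩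
  obtain ⟨u, hu⟩ := h.exists_flat' (I × I) Ψ hΨ
  refine ⟨u, fun γ p hp => ?_⟩
  rw [← hu]
  congr 1
  ext τ
  exact hp τ

theorem hol_const {γ : C(I, Z)} {x : Z} (hx : x ∈ M) (hγ : ∀ τ, γ τ = x) : h.hol γ = 1 := by
  rw [← h.hol_refl hx]
  congr 1
  ext τ
  exact hγ τ

/-- A function that is a potential along the tracks of a contraction is a potential. -/
theorem FlatOn.of_contraction {f : Z → H} {V : Set Z} {P : Z} {K : V × I → Z} (hK : Continuous K)
    (hKM : ∀ x, K x ∈ M) (hK0 : ∀ x, K (x, 0) = x) (hK1 : ∀ x, K (x, 1) = P)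
    (ht : ∀ (x : V) (γ : C(I, Z)), (∀ τ, γ τ = K (x, τ)) → h.hol γ = f P * (f x)⁻¹) :
    h.FlatOn f V := by
  intro γ hγ
  -- The square is swept by `γ` under the contraction. One side is `γ`, the opposite side is
  -- constant at `P`, and the other two are tracks, where the increments of `f` are known.
  obtain ⟨u, hu⟩ := h.exists_flat_square ⟨fun x => K (⟨γ x.1, hγ x.1⟩, x.2), by fun_prop⟩ fun _ => hKM _
  have e0 := hu γ ⟨fun τ => (τ, 0), by fun_prop⟩ fun τ => (hK0 ⟨γ τ, hγ τ⟩).symm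
  have e1 := hu (.const I P) ⟨fun τ => (τ, 1), by fun_prop⟩ fun τ => (hK1 _).symm
  have track : ∀ τ : I, u (τ, 1) * (u (τ, 0))⁻¹ = f P * (f (γ τ))⁻¹ := fun τ => by
    rw [← ht ⟨γ τ, hγ τ⟩ ⟨fun υ => K (⟨γ τ, hγ τ⟩, υ), by fun_prop⟩ fun _ => rfl]
    exact (hu _ ⟨fun υ => (τ, υ), by fun_prop⟩ fun _ => rfl).symm
  have hP : P ∈ M := hK1 ⟨γ 0, hγ 0⟩ ▸ hKM _
  rw [hol_const hP fun _ => rfl] at e1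
  simp only [ContinuousMap.coe_mk] at e0 e1
  have t0 := track 0
  have t1 := track 1
  rw [mul_inv_eq_one.1 e1.symm] at t1
  rw [e0]
  have a1 : u (1, 0) = f (γ 1) * (f P)⁻¹ * u (0, 1) := by
    rw [mul_inv_eq_iff_eq_mul] at t1
    rw [t1]; group
  have a0 : u (0, 0) = f (γ 0) * (f P)⁻¹ * u (0, 1) := by
    rw [mul_inv_eq_iff_eq_mul] at t0
    rw [t0]; group
  rw [a1, a0]; group

/-! ### Products -/

section Prod

variable {F G : Type} [TopologicalSpace F] [TopologicalSpace G] {M : Set (F × G)}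

/-- The holonomy of `α × {Q}`. -/
def left (h : Holonomy (F × G) M H) (α : C(I, F)) (Q : G) : H := h.hol (α.prodMk (.const I Q))

/-- The holonomy of `{P} × β`. -/
def right (h : Holonomy (F × G) M H) (P : F) (β : C(I, G)) : H :=
  h.hol ((ContinuousMap.const I P).prodMk β)

variable {h : Holonomy (F × G) M H} {α : C(I, F)} {β : C(I, G)}

/-- The diagonal of the square spanned by `α` and `β` has the same ends as either path along two
sides. -/
theorem hol_prodMk (hM : ∀ τ υ, (α τ, β υ) ∈ M) :
    h.hol (α.prodMk β) = h.left α (β 1) * h.right (α 0) β ∧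
    h.hol (α.prodMk β) = h.right (α 1) β * h.left α (β 0) := by
  obtain ⟨u, hu⟩ := h.exists_flat_square ⟨fun x => (α x.1, β x.2), by fun_prop⟩ fun _ => hM _ _
  have e := hu (α.prodMk β) ⟨fun τ => (τ, τ), by fun_prop⟩ fun _ => rfl
  have l : ∀ υ, h.left α (β υ) = u (1, υ) * (u (0, υ))⁻¹ := fun υ =>
    hu _ ⟨fun τ => (τ, υ), by fun_prop⟩ fun _ => rfl
  have r : ∀ τ, h.right (α τ) β = u (τ, 1) * (u (τ, 0))⁻¹ := fun τ =>
    hu _ ⟨fun υ => (τ, υ), by fun_prop⟩ fun _ => rfl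
  rw [e, l, l, r, r]
  simp

theorem left_mul_right (hM : ∀ τ υ, (α τ, β υ) ∈ M) :
    h.left α (β 1) * h.right (α 0) β = h.right (α 1) β * h.left α (β 0) :=
  (hol_prodMk hM).1.symm.trans (hol_prodMk hM).2

/-- Potentials on two slices give a potential on the product. -/
theorem exists_flat_prod {A : Set F} {B : Set G} (hAB : A ×ˢ B ⊆ M) (hA : IsPathConnected A)
    (hB : IsPathConnected B) {P₀ : F} {Q₀ : G} (hP₀ : P₀ ∈ A) (hQ₀ : Q₀ ∈ B) {fA fB : F × G → H}
    (hfA : h.FlatOn fA (A ×ˢ {Q₀})) (hfB : h.FlatOn fB ({P₀} ×ˢ B))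
    (e : fA (P₀, Q₀) = fB (P₀, Q₀)) :
    ∃ f : F × G → H, h.FlatOn f (A ×ˢ B) ∧ (∀ P ∈ A, f (P, Q₀) = fA (P, Q₀)) ∧
      ∀ Q ∈ B, f (P₀, Q) = fB (P₀, Q) := by
  classical
  have ha : ∀ P, ∃ a : C(I, F), P ∈ A → (∀ τ, a τ ∈ A) ∧ a 0 = P₀ ∧ a 1 = P := by
    intro P
    by_cases hP : P ∈ A
    · obtain ⟨p, hp⟩ := hA.joinedIn P₀ hP₀ P hP
      exact ⟨p.toContinuousMap, fun _ => ⟨hp, p.source, p.target⟩⟩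
    · exact ⟨.const I P₀, fun h => absurd h hP⟩
  choose a ha using ha
  have hb : ∀ Q ∈ B, ∃ b : C(I, G), (∀ τ, b τ ∈ B) ∧ b 0 = Q₀ ∧ b 1 = Q := by
    intro Q hQ
    obtain ⟨p, hp⟩ := hB.joinedIn Q₀ hQ₀ Q hQ
    exact ⟨p.toContinuousMap, hp, p.source, p.target⟩
  have hM : ∀ {P Q}, P ∈ A → Q ∈ B → (P, Q) ∈ M := fun hP hQ => hAB ⟨hP, hQ⟩
  have lA : ∀ α : C(I, F), (∀ τ, α τ ∈ A) →
      h.left α Q₀ = fA (α 1, Q₀) * (fA (α 0, Q₀))⁻¹ := fun α hα => hfA _ fun τ => ⟨hα τ, rfl⟩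
  have rB : ∀ β : C(I, G), (∀ τ, β τ ∈ B) →
      h.right P₀ β = fB (P₀, β 1) * (fB (P₀, β 0))⁻¹ := fun β hβ => hfB _ fun τ => ⟨rfl, hβ τ⟩
  -- The value is continued from the slice over `P₀`, horizontally at the height of the point, along
  -- a path chosen for the first coordinate only.
  let f : F × G → H := fun z => h.left (a z.1) z.2 * fB (P₀, z.2)
  have fP₀ : ∀ P ∈ A, f (P, Q₀) = fA (P, Q₀) := by
    intro P hP
    obtain ⟨h1, h2, h3⟩ := ha P hP
    simp only [f]
    rw [lA _ h1, h2, h3, ← e]; group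
  have r : ∀ P ∈ A, ∀ β : C(I, G), (∀ τ, β τ ∈ B) →
      h.right P β = f (P, β 1) * (f (P, β 0))⁻¹ := by
    intro P hP β hβ
    obtain ⟨h1, h2, h3⟩ := ha P hP
    have key := left_mul_right (h := h) (α := a P) (β := β) fun τ υ => hM (h1 τ) (hβ υ)
    rw [h2, h3, rB β hβ] at key
    simp only [f]
    rw [eq_mul_inv_iff_mul_eq, ← mul_assoc, ← key]; group
  -- A horizontal path at height `Q` is compared with the one at height `Q₀`; the two vertical sides
  -- are already known by `r`.
  have l : ∀ Q ∈ B, ∀ α : C(I, F), (∀ τ, α τ ∈ A) →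
      h.left α Q = f (α 1, Q) * (f (α 0, Q))⁻¹ := by
    intro Q hQ α hα
    obtain ⟨b, h1, h2, h3⟩ := hb Q hQ
    have key := left_mul_right (h := h) (α := α) (β := b) fun τ υ => hM (hα τ) (h1 υ)
    rw [r _ (hα 0) b h1, r _ (hα 1) b h1, h2, h3, lA α hα, fP₀ _ (hα 0), fP₀ _ (hα 1)] at key
    rw [eq_mul_inv_iff_mul_eq]
    have := congrArg (· * fA (α 0, Q₀)) key
    simp only [mul_assoc, inv_mul_cancel, mul_one, inv_mul_cancel_left] at this
    exact this
  refine ⟨f, fun γ hγ => ?_, fP₀, ?_⟩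
  · let α : C(I, F) := ⟨fun τ => (γ τ).1, by fun_prop⟩
    let β : C(I, G) := ⟨fun τ => (γ τ).2, by fun_prop⟩
    have key := (hol_prodMk (h := h) (α := α) (β := β) fun τ υ => hM (hγ τ).1 (hγ υ).2).1
    rw [l (β 1) (hγ 1).2 α fun τ => (hγ τ).1, r (α 0) (hγ 0).1 β fun τ => (hγ τ).2] at key
    have e' : α.prodMk β = γ := by ext τ <;> rfl
    rw [e'] at key
    rw [key]
    simp only [α, β, ContinuousMap.coe_mk]
    group
  · intro Q hQ
    obtain ⟨b, h1, h2, h3⟩ := hb Q hQ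
    have := l Q hQ (.const I P₀) fun _ => hP₀
    obtain ⟨h4, h5, h6⟩ := ha P₀ hP₀
    -- The path chosen for `P₀` itself may be a nonconstant loop. Its holonomy vanishes at height
    -- `Q₀` because `fA` is a potential there, and this is transported to height `Q`.
    have key := left_mul_right (h := h) (α := a P₀) (β := b) fun τ υ => hM (h4 τ) (h1 υ)
    rw [h2, h3, h5, h6, lA _ h4, h5, h6, mul_inv_cancel, mul_one] at key
    simp only [f]
    rw [mul_eq_right.1 key, one_mul]

end Prod

end Holonomy
end SurfaceProduct

namespace SurfaceProduct

/-! ### Generators of the fundamental group of the closed surface -/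

section Generation

variable {k : ℕ}

theorem continuous_pt' : Continuous fun z : ZMod k × (ℝ × ℝ) => (pt z.1 z.2 : Surface k) :=
  continuous_prod_of_discrete_left.2 fun i => continuous_pt i

theorem mk_eq_pt (z : ZMod k × (I × I)) : (Quot.mk _ z : Surface k) = pt z.1 (z.2.1, z.2.2) := by
  simp [pt]

theorem exists_pt (Q : Surface k) : ∃ (i : ZMod k) (s t : I), Q = pt i (s, t) := by
  obtain ⟨⟨i, s, t⟩, rfl⟩ := Quot.exists_rep Q
  exact ⟨i, s, t, mk_eq_pt _⟩

/-- Besides the base point there is only one vertex: the slit gluing passes from the corner of one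
square to that of the next. -/
theorem pt_corner (i : ZMod k) (a b : I) (ha : a = 0 ∨ a = 1) (hb : b = 0 ∨ b = 1) :
    (pt i (a, b) : Surface k) = pt 0 (0, 0) := by
  have step : ∀ j : ZMod k, (pt (j + 1) (0, 0) : Surface k) = pt j (0, 0) := fun j => by
    rw [← pt_slit j (by norm_num), ← pt_side, pt_edge j (by norm_num), pt_side]
  have h0 : (pt i (0, 0) : Surface k) = pt 0 (0, 0) := by
    obtain ⟨n, rfl⟩ := ZMod.intCast_surjective i
    induction n using Int.induction_on with
    | zero => simp
    | succ n ih => rw [← ih]; push_cast; exact step _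
    | pred n ih => rw [← ih, ← step]; push_cast; ring_nf
  rw [← h0]
  have h1 : (pt i (1, 1) : Surface k) = pt i (0, 0) := by rw [pt_edge i (by norm_num), pt_side]
  rcases ha with rfl | rfl <;> rcases hb with rfl | rfl <;>
    simp only [Set.Icc.coe_zero, Set.Icc.coe_one]
  · rw [← pt_side, h1]
  · exact pt_side i _
  · exact h1

/-- The centre towards which a coordinate is contracted: `1 / 2`, or the nearest end of the interval. -/
noncomputable def contractCenter (a : Prop) [Decidable a] (x : ℝ) : ℝ :=
  if a then (if x < 1 / 2 then 0 else 1) else 1 / 2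

/-- The coordinates that can be contracted towards `contractCenter a`. -/
def Contractible (a : Prop) (x : ℝ) : Prop := (a → x ≠ 1 / 2) ∧ (¬ a → x ≠ 0 ∧ x ≠ 1)

theorem isOpen_contractible (a : Prop) : IsOpen {x | Contractible a x} := by
  by_cases ha : a <;> simp only [Contractible, ha, true_implies, not_true, not_false_eq_true, false_implies,
    true_and, and_true]
  · exact isOpen_ne
  · exact isOpen_ne.inter isOpen_ne

theorem continuousOn_contractCenter (a : Prop) [Decidable a] :
    ContinuousOn (contractCenter a) {x | Contractible a x} := by
  by_cases ha : a
  · intro x hx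
    have hx : x ≠ 1 / 2 := hx.1 ha
    refine ContinuousAt.continuousWithinAt ?_
    rcases hx.lt_or_gt with h | h
    · refine (continuousAt_const (y := (0 : ℝ))).congr ?_
      filter_upwards [gt_mem_nhds h] with y hy
      rw [contractCenter, if_pos ha, if_pos hy]
    · refine (continuousAt_const (y := (1 : ℝ))).congr ?_
      filter_upwards [lt_mem_nhds h] with y hy
      rw [contractCenter, if_pos ha, if_neg hy.not_gt]
  · exact (continuousOn_const (c := (1 / 2 : ℝ))).congr fun x _ => if_neg ha

/-- The straight path towards the centre. -/
noncomputable def contractTo (a : Prop) [Decidable a] (x τ : ℝ) : ℝ := (1 - τ) * x + τ * contractCenter a x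

variable (a b : Prop) [Decidable a] [Decidable b]

theorem contractTo_zero {x : ℝ} : contractTo a x 0 = x := by simp [contractTo]

theorem contractTo_one {x : ℝ} : contractTo a x 1 = contractCenter a x := by simp [contractTo]

theorem contractTo_of_zero (ha : a) (τ : ℝ) : contractTo a 0 τ = 0 := by
  simp [contractTo, contractCenter, ha]

theorem contractTo_of_one (ha : a) (τ : ℝ) : contractTo a 1 τ = 1 := by
  have : ¬ (1 : ℝ) < 1 / 2 := by norm_num
  rw [contractTo, contractCenter, if_pos ha, if_neg this]
  ring

/-- The slit half of an edge is preserved, as the gluing there requires. The point `1 / 2` has to be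
excluded when `a` holds, since its centre is then `1`. -/
theorem contractTo_le {x : ℝ} (hx : x ≤ 1 / 2) (hc : Contractible a x) (τ : I) :
    contractTo a x τ ≤ 1 / 2 := by
  have h0 := τ.2.1
  have h1 := τ.2.2
  unfold contractTo contractCenter
  split_ifs with h h' <;> try nlinarith
  exact absurd (le_antisymm hx (not_lt.1 h')) (hc.1 h)

theorem le_contractTo {x : ℝ} (hx : 1 / 2 ≤ x) (τ : I) : 1 / 2 ≤ contractTo a x τ := by
  have h0 := τ.2.1
  have h1 := τ.2.2
  unfold contractTo contractCenter
  split_ifs with h h' <;> try nlinarith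

/-- The representatives of points of an open set which is contracted; `b` says that the vertical
coordinate is contracted to the ends, otherwise it is contracted inside the `i`-th square. -/
def ContractDomain (i : ZMod k) (z : ZMod k × (I × I)) : Prop :=
  Contractible a z.2.1 ∧ Contractible b z.2.2 ∧ (¬ b → z.1 = i)

/-- The contraction on representatives. -/
noncomputable def contractPath (z : ZMod k × (I × I)) (τ : I) : Surface k :=
  pt z.1 (contractTo a z.2.1 τ, contractTo b z.2.2 τ)

variable {a b} {i : ZMod k}

/-- A coordinate `0` or `1` is admissible only if it is contracted towards the ends, and then it
does not move. So glued points have glued tracks. A slit gluing changes the square, but only where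
`b` holds and the square is unrestricted. -/
theorem ContractDomain.glue {z w : ZMod k × (I × I)} (h : Glue k z w) :
    (ContractDomain a b i z ↔ ContractDomain a b i w) ∧
      (ContractDomain a b i z → ∀ τ, contractPath a b z τ = contractPath a b w τ) := by
  have h01 : ∀ c : Prop, Contractible c 1 ↔ Contractible c 0 := by
    intro c; simp only [Contractible]; norm_num
  have hc : ∀ c : Prop, Contractible c 1 → c := by
    intro c h1; by_contra h2; exact (h1.2 h2).2 rfl
  rcases h with ⟨j, t⟩ | ⟨j, s, hs⟩ | ⟨j, s, hs⟩
  · refine ⟨?_, fun hz τ => ?_⟩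
    · simp only [ContractDomain, Set.Icc.coe_one, Set.Icc.coe_zero, h01]
    · have := hc a (by simpa using hz.1)
      simp only [contractPath, Set.Icc.coe_one, Set.Icc.coe_zero, contractTo_of_zero a this,
        contractTo_of_one a this]
      exact pt_side j _
  · refine ⟨?_, fun hz τ => ?_⟩
    · simp only [ContractDomain, Set.Icc.coe_one, Set.Icc.coe_zero, h01]
      constructor
      · rintro ⟨h1, h2, h3⟩
        exact ⟨h1, h2, fun hb => absurd (hc b ((h01 b).2 h2)) hb⟩
      · rintro ⟨h1, h2, h3⟩
        exact ⟨h1, h2, fun hb => absurd (hc b ((h01 b).2 h2)) hb⟩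
    · have := hc b (by simpa using hz.2.1)
      simp only [contractPath, Set.Icc.coe_one, Set.Icc.coe_zero, contractTo_of_zero b this,
        contractTo_of_one b this]
      exact pt_slit j (contractTo_le a hs hz.1 τ)
  · refine ⟨?_, fun hz τ => ?_⟩
    · simp only [ContractDomain, Set.Icc.coe_one, Set.Icc.coe_zero, h01]
    · have := hc b (by simpa using hz.2.1)
      simp only [contractPath, Set.Icc.coe_one, Set.Icc.coe_zero, contractTo_of_zero b this,
        contractTo_of_one b this]
      exact pt_edge j (le_contractTo a hs τ)

variable (a b i) in
/-- The open set which is contracted. -/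
def contractSet : Set (Surface k) :=
  {Q | Quot.lift (ContractDomain a b i) (fun _ _ h => propext (ContractDomain.glue h).1) Q}

theorem isOpen_contractSet : IsOpen (contractSet a b i) := by
  have : IsOpen {z : ZMod k × (I × I) | ContractDomain a b i z} := by
    have h1 : Continuous fun z : ZMod k × (I × I) => (z.2.1 : ℝ) := by fun_prop
    have h2 : Continuous fun z : ZMod k × (I × I) => (z.2.2 : ℝ) := by fun_prop
    have h3 : IsOpen {z : ZMod k × (I × I) | ¬ b → z.1 = i} := by
      have : {z : ZMod k × (I × I) | ¬ b → z.1 = i} = Prod.fst ⁻¹' {j | ¬ b → j = i} := rfl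
      rw [this]
      exact (isOpen_discrete _).preimage continuous_fst
    exact ((isOpen_contractible a).preimage h1).inter (((isOpen_contractible b).preimage h2).inter h3)
  exact this

theorem pt_mem_contractSet (s t : I) (j : ZMod k) :
    (pt j (s, t) : Surface k) ∈ contractSet a b i ↔ ContractDomain a b i (j, (s, t)) := by
  rw [← mk_eq_pt (j, (s, t))]
  rfl

open Classical in
/-- The contraction, on all of the surface (constant outside the open set `contractSet`). -/
noncomputable def contraction (a b : Prop) [Decidable a] [Decidable b] (i : ZMod k) (Q : Surface k) (τ : I) : Surface k :=
  Quot.lift (fun z => if ContractDomain a b i z then contractPath a b z τ else Quot.mk _ z) (by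
    intro z w h
    have h1 := ContractDomain.glue (a := a) (b := b) (i := i) h
    by_cases hz : ContractDomain a b i z
    · exact (if_pos hz).trans ((h1.2 hz τ).trans (if_pos (h1.1.1 hz)).symm)
    · exact (if_neg hz).trans ((Quot.sound h).trans (if_neg fun hw => hz (h1.1.2 hw)).symm)) Q

theorem contraction_pt {s t : I} {j : ZMod k} (h : ContractDomain a b i (j, (s, t))) (τ : I) :
    contraction a b i (pt j (s, t)) τ = contractPath a b (j, (s, t)) τ := by
  rw [← mk_eq_pt (j, (s, t))]
  exact if_pos h

/-- The quotient map stays a quotient map over an open set. Joint continuity in the time parameter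
is obtained by currying, as continuity of a map into `C(I, Surface k)`. -/
theorem continuous_contraction :
    Continuous fun x : contractSet a b i × I => contraction a b i x.1 x.2 := by
  let q : ZMod k × (I × I) → Surface k := Quot.mk _
  have hq : Topology.IsQuotientMap q := isQuotientMap_quot_mk
  let V' : Set (ZMod k × (I × I)) := q ⁻¹' contractSet a b i
  have hV' : ∀ z : V', ContractDomain a b i z := fun z => z.2
  have hqV : Topology.IsQuotientMap ((contractSet a b i).restrictPreimage q) :=
    hq.restrictPreimage_isOpen isOpen_contractSet
  have hcc : ∀ c : Prop, [Decidable c] → ∀ f : V' × I → ℝ, Continuous f → (∀ x, Contractible c (f x)) →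
      Continuous fun x : V' × I => contractTo c (f x) x.2 := by
    intro c _ f hf hc
    have h1 : Continuous fun x : V' × I => contractCenter c (f x) :=
      (continuousOn_contractCenter c).comp_continuous hf hc
    have h2 : Continuous fun x : V' × I => (x.2 : ℝ) := by fun_prop
    unfold contractTo
    fun_prop
  have h1 : Continuous fun x : V' × I => contractPath a b x.1.1 x.2 := by
    refine continuous_pt'.comp (.prodMk (by fun_prop) (.prodMk ?_ ?_))
    · exact hcc a _ (by fun_prop) fun x => (hV' x.1).1
    · exact hcc b _ (by fun_prop) fun x => (hV' x.1).2.1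
  have h2 : Continuous (ContinuousMap.curry ⟨_, h1⟩ : V' → C(I, Surface k)) := ContinuousMap.continuous _
  have hval : ∀ z : V', ∀ τ, contraction a b i (q z) τ = contractPath a b z.1 τ := fun z τ => if_pos (hV' z)
  have hcont : ∀ x : contractSet a b i, Continuous fun τ => contraction a b i x τ := by
    intro x
    obtain ⟨z, rfl⟩ := hqV.surjective x
    have : (fun τ => contraction a b i ((contractSet a b i).restrictPreimage q z) τ) =
        fun τ => contractPath a b z.1 τ := funext (hval z)
    rw [this]
    exact h1.comp (by fun_prop : Continuous fun τ : I => (z, τ))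
  let κ : contractSet a b i → C(I, Surface k) := fun x => ⟨_, hcont x⟩
  have hκ : Continuous κ := by
    rw [hqV.continuous_iff]
    convert h2
    ext z τ
    exact hval z τ
  exact ContinuousMap.continuous_uncurry_of_continuous ⟨κ, hκ⟩

variable {H : Type} [Group H]

/-- A holonomy on the closed surface which is trivial on the standard generators has a potential. -/
theorem Holonomy.exists_flat_surface (h : Holonomy (Surface k) Set.univ H)
    (hx : ∀ i, h.hol (xLoop i).toContinuousMap = 1) (hy : ∀ i, h.hol (yLoop i).toContinuousMap = 1) :
    ∃ f : Surface k → H, h.FlatOn f Set.univ := by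
  -- Each square has a potential. All are normalized at the vertex common to all squares, which
  -- makes them comparable across the slit.
  have hex : ∀ i : ZMod k, ∃ g : ℝ × ℝ → H, g (1 / 2, 0) = 1 ∧ ∀ (γ : C(I, Surface k)) (p : C(I, ℝ × ℝ)),
      (∀ τ, γ τ = pt i (p τ)) → h.hol γ = g (p 1) * (g (p 0))⁻¹ := by
    intro i
    obtain ⟨g, hg⟩ := h.exists_flat_convex convex_univ (continuous_pt i).continuousOn fun _ _ => Set.mem_univ _
    refine ⟨fun x => g x * (g (1 / 2, 0))⁻¹, by simp, fun γ p hp => ?_⟩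
    rw [hg γ p (fun _ => Set.mem_univ _) hp]
    group
  choose g g0 hg using hex
  have hseg : ∀ i p q, h.hol (seg i p q).toContinuousMap = g i q * (g i p)⁻¹ := by
    intro i p q
    have := hg i (seg i p q).toContinuousMap ⟨fun τ => AffineMap.lineMap p q (τ : ℝ),
      (AffineMap.lineMap_continuous).comp continuous_subtype_val⟩ fun _ => rfl
    simpa using this
  have hu : ∀ {x y : Surface k} (p : Path x y) τ, p τ ∈ (Set.univ : Set (Surface k)) :=
    fun _ _ => Set.mem_univ _
  -- the two ways to run along an identified segment
  have hpar : ∀ (i j : ZMod k) (p q p' q' : ℝ × ℝ),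
      (∀ τ : I, (pt i (AffineMap.lineMap p q (τ : ℝ)) : Surface k) = pt j (AffineMap.lineMap p' q' (τ : ℝ))) →
      g i p = g j p' → g i q = g j q' := by
    intro i j p q p' q' hpq e
    have h1 := hseg i p q
    have h2 := hseg j p' q'
    have : (seg i p q).toContinuousMap = (seg j p' q').toContinuousMap := by
      ext τ
      exact hpq τ
    rw [this, h2, e] at h1
    exact (mul_right_cancel h1).symm
  have hl : ∀ (u v u' v' τ : ℝ), AffineMap.lineMap (u, v) (u', v') τ =
      ((1 - τ) * u + τ * u', (1 - τ) * v + τ * v') := by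
    intro u v u' v' τ
    rw [AffineMap.lineMap_apply_module]
    simp
  -- Triviality on `x_i` gives equality where `x_i` crosses the side, and moving along the side
  -- gives it everywhere. The same works for the right half of the top side with `y_i`.
  have gside : ∀ i (t : ℝ), g i (1, t) = g i (0, t) := by
    intro i t
    have e : g i (1, 1 / 4) = g i (0, 1 / 4) := by
      have := hx i
      rw [xLoop, hLoop, hol_trans _ _ (hu _) (hu _)] at this
      rw [hseg] at this
      have e2 : h.hol ((seg i (0, 1 / 4) (5 / 8, 1 / 4)).cast (pt_side i (1 / 4)) rfl).toContinuousMap =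
        h.hol (seg i (0, 1 / 4) (5 / 8, 1 / 4)).toContinuousMap := rfl
      rw [e2, hseg] at this
      rw [mul_eq_one_iff_eq_inv] at this
      simpa using this.symm
    refine hpar i i (1, 1 / 4) _ (0, 1 / 4) _ (fun τ => ?_) e
    rw [hl, hl]
    have : (1 - (τ : ℝ)) * 1 + τ * 1 = 1 := by ring
    rw [this, pt_side]
    congr 2; ring
  have gedge : ∀ i (s : ℝ), 1 / 2 ≤ s → g i (s, 1) = g i (s, 0) := by
    intro i s hs
    have e : g i (5 / 8, 1) = g i (5 / 8, 0) := by
      have := hy i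
      rw [yLoop, vLoop, hol_trans _ _ (hu _) (hu _)] at this
      rw [hseg] at this
      have e2 : h.hol ((seg i (5 / 8, 0) (5 / 8, 1 / 4)).cast (pt_edge i (by norm_num)) rfl).toContinuousMap =
        h.hol (seg i (5 / 8, 0) (5 / 8, 1 / 4)).toContinuousMap := rfl
      rw [e2, hseg] at this
      rw [mul_eq_one_iff_eq_inv] at this
      simpa using this.symm
    refine hpar i i (5 / 8, 1) _ (5 / 8, 0) _ (fun τ => ?_) e
    rw [hl, hl]
    have : (1 - (τ : ℝ)) * 1 + τ * 1 = 1 := by ring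
    rw [this, pt_edge]
    · congr 2; ring
    · nlinarith [τ.2.1, τ.2.2]
  have gslit : ∀ i (s : ℝ), s ≤ 1 / 2 → g i (s, 1) = g (i + 1) (s, 0) := by
    intro i s hs
    -- No generator crosses the slit; the comparison starts at its end point `1 / 2`, where the
    -- normalization applies.
    refine hpar i (i + 1) (1 / 2, 1) _ (1 / 2, 0) _ (fun τ => ?_) ?_
    · rw [hl, hl]
      have : (1 - (τ : ℝ)) * 1 + τ * 1 = 1 := by ring
      rw [this, pt_slit]
      · congr 2; ring
      · nlinarith [τ.2.1, τ.2.2]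
    · rw [gedge i _ le_rfl, g0, g0]
  let f : Surface k → H := Quot.lift (fun z => g z.1 (z.2.1, z.2.2)) (by
    rintro _ _ (⟨i, t⟩ | ⟨i, s, hs⟩ | ⟨i, s, hs⟩)
    · exact gside i t
    · exact gslit i s hs
    · exact gedge i s hs)
  have fpt : ∀ i (s t : I), f (pt i (s, t)) = g i (s, t) := by
    intro i s t
    rw [← mk_eq_pt (i, (s, t))]
  classical
  -- The four choices of `a`, `b` give open sets contracting to a vertex, to the other vertex, to
  -- the midpoint of a side, or to the centre of a square. Each track stays in one square, where `f`
  -- is the potential of that square.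
  have local_flat : ∀ (a b : Prop) (i : ZMod k), h.FlatOn f (contractSet a b i) := by
    intro a b i
    have hcm : ∀ (c : Prop) (x : I), contractCenter c x ∈ I := by
      intro c x
      unfold contractCenter
      split_ifs <;> constructor <;> norm_num
    obtain ⟨P, hP⟩ : ∃ P : Surface k, ∀ (j : ZMod k) (s t : I), ContractDomain a b i (j, (s, t)) →
        pt j (contractCenter a s, contractCenter b t) = P := by
      have h01 : ∀ x : I, (if (x : ℝ) < 1 / 2 then (0 : ℝ) else 1) =
          (((if (x : ℝ) < 1 / 2 then 0 else 1) : I) : ℝ) := by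
        intro x; split_ifs <;> simp
      by_cases ha : a <;> by_cases hb : b <;> simp only [contractCenter, ha, hb, if_true, if_false]
      · refine ⟨pt 0 (0, 0), fun j s t _ => ?_⟩
        rw [h01, h01]
        exact pt_corner j _ _ (by split_ifs <;> simp) (by split_ifs <;> simp)
      · refine ⟨pt i (0, 1 / 2), fun j s t hz => ?_⟩
        obtain rfl : j = i := hz.2.2 (by simp)
        split_ifs
        · rfl
        · exact pt_side _ _
      · refine ⟨base k, fun j s t hz => ?_⟩
        split_ifs
        · exact pt_base j
        · rw [pt_edge j le_rfl]
          exact pt_base j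
      · refine ⟨pt i (1 / 2, 1 / 2), fun j s t hz => ?_⟩
        obtain rfl : j = i := hz.2.2 (by simp)
        rfl
    have rep : ∀ x : contractSet a b i, ∃ (j : ZMod k) (s t : I), ContractDomain a b i (j, (s, t)) ∧
        (x : Surface k) = pt j (s, t) := by
      rintro ⟨x, hx⟩
      obtain ⟨j, s, t, rfl⟩ := exists_pt x
      exact ⟨j, s, t, (pt_mem_contractSet s t j).1 hx, rfl⟩
    refine FlatOn.of_contraction (P := P) continuous_contraction (fun _ => Set.mem_univ _) ?_ ?_ ?_
    · intro x
      obtain ⟨j, s, t, hz, e⟩ := rep x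
      simp only [e, contraction_pt hz, contractPath, Set.Icc.coe_zero, contractTo_zero]
    · intro x
      obtain ⟨j, s, t, hz, e⟩ := rep x
      simp only [e, contraction_pt hz, contractPath, Set.Icc.coe_one, contractTo_one]
      exact hP j s t hz
    · intro x γ hγ
      obtain ⟨j, s, t, hz, e⟩ := rep x
      have := hg j γ ⟨fun τ => (contractTo a s τ, contractTo b t τ), by unfold contractTo; fun_prop⟩
        fun τ => by rw [hγ]; simp only [e, contraction_pt hz, contractPath, ContinuousMap.coe_mk]
      rw [this, ← hP j s t hz, e, fpt]
      simp only [ContinuousMap.coe_mk, Set.Icc.coe_zero, Set.Icc.coe_one, contractTo_zero, contractTo_one]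
      rw [fpt j ⟨_, hcm a s⟩ ⟨_, hcm b t⟩]
  refine ⟨f, FlatOn.of_local subset_rfl fun x _ => ?_⟩
  obtain ⟨j, s, t, rfl⟩ := exists_pt x
  -- A coordinate that is not `1 / 2` may be contracted to the ends, and the coordinate `1 / 2` may
  -- be contracted to the middle, so these sets cover the surface.
  refine ⟨contractSet ((s : ℝ) ≠ 1 / 2) ((t : ℝ) ≠ 1 / 2) j, isOpen_contractSet, ?_,
    (local_flat _ _ _).mono Set.inter_subset_left⟩
  rw [pt_mem_contractSet]
  refine ⟨⟨id, fun h => ?_⟩, ⟨id, fun h => ?_⟩, fun _ => rfl⟩ <;>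
  · rw [not_not] at h
    rw [h]
    norm_num

end Generation

end SurfaceProduct

namespace SurfaceProduct

/-! ### Distances and tubes -/

variable {k m : ℕ}

namespace Curve

/-- The transversal coordinate. -/
def level : Curve k → ℝ
  | horiz _ c _ => c
  | vert _ c _ => c

/-- The coordinate that is constant on the curve. -/
def height : Curve k → ℝ × ℝ → ℝ
  | horiz _ _ _, p => p.2
  | vert _ _ _, p => p.1

theorem level_mem (C : Curve k) : C.level ∈ Set.Icc (1 / 16 : ℝ) (15 / 16) := by
  cases C with
  | horiz i c h => exact h
  | vert i c h => exact ⟨by have := h.1; simp only [level]; linarith, h.2⟩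

open Classical in
theorem dist_pt (C : Curve k) (j : ZMod k) {p : ℝ × ℝ} (hp : p ∈ Set.Icc (0 : ℝ) 1 ×ˢ Set.Icc (0 : ℝ) 1) :
    C.dist (pt j p) = if j = C.sheet then min |C.height p - C.level| (1 / 16) else 1 / 16 := by
  have h1 : ((Set.projIcc 0 1 zero_le_one p.1 : I) : ℝ) = p.1 := by
    rw [Set.projIcc_of_mem _ hp.1]
  have h2 : ((Set.projIcc 0 1 zero_le_one p.2 : I) : ℝ) = p.2 := by
    rw [Set.projIcc_of_mem _ hp.2]
  cases C <;> simp only [dist, pt, h1, h2, height, level, sheet] <;> congr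

theorem dist_nonneg (C : Curve k) (P : Surface k) : 0 ≤ C.dist P := by
  obtain ⟨j, s, t, rfl⟩ := exists_pt P
  rw [dist_pt _ _ ⟨s.2, t.2⟩]
  split_ifs <;> positivity

theorem continuous_dist (C : Curve k) : Continuous C.dist := by
  classical
  refine isQuotientMap_quot_mk.continuous_iff.2 ?_
  refine continuous_prod_of_discrete_left.2 fun j => ?_
  have : (fun z : I × I => C.dist (Quot.mk _ (j, z))) = fun z : I × I =>
      if j = C.sheet then min |C.height (z.1, z.2) - C.level| (1 / 16) else 1 / 16 := by
    ext z
    rw [← C.dist_pt j (p := (z.1, z.2)) ⟨z.1.2, z.2.2⟩, ← mk_eq_pt (j, z)]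
  have h2 : Continuous fun z : I × I => C.height (z.1, z.2) := by
    cases C <;> simp only [height] <;> fun_prop
  refine (show Continuous fun z : I × I => C.dist (Quot.mk _ (j, z)) from ?_)
  rw [this]
  split_ifs <;> fun_prop

theorem coord_mem (C : Curve k) {θ r : ℝ} (hθ : θ ∈ I) (hr : |r| ≤ 1 / 16) :
    C.coord (θ, r) ∈ Set.Icc (0 : ℝ) 1 ×ˢ Set.Icc (0 : ℝ) 1 := by
  have hl := C.level_mem
  rw [abs_le] at hr
  cases C with
  | horiz i c h =>
    simp only [level] at hl
    exact ⟨hθ, by simp only [coord]; constructor <;> linarith [hl.1, hl.2, hr.1, hr.2]⟩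
  | vert i c h =>
    simp only [level] at hl
    exact ⟨by simp only [coord]; constructor <;> linarith [hl.1, hl.2, hr.1, hr.2], hθ⟩

theorem dist_point (C : Curve k) {θ r : ℝ} (hθ : θ ∈ I) (hr : |r| ≤ 1 / 16) :
    C.dist (C.point θ r) = |r| := by
  rw [point, dist_pt _ _ (C.coord_mem hθ hr), if_pos rfl]
  cases C <;> simp only [coord, height, level]
  · rw [add_sub_cancel_left, min_eq_left hr]
  · rw [sub_sub_cancel_left, abs_neg, min_eq_left hr]

theorem exists_point (C : Curve k) {P : Surface k} (hP : C.dist P < 1 / 16) :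
    ∃ θ ∈ I, ∃ r, |r| = C.dist P ∧ P = C.point θ r := by
  obtain ⟨j, s, t, rfl⟩ := exists_pt P
  rw [dist_pt _ _ ⟨s.2, t.2⟩] at hP ⊢
  split_ifs at hP ⊢ with hj
  · subst hj
    rw [min_lt_iff, or_iff_left (lt_irrefl _)] at hP
    rw [min_eq_left hP.le]
    cases C with
    | horiz i c h => exact ⟨s, s.2, t - c, rfl, by simp [point, coord]⟩
    | vert i c h => exact ⟨t, t.2, c - s, by simp only [height, level]; rw [abs_sub_comm], by simp [point, coord]⟩
  · exact absurd hP (lt_irrefl _)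

end Curve

/-- Below the truncation radius `1 / 16` the truncated distances are exactly the absolute values of
the transversal coordinates, so tubes become level and sublevel sets of a continuous function. -/
theorem mem_tube_iff {C : Curve k} {C' : Curve m} {S : Set ℝ} (hS : ∀ x ∈ S, x < (1 / 16) ^ 2)
    (z : Surface k × Surface m) : z ∈ tube C C' S ↔ C.dist z.1 ^ 2 + C'.dist z.2 ^ 2 ∈ S := by
  constructor
  · rintro ⟨θ, hθ, φ, hφ, r, q, hrq, rfl⟩
    have h := hS _ hrq
    have hr : |r| ≤ 1 / 16 := abs_le_of_sq_le_sq (by nlinarith [sq_nonneg q]) (by norm_num)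
    have hq : |q| ≤ 1 / 16 := abs_le_of_sq_le_sq (by nlinarith [sq_nonneg r]) (by norm_num)
    simpa only [C.dist_point hθ hr, C'.dist_point hφ hq, sq_abs] using hrq
  · intro h
    have h' := hS _ h
    have h1 : C.dist z.1 < 1 / 16 :=
      lt_of_pow_lt_pow_left₀ 2 (by norm_num) (by nlinarith [sq_nonneg (C'.dist z.2)])
    have h2 : C'.dist z.2 < 1 / 16 :=
      lt_of_pow_lt_pow_left₀ 2 (by norm_num) (by nlinarith [sq_nonneg (C.dist z.1)])
    obtain ⟨θ, hθ, r, hr, e⟩ := C.exists_point h1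
    obtain ⟨φ, hφ, q, hq, e'⟩ := C'.exists_point h2
    refine ⟨θ, hθ, φ, hφ, r, q, ?_, Prod.ext e e'⟩
    rwa [← sq_abs r, ← sq_abs q, hr, hq]

section

variable {C : Curve k} {C' : Curve m} {ε : ℝ}

theorem sq_lt_of_mem (hε : 0 < ε) (hε' : ε < 1 / 16) {x : ℝ} (hx : x ≤ ε ^ 2) : x < (1 / 16) ^ 2 := by
  nlinarith

theorem mem_tube_Iio (hε : 0 < ε) (hε' : ε < 1 / 16) (z : Surface k × Surface m) :
    z ∈ tube C C' (Set.Iio (ε ^ 2)) ↔ C.dist z.1 ^ 2 + C'.dist z.2 ^ 2 < ε ^ 2 :=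
  mem_tube_iff (fun _ hx => sq_lt_of_mem hε hε' (le_of_lt hx)) z

theorem mem_tube_Iic (hε : 0 < ε) (hε' : ε < 1 / 16) (z : Surface k × Surface m) :
    z ∈ tube C C' (Set.Iic (ε ^ 2)) ↔ C.dist z.1 ^ 2 + C'.dist z.2 ^ 2 ≤ ε ^ 2 :=
  mem_tube_iff (fun _ hx => sq_lt_of_mem hε hε' hx) z

theorem mem_tube_singleton (hε : 0 < ε) (hε' : ε < 1 / 16) (z : Surface k × Surface m) :
    z ∈ tube C C' {ε ^ 2} ↔ C.dist z.1 ^ 2 + C'.dist z.2 ^ 2 = ε ^ 2 :=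
  mem_tube_iff (fun _ hx => sq_lt_of_mem hε hε' (le_of_eq hx)) z

end

/-- Two parallel curves are apart, so that a point cannot be close to both. -/
def Curve.Apart (C D : Curve k) : Prop := ∀ P, C.dist P < 1 / 16 → 1 / 16 ≤ D.dist P

theorem Curve.Apart.symm {C D : Curve k} (h : C.Apart D) : D.Apart C := fun P hP => by
  by_contra hC
  exact (h P (not_le.1 hC)).not_gt hP

theorem Curve.apart_of_sheet {C D : Curve k} (h : C.sheet ≠ D.sheet) : C.Apart D := by
  intro P hP
  obtain ⟨j, s, t, rfl⟩ := exists_pt P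
  rw [dist_pt _ _ ⟨s.2, t.2⟩] at hP ⊢
  split_ifs at hP with h1
  · rw [if_neg fun h2 => h (h1.symm.trans h2)]
  · exact absurd hP (lt_irrefl _)

/-- The constant is twice the truncation radius, and the claim is the triangle inequality. -/
theorem Curve.apart_of_level {C D : Curve k} (hh : C.height = D.height)
    (h : 1 / 8 ≤ |C.level - D.level|) : C.Apart D := by
  intro P hP
  obtain ⟨j, s, t, rfl⟩ := exists_pt P
  rw [dist_pt _ _ ⟨s.2, t.2⟩] at hP ⊢
  by_cases h2 : j = D.sheet
  · rw [if_pos h2]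
    by_cases h1 : j = C.sheet
    · rw [if_pos h1, min_lt_iff, or_iff_left (lt_irrefl _), hh, abs_sub_comm] at hP
      refine le_min ?_ le_rfl
      have := abs_sub_le C.level (D.height (s, t)) D.level
      linarith
    · rw [if_neg h1] at hP
      exact absurd hP (lt_irrefl _)
  · rw [if_neg h2]

theorem disjoint_tube {C D : Curve k} {C' D' : Curve m} {ε : ℝ} (hε : 0 < ε) (hε' : ε < 1 / 16)
    (h : C.Apart D ∨ C'.Apart D') :
    Disjoint (tube C C' (Set.Iic (ε ^ 2))) (tube D D' (Set.Iic (ε ^ 2))) := by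
  rw [Set.disjoint_left]
  intro z hz hz'
  rw [mem_tube_Iic hε hε'] at hz hz'
  have key : ∀ x y : ℝ, 0 ≤ x → 0 ≤ y → x ^ 2 + y ^ 2 ≤ ε ^ 2 → x < 1 / 16 ∧ y < 1 / 16 := by
    intro x y hx hy h
    constructor <;> nlinarith
  have h1 := key _ _ (C.dist_nonneg _) (C'.dist_nonneg _) hz
  have h2 := key _ _ (D.dist_nonneg _) (D'.dist_nonneg _) hz'
  rcases h with h | h
  · exact (h _ h1.1).not_gt h2.1
  · exact (h _ h1.2).not_gt h2.2

/-- Tori of the same kind lie over different squares of `F`; tori of different kinds lie over the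
parallel curves `A` and `A'`. -/
theorem apart_puncturedTori {j j' : PuncturedIndex k} (h : j ≠ j') :
    (puncturedTori j).1.Apart (puncturedTori j').1 ∨ (puncturedTori j).2.Apart (puncturedTori j').2 := by
  have hXX' : (curveX (0 : ZMod 1)).Apart (curveX' 0) :=
    Curve.apart_of_level rfl (by norm_num [Curve.level, curveX, curveX', abs_of_neg])
  rcases j with i | i <;> rcases j' with i' | i'
  · exact Or.inl (Curve.apart_of_sheet fun e => h (congrArg _ e))
  · exact Or.inr hXX'
  · exact Or.inr hXX'.symm
  · exact Or.inl (Curve.apart_of_sheet fun e => h (congrArg _ e))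

/-- The new tori `J_1`, `J_2` are separated from the `T_i`, `L_i` by the square of `G`, and from
each other by the parallel curves `Y_1` and `Y'_1`. -/
theorem apart_tori {j j' : TorusIndex k} (h : j ≠ j') :
    (tori j).1.Apart (tori j').1 ∨ (tori j).2.Apart (tori j').2 := by
  have hXX' : (curveX (0 : ZMod 2)).Apart (curveX' 0) :=
    Curve.apart_of_level rfl (by norm_num [Curve.level, curveX, curveX', abs_of_neg])
  have hYY' : (curveY (0 : ZMod k)).Apart (curveY' 0) :=
    Curve.apart_of_level rfl (by norm_num [Curve.level, curveY, curveY', abs_of_neg])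
  have h01 : ∀ C D : Curve 2, C.sheet = 0 → D.sheet = 1 → C.Apart D := fun C D h1 h2 =>
    Curve.apart_of_sheet (by rw [h1, h2]; decide)
  rcases j with i | i | _ | _ <;> rcases j' with i' | i' | _ | _
  · exact Or.inl (Curve.apart_of_sheet fun e => h (congrArg _ e))
  · exact Or.inr hXX'
  · exact Or.inr (h01 _ _ rfl rfl)
  · exact Or.inr (h01 _ _ rfl rfl)
  · exact Or.inr hXX'.symm
  · exact Or.inl (Curve.apart_of_sheet fun e => h (congrArg _ e))
  · exact Or.inr (h01 _ _ rfl rfl)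
  · exact Or.inr (h01 _ _ rfl rfl)
  · exact Or.inr (h01 _ _ rfl rfl).symm
  · exact Or.inr (h01 _ _ rfl rfl).symm
  · exact absurd rfl h
  · exact Or.inl hYY'
  · exact Or.inr (h01 _ _ rfl rfl).symm
  · exact Or.inr (h01 _ _ rfl rfl).symm
  · exact Or.inl hYY'.symm
  · exact absurd rfl h

/-! ### Weinstein coordinates -/

/-- The linear part of the annular coordinates. -/
def Curve.linear : Curve k → (ℝ × ℝ →L[ℝ] ℝ × ℝ)
  | horiz _ _ _ => ContinuousLinearMap.id ℝ _
  | vert _ _ _ => (-ContinuousLinearMap.snd ℝ ℝ ℝ).prod (ContinuousLinearMap.fst ℝ ℝ ℝ)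

theorem Curve.hasFDerivAt_coord (C : Curve k) (x : ℝ × ℝ) : HasFDerivAt C.coord C.linear x := by
  cases C with
  | horiz i c h =>
    have : (Curve.horiz i c h).coord = fun x => (0, c) + x := by
      ext x <;> simp [coord]
    rw [this]
    exact (hasFDerivAt_id x).const_add _
  | vert i c h =>
    have : (Curve.vert i c h).coord =
        fun x => (c, 0) + (Curve.vert i c h).linear x := by
      ext x <;> simp [coord, linear, sub_eq_add_neg]
    rw [this]
    exact ((Curve.vert i c h).linear.hasFDerivAt).const_add _

theorem fderiv_tubeCoord (C : Curve k) (C' : Curve m) (x : (ℝ × ℝ) × (ℝ × ℝ)) :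
    fderiv ℝ (tubeCoord C C') x = C.linear.prodMap C'.linear :=
  ((C.hasFDerivAt_coord x.1).prodMap x (C'.hasFDerivAt_coord x.2)).fderiv

/-- Both linear parts have determinant one. For a vertical curve this is a quarter turn and explains
the sign in `c - r`. -/
theorem Curve.linear_area (C : Curve k) (v w : ℝ × ℝ) :
    (C.linear v).1 * (C.linear w).2 - (C.linear v).2 * (C.linear w).1 = v.1 * w.2 - v.2 * w.1 := by
  cases C <;> simp [linear]
  ring

theorem weinsteinCoord (C : Curve k) (C' : Curve m) : WeinsteinCoord C C' := by
  intro x v w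
  rw [fderiv_tubeCoord]
  simp only [flatForm, ContinuousLinearMap.coe_prodMap', Prod.map, C.linear_area, C'.linear_area]

theorem parallelsLagrangian (C : Curve k) (C' : Curve m) : ParallelsLagrangian C C' := by
  intro x
  refine ⟨?_, ?_⟩
  · rw [fderiv_tubeCoord, LinearIndependent.pair_iff]
    intro a b h
    have h1 := congrArg Prod.fst h
    have h2 := congrArg Prod.snd h
    cases C <;> cases C' <;> simpa [Curve.linear] using And.intro h1 h2
  · have := weinsteinCoord C C' x ((1, 0), (0, 0)) ((0, 0), (1, 0))
    rw [this]
    simp [flatForm]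

end SurfaceProduct

namespace SurfaceProduct

/-! ### Pushing points out of the tubes -/

variable {k m : ℕ}

/-- Truncation to `[-1/16, 1/16]`. -/
noncomputable def clamp (r : ℝ) : ℝ := max (-(1 / 16)) (min r (1 / 16))

/-- The radial stretching by the factor `l ≥ 1` near `0`, cut off at distance `1/16`. -/
noncomputable def stretch (l r : ℝ) : ℝ := r + (clamp (l * clamp r) - clamp r)

theorem continuous_clamp : Continuous clamp := by unfold clamp; fun_prop

theorem continuous_stretch : Continuous fun x : ℝ × ℝ => stretch x.1 x.2 := by
  have := continuous_clamp
  unfold stretch; fun_prop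

theorem clamp_of_abs_le {r : ℝ} (h : |r| ≤ 1 / 16) : clamp r = r := by
  rw [abs_le] at h
  rw [clamp, min_eq_left h.2, max_eq_right h.1]

theorem clamp_of_le {r : ℝ} (h : 1 / 16 ≤ r) : clamp r = 1 / 16 := by
  rw [clamp, min_eq_right h, max_eq_right (by norm_num)]

theorem clamp_of_le_neg {r : ℝ} (h : r ≤ -(1 / 16)) : clamp r = -(1 / 16) := by
  rw [clamp, max_eq_left ((min_le_left _ _).trans h)]

theorem abs_clamp (r : ℝ) : |clamp r| = min |r| (1 / 16) := by
  rcases le_total |r| (1 / 16) with h | h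
  · rw [clamp_of_abs_le h, min_eq_left h]
  · rw [min_eq_right h]
    rcases le_abs.1 h with h' | h'
    · rw [clamp_of_le h']; norm_num
    · rw [clamp_of_le_neg (by linarith)]; norm_num [abs_of_neg]

theorem stretch_one (r : ℝ) : stretch 1 r = r := by
  have : clamp (clamp r) = clamp r := clamp_of_abs_le (by rw [abs_clamp]; exact min_le_right _ _)
  rw [stretch, one_mul, this]; ring

theorem stretch_of_abs_le {l r : ℝ} (h : |r| ≤ 1 / 16) : stretch l r = clamp (l * r) := by
  rw [stretch, clamp_of_abs_le h]; ring

theorem stretch_of_le_abs {l r : ℝ} (hl : 1 ≤ l) (h : 1 / 16 ≤ |r|) : stretch l r = r := by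
  rcases le_abs.1 h with h' | h'
  · rw [stretch, clamp_of_le h', clamp_of_le (by linarith)]; ring
  · rw [stretch, clamp_of_le_neg (by linarith : r ≤ -(1 / 16)), clamp_of_le_neg (by linarith)]; ring

/-- Truncating on both sides lets one formula hold inside and outside the collar; it is exactly the
behaviour of the truncated distance under `Curve.push`. -/
theorem abs_stretch {l r : ℝ} (hl : 1 ≤ l) : min |stretch l r| (1 / 16) = min (l * min |r| (1 / 16)) (1 / 16) := by
  rcases le_total |r| (1 / 16) with h | h
  · rw [stretch_of_abs_le h, abs_clamp, min_assoc, min_self, abs_mul, abs_of_nonneg (by linarith : 0 ≤ l),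
      min_eq_left h]
  · rw [stretch_of_le_abs hl h, min_eq_right h, min_eq_right (by linarith)]

theorem add_stretch_mem {a b c l r : ℝ} (hl : 1 ≤ l) (h1 : a ≤ c - 1 / 16) (h2 : c + 1 / 16 ≤ b)
    (hr : c + r ∈ Set.Icc a b) : c + stretch l r ∈ Set.Icc a b := by
  rcases le_total |r| (1 / 16) with h | h
  · have : |stretch l r| ≤ 1 / 16 := by
      rw [stretch_of_abs_le h, abs_clamp]; exact min_le_right _ _
    rw [abs_le] at this
    constructor <;> linarith [this.1, this.2]
  · rwa [stretch_of_le_abs hl h]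

/-- Local compactness of the parameter space allows currying, so that joint continuity can be tested
on the disjoint squares before gluing. -/
theorem continuous_uncurry_surface {T X : Type} [TopologicalSpace T] [LocallyCompactSpace T] [TopologicalSpace X]
    {f : T → Surface k → X}
    (h : Continuous fun x : (ZMod k × (I × I)) × T => f x.2 (Quot.mk _ x.1)) :
    Continuous fun x : Surface k × T => f x.2 x.1 := by
  let π : ZMod k × (I × I) → Surface k := Quot.mk _
  have hq : Topology.IsQuotientMap π := isQuotientMap_quot_mk
  have hcont : ∀ P : Surface k, Continuous fun l => f l P := by
    intro P
    obtain ⟨z, rfl⟩ := hq.surjective P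
    exact h.comp (by fun_prop : Continuous fun l : T => (z, l))
  have hκ : Continuous (fun P => ⟨_, hcont P⟩ : Surface k → C(T, X)) := by
    rw [hq.continuous_iff]
    exact ContinuousMap.continuous (ContinuousMap.curry ⟨_, h⟩)
  exact ContinuousMap.continuous_uncurry_of_continuous ⟨_, hκ⟩

namespace Curve

/-- The stretching in the coordinates of the square of the curve. -/
noncomputable def stretchCoord : Curve k → ℝ → ℝ × ℝ → ℝ × ℝ
  | horiz _ c _, l, p => (p.1, c + stretch l (p.2 - c))
  | vert _ c _, l, p => (c + stretch l (p.1 - c), p.2)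

theorem continuous_stretchCoord (C : Curve k) :
    Continuous fun x : ℝ × (ℝ × ℝ) => C.stretchCoord x.1 x.2 := by
  cases C <;> simp only [stretchCoord]
  · exact .prodMk (by fun_prop) (continuous_const.add (continuous_stretch.comp
      (by fun_prop : Continuous fun x : ℝ × (ℝ × ℝ) => (x.1, x.2.2 - _))))
  · exact .prodMk (continuous_const.add (continuous_stretch.comp
      (by fun_prop : Continuous fun x : ℝ × (ℝ × ℝ) => (x.1, x.2.1 - _)))) (by fun_prop)

theorem stretchCoord_mem (C : Curve k) {l : ℝ} (hl : 1 ≤ l) {p : ℝ × ℝ}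
    (hp : p ∈ Set.Icc (0 : ℝ) 1 ×ˢ Set.Icc (0 : ℝ) 1) :
    C.stretchCoord l p ∈ Set.Icc (0 : ℝ) 1 ×ˢ Set.Icc (0 : ℝ) 1 := by
  have hl' := C.level_mem
  cases C with
  | horiz i c h =>
    simp only [level] at hl'
    exact ⟨hp.1, add_stretch_mem hl (by linarith [hl'.1]) (by linarith [hl'.2]) (by simpa using hp.2)⟩
  | vert i c h =>
    simp only [level] at hl'
    exact ⟨add_stretch_mem hl (by linarith [hl'.1]) (by linarith [hl'.2]) (by simpa using hp.1), hp.2⟩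

/-- The stretching on the surface. -/
noncomputable def push (C : Curve k) (l : ℝ) : Surface k → Surface k :=
  -- Truncating the factor below at `1` makes the map the identity for `l ≤ 1`, which is how points
  -- outside the tube are left fixed.
  Quot.lift (fun z => if z.1 = C.sheet then pt z.1 (C.stretchCoord (max 1 l) (z.2.1, z.2.2)) else
    pt z.1 (z.2.1, z.2.2)) (by
    have hl : 1 ≤ max 1 l := le_max_left _ _
    have habs : ∀ c : ℝ, c ∈ Set.Icc (1 / 16 : ℝ) (15 / 16) → c + stretch (max 1 l) (1 - c) = 1 ∧
        c + stretch (max 1 l) (0 - c) = 0 := by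
      intro c hc
      rw [stretch_of_le_abs hl (le_abs.2 (Or.inl (by linarith [hc.2]))),
        stretch_of_le_abs hl (le_abs.2 (Or.inr (by linarith [hc.1])))]
      constructor <;> ring
    have hC := C.level_mem
    cases C with
    | horiz i c h =>
      obtain ⟨h1, h0⟩ := habs c hC
      rintro _ _ (⟨j, t⟩ | ⟨j, s, hs⟩ | ⟨j, s, hs⟩) <;>
        simp only [stretchCoord, Set.Icc.coe_one, Set.Icc.coe_zero, h1, h0, ite_self]
      · split_ifs
        · exact pt_side j _
        · exact pt_side j _
      · exact pt_slit j hs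
      · exact pt_edge j hs
    | vert i c h =>
      obtain ⟨h1, h0⟩ := habs c hC
      rintro _ _ (⟨j, t⟩ | ⟨j, s, hs⟩ | ⟨j, s, hs⟩) <;>
        simp only [stretchCoord, Set.Icc.coe_one, Set.Icc.coe_zero, h1, h0, ite_self]
      · exact pt_side j _
      · have : c + stretch (max 1 l) (s - c) = s := by
          rw [stretch_of_le_abs hl (le_abs.2 (Or.inr (by linarith [h.1])))]; ring
        simp only [this, ite_self]
        exact pt_slit j hs
      · split_ifs
        · refine pt_edge j (add_stretch_mem (b := 1) hl (by linarith [h.1]) (by linarith [h.2]) ⟨?_, ?_⟩).1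
          · linarith
          · linarith [s.2.2]
        · exact pt_edge j hs)

theorem push_pt (C : Curve k) (l : ℝ) (j : ZMod k) (s t : I) : C.push l (pt j (s, t)) =
    if j = C.sheet then pt j (C.stretchCoord (max 1 l) (s, t)) else pt j (s, t) := by
  conv_lhs => rw [← mk_eq_pt (j, (s, t))]
  rfl

theorem continuous_push (C : Curve k) : Continuous fun x : ℝ × Surface k => C.push x.1 x.2 := by
  have h0 : Continuous fun x : ZMod k × ((I × I) × ℝ) => C.push x.2.2 (Quot.mk _ (x.1, x.2.1)) := by
    refine continuous_prod_of_discrete_left.2 fun j => ?_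
    have h2 : Continuous fun x : (I × I) × ℝ => C.stretchCoord (max 1 x.2) ((x.1.1 : ℝ), (x.1.2 : ℝ)) :=
      C.continuous_stretchCoord.comp
        (by fun_prop : Continuous fun x : (I × I) × ℝ => (max 1 x.2, ((x.1.1 : ℝ), (x.1.2 : ℝ))))
    refine (show Continuous fun x : (I × I) × ℝ => if j = C.sheet then
      pt j (C.stretchCoord (max 1 x.2) (x.1.1, x.1.2)) else pt j ((x.1.1 : ℝ), (x.1.2 : ℝ)) from ?_)
    split_ifs <;> fun_prop
  have h1 : Continuous fun x : (ZMod k × (I × I)) × ℝ => C.push x.2 (Quot.mk _ x.1) :=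
    h0.comp (by fun_prop : Continuous fun x : (ZMod k × (I × I)) × ℝ => (x.1.1, (x.1.2, x.2)))
  exact (continuous_uncurry_surface h1).comp continuous_swap

theorem push_of_le (C : Curve k) {l : ℝ} (hl : l ≤ 1) (P : Surface k) : C.push l P = P := by
  obtain ⟨j, s, t, rfl⟩ := exists_pt P
  rw [push_pt, max_eq_left hl]
  have : C.stretchCoord 1 ((s : ℝ), (t : ℝ)) = ((s : ℝ), (t : ℝ)) := by
    cases C <;> simp [stretchCoord, stretch_one]
  rw [this, ite_self]

theorem dist_push (C : Curve k) {l : ℝ} (hl : 1 ≤ l) (P : Surface k) :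
    C.dist (C.push l P) = min (l * C.dist P) (1 / 16) := by
  obtain ⟨j, s, t, rfl⟩ := exists_pt P
  have hp : ((s : ℝ), (t : ℝ)) ∈ Set.Icc (0 : ℝ) 1 ×ˢ Set.Icc (0 : ℝ) 1 := ⟨s.2, t.2⟩
  rw [push_pt, max_eq_right hl, C.dist_pt j hp]
  split_ifs with hj
  · rw [C.dist_pt j (C.stretchCoord_mem hl hp), if_pos hj, ← abs_stretch hl]
    cases C <;> simp [stretchCoord, height, level]
  · rw [C.dist_pt j hp, if_neg hj, min_eq_right (by linarith)]

end Curve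

section Tube

variable (C : Curve k) (C' : Curve m) {ε : ℝ}

/-- The squared distance to the product torus. -/
noncomputable def torusDist (z : Surface k × Surface m) : ℝ := C.dist z.1 ^ 2 + C'.dist z.2 ^ 2

theorem continuous_torusDist : Continuous (torusDist C C') := by
  have h1 := C.continuous_dist
  have h2 := C'.continuous_dist
  unfold torusDist
  fun_prop

/-- Pushing out of the tube of radius `ε`. -/
noncomputable def pushOut (ε : ℝ) (z : Surface k × Surface m) : Surface k × Surface m :=
  (C.push (ε / √(torusDist C C' z)) z.1, C'.push (ε / √(torusDist C C' z)) z.2)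

theorem continuousAt_pushOut {z : Surface k × Surface m} (hz : 0 < torusDist C C' z) :
    ContinuousAt (pushOut C C' ε) z := by
  have h1 : ContinuousAt (fun z => ε / √(torusDist C C' z)) z :=
    continuousAt_const.div (continuous_torusDist C C').sqrt.continuousAt (Real.sqrt_pos.2 hz).ne'
  exact (C.continuous_push.continuousAt.comp₂ h1 continuousAt_fst).prodMk
    (C'.continuous_push.continuousAt.comp₂ h1 continuousAt_snd)

theorem pushOut_of_le {z : Surface k × Surface m} (hz : ε ^ 2 ≤ torusDist C C' z) :
    pushOut C C' ε z = z := by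
  have : ε / √(torusDist C C' z) ≤ 1 := by
    have h : ε ≤ √(torusDist C C' z) := Real.le_sqrt_of_sq_le hz
    exact div_le_one_of_le₀ h (Real.sqrt_nonneg _)
  rw [pushOut, Curve.push_of_le _ this, Curve.push_of_le _ this]

theorem torusDist_pushOut (hε : 0 < ε) (hε' : ε < 1 / 16) {z : Surface k × Surface m} (h0 : 0 < torusDist C C' z)
    (hz : torusDist C C' z < ε ^ 2) : torusDist C C' (pushOut C C' ε z) = ε ^ 2 := by
  set l := ε / √(torusDist C C' z) with hl
  have hs : √(torusDist C C' z) ^ 2 = torusDist C C' z := Real.sq_sqrt h0.le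
  have hsp := Real.sqrt_pos.2 h0
  have hl1 : 1 ≤ l := by
    rw [hl, le_div_iff₀ hsp, one_mul]
    exact le_of_lt (lt_of_pow_lt_pow_left₀ 2 hε.le (by rwa [hs]))
  have hll : l ^ 2 * torusDist C C' z = ε ^ 2 := by
    rw [hl, div_pow, hs]
    field_simp
  have hd : l * C.dist z.1 ≤ ε := by
    refine abs_le_of_sq_le_sq' ?_ hε.le |>.2
    rw [mul_pow, ← hll, torusDist]
    nlinarith [sq_nonneg (C'.dist z.2), sq_nonneg l, mul_nonneg (sq_nonneg l) (sq_nonneg (C'.dist z.2))]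
  have hd' : l * C'.dist z.2 ≤ ε := by
    refine abs_le_of_sq_le_sq' ?_ hε.le |>.2
    rw [mul_pow, ← hll, torusDist]
    nlinarith [sq_nonneg (C.dist z.1), sq_nonneg l, mul_nonneg (sq_nonneg l) (sq_nonneg (C.dist z.1))]
  rw [torusDist, pushOut, ← hl]
  simp only
  rw [C.dist_push hl1, C'.dist_push hl1, min_eq_left (by linarith), min_eq_left (by linarith), ← hll, torusDist]
  ring

end Tube

/-- The complement of the open tubes retracts from the complement of the tori. -/
theorem exists_tube_retraction {ι : Type} [Finite ι] (tor : ι → Curve k × Curve m) {ε : ℝ} (hε : 0 < ε)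
    (hε' : ε < 1 / 16)
    (hdisj : ∀ j j', j ≠ j' → Disjoint (tube (tor j).1 (tor j).2 (Set.Iic (ε ^ 2)))
      (tube (tor j').1 (tor j').2 (Set.Iic (ε ^ 2)))) :
    ∃ ρ : Surface k × Surface m → Surface k × Surface m,
      ContinuousOn ρ {z | ∀ j, 0 < torusDist (tor j).1 (tor j).2 z} ∧
      (∀ z, (∀ j, 0 < torusDist (tor j).1 (tor j).2 z) →
        (ρ z = z ∨ ∃ j, torusDist (tor j).1 (tor j).2 (ρ z) = ε ^ 2) ∧
          ∀ j, ρ z ∉ tube (tor j).1 (tor j).2 (Set.Iio (ε ^ 2))) ∧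
      ∀ z, (∀ j, z ∉ tube (tor j).1 (tor j).2 (Set.Iio (ε ^ 2))) → ρ z = z := by
  classical
  have hlt : ∀ j z, z ∈ tube (tor j).1 (tor j).2 (Set.Iio (ε ^ 2)) ↔
      torusDist (tor j).1 (tor j).2 z < ε ^ 2 := fun j z => mem_tube_Iio hε hε' z
  -- Disjointness of the closed tubes means that at most one torus has to be pushed away from at a
  -- given point.
  have huniq : ∀ j j' z, torusDist (tor j).1 (tor j).2 z ≤ ε ^ 2 →
      torusDist (tor j').1 (tor j').2 z ≤ ε ^ 2 → j = j' := by
    intro j j' z h h'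
    by_contra hne
    exact Set.disjoint_left.1 (hdisj j j' hne) ((mem_tube_Iic hε hε' z).2 h) ((mem_tube_Iic hε hε' z).2 h')
  let ρ : Surface k × Surface m → Surface k × Surface m := fun z =>
    if h : ∃ j, torusDist (tor j).1 (tor j).2 z < ε ^ 2 then
      pushOut (tor h.choose).1 (tor h.choose).2 ε z else z
  have hρ : ∀ j z, torusDist (tor j).1 (tor j).2 z < ε ^ 2 → ρ z = pushOut (tor j).1 (tor j).2 ε z := by
    intro j z h
    have hex : ∃ j, torusDist (tor j).1 (tor j).2 z < ε ^ 2 := ⟨j, h⟩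
    have e : hex.choose = j := huniq _ _ z hex.choose_spec.le h.le
    simp only [ρ, dif_pos hex, e]
  have hρ' : ∀ z, (∀ j, ε ^ 2 ≤ torusDist (tor j).1 (tor j).2 z) → ρ z = z := by
    intro z h
    exact dif_neg fun ⟨j, hj⟩ => (h j).not_gt hj
  have hopen : ∀ p : ι → Prop, IsOpen {z | ∀ j, p j → ε ^ 2 < torusDist (tor j).1 (tor j).2 z} := by
    intro p
    simp only [Set.ofPred_forall]
    exact isOpen_iInter_of_finite fun j => isOpen_iInter_of_finite fun _ =>
      isOpen_lt continuous_const (continuous_torusDist _ _)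
  refine ⟨ρ, ?_, ?_, ?_⟩
  · intro z hz
    refine ContinuousAt.continuousWithinAt ?_
    by_cases hex : ∃ j, torusDist (tor j).1 (tor j).2 z ≤ ε ^ 2
    · obtain ⟨j, hj⟩ := hex
      -- Near a point of the closed tube of index `j`, boundary included, the other tubes are out of
      -- reach and the map is the radial push for `j`, which is already the identity outside the
      -- tube.
      refine (continuousAt_pushOut (tor j).1 (tor j).2 (ε := ε) (hz j)).congr ?_
      filter_upwards [(hopen (· ≠ j)).mem_nhds (fun j' hj' => not_le.1 fun h => hj' (huniq _ _ z h hj))]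
        with w hw
      by_cases hwj : torusDist (tor j).1 (tor j).2 w < ε ^ 2
      · exact (hρ j w hwj).symm
      · rw [pushOut_of_le _ _ (not_lt.1 hwj), hρ']
        intro j'
        by_cases hjj : j' = j
        · rw [hjj]; exact not_lt.1 hwj
        · exact (hw j' hjj).le
    · push Not at hex
      refine continuousAt_id.congr ?_
      filter_upwards [(hopen fun _ => True).mem_nhds (fun j' _ => hex j')] with w hw
      exact (hρ' w fun j => (hw j trivial).le).symm
  · intro z hz
    by_cases hex : ∃ j, torusDist (tor j).1 (tor j).2 z < ε ^ 2
    · obtain ⟨j, hj⟩ := hex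
      rw [hρ j z hj]
      have e := torusDist_pushOut _ _ hε hε' (hz j) hj
      refine ⟨Or.inr ⟨j, e⟩, fun j' => ?_⟩
      rw [hlt]
      intro h
      have := huniq _ _ _ h.le e.le
      rw [this] at h
      linarith
    · have hle : ∀ j, ε ^ 2 ≤ torusDist (tor j).1 (tor j).2 z := fun j => not_lt.1 fun h => hex ⟨j, h⟩
      rw [hρ' z hle]
      exact ⟨Or.inl rfl, fun j => by rw [hlt]; exact (hle j).not_gt⟩
  · intro z hz
    exact hρ' z fun j => not_lt.1 fun h => hz j ((hlt j z).2 h)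

/-! ### Pushing points out of the disc -/

/-- The point of the plane pushed radially out of the disc. -/
noncomputable def discPushCoord (p : ℝ × ℝ) : ℝ × ℝ :=
  let l := max 1 ((1 / 16) / √((p.1 - 1 / 4) ^ 2 + (p.2 - 1 / 8) ^ 2))
  (1 / 4 + l * (p.1 - 1 / 4), 1 / 8 + l * (p.2 - 1 / 8))

theorem discPushCoord_of_le {p : ℝ × ℝ} (hp : (1 / 16) ^ 2 ≤ (p.1 - 1 / 4) ^ 2 + (p.2 - 1 / 8) ^ 2) :
    discPushCoord p = p := by
  have h : (1 / 16) ≤ √((p.1 - 1 / 4) ^ 2 + (p.2 - 1 / 8) ^ 2) := Real.le_sqrt_of_sq_le hp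
  have : (1 / 16) / √((p.1 - 1 / 4) ^ 2 + (p.2 - 1 / 8) ^ 2) ≤ 1 :=
    div_le_one_of_le₀ h (Real.sqrt_nonneg _)
  simp only [discPushCoord, max_eq_left this]
  ext <;> ring

theorem discPushCoord_of_lt {p : ℝ × ℝ} (h0 : 0 < (p.1 - 1 / 4) ^ 2 + (p.2 - 1 / 8) ^ 2)
    (hp : (p.1 - 1 / 4) ^ 2 + (p.2 - 1 / 8) ^ 2 < (1 / 16) ^ 2) :
    ((discPushCoord p).1 - 1 / 4) ^ 2 + ((discPushCoord p).2 - 1 / 8) ^ 2 = (1 / 16) ^ 2 := by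
  have hs : √((p.1 - 1 / 4) ^ 2 + (p.2 - 1 / 8) ^ 2) ^ 2 = (p.1 - 1 / 4) ^ 2 + (p.2 - 1 / 8) ^ 2 :=
    Real.sq_sqrt h0.le
  have hsp := Real.sqrt_pos.2 h0
  have : 1 ≤ (1 / 16) / √((p.1 - 1 / 4) ^ 2 + (p.2 - 1 / 8) ^ 2) := by
    rw [le_div_iff₀ hsp, one_mul]
    exact le_of_lt (lt_of_pow_lt_pow_left₀ 2 (by norm_num) (by rwa [hs]))
  simp only [discPushCoord, max_eq_right this]
  have e : (1 / 4 + 1 / 16 / √((p.1 - 1 / 4) ^ 2 + (p.2 - 1 / 8) ^ 2) * (p.1 - 1 / 4) - 1 / 4) ^ 2 +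
      (1 / 8 + 1 / 16 / √((p.1 - 1 / 4) ^ 2 + (p.2 - 1 / 8) ^ 2) * (p.2 - 1 / 8) - 1 / 8) ^ 2 =
      ((1 / 16) / √((p.1 - 1 / 4) ^ 2 + (p.2 - 1 / 8) ^ 2)) ^ 2 *
        ((p.1 - 1 / 4) ^ 2 + (p.2 - 1 / 8) ^ 2) := by ring
  rw [e, div_pow, hs, div_mul_cancel₀ _ h0.ne']

/-- The point of the torus pushed radially out of the disc. -/
noncomputable def discPush : Surface 1 → Surface 1 :=
  Quot.lift (fun z => pt z.1 (discPushCoord (z.2.1, z.2.2))) (by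
    rintro _ _ (⟨j, t⟩ | ⟨j, s, hs⟩ | ⟨j, s, hs⟩)
    · simp only [Set.Icc.coe_one, Set.Icc.coe_zero]
      rw [discPushCoord_of_le, discPushCoord_of_le]
      · exact pt_side j _
      · nlinarith [sq_nonneg ((t : ℝ) - 1 / 8)]
      · nlinarith [sq_nonneg ((t : ℝ) - 1 / 8)]
    all_goals
      simp only [Set.Icc.coe_one, Set.Icc.coe_zero]
      rw [discPushCoord_of_le, discPushCoord_of_le]
    · exact pt_slit j hs
    · nlinarith [sq_nonneg ((s : ℝ) - 1 / 4)]
    · nlinarith [sq_nonneg ((s : ℝ) - 1 / 4)]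
    · exact pt_edge j hs
    · nlinarith [sq_nonneg ((s : ℝ) - 1 / 4)]
    · nlinarith [sq_nonneg ((s : ℝ) - 1 / 4)])

/-- The centre of the disc. -/
noncomputable def discCenter : Surface 1 := pt 0 (1 / 4, 1 / 8)

theorem discPush_pt (j : ZMod 1) (s t : I) : discPush (pt j (s, t)) = pt j (discPushCoord (s, t)) := by
  rw [← mk_eq_pt (j, (s, t))]
  rfl

theorem discDist_pt (j : ZMod 1) {p : ℝ × ℝ} (hp : p ∈ Set.Icc (0 : ℝ) 1 ×ˢ Set.Icc (0 : ℝ) 1) :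
    discDist (pt j p) = min ((p.1 - 1 / 4) ^ 2 + (p.2 - 1 / 8) ^ 2) ((1 / 16) ^ 2) := by
  simp only [discDist, pt]
  rw [Set.projIcc_of_mem zero_le_one hp.1, Set.projIcc_of_mem zero_le_one hp.2]

theorem continuous_discDist : Continuous discDist := by
  refine isQuotientMap_quot_mk.continuous_iff.2 ?_
  exact (by fun_prop : Continuous fun z : ZMod 1 × (I × I) =>
    min (((z.2.1 : ℝ) - 1 / 4) ^ 2 + ((z.2.2 : ℝ) - 1 / 8) ^ 2) ((1 / 16) ^ 2))

theorem discDist_pos_iff (Q : Surface 1) : 0 < discDist Q ↔ Q ≠ discCenter := by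
  obtain ⟨j, s, t, rfl⟩ := exists_pt Q
  have hc : discDist discCenter = 0 := by
    rw [discCenter, discDist_pt 0 ⟨by norm_num, by norm_num⟩]; norm_num
  constructor
  · rintro h rfl'
    rw [rfl', hc] at h
    exact lt_irrefl _ h
  · intro h
    rw [discDist_pt j ⟨s.2, t.2⟩]
    refine lt_min ?_ (by norm_num)
    by_contra h'
    have h1 : ((s : ℝ) - 1 / 4) ^ 2 = 0 := by nlinarith [sq_nonneg ((s : ℝ) - 1 / 4), sq_nonneg ((t : ℝ) - 1 / 8)]
    have h2 : ((t : ℝ) - 1 / 8) ^ 2 = 0 := by nlinarith [sq_nonneg ((s : ℝ) - 1 / 4), sq_nonneg ((t : ℝ) - 1 / 8)]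
    apply h
    rw [discCenter, Subsingleton.elim j 0]
    congr 2
    · linarith [pow_eq_zero_iff (two_ne_zero) |>.1 h1]
    · linarith [pow_eq_zero_iff (two_ne_zero) |>.1 h2]

theorem mem_disc_iff (Q : Surface 1) : Q ∈ disc ↔ discDist Q < (1 / 16) ^ 2 := by
  refine ⟨discDist_lt, fun h => ?_⟩
  obtain ⟨j, s, t, rfl⟩ := exists_pt Q
  rw [discDist_pt j ⟨s.2, t.2⟩, min_lt_iff, or_iff_left (lt_irrefl _)] at h
  exact ⟨(s, t), h, by rw [Subsingleton.elim j 0]⟩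

theorem discPush_of_notMem {Q : Surface 1} (h : Q ∉ disc) : discPush Q = Q := by
  obtain ⟨j, s, t, rfl⟩ := exists_pt Q
  rw [mem_disc_iff, discDist_pt j ⟨s.2, t.2⟩, not_lt, le_min_iff] at h
  rw [discPush_pt, discPushCoord_of_le h.1]

/-- The second alternative records that a displaced point still has height at most `3 / 16`. It is
therefore far from `A` and `A'`, and pushing out of the disc cannot reach a torus. -/
theorem discPush_spec {Q : Surface 1} (h : Q ≠ discCenter) : discPush Q ∉ disc ∧
    (discPush Q = Q ∨ ∃ p : ℝ × ℝ, p ∈ Set.Icc (0 : ℝ) 1 ×ˢ Set.Icc (0 : ℝ) (3 / 16) ∧ Q ∈ disc ∧ discPush Q = pt 0 p) := by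
  by_cases hQ : Q ∈ disc
  · have h0 := (discDist_pos_iff Q).2 h
    have h1 := discDist_lt hQ
    obtain ⟨j, s, t, rfl⟩ := exists_pt Q
    obtain rfl := Subsingleton.elim j 0
    rw [discDist_pt 0 ⟨s.2, t.2⟩, lt_min_iff] at h0
    rw [discDist_pt 0 ⟨s.2, t.2⟩, min_lt_iff, or_iff_left (lt_irrefl _)] at h1
    have e := discPushCoord_of_lt h0.1 h1
    have b1 : |(discPushCoord (s, t)).1 - 1 / 4| ≤ 1 / 16 :=
      abs_le_of_sq_le_sq (by nlinarith [sq_nonneg ((discPushCoord (s, t)).2 - 1 / 8)]) (by norm_num)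
    have b2 : |(discPushCoord (s, t)).2 - 1 / 8| ≤ 1 / 16 :=
      abs_le_of_sq_le_sq (by nlinarith [sq_nonneg ((discPushCoord (s, t)).1 - 1 / 4)]) (by norm_num)
    rw [abs_le] at b1 b2
    have hm : discPushCoord (s, t) ∈ Set.Icc (0 : ℝ) 1 ×ˢ Set.Icc (0 : ℝ) (3 / 16) :=
      ⟨⟨by linarith [b1.1], by linarith [b1.2]⟩, ⟨by linarith [b2.1], by linarith [b2.2]⟩⟩
    rw [discPush_pt, mem_disc_iff, discDist_pt 0 ⟨hm.1, ⟨hm.2.1, by linarith [hm.2.2]⟩⟩, e, min_self]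
    exact ⟨lt_irrefl _, Or.inr ⟨_, hm, hQ, rfl⟩⟩
  · rw [discPush_of_notMem hQ]
    exact ⟨hQ, Or.inl rfl⟩

theorem continuousOn_discPush : ContinuousOn discPush {Q | Q ≠ discCenter} := by
  have hopen : IsOpen {Q : Surface 1 | Q ≠ discCenter} := by
    simp only [← discDist_pos_iff]
    exact isOpen_lt continuous_const continuous_discDist
  let π : ZMod 1 × (I × I) → Surface 1 := Quot.mk _
  have hq : Topology.IsQuotientMap π := isQuotientMap_quot_mk
  rw [continuousOn_iff_continuous_domRestrict, (hq.restrictPreimage_isOpen hopen).continuous_iff]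
  let V' := π ⁻¹' {Q | Q ≠ discCenter}
  have h0 : ∀ z : V', ((z.1.2.1 : ℝ) - 1 / 4) ^ 2 + ((z.1.2.2 : ℝ) - 1 / 8) ^ 2 ≠ 0 := by
    intro z
    have := (discDist_pos_iff (Quot.mk _ z.1)).2 z.2
    rw [mk_eq_pt z.1, discDist_pt _ ⟨z.1.2.1.2, z.1.2.2.2⟩, lt_min_iff] at this
    exact this.1.ne'
  have h1 : Continuous fun z : V' => √(((z.1.2.1 : ℝ) - 1 / 4) ^ 2 + ((z.1.2.2 : ℝ) - 1 / 8) ^ 2) := by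
    fun_prop
  have h2 : Continuous fun z : V' => (1 / 16) / √(((z.1.2.1 : ℝ) - 1 / 4) ^ 2 + ((z.1.2.2 : ℝ) - 1 / 8) ^ 2) :=
    continuous_const.div h1 fun z => Real.sqrt_ne_zero'.2 (lt_of_le_of_ne (by positivity) (h0 z).symm)
  have h3 := (continuous_const (y := (1 : ℝ))).max h2
  refine continuous_pt'.comp (.prodMk (f := fun z : V' => z.1.1) (by fun_prop)
    (show Continuous fun z : V' => discPushCoord ((z.1.2.1 : ℝ), (z.1.2.2 : ℝ)) from ?_))
  unfold discPushCoord
  fun_prop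

end SurfaceProduct

namespace SurfaceProduct

namespace Holonomy

/-! ### Gluing products along walls -/

section Walls

variable {F G H : Type} [TopologicalSpace F] [TopologicalSpace G] [Group H] {M : Set (F × G)}

/-- The overlap of two products is a path connected product, so agreement at one point over `P₀`
suffices. Normalizing everything by a single potential over `P₀` makes all later gluings consistent.
-/
theorem FlatOn.eqOn_prod {h : Holonomy (F × G) M H} {f f' fG : F × G → H} {A A' : Set F} {B B' : Set G} (hf : h.FlatOn f (A ×ˢ B))
    (hf' : h.FlatOn f' (A' ×ˢ B')) (hA : IsPathConnected (A ∩ A')) (hB : IsPathConnected (B ∩ B')) {P₀ : F} (hP : P₀ ∈ A ∩ A')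
    (hG : ∀ Q ∈ B, f (P₀, Q) = fG (P₀, Q)) (hG' : ∀ Q ∈ B', f' (P₀, Q) = fG (P₀, Q)) :
    ∀ z ∈ (A ×ˢ B) ∩ (A' ×ˢ B'), f z = f' z := by
  obtain ⟨Q₀, hQ⟩ := hB.nonempty
  have e : (A ×ˢ B) ∩ (A' ×ˢ B') = (A ∩ A') ×ˢ (B ∩ B') := Set.prod_inter_prod
  refine (hf.mono Set.inter_subset_left).eqOn (hf'.mono Set.inter_subset_right) ?_ (x := (P₀, Q₀)) ?_ ?_
  · rw [e]
    exact hA.prod hB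
  · rw [e]
    exact ⟨hP, hQ⟩
  · rw [hG _ hQ.1, hG' _ hQ.2]

/-- Over a space `G` with two walls, which separate the part `B₁` from the part `B₀` and have the
neighbourhoods `A₁`, `A₂`, there is a potential on `FF × B₀ ∪ FF × B₁ ∪ FX × A₁ ∪ FY × A₂`. -/
theorem exists_flat_walls (h : Holonomy (F × G) M H) {FF FX FY : Set F} {B₀ B₁ A₁ A₂ : Set G}
    (oF : IsOpen FF) (oX : IsOpen FX) (oY : IsOpen FY) (oB₀ : IsOpen B₀) (oB₁ : IsOpen B₁) (oA₁ : IsOpen A₁)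
    (oA₂ : IsOpen A₂)
    (m₀ : FF ×ˢ B₀ ⊆ M) (m₁ : FF ×ˢ B₁ ⊆ M) (m₂ : FX ×ˢ A₁ ⊆ M) (m₃ : FY ×ˢ A₂ ⊆ M)
    (cF : IsPathConnected FF) (cX : IsPathConnected FX) (cY : IsPathConnected FY)
    (sX : FX ⊆ FF) (sY : FY ⊆ FF)
    (cB₀ : IsPathConnected B₀) (cB₁ : IsPathConnected B₁) (cA₁ : IsPathConnected A₁) (cA₂ : IsPathConnected A₂)
    (c₁₀ : IsPathConnected (A₁ ∩ B₀)) (c₁₁ : IsPathConnected (A₁ ∩ B₁)) (c₂₀ : IsPathConnected (A₂ ∩ B₀))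
    (c₂₁ : IsPathConnected (A₂ ∩ B₁)) (dB : Disjoint B₀ B₁) (dA : Disjoint A₁ A₂)
    {P₀ : F} (hX : P₀ ∈ FX) (hY : P₀ ∈ FY) {g : G} (hg : g ∈ B₀)
    {fG fF : F × G → H} (hfG : h.FlatOn fG ({P₀} ×ˢ (B₀ ∪ B₁ ∪ A₁ ∪ A₂))) (hfF : h.FlatOn fF (FF ×ˢ {g}))
    {ι : Type} (x y : ι → C(I, F)) (hx : ∀ i τ, x i τ ∈ FX) (hy : ∀ i τ, y i τ ∈ FY)
    (hx' : ∀ i, x i 0 = x i 1) (hy' : ∀ i, y i 0 = y i 1)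
    (gen : ∀ Q ∈ B₁, (∀ i, h.left (x i) Q = 1) → (∀ i, h.left (y i) Q = 1) → ∃ f : F × G → H, h.FlatOn f (FF ×ˢ {Q})) :
    ∃ f : F × G → H, h.FlatOn f (FF ×ˢ B₀ ∪ FF ×ˢ B₁ ∪ FX ×ˢ A₁ ∪ FY ×ˢ A₂) := by
  have hP : P₀ ∈ FF := sX hX
  have sG : ∀ {B : Set G}, B ⊆ B₀ ∪ B₁ ∪ A₁ ∪ A₂ → h.FlatOn fG ({P₀} ×ˢ B) := fun hB =>
    hfG.mono (Set.prod_mono_right hB)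
  have norm : ∀ {A : Set F} {Q : G} {f : F × G → H}, h.FlatOn f (A ×ˢ {Q}) →
      ∃ f' : F × G → H, h.FlatOn f' (A ×ˢ {Q}) ∧ f' (P₀, Q) = fG (P₀, Q) := fun {A Q f} hf =>
    ⟨_, hf.mul_right ((f (P₀, Q))⁻¹ * fG (P₀, Q)), by group⟩
  obtain ⟨fF', hfF', eF⟩ := norm hfF
  obtain ⟨f₀, hf₀, -, e₀⟩ := exists_flat_prod m₀ cF cB₀ hP hg hfF'
    (sG fun _ hq => Or.inl (Or.inl (Or.inl hq))) eF
  -- Over a wall neighbourhood the horizontal slice is taken on the outer side, where the potential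
  -- `f₀` is already available.
  have wall : ∀ {A : Set F} {B : Set G}, A ×ˢ B ⊆ M → A ⊆ FF → IsPathConnected A → IsPathConnected B →
      IsPathConnected (B ∩ B₀) → P₀ ∈ A → B ⊆ B₀ ∪ B₁ ∪ A₁ ∪ A₂ →
      ∃ f : F × G → H, h.FlatOn f (A ×ˢ B) ∧ ∀ Q ∈ B, f (P₀, Q) = fG (P₀, Q) := by
    intro A B hm hA cA cB cBB hPA hB
    obtain ⟨Q, hQ⟩ := cBB.nonempty
    obtain ⟨f, hf, -, e⟩ := exists_flat_prod hm cA cB hPA hQ.1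
      (hf₀.mono (Set.prod_mono hA (Set.singleton_subset_iff.2 hQ.2))) (sG hB) (e₀ Q hQ.2)
    exact ⟨f, hf, e⟩
  obtain ⟨f₂, hf₂, e₂⟩ := wall m₂ sX cX cA₁ c₁₀ hX fun _ hq => Or.inl (Or.inr hq)
  obtain ⟨f₃, hf₃, e₃⟩ := wall m₃ sY cY cA₂ c₂₀ hY fun _ hq => Or.inr hq
  obtain ⟨Q₁, hQ₁⟩ := c₁₁.nonempty
  -- A closed curve that survives over a wall has trivial holonomy there, hence also just inside the
  -- strip, and can then be transported within the strip, over which the whole fibre is present.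
  have move : ∀ {A : Set F} {B : Set G} {f : F × G → H}, h.FlatOn f (A ×ˢ B) → A ⊆ FF → IsPathConnected (B ∩ B₁) →
      ∀ γ : C(I, F), (∀ τ, γ τ ∈ A) → γ 0 = γ 1 → h.left γ Q₁ = 1 := by
    intro A B f hf hA cB γ hγ e
    obtain ⟨Q, hQ⟩ := cB.nonempty
    have h1 : h.left γ Q = 1 := by
      rw [left, hf _ fun τ => ⟨hγ τ, hQ.1⟩]
      simp [e]
    obtain ⟨b, hb⟩ := cB₁.joinedIn Q hQ.2 Q₁ hQ₁.2
    have key := left_mul_right (h := h) (α := γ) (β := b.toContinuousMap) fun τ υ => m₁ ⟨hA (hγ τ), hb υ⟩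
    simp only [Path.coe_toContinuousMap, Path.source, Path.target, h1, e, mul_one] at key
    exact mul_eq_right.1 key
  -- The curves `x` enter the strip through the first wall and the curves `y` through the second;
  -- neither wall alone would be enough.
  obtain ⟨fQ, hfQ⟩ := gen Q₁ hQ₁.2 (fun i => move hf₂ sX c₁₁ (x i) (hx i) (hx' i))
    (fun i => move hf₃ sY c₂₁ (y i) (hy i) (hy' i))
  obtain ⟨fQ', hfQ', eQ⟩ := norm hfQ
  obtain ⟨f₁, hf₁, -, e₁⟩ := exists_flat_prod m₁ cF cB₁ hP hQ₁.2 hfQ'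
    (sG fun _ hq => Or.inl (Or.inl (Or.inr hq))) eQ
  have i₀ : FX ∩ FF = FX := Set.inter_eq_left.2 sX
  have i₁ : FY ∩ FF = FY := Set.inter_eq_left.2 sY
  have a₂₀ := hf₂.eqOn_prod hf₀ (i₀.symm ▸ cX) c₁₀ ⟨hX, hP⟩ e₂ e₀
  have a₂₁ := hf₂.eqOn_prod hf₁ (i₀.symm ▸ cX) c₁₁ ⟨hX, hP⟩ e₂ e₁
  have a₃₀ := hf₃.eqOn_prod hf₀ (i₁.symm ▸ cY) c₂₀ ⟨hY, hP⟩ e₃ e₀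
  have a₃₁ := hf₃.eqOn_prod hf₁ (i₁.symm ▸ cY) c₂₁ ⟨hY, hP⟩ e₃ e₁
  obtain ⟨u, hu, u₀, u₁⟩ := hf₀.union hf₁ m₀ m₁ (oF.prod oB₀) (oF.prod oB₁)
    fun z hz => absurd hz.2.2 (Set.disjoint_left.1 dB hz.1.2)
  obtain ⟨v, hv, v₀, v₁⟩ := hu.union hf₂ (Set.union_subset m₀ m₁) m₂ ((oF.prod oB₀).union (oF.prod oB₁)) (oX.prod oA₁) (by
    rintro z ⟨hz | hz, hz'⟩
    · rw [u₀ z hz, a₂₀ z ⟨hz', hz⟩]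
    · rw [u₁ z hz, a₂₁ z ⟨hz', hz⟩])
  obtain ⟨w, hw, -⟩ := hv.union hf₃ (Set.union_subset (Set.union_subset m₀ m₁) m₂) m₃
    (((oF.prod oB₀).union (oF.prod oB₁)).union (oX.prod oA₁)) (oY.prod oA₂) (by
    rintro z ⟨(hz | hz) | hz, hz'⟩
    · rw [v₀ z (Or.inl hz), u₀ z hz, a₃₀ z ⟨hz', hz⟩]
    · rw [v₀ z (Or.inr hz), u₁ z hz, a₃₁ z ⟨hz', hz⟩]
    · exact absurd hz'.2 (Set.disjoint_left.1 dA hz.2))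
  exact ⟨w, hw⟩

end Walls

/-! ### Annuli -/

/-- A holonomy on an annulus which is trivial on the core has a potential. -/
theorem exists_flat_annulus {X H : Type} [TopologicalSpace X] [Group H] {M U : Set X} (h : Holonomy X M H)
    {J : Set ℝ} (hJ : Convex ℝ J) {e : ℝ × ℝ → X} (he : Continuous e) (hM : ∀ x, ∀ y ∈ J, e (x, y) ∈ M)
    (hper : ∀ x, ∀ y, e (x + 1, y) = e (x, y))
    {c : X → AddCircle (1 : ℝ)} (hc : Continuous c) {y : X → ℝ} (hy : ContinuousOn y U) (hyJ : ∀ Q ∈ U, y Q ∈ J)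
    (hU : ∀ Q ∈ U, ∀ x : ℝ, (x : AddCircle (1 : ℝ)) = c Q → e (x, y Q) = Q)
    {y₀ : ℝ} (hy₀ : y₀ ∈ J) {γ₀ : C(I, X)} {p₀ : C(I, ℝ)} (hp₀ : p₀ 1 = p₀ 0 + 1) (hγ₀ : ∀ τ, γ₀ τ = e (p₀ τ, y₀))
    (h1 : h.hol γ₀ = 1) : ∃ f : X → H, h.FlatOn f U := by
  obtain ⟨f, hf⟩ := h.exists_flat_convex (D := Set.univ ×ˢ J) (convex_univ.prod hJ) he.continuousOn
    fun x hx => hM x.1 x.2 hx.2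
  -- Triviality on the core says that the potential on the universal cover is periodic at one point
  -- of one level; the next step moves this to every point and level.
  have e0 : f (p₀ 0 + 1, y₀) = f (p₀ 0, y₀) := by
    have := hf γ₀ ⟨fun τ => (p₀ τ, y₀), by fun_prop⟩ (fun τ => ⟨Set.mem_univ _, hy₀⟩) hγ₀
    rw [h1] at this
    simp only [ContinuousMap.coe_mk, hp₀] at this
    exact mul_inv_eq_one.1 this.symm
  have per1 : ∀ x, ∀ t ∈ J, f (x + 1, t) = f (x, t) := by
    intro x t ht
    let p : C(I, ℝ × ℝ) := ⟨fun τ => ((1 - (τ : ℝ)) * p₀ 0 + τ * x, (1 - (τ : ℝ)) * y₀ + τ * t), by fun_prop⟩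
    have hp : ∀ τ, (p τ).2 ∈ J := fun τ => hJ hy₀ ht (sub_nonneg.2 τ.2.2) τ.2.1 (by ring)
    let γ : C(I, X) := ⟨fun τ => e (p τ), by fun_prop⟩
    have a1 := hf γ p (fun τ => ⟨Set.mem_univ _, hp τ⟩) fun _ => rfl
    have a2 := hf γ ⟨fun τ => ((p τ).1 + 1, (p τ).2), by fun_prop⟩ (fun τ => ⟨Set.mem_univ _, hp τ⟩)
      fun τ => (hper _ _).symm
    rw [a1] at a2
    simp only [p, ContinuousMap.coe_mk, Set.Icc.coe_zero, Set.Icc.coe_one, sub_zero, sub_self, one_mul, zero_mul,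
      add_zero, zero_add, e0] at a2
    exact (mul_right_cancel a2).symm
  have pern : ∀ (n : ℤ) x, ∀ t ∈ J, f (x + n, t) = f (x, t) := by
    intro n x t ht
    induction n using Int.induction_on with
    | zero => simp
    | succ n ih => push_cast at ih ⊢; rw [← add_assoc, per1 _ t ht, ih]
    | pred n ih =>
      push_cast at ih ⊢
      rw [← ih, ← per1 _ t ht]
      congr 2; ring
  have percoe : ∀ x x' : ℝ, (x : AddCircle (1 : ℝ)) = x' → ∀ t ∈ J, f (x, t) = f (x', t) := by
    intro x x' hxx t ht
    obtain ⟨n, hn⟩ := AddSubgroup.mem_zmultiples_iff.1 (QuotientAddGroup.eq.1 hxx)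
    have : x' = x + n := by rw [zsmul_eq_mul, mul_one] at hn; linarith
    rw [this, pern n x t ht]
  choose l hl using (QuotientAddGroup.mk_surjective : Function.Surjective ((↑) : ℝ → AddCircle (1 : ℝ)))
  refine ⟨fun Q => f (l (c Q), y Q), fun γ hγ => ?_⟩
  -- The angle is lifted continuously along the path. The end of the lift may differ from the chosen
  -- representative by an integer, which periodicity absorbs.
  obtain ⟨p, hp, -⟩ := (AddCircle.isCoveringMap_coe (1 : ℝ)).exists_path_lifts ⟨fun τ => c (γ τ), by fun_prop⟩ (l (c (γ 0))) (hl _).symm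
  have hp' : ∀ τ, (p τ : AddCircle (1 : ℝ)) = c (γ τ) := fun τ => congrFun hp τ
  have hyc : Continuous fun τ => y (γ τ) := hy.comp_continuous γ.continuous hγ
  rw [hf γ ⟨fun τ => (p τ, y (γ τ)), p.continuous.prodMk hyc⟩ (fun τ => ⟨Set.mem_univ _, hyJ _ (hγ τ)⟩)
    fun τ => (hU _ (hγ τ) _ (hp' τ)).symm]
  simp only [ContinuousMap.coe_mk]
  rw [percoe _ _ ((hp' 1).trans (hl _).symm) _ (hyJ _ (hγ 1)), percoe _ _ ((hp' 0).trans (hl _).symm) _ (hyJ _ (hγ 0))]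

end Holonomy

/-! ### Periodic charts -/

variable {k : ℕ}

/-- The chart of a square that is periodic in the horizontal direction. -/
noncomputable def hChart (i : ZMod k) (x : ℝ × ℝ) : Surface k := pt i (Int.fract x.1, x.2)

/-- The chart of a square that is periodic in the vertical direction, for `s ≥ 1/2`. -/
noncomputable def vChart (i : ZMod k) (x : ℝ × ℝ) : Surface k := pt i (max x.1 (1 / 2), Int.fract x.2)

/-- The chart of the torus that is periodic in both directions. -/
noncomputable def tChart (x : ℝ × ℝ) : Surface 1 := pt 0 (Int.fract x.1, Int.fract x.2)

theorem pt_one_torus (s : ℝ) : (pt 0 (s, 1) : Surface 1) = pt 0 (s, 0) := by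
  rcases le_total s (1 / 2) with h | h
  · exact pt_slit 0 h
  · exact pt_edge 0 h

@[fun_prop]
theorem continuous_hChart (i : ZMod k) : Continuous (hChart i) := by
  have := ContinuousOn.comp_fract (f := fun (x : ℝ × ℝ) (r : ℝ) => (pt i (r, x.2) : Surface k)) (s := Prod.fst)
    (Continuous.continuousOn (by unfold Function.uncurry; fun_prop)) continuous_fst fun x => (pt_side i x.2).symm
  exact this

@[fun_prop]
theorem continuous_vChart (i : ZMod k) : Continuous (vChart i) := by
  have := ContinuousOn.comp_fract (f := fun (x : ℝ × ℝ) (r : ℝ) => (pt i (max x.1 (1 / 2), r) : Surface k)) (s := Prod.snd)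
    (Continuous.continuousOn (by unfold Function.uncurry; fun_prop)) continuous_snd
    fun x => (pt_edge i (le_max_right _ _)).symm
  exact this

@[fun_prop]
theorem continuous_tChart : Continuous tChart := by
  have h1 : Continuous fun z : (ℝ × ℝ) × ℝ => (pt 0 (Int.fract z.1.1, z.2) : Surface 1) :=
    (continuous_hChart 0).comp (by fun_prop : Continuous fun z : (ℝ × ℝ) × ℝ => (z.1.1, z.2))
  have := ContinuousOn.comp_fract (f := fun (x : ℝ × ℝ) (r : ℝ) => (pt 0 (Int.fract x.1, r) : Surface 1)) (s := Prod.snd)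
    h1.continuousOn continuous_snd fun x => (pt_one_torus _).symm
  exact this

/-- The horizontal coordinate modulo `1`. -/
noncomputable def hCoord : Surface k → AddCircle (1 : ℝ) :=
  Quot.lift (fun z => ((z.2.1 : ℝ) : AddCircle (1 : ℝ))) (by
    rintro _ _ (⟨j, t⟩ | ⟨j, s, hs⟩ | ⟨j, s, hs⟩) <;> simp)

/-- The vertical coordinate modulo `1`. -/
noncomputable def vCoord : Surface k → AddCircle (1 : ℝ) :=
  Quot.lift (fun z => ((z.2.2 : ℝ) : AddCircle (1 : ℝ))) (by
    rintro _ _ (⟨j, t⟩ | ⟨j, s, hs⟩ | ⟨j, s, hs⟩) <;> simp)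

theorem hCoord_pt (i : ZMod k) {p : ℝ × ℝ} (hp : p.1 ∈ I) : hCoord (pt i p) = (p.1 : AddCircle (1 : ℝ)) := by
  simp only [hCoord, pt]
  rw [Set.projIcc_of_mem _ hp]

theorem vCoord_pt (i : ZMod k) {p : ℝ × ℝ} (hp : p.2 ∈ I) : vCoord (pt i p) = (p.2 : AddCircle (1 : ℝ)) := by
  simp only [vCoord, pt]
  rw [Set.projIcc_of_mem _ hp]

@[fun_prop]
theorem continuous_hCoord : Continuous (hCoord (k := k)) :=
  isQuotientMap_quot_mk.continuous_iff.2
    (continuous_quotient_mk'.comp (by fun_prop : Continuous fun z : ZMod k × (I × I) => (z.2.1 : ℝ)))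

@[fun_prop]
theorem continuous_vCoord : Continuous (vCoord (k := k)) :=
  isQuotientMap_quot_mk.continuous_iff.2
    (continuous_quotient_mk'.comp (by fun_prop : Continuous fun z : ZMod k × (I × I) => (z.2.2 : ℝ)))

/-- The parametrization of a loop that is cut into two segments. -/
noncomputable def loopParam (s : ℝ) : C(I, ℝ) :=
  ⟨fun τ => s + 2 * (1 - s) * min (τ : ℝ) (1 / 2) + 2 * s * max ((τ : ℝ) - 1 / 2) 0, by fun_prop⟩

theorem loopParam_zero (s : ℝ) : loopParam s 0 = s := by simp [loopParam]

theorem loopParam_one (s : ℝ) : loopParam s 1 = loopParam s 0 + 1 := by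
  rw [loopParam_zero]
  have h1 : min (1 : ℝ) (1 / 2) = 1 / 2 := by norm_num
  have h2 : max ((1 : ℝ) - 1 / 2) 0 = 1 / 2 := by norm_num
  simp only [loopParam, ContinuousMap.coe_mk, Set.Icc.coe_one, h1, h2]
  ring

theorem loopParam_of_le {s : ℝ} {τ : I} (h : (τ : ℝ) ≤ 1 / 2) : loopParam s τ = s + 2 * τ * (1 - s) := by
  simp only [loopParam, ContinuousMap.coe_mk, min_eq_left h, max_eq_right (by linarith : (τ : ℝ) - 1 / 2 ≤ 0)]
  ring

theorem loopParam_of_ge {s : ℝ} {τ : I} (h : 1 / 2 ≤ (τ : ℝ)) : loopParam s τ = 1 + (2 * τ - 1) * s := by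
  simp only [loopParam, ContinuousMap.coe_mk, min_eq_right h, max_eq_left (by linarith : 0 ≤ (τ : ℝ) - 1 / 2)]
  ring

theorem fract_loopParam_lt {s : ℝ} (hs : s ∈ Set.Ico (0 : ℝ) 1) {τ : I} (h : (τ : ℝ) < 1 / 2) :
    Int.fract (loopParam s τ) = s + 2 * τ * (1 - s) := by
  have := τ.2.1
  rw [loopParam_of_le h.le, Int.fract_eq_self]
  constructor
  · nlinarith [hs.1, hs.2]
  · nlinarith [hs.1, hs.2]

theorem fract_loopParam_ge {s : ℝ} (hs : s ∈ Set.Ico (0 : ℝ) 1) {τ : I} (h : 1 / 2 ≤ (τ : ℝ)) :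
    Int.fract (loopParam s τ) = (2 * τ - 1) * s := by
  have := τ.2.2
  rw [loopParam_of_ge h, add_comm, Int.fract_add_one, Int.fract_eq_self]
  constructor
  · nlinarith [hs.1, hs.2]
  · nlinarith [hs.1, hs.2]

theorem hLoop_eq (i : ZMod k) {s : ℝ} (hs : s ∈ Set.Ico (0 : ℝ) 1) (t : ℝ) (τ : I) :
    hLoop i s t τ = hChart i (loopParam s τ, t) := by
  rw [hLoop, Path.trans_apply, hChart]
  split_ifs with h
  · simp only [seg, Path.coe_mk_mk, AffineMap.lineMap_apply_module, Prod.smul_mk, Prod.mk_add_mk, smul_eq_mul]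
    rcases h.lt_or_eq with h' | h'
    · rw [fract_loopParam_lt hs h']
      congr 2 <;> ring
    -- At the break the loop is written with first coordinate `1`, while the fractional part is
    -- already `0`; the side gluing identifies them.
    · rw [fract_loopParam_ge hs h'.ge, h']
      have e1 : (1 - 2 * (1 / 2 : ℝ)) * s + 2 * (1 / 2) * 1 = 1 := by ring
      have e2 : (2 * (1 / 2 : ℝ) - 1) * s = 0 := by ring
      rw [e1, e2, pt_side]
      congr 2; ring
  · rw [fract_loopParam_ge hs (not_le.1 h).le]
    simp only [Path.cast_coe, seg, Path.coe_mk_mk, AffineMap.lineMap_apply_module, Prod.smul_mk, Prod.mk_add_mk, smul_eq_mul]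
    congr 2 <;> ring

theorem vLoop_eq (i : ZMod k) {s t : ℝ} (hs : 1 / 2 ≤ s) (ht : t ∈ Set.Ico (0 : ℝ) 1) (τ : I) :
    vLoop i s t hs τ = vChart i (s, loopParam t τ) := by
  rw [vLoop, Path.trans_apply, vChart]
  simp only [max_eq_left hs]
  split_ifs with h
  · simp only [seg, Path.coe_mk_mk, AffineMap.lineMap_apply_module, Prod.smul_mk, Prod.mk_add_mk, smul_eq_mul]
    rcases h.lt_or_eq with h' | h'
    · rw [fract_loopParam_lt ht h']
      congr 2 <;> ring
    · rw [fract_loopParam_ge ht h'.ge, h']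
      have e1 : (1 - 2 * (1 / 2 : ℝ)) * t + 2 * (1 / 2) * 1 = 1 := by ring
      have e2 : (2 * (1 / 2 : ℝ) - 1) * t = 0 := by ring
      have e3 : (1 - 2 * (1 / 2 : ℝ)) * s + 2 * (1 / 2) * s = s := by ring
      rw [e1, e2, e3, pt_edge i hs]
  · rw [fract_loopParam_ge ht (not_le.1 h).le]
    simp only [Path.cast_coe, seg, Path.coe_mk_mk, AffineMap.lineMap_apply_module, Prod.smul_mk, Prod.mk_add_mk, smul_eq_mul]
    congr 2 <;> ring

end SurfaceProduct

/-! ### Holonomy on slices of products, and regions of the surface. -/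

namespace SurfaceProduct

namespace Holonomy

variable {F G H : Type} [TopologicalSpace F] [TopologicalSpace G] [Group H] {M : Set (F × G)}

theorem hol_conj {Z : Type} [TopologicalSpace Z] {M : Set Z} {h : Holonomy Z M H} {x y : Z} (p : Path x y) (q : Path y y)
    (hp : ∀ τ, p τ ∈ M) (hq : ∀ τ, q τ ∈ M) :
    h.hol (p.trans (q.trans p.symm)).toContinuousMap =
      (h.hol p.toContinuousMap)⁻¹ * h.hol q.toContinuousMap * h.hol p.toContinuousMap := by
  have hp' : ∀ τ, p.symm τ ∈ M := fun τ => hp _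
  have hqp : ∀ τ, (q.trans p.symm) τ ∈ M := by
    intro τ
    have : (q.trans p.symm) τ ∈ Set.range (q.trans p.symm) := ⟨τ, rfl⟩
    rw [Path.trans_range] at this
    rcases this with ⟨υ, hυ⟩ | ⟨υ, hυ⟩
    · exact hυ ▸ hq υ
    · exact hυ ▸ hp' υ
  rw [hol_trans _ _ hp hqp, hol_trans _ _ hq hp', hol_symm _ hp]

/-- The holonomy on a slice `A × {Q}`. -/
noncomputable def sliceLeft (h : Holonomy (F × G) M H) (A : Set F) (Q : G) (hA : ∀ P ∈ A, (P, Q) ∈ M) : Holonomy F A H :=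
  h.comapOn (fun P => (P, Q)) (by fun_prop) hA

/-- The holonomy on a slice `{P} × B`. -/
noncomputable def sliceRight (h : Holonomy (F × G) M H) (B : Set G) (P : F) (hB : ∀ Q ∈ B, (P, Q) ∈ M) : Holonomy G B H :=
  h.comapOn (fun Q => (P, Q)) (by fun_prop) hB

variable {h : Holonomy (F × G) M H}

theorem sliceLeft_hol {A : Set F} {Q : G} (hA : ∀ P ∈ A, (P, Q) ∈ M) {α : C(I, F)} (hα : ∀ τ, α τ ∈ A) :
    (h.sliceLeft A Q hA).hol α = h.left α Q :=
  comapOn_hol _ _ _ _ _ _ hα fun _ => rfl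

theorem sliceRight_hol {B : Set G} {P : F} (hB : ∀ Q ∈ B, (P, Q) ∈ M) {β : C(I, G)} (hβ : ∀ τ, β τ ∈ B) :
    (h.sliceRight B P hB).hol β = h.right P β :=
  comapOn_hol _ _ _ _ _ _ hβ fun _ => rfl

theorem FlatOn.of_sliceLeft {A U : Set F} {Q : G} {hA : ∀ P ∈ A, (P, Q) ∈ M} {f : F → H}
    (hf : (h.sliceLeft A Q hA).FlatOn f U) (hU : U ⊆ A) : h.FlatOn (fun z => f z.1) (U ×ˢ {Q}) := by
  intro γ hγ
  have := hf ⟨fun τ => (γ τ).1, by fun_prop⟩ fun τ => (hγ τ).1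
  rw [sliceLeft_hol hA fun τ => hU (hγ τ).1] at this
  refine Eq.trans ?_ this
  rw [left]
  congr 1
  ext τ
  · rfl
  · exact (Set.mem_singleton_iff.1 (hγ τ).2)

theorem FlatOn.of_sliceRight {B U : Set G} {P : F} {hB : ∀ Q ∈ B, (P, Q) ∈ M} {f : G → H}
    (hf : (h.sliceRight B P hB).FlatOn f U) (hU : U ⊆ B) : h.FlatOn (fun z => f z.2) ({P} ×ˢ U) := by
  intro γ hγ
  have := hf ⟨fun τ => (γ τ).2, by fun_prop⟩ fun τ => (hγ τ).2
  rw [sliceRight_hol hB fun τ => hU (hγ τ).2] at this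
  refine Eq.trans ?_ this
  rw [right]
  congr 1
  ext τ
  · exact (Set.mem_singleton_iff.1 (hγ τ).1)
  · rfl

theorem exists_flat_surface_left {k : ℕ} {M : Set (Surface k × G)} (h : Holonomy (Surface k × G) M H) {Q : G}
    (hQ : ∀ P, (P, Q) ∈ M) (hx : ∀ i, h.left (xLoop i).toContinuousMap Q = 1) (hy : ∀ i, h.left (yLoop i).toContinuousMap Q = 1) :
    ∃ f : Surface k × G → H, h.FlatOn f (Set.univ ×ˢ {Q}) := by
  obtain ⟨f, hf⟩ := (h.sliceLeft Set.univ Q fun P _ => hQ P).exists_flat_surface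
    (fun i => (sliceLeft_hol _ fun _ => Set.mem_univ _).trans (hx i))
    fun i => (sliceLeft_hol _ fun _ => Set.mem_univ _).trans (hy i)
  exact ⟨_, hf.of_sliceLeft (Set.subset_univ _)⟩

theorem exists_flat_surface_right {k : ℕ} {M : Set (F × Surface k)} (h : Holonomy (F × Surface k) M H) {P : F}
    (hP : ∀ Q, (P, Q) ∈ M) (hx : ∀ i, h.right P (xLoop i).toContinuousMap = 1) (hy : ∀ i, h.right P (yLoop i).toContinuousMap = 1) :
    ∃ f : F × Surface k → H, h.FlatOn f ({P} ×ˢ Set.univ) := by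
  obtain ⟨f, hf⟩ := (h.sliceRight Set.univ P fun Q _ => hP Q).exists_flat_surface
    (fun i => (sliceRight_hol _ fun _ => Set.mem_univ _).trans (hx i))
    fun i => (sliceRight_hol _ fun _ => Set.mem_univ _).trans (hy i)
  exact ⟨_, hf.of_sliceRight (Set.subset_univ _)⟩

theorem left_conj {Q : G} {x y : F} (p : Path x y) (q : Path y y) (hp : ∀ τ, (p τ, Q) ∈ M) (hq : ∀ τ, (q τ, Q) ∈ M) :
    h.left (p.trans (q.trans p.symm)).toContinuousMap Q =
      (h.left p.toContinuousMap Q)⁻¹ * h.left q.toContinuousMap Q * h.left p.toContinuousMap Q := by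
  have hA : ∀ P ∈ {P | (P, Q) ∈ M}, (P, Q) ∈ M := fun _ h => h
  have hpq : ∀ τ, (p.trans (q.trans p.symm)) τ ∈ {P | (P, Q) ∈ M} := by
    intro τ
    have : (p.trans (q.trans p.symm)) τ ∈ Set.range (p.trans (q.trans p.symm)) := ⟨τ, rfl⟩
    rw [Path.trans_range, Path.trans_range] at this
    rcases this with ⟨υ, hυ⟩ | ⟨υ, hυ⟩ | ⟨υ, hυ⟩
    · exact hυ ▸ hp υ
    · exact hυ ▸ hq υ
    · exact hυ ▸ hp _
  have := hol_conj (h := h.sliceLeft _ Q hA) p q hp hq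
  rwa [sliceLeft_hol hA hpq, sliceLeft_hol hA hp, sliceLeft_hol hA hq] at this

theorem right_conj {P : F} {x y : G} (p : Path x y) (q : Path y y) (hp : ∀ τ, (P, p τ) ∈ M) (hq : ∀ τ, (P, q τ) ∈ M) :
    h.right P (p.trans (q.trans p.symm)).toContinuousMap =
      (h.right P p.toContinuousMap)⁻¹ * h.right P q.toContinuousMap * h.right P p.toContinuousMap := by
  have hA : ∀ Q ∈ {Q | (P, Q) ∈ M}, (P, Q) ∈ M := fun _ h => h
  have hpq : ∀ τ, (p.trans (q.trans p.symm)) τ ∈ {Q | (P, Q) ∈ M} := by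
    intro τ
    have : (p.trans (q.trans p.symm)) τ ∈ Set.range (p.trans (q.trans p.symm)) := ⟨τ, rfl⟩
    rw [Path.trans_range, Path.trans_range] at this
    rcases this with ⟨υ, hυ⟩ | ⟨υ, hυ⟩ | ⟨υ, hυ⟩
    · exact hυ ▸ hp υ
    · exact hυ ▸ hq υ
    · exact hυ ▸ hp _
  have := hol_conj (h := h.sliceRight _ P hA) p q hp hq
  rwa [sliceRight_hol hA hpq, sliceRight_hol hA hp, sliceRight_hol hA hq] at this

/-- Transport of a closed curve. -/
theorem left_eq_one_of_joined {α : C(I, F)} {Q Q' : G} (hα : α 0 = α 1) {B : Set G} (hB : JoinedIn B Q Q')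
    (hM : ∀ τ, ∀ q ∈ B, (α τ, q) ∈ M) (h1 : h.left α Q = 1) : h.left α Q' = 1 := by
  obtain ⟨b, hb⟩ := hB
  have key := left_mul_right (h := h) (α := α) (β := b.toContinuousMap) fun τ υ => hM τ _ (hb υ)
  simp only [Path.coe_toContinuousMap, Path.source, Path.target, h1, hα, mul_one] at key
  exact mul_eq_right.1 key

/-- Turns normal generation into the vanishing of a holonomy with values in the quotient by `N`:
every element is represented by a loop, whose holonomy is its class modulo `N`. -/
theorem eq_top_of_hol {Z : Type} [TopologicalSpace Z] {M : Set Z} {z : M} {N : Subgroup (FundamentalGroup M z)} [N.Normal]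
    (hN : ∀ γ : Path z.1 z.1, (∀ τ, γ τ ∈ M) → ((ofBase M z).mapHom (QuotientGroup.mk' N)).hol γ.toContinuousMap = 1) :
    N = ⊤ := by
  rw [eq_top_iff]
  rintro g -
  obtain ⟨p, hp⟩ := Quotient.exists_rep (FundamentalGroup.toPath g)
  have e : loopClass z.2 (p.map continuous_subtype_val) (fun τ => (p τ).2) = g := by
    exact (congrArg FundamentalGroup.fromPath hp : _)
  have := hN (p.map continuous_subtype_val) fun τ => (p τ).2
  have e' := ofBase_loop z.2 (p.map continuous_subtype_val) fun τ => (p τ).2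
  rw [e] at e'
  exact (QuotientGroup.eq_one_iff g).1 ((congrArg (QuotientGroup.mk' N) e').symm.trans this)

theorem mapHom_loop {Z : Type} [TopologicalSpace Z] {M : Set Z} (z : M) {N : Subgroup (FundamentalGroup M z)} [N.Normal]
    (γ : Path z.1 z.1) (hγ : ∀ τ, γ τ ∈ M) (hN : loopClass z.2 γ hγ ∈ N) :
    ((ofBase M z).mapHom (QuotientGroup.mk' N)).hol γ.toContinuousMap = 1 :=
  (congrArg (QuotientGroup.mk' N) (ofBase_loop z.2 γ hγ)).trans ((QuotientGroup.eq_one_iff _).2 hN)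

end Holonomy

/-! ### Regions of the surface -/

variable {k m : ℕ}

theorem mem_square {s t : ℝ} (h0 : 0 ≤ s) (h1 : s ≤ 1) (h2 : 0 ≤ t) (h3 : t ≤ 1) :
    (s, t) ∈ Set.Icc (0 : ℝ) 1 ×ˢ Set.Icc (0 : ℝ) 1 := ⟨⟨h0, h1⟩, h2, h3⟩

theorem exists_pt_square (Q : Surface k) : ∃ i : ZMod k, ∃ s t : ℝ, 0 ≤ s ∧ s ≤ 1 ∧ 0 ≤ t ∧ t ≤ 1 ∧ Q = pt i (s, t) := by
  obtain ⟨i, s, t, rfl⟩ := exists_pt Q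
  exact ⟨i, s, t, s.2.1, s.2.2, t.2.1, t.2.2, rfl⟩

theorem joinedIn_pt (i : ZMod k) {S : Set (Surface k)} {a b c d s t s' t' : ℝ}
    (hS : ∀ s t, a ≤ s → s ≤ b → c ≤ t → t ≤ d → pt i (s, t) ∈ S) (h : a ≤ s ∧ s ≤ b ∧ c ≤ t ∧ t ≤ d)
    (h' : a ≤ s' ∧ s' ≤ b ∧ c ≤ t' ∧ t' ≤ d) : JoinedIn S (pt i (s, t)) (pt i (s', t')) := by
  refine ⟨seg i (s, t) (s', t'), fun τ => ?_⟩
  have hm := ((convex_Icc a b).prod (convex_Icc c d)).lineMap_mem (x := (s, t)) (y := (s', t'))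
    (by exact ⟨⟨h.1, h.2.1⟩, h.2.2⟩) (by exact ⟨⟨h'.1, h'.2.1⟩, h'.2.2⟩) τ.2
  exact hS _ _ hm.1.1 hm.1.2 hm.2.1 hm.2.2

theorem isPathConnected_of_joined {S : Set (Surface k)} {Q : Surface k} (hQ : Q ∈ S)
    (h : ∀ i s t, 0 ≤ s → s ≤ 1 → 0 ≤ t → t ≤ 1 → pt i (s, t) ∈ S → JoinedIn S Q (pt i (s, t))) : IsPathConnected S := by
  refine ⟨Q, hQ, fun {P} hP => ?_⟩
  obtain ⟨i, s, t, h0, h1, h2, h3, rfl⟩ := exists_pt_square P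
  exact h i s t h0 h1 h2 h3 hP

/-- The infimum of the heights at which there are parallel closed curves. -/
noncomputable def Curve.floor : Curve k → ℝ
  | .horiz _ _ _ => 0
  | .vert _ _ _ => 1 / 2

theorem Curve.floor_nonneg (C : Curve k) : 0 ≤ C.floor := by
  cases C <;> norm_num [Curve.floor]

/-- The union of the parallel copies of a curve with heights in a set. -/
def Curve.band (C : Curve k) (J : Set ℝ) : Set (Surface k) :=
  {Q | Quot.lift (fun z : ZMod k × (I × I) => z.1 = C.sheet ∧ C.height (z.2.1, z.2.2) ∈ J ∩ Set.Ioo C.floor 1) (by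
    cases C
    all_goals
      rintro _ _ (⟨j, t⟩ | ⟨j, s, hs⟩ | ⟨j, s, hs⟩) <;> simp only [Curve.height, Curve.floor]
      <;> norm_num
    intros
    linarith) Q}

theorem Curve.pt_mem_band (C : Curve k) {J : Set ℝ} {j : ZMod k} {s t : ℝ} (h0 : 0 ≤ s) (h1 : s ≤ 1) (h2 : 0 ≤ t) (h3 : t ≤ 1) :
    pt j (s, t) ∈ C.band J ↔ j = C.sheet ∧ C.height (s, t) ∈ J ∩ Set.Ioo C.floor 1 := by
  simp only [pt]
  rw [Set.projIcc_of_mem _ (⟨h0, h1⟩ : s ∈ Set.Icc (0 : ℝ) 1), Set.projIcc_of_mem _ (⟨h2, h3⟩ : t ∈ Set.Icc (0 : ℝ) 1)]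
  rfl

theorem Curve.continuous_height (C : Curve k) : Continuous C.height := by
  cases C <;> (unfold height; fun_prop)

theorem Curve.isOpen_band (C : Curve k) {J : Set ℝ} (hJ : IsOpen J) : IsOpen (C.band J) := by
  let π : ZMod k × (I × I) → Surface k := Quot.mk _
  have hq : Topology.IsQuotientMap π := isQuotientMap_quot_mk
  rw [← hq.isOpen_preimage]
  have : π ⁻¹' C.band J = {z | z.1 = C.sheet} ∩ (fun z : ZMod k × (I × I) => C.height (z.2.1, z.2.2)) ⁻¹' (J ∩ Set.Ioo C.floor 1) := rfl
  rw [this]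
  have hc := C.continuous_height
  exact ((isOpen_discrete {C.sheet}).preimage continuous_fst).inter ((hJ.inter isOpen_Ioo).preimage (by fun_prop))

theorem Curve.isClosed_band (C : Curve k) {J : Set ℝ} (hJ : IsClosed J) (hJ' : J ⊆ Set.Ioo C.floor 1) : IsClosed (C.band J) := by
  let π : ZMod k × (I × I) → Surface k := Quot.mk _
  have hq : Topology.IsQuotientMap π := isQuotientMap_quot_mk
  rw [← hq.isClosed_preimage]
  have : π ⁻¹' C.band J = {z | z.1 = C.sheet} ∩ (fun z : ZMod k × (I × I) => C.height (z.2.1, z.2.2)) ⁻¹' (J ∩ Set.Ioo C.floor 1) := rfl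
  rw [this, Set.inter_eq_left.2 hJ']
  have hc := C.continuous_height
  exact ((isClosed_discrete {C.sheet}).preimage continuous_fst).inter (hJ.preimage (by fun_prop))

theorem Curve.isPathConnected_band (C : Curve k) {J : Set ℝ} (hJ : Convex ℝ (J ∩ Set.Ioo C.floor 1)) (hne : (J ∩ Set.Ioo C.floor 1).Nonempty) :
    IsPathConnected (C.band J) := by
  let D : Set (ℝ × ℝ) := {p | C.height p ∈ J ∩ Set.Ioo C.floor 1} ∩ Set.Icc (0 : ℝ) 1 ×ˢ Set.Icc (0 : ℝ) 1
  have hD : Convex ℝ D := by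
    refine Convex.inter ?_ ((convex_Icc _ _).prod (convex_Icc _ _))
    cases C
    · exact hJ.linear_preimage (LinearMap.snd ℝ ℝ ℝ)
    · exact hJ.linear_preimage (LinearMap.fst ℝ ℝ ℝ)
  have hn : D.Nonempty := by
    obtain ⟨x, hx⟩ := hne
    have h0 : x ∈ Set.Icc (0 : ℝ) 1 := ⟨C.floor_nonneg.trans hx.2.1.le, hx.2.2.le⟩
    cases C
    · exact ⟨(0, x), hx, by simp, h0⟩
    · exact ⟨(x, 0), hx, h0, by simp⟩
  have e : C.band J = pt C.sheet '' D := by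
    ext Q
    constructor
    · intro hQ
      obtain ⟨i, s, t, h0, h1, h2, h3, rfl⟩ := exists_pt_square Q
      obtain ⟨rfl, h⟩ := (C.pt_mem_band h0 h1 h2 h3).1 hQ
      exact ⟨(s, t), ⟨h, ⟨h0, h1⟩, h2, h3⟩, rfl⟩
    · rintro ⟨⟨s, t⟩, ⟨h, ⟨h0, h1⟩, h2, h3⟩, rfl⟩
      exact (C.pt_mem_band h0 h1 h2 h3).2 ⟨rfl, h⟩
  rw [e]
  exact (hD.isPathConnected hn).image (continuous_pt _)

theorem Curve.dist_pos_iff (C : Curve k) {j : ZMod k} {s t : ℝ} (h0 : 0 ≤ s) (h1 : s ≤ 1) (h2 : 0 ≤ t) (h3 : t ≤ 1) :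
    0 < C.dist (pt j (s, t)) ↔ (j = C.sheet → C.height (s, t) ≠ C.level) := by
  rw [C.dist_pt j (mem_square h0 h1 h2 h3)]
  split_ifs with h
  · simp [h, sub_eq_zero]
  · simp [h]

theorem torusDist_pos_iff (C : Curve k) (C' : Curve m) (z : Surface k × Surface m) :
    0 < torusDist C C' z ↔ 0 < C.dist z.1 ∨ 0 < C'.dist z.2 := by
  have h1 := C.dist_nonneg z.1
  have h2 := C'.dist_nonneg z.2
  constructor
  · intro h
    by_contra! hc
    have e1 : C.dist z.1 = 0 := le_antisymm hc.1 h1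
    have e2 : C'.dist z.2 = 0 := le_antisymm hc.2 h2
    simp [torusDist, e1, e2] at h
  · rintro (h | h) <;> (unfold torusDist; positivity)

theorem isOpen_dist_pos (C : Curve k) : IsOpen {P | 0 < C.dist P} := isOpen_lt continuous_const C.continuous_dist

/-- The complement of the curves `X_i`. -/
def complX (k : ℕ) : Set (Surface k) := {P | ∀ i : ZMod k, 0 < (curveX i).dist P}

/-- The complement of the curves `Y_i`. -/
def complY (k : ℕ) : Set (Surface k) := {P | ∀ i : ZMod k, 0 < (curveY i).dist P}

theorem isOpen_complX [NeZero k] : IsOpen (complX k) := by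
  rw [complX, Set.ofPred_forall]
  exact isOpen_iInter_of_finite fun i => isOpen_dist_pos _

theorem isOpen_complY [NeZero k] : IsOpen (complY k) := by
  rw [complY, Set.ofPred_forall]
  exact isOpen_iInter_of_finite fun i => isOpen_dist_pos _

theorem pt_mem_complX {j : ZMod k} {s t : ℝ} (h0 : 0 ≤ s) (h1 : s ≤ 1) (h2 : 0 ≤ t) (h3 : t ≤ 1) :
    pt j (s, t) ∈ complX k ↔ t ≠ 1 / 2 := by
  simp only [complX, Set.mem_ofPred_eq, Curve.dist_pos_iff _ h0 h1 h2 h3]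
  exact ⟨fun h => h j rfl, fun h _ _ => h⟩

theorem pt_mem_complY {j : ZMod k} {s t : ℝ} (h0 : 0 ≤ s) (h1 : s ≤ 1) (h2 : 0 ≤ t) (h3 : t ≤ 1) :
    pt j (s, t) ∈ complY k ↔ s ≠ 3 / 4 := by
  simp only [complY, Set.mem_ofPred_eq, Curve.dist_pos_iff _ h0 h1 h2 h3]
  exact ⟨fun h => h j rfl, fun h _ _ => h⟩

theorem base_mem_complX : base k ∈ complX k := by
  rw [base, pt_mem_complX] <;> norm_num

theorem base_mem_complY : base k ∈ complY k := by
  rw [base, pt_mem_complY] <;> norm_num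

theorem pt_base' (i : ZMod k) : pt i (1 / 2, 1) = base k := by rw [pt_edge i le_rfl, pt_base]

/-- The curves cut every square into a lower and an upper part, and the base point lies on both the
bottom and the top side of every square. -/
theorem isPathConnected_complX : IsPathConnected (complX k) := by
  refine isPathConnected_of_joined base_mem_complX fun i s t h0 h1 h2 h3 h => ?_
  rw [pt_mem_complX h0 h1 h2 h3] at h
  rcases h.lt_or_gt with h | h
  · rw [← pt_base i]
    refine joinedIn_pt i (a := 0) (b := 1) (c := 0) (d := t) (fun s' t' a1 a2 a3 a4 => ?_) (by norm_num; linarith) ⟨h0, h1, h2, le_rfl⟩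
    exact (pt_mem_complX a1 a2 a3 (a4.trans h3)).2 (a4.trans_lt h).ne
  · rw [← pt_base' i]
    refine joinedIn_pt i (a := 0) (b := 1) (c := t) (d := 1) (fun s' t' a1 a2 a3 a4 => ?_) (by norm_num; linarith) ⟨h0, h1, le_rfl, h3⟩
    exact (pt_mem_complX a1 a2 (h2.trans a3) a4).2 (h.trans_le a3).ne'

/-- The part to the right of the curve is reached through the side gluing, from the left edge of the
same square. -/
theorem isPathConnected_complY : IsPathConnected (complY k) := by
  refine isPathConnected_of_joined base_mem_complY fun i s t h0 h1 h2 h3 h => ?_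
  rw [pt_mem_complY h0 h1 h2 h3] at h
  have low : ∀ s, 0 ≤ s → s < 3 / 4 → JoinedIn (complY k) (base k) (pt i (s, t)) := by
    intro s h0 h
    rw [← pt_base i]
    refine joinedIn_pt i (a := 0) (b := max s (1 / 2)) (c := 0) (d := 1) (fun s' t' a1 a2 a3 a4 => ?_) (by norm_num) ⟨h0, le_max_left _ _, h2, h3⟩
    have : max s (1 / 2) < 3 / 4 := max_lt h (by norm_num)
    exact (pt_mem_complY a1 (by linarith) a3 a4).2 (a2.trans_lt this).ne
  rcases h.lt_or_gt with h | h
  · exact low s h0 h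
  · refine (low 0 le_rfl (by norm_num)).trans ?_
    rw [← pt_side]
    refine joinedIn_pt i (a := s) (b := 1) (c := 0) (d := 1) (fun s' t' a1 a2 a3 a4 => ?_) ⟨h1, le_rfl, h2, h3⟩ ⟨le_rfl, h1, h2, h3⟩
    exact (pt_mem_complY (h0.trans a1) a2 a3 a4).2 (h.trans_le a1).ne'

end SurfaceProduct

/-! ### Walls along parallel curves, and the punctured torus. -/

namespace SurfaceProduct

variable {k m : ℕ} {H : Type} [Group H]

namespace Curve

theorem band_inter (C : Curve k) (J J' : Set ℝ) : C.band J ∩ C.band J' = C.band (J ∩ J') := by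
  ext Q
  obtain ⟨i, s, t, h0, h1, h2, h3, rfl⟩ := exists_pt_square Q
  simp only [Set.mem_inter_iff, C.pt_mem_band h0 h1 h2 h3]
  tauto

theorem band_mono (C : Curve k) {J J' : Set ℝ} (h : J ⊆ J') : C.band J ⊆ C.band J' := by
  intro Q
  obtain ⟨i, s, t, h0, h1, h2, h3, rfl⟩ := exists_pt_square Q
  simp only [C.pt_mem_band h0 h1 h2 h3]
  exact fun hQ => ⟨hQ.1, h hQ.2.1, hQ.2.2⟩

theorem band_union (C : Curve k) (J J' : Set ℝ) : C.band (J ∪ J') = C.band J ∪ C.band J' := by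
  ext Q
  obtain ⟨i, s, t, h0, h1, h2, h3, rfl⟩ := exists_pt_square Q
  simp only [Set.mem_union, Set.mem_inter_iff, C.pt_mem_band h0 h1 h2 h3]
  tauto

theorem band_diff (C : Curve k) (J J' : Set ℝ) : C.band J \ C.band J' = C.band (J \ J') := by
  ext Q
  obtain ⟨i, s, t, h0, h1, h2, h3, rfl⟩ := exists_pt_square Q
  simp only [Set.mem_sdiff, Set.mem_inter_iff, C.pt_mem_band h0 h1 h2 h3]
  tauto

theorem band_empty (C : Curve k) : C.band ∅ = ∅ := by
  ext Q
  obtain ⟨i, s, t, h0, h1, h2, h3, rfl⟩ := exists_pt_square Q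
  simp [C.pt_mem_band h0 h1 h2 h3]

theorem isPathConnected_band_Ioo (C : Curve k) {a b : ℝ} (hab : a < b) (ha : C.floor ≤ a) (hb : b ≤ 1) :
    IsPathConnected (C.band (Set.Ioo a b)) := by
  have e : Set.Ioo a b ∩ Set.Ioo C.floor 1 = Set.Ioo a b :=
    Set.inter_eq_left.2 (Set.Ioo_subset_Ioo ha hb)
  refine C.isPathConnected_band ?_ ?_ <;> rw [e]
  · exact convex_Ioo a b
  · exact Set.nonempty_Ioo.2 hab

end Curve

/-- A potential on a product over a surface with two walls along parallel curves. -/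
theorem Holonomy.exists_flat_bands {F : Type} [TopologicalSpace F] {M : Set (F × Surface m)}
    (h : Holonomy (F × Surface m) M H) (C : Curve m) {w w' d : ℝ} (hd : 0 < d) (h0 : C.floor ≤ w - d) (hw : w + d ≤ w' - d)
    (h1 : w' + d ≤ 1) {E : Set (Surface m)} (oE : IsOpen E) (hE : C.band (Set.Ioo (w - d) (w' + d)) ⊆ E)
    (cE : IsPathConnected (E \ C.band (Set.Icc w w'))) {FF FX FY : Set F} (oF : IsOpen FF) (oX : IsOpen FX) (oY : IsOpen FY)
    (cF : IsPathConnected FF) (cX : IsPathConnected FX) (cY : IsPathConnected FY) (sX : FX ⊆ FF) (sY : FY ⊆ FF)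
    (hM : ∀ P ∈ FF, ∀ Q ∈ E, (Q ∈ C.band {w} → P ∈ FX) → (Q ∈ C.band {w'} → P ∈ FY) → (P, Q) ∈ M)
    {P₀ : F} (hX : P₀ ∈ FX) (hY : P₀ ∈ FY) {g : Surface m} (hg : g ∈ E \ C.band (Set.Icc w w'))
    {fG fF : F × Surface m → H} (hfG : h.FlatOn fG ({P₀} ×ˢ E)) (hfF : h.FlatOn fF (FF ×ˢ {g}))
    {ι : Type} (x y : ι → C(I, F)) (hx : ∀ i τ, x i τ ∈ FX) (hy : ∀ i τ, y i τ ∈ FY)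
    (hx' : ∀ i, x i 0 = x i 1) (hy' : ∀ i, y i 0 = y i 1)
    (gen : ∀ Q ∈ C.band (Set.Ioo w w'), (∀ i, h.left (x i) Q = 1) → (∀ i, h.left (y i) Q = 1) →
      ∃ f : F × Surface m → H, h.FlatOn f (FF ×ˢ {Q})) :
    ∃ f : F × Surface m → H, h.FlatOn f {z | z.1 ∈ FF ∧ z.2 ∈ E ∧ (z.2 ∈ C.band {w} → z.1 ∈ FX) ∧ (z.2 ∈ C.band {w'} → z.1 ∈ FY)} := by
  have hww : w < w' := by linarith
  have sub : Set.Icc w w' ⊆ Set.Ioo C.floor 1 := fun x hx => ⟨by linarith [hx.1], by linarith [hx.2]⟩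
  have nb : ∀ {J : Set ℝ} {Q a}, Q ∈ C.band J → a ∉ J → Q ∉ C.band {a} := by
    intro J Q a hQ ha hQ'
    have := (C.band_inter J {a}).le ⟨hQ, hQ'⟩
    rw [Set.inter_singleton_eq_empty.2 ha, C.band_empty] at this
    exact this
  have mono : ∀ {J : Set ℝ}, J ⊆ Set.Ioo (w - d) (w' + d) → C.band J ⊆ E := fun hJ => (C.band_mono hJ).trans hE
  have i₁₀ : C.band (Set.Ioo (w - d) (w + d)) ∩ (E \ C.band (Set.Icc w w')) = C.band (Set.Ioo (w - d) w) := by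
    rw [← Set.inter_sdiff_assoc, Set.inter_eq_left.2 (mono (Set.Ioo_subset_Ioo_right (by linarith))), C.band_diff]
    congr 1
    ext u
    simp only [Set.mem_sdiff, Set.mem_Ioo, Set.mem_Icc, not_and, not_le]
    exact ⟨fun h => ⟨h.1.1, lt_of_not_ge fun hu => by linarith [h.2 hu, h.1.2]⟩,
      fun h => ⟨⟨h.1, by linarith⟩, fun hu => absurd h.2 (not_lt.2 hu)⟩⟩
  have i₂₀ : C.band (Set.Ioo (w' - d) (w' + d)) ∩ (E \ C.band (Set.Icc w w')) = C.band (Set.Ioo w' (w' + d)) := by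
    rw [← Set.inter_sdiff_assoc, Set.inter_eq_left.2 (mono (Set.Ioo_subset_Ioo_left (by linarith))), C.band_diff]
    congr 1
    ext u
    simp only [Set.mem_sdiff, Set.mem_Ioo, Set.mem_Icc, not_and, not_le]
    exact ⟨fun h => ⟨h.2 (by linarith [h.1.1]), h.1.2⟩, fun h => ⟨⟨by linarith, h.2⟩, fun _ => h.1⟩⟩
  have i₁₁ : C.band (Set.Ioo (w - d) (w + d)) ∩ C.band (Set.Ioo w w') = C.band (Set.Ioo w (w + d)) := by
    rw [C.band_inter, Set.Ioo_inter_Ioo, max_eq_right (by linarith), min_eq_left (by linarith)]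
  have i₂₁ : C.band (Set.Ioo (w' - d) (w' + d)) ∩ C.band (Set.Ioo w w') = C.band (Set.Ioo (w' - d) w') := by
    rw [C.band_inter, Set.Ioo_inter_Ioo, max_eq_left (by linarith), min_eq_right (by linarith)]
  have hu : E \ C.band (Set.Icc w w') ∪ C.band (Set.Ioo w w') ∪ C.band (Set.Ioo (w - d) (w + d)) ∪
      C.band (Set.Ioo (w' - d) (w' + d)) ⊆ E := by
    refine Set.union_subset (Set.union_subset (Set.union_subset Set.sdiff_subset ?_) ?_) ?_
    · exact mono (Set.Ioo_subset_Ioo (by linarith) (by linarith))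
    · exact mono (Set.Ioo_subset_Ioo le_rfl (by linarith))
    · exact mono (Set.Ioo_subset_Ioo (by linarith) le_rfl)
  have n₀ : ∀ {a} {Q}, a ∈ Set.Icc w w' → Q ∈ E \ C.band (Set.Icc w w') → Q ∉ C.band {a} := fun ha hQ h' =>
    hQ.2 (C.band_mono (Set.singleton_subset_iff.2 ha) h')
  obtain ⟨f, hf⟩ := h.exists_flat_walls (FF := FF) (FX := FX) (FY := FY) (B₀ := E \ C.band (Set.Icc w w')) (B₁ := C.band (Set.Ioo w w'))
    (A₁ := C.band (Set.Ioo (w - d) (w + d))) (A₂ := C.band (Set.Ioo (w' - d) (w' + d))) oF oX oY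
    (oE.sdiff (C.isClosed_band isClosed_Icc sub)) (C.isOpen_band isOpen_Ioo) (C.isOpen_band isOpen_Ioo) (C.isOpen_band isOpen_Ioo)
    (fun z hz => hM _ hz.1 _ hz.2.1 (fun h' => absurd h' (n₀ ⟨le_rfl, hww.le⟩ hz.2)) fun h' => absurd h' (n₀ ⟨hww.le, le_rfl⟩ hz.2))
    (fun z hz => hM _ hz.1 _ (hu (Or.inl (Or.inl (Or.inr hz.2)))) (fun h' => absurd h' (nb hz.2 (by simp)))
      fun h' => absurd h' (nb hz.2 (by simp)))
    (fun z hz => hM _ (sX hz.1) _ (hu (Or.inl (Or.inr hz.2))) (fun _ => hz.1)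
      fun h' => absurd h' (nb hz.2 fun hw' => by linarith [hw'.2]))
    (fun z hz => hM _ (sY hz.1) _ (hu (Or.inr hz.2)) (fun h' => absurd h' (nb hz.2 fun hw' => by linarith [hw'.1]))
      fun _ => hz.1)
    cF cX cY sX sY cE (C.isPathConnected_band_Ioo hww (by linarith) (by linarith))
    (C.isPathConnected_band_Ioo (by linarith) (by linarith) (by linarith))
    (C.isPathConnected_band_Ioo (by linarith) (by linarith) (by linarith))
    (i₁₀ ▸ C.isPathConnected_band_Ioo (by linarith) (by linarith) (by linarith))
    (i₁₁ ▸ C.isPathConnected_band_Ioo (by linarith) (by linarith) (by linarith))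
    (i₂₀ ▸ C.isPathConnected_band_Ioo (by linarith) (by linarith) (by linarith))
    (i₂₁ ▸ C.isPathConnected_band_Ioo (by linarith) (by linarith) (by linarith))
    (Set.disjoint_left.2 fun Q hQ hQ' => hQ.2 (C.band_mono Set.Ioo_subset_Icc_self hQ'))
    (Set.disjoint_iff_inter_eq_empty.2 (by
      rw [C.band_inter, Set.Ioo_inter_Ioo, Set.Ioo_eq_empty, C.band_empty]
      rw [max_eq_right (by linarith), min_eq_left (by linarith)]; linarith))
    hX hY hg (hfG.mono (Set.prod_mono_right hu)) hfF x y hx hy hx' hy' gen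
  refine ⟨f, hf.mono ?_⟩
  rintro ⟨P, Q⟩ ⟨hP, hQ, q1, q2⟩
  simp only at hP hQ q1 q2
  -- A point lies on a wall, strictly between the walls, or outside the closed strip; these cases
  -- match the four pieces of the union.
  by_cases a1 : Q ∈ C.band {w}
  · exact Or.inl (Or.inr ⟨q1 a1, C.band_mono (Set.singleton_subset_iff.2 (Set.mem_Ioo.2 ⟨by linarith, by linarith⟩)) a1⟩)
  by_cases a2 : Q ∈ C.band {w'}
  · exact Or.inr ⟨q2 a2, C.band_mono (Set.singleton_subset_iff.2 (Set.mem_Ioo.2 ⟨by linarith, by linarith⟩)) a2⟩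
  by_cases a3 : Q ∈ C.band (Set.Icc w w')
  · refine Or.inl (Or.inl (Or.inr ⟨hP, ?_⟩))
    rw [← Set.Ioo_union_both hww.le] at a3
    rw [C.band_union, Set.insert_eq, C.band_union] at a3
    exact a3.resolve_right (not_or.2 ⟨a1, a2⟩)
  · exact Or.inl (Or.inl (Or.inl ⟨hP, hQ, a3⟩))

/-! ### The punctured torus -/

theorem circle_eq_iff {x y : ℝ} : (x : AddCircle (1 : ℝ)) = y ↔ Int.fract x = Int.fract y := by
  rw [Int.fract_eq_fract, QuotientAddGroup.eq, AddSubgroup.mem_zmultiples_iff]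
  constructor
  · rintro ⟨n, hn⟩
    exact ⟨-n, by rw [zsmul_eq_mul, mul_one] at hn; push_cast; linarith⟩
  · rintro ⟨n, hn⟩
    exact ⟨-n, by rw [zsmul_eq_mul, mul_one]; push_cast; linarith⟩

theorem hCoord_tChart (x : ℝ × ℝ) : hCoord (tChart x) = x.1 := by
  rw [tChart, hCoord_pt _ ⟨Int.fract_nonneg _, (Int.fract_lt_one _).le⟩, circle_eq_iff, Int.fract_fract]

theorem vCoord_tChart (x : ℝ × ℝ) : vCoord (tChart x) = x.2 := by
  rw [tChart, vCoord_pt _ ⟨Int.fract_nonneg _, (Int.fract_lt_one _).le⟩, circle_eq_iff, Int.fract_fract]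

theorem pt_fract_left (i : ZMod k) {s t : ℝ} (h0 : 0 ≤ s) (h1 : s ≤ 1) : pt i (Int.fract s, t) = pt i (s, t) := by
  rcases h1.lt_or_eq with h | rfl
  · rw [Int.fract_eq_self.2 ⟨h0, h⟩]
  · rw [Int.fract_one, pt_side]

theorem pt_fract_right (i : ZMod k) {s t : ℝ} (hs : 1 / 2 ≤ s) (h0 : 0 ≤ t) (h1 : t ≤ 1) : pt i (s, Int.fract t) = pt i (s, t) := by
  rcases h1.lt_or_eq with h | rfl
  · rw [Int.fract_eq_self.2 ⟨h0, h⟩]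
  · rw [Int.fract_one, pt_edge i hs]

theorem tChart_eq {Q : Surface 1} {x y : ℝ} (hx : (x : AddCircle (1 : ℝ)) = hCoord Q) (hy : (y : AddCircle (1 : ℝ)) = vCoord Q) :
    tChart (x, y) = Q := by
  obtain ⟨i, s, t, h0, h1, h2, h3, rfl⟩ := exists_pt_square Q
  obtain rfl : i = 0 := Subsingleton.elim _ _
  rw [hCoord_pt _ ⟨h0, h1⟩, circle_eq_iff] at hx
  rw [vCoord_pt _ ⟨h2, h3⟩, circle_eq_iff] at hy
  simp only at hx hy
  rw [tChart]
  simp only [hx, hy]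
  rw [pt_fract_left 0 h0 h1]
  rcases h3.lt_or_eq with h | rfl
  · rw [Int.fract_eq_self.2 ⟨h2, h⟩]
  · rw [Int.fract_one, pt_one_torus]

theorem ne_coe_of_mem_Ioo {a x : ℝ} (hx : x ∈ Set.Ioo a (a + 1)) : (x : AddCircle (1 : ℝ)) ≠ a := by
  rw [Ne, circle_eq_iff, Int.fract_eq_fract]
  rintro ⟨n, hn⟩
  have h1 : (0 : ℝ) < n := by linarith [hx.1]
  have h2 : (n : ℝ) < 1 := by linarith [hx.2]
  norm_cast at h1 h2
  omega

/-- The circle without the point `a` is an open interval, which gives a continuous real branch of an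
angular coordinate. -/
theorem exists_lift_Ioo {X : Type} [TopologicalSpace X] {c : X → AddCircle (1 : ℝ)} (hc : Continuous c) (a : ℝ) :
    ∃ y : X → ℝ, ContinuousOn y {Q | c Q ≠ a} ∧ (∀ Q, c Q ≠ a → y Q ∈ Set.Ioo a (a + 1)) ∧ ∀ Q, (y Q : AddCircle (1 : ℝ)) = c Q := by
  have : Fact ((0 : ℝ) < 1) := ⟨one_pos⟩
  refine ⟨fun Q => (AddCircle.equivIco 1 a (c Q) : ℝ), fun Q hQ => ?_, fun Q hQ => ?_, fun Q => ?_⟩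
  · have := AddCircle.continuousAt_equivIco (1 : ℝ) a hQ
    exact (continuous_subtype_val.continuousAt.comp (this.comp (f := c) hc.continuousAt)).continuousWithinAt
  · have hm := (AddCircle.equivIco 1 a (c Q)).2
    refine ⟨lt_of_le_of_ne hm.1 fun e => hQ ?_, hm.2⟩
    rw [← AddCircle.coe_equivIco (p := (1 : ℝ)) (a := a) (y := c Q)]
    exact congrArg _ e.symm
  · exact AddCircle.coe_equivIco

/-- The torus without the centre is the union of two open annuli, obtained by removing the
horizontal or the vertical circle through the centre. Their cores are `a` and `b`, and they meet in
an open square. -/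
theorem Holonomy.exists_flat_punctured_torus (h : Holonomy (Surface 1) {Q | Q ≠ discCenter} H)
    (ha : h.hol (xLoop 0).toContinuousMap = 1) (hb : h.hol (yLoop 0).toContinuousMap = 1) :
    ∃ f : Surface 1 → H, h.FlatOn f {Q | Q ≠ discCenter} := by
  have e1 : hCoord discCenter = ((1 / 4 : ℝ) : AddCircle (1 : ℝ)) := hCoord_pt _ (by norm_num)
  have e2 : vCoord discCenter = ((1 / 8 : ℝ) : AddCircle (1 : ℝ)) := vCoord_pt _ (by norm_num)
  have hva : ∀ x, ∀ y ∈ Set.Ioo (1 / 8 : ℝ) (1 / 8 + 1), tChart (x, y) ∈ {Q | Q ≠ discCenter} := by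
    intro x y hy he
    have := vCoord_tChart (x, y)
    rw [he, e2] at this
    exact ne_coe_of_mem_Ioo hy this.symm
  have hvb : ∀ x, ∀ y ∈ Set.Ioo (1 / 4 : ℝ) (1 / 4 + 1), tChart (y, x) ∈ {Q | Q ≠ discCenter} := by
    intro x y hy he
    have := hCoord_tChart (y, x)
    rw [he, e1] at this
    exact ne_coe_of_mem_Ioo hy this.symm
  obtain ⟨y, yc, yJ, yl⟩ := exists_lift_Ioo (continuous_vCoord (k := 1)) (1 / 8)
  obtain ⟨x, xc, xJ, xl⟩ := exists_lift_Ioo (continuous_hCoord (k := 1)) (1 / 4)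
  obtain ⟨fa, hfa⟩ := h.exists_flat_annulus (convex_Ioo _ _) (e := tChart) continuous_tChart hva
    (fun x y => by simp only [tChart, Int.fract_add_one]) continuous_hCoord yc yJ
    (fun Q _ x hx => tChart_eq hx (yl Q)) (y₀ := 1 / 4) (by norm_num) (γ₀ := (xLoop 0).toContinuousMap)
    (loopParam_one (5 / 8)) (fun τ => by
      refine (hLoop_eq 0 (by norm_num) (1 / 4) τ).trans ?_
      simp only [hChart, tChart]
      rw [Int.fract_eq_self.2 (by norm_num : (0 : ℝ) ≤ 1 / 4 ∧ (1 / 4 : ℝ) < 1)]) ha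
  obtain ⟨fb, hfb⟩ := h.exists_flat_annulus (convex_Ioo _ _) (e := fun x => tChart (x.2, x.1)) (by fun_prop) hvb
    (fun x y => by simp only [tChart, Int.fract_add_one]) continuous_vCoord xc xJ
    (fun Q _ y hy => tChart_eq (xl Q) hy) (y₀ := 5 / 8) (by norm_num) (γ₀ := (yLoop 0).toContinuousMap)
    (loopParam_one (1 / 4)) (fun τ => by
      refine (vLoop_eq 0 (by norm_num) (by norm_num) τ).trans ?_
      simp only [vChart, tChart]
      rw [max_eq_left (by norm_num), Int.fract_eq_self.2 (by norm_num : (0 : ℝ) ≤ 5 / 8 ∧ (5 / 8 : ℝ) < 1)]) hb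
  have sa : {Q : Surface 1 | vCoord Q ≠ ((1 / 8 : ℝ) : AddCircle (1 : ℝ))} ⊆ {Q | Q ≠ discCenter} := by
    rintro Q hQ rfl
    exact hQ e2
  have sb : {Q : Surface 1 | hCoord Q ≠ ((1 / 4 : ℝ) : AddCircle (1 : ℝ))} ⊆ {Q | Q ≠ discCenter} := by
    rintro Q hQ rfl
    exact hQ e1
  have : T1Space (AddCircle (1 : ℝ)) := inferInstance
  obtain ⟨f, hf⟩ := hfa.union_of_isPathConnected hfb sa sb (isOpen_ne.preimage continuous_vCoord) (isOpen_ne.preimage continuous_hCoord) (by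
    have e : {Q : Surface 1 | vCoord Q ≠ ((1 / 8 : ℝ) : AddCircle (1 : ℝ))} ∩ {Q : Surface 1 | hCoord Q ≠ ((1 / 4 : ℝ) : AddCircle (1 : ℝ))} =
        tChart '' (Set.Ioo (1 / 4) (1 / 4 + 1) ×ˢ Set.Ioo (1 / 8) (1 / 8 + 1)) := by
      ext Q
      constructor
      · rintro ⟨h1, h2⟩
        exact ⟨(x Q, y Q), ⟨xJ Q h2, yJ Q h1⟩, tChart_eq (xl Q) (yl Q)⟩
      · rintro ⟨⟨x, y⟩, ⟨h1, h2⟩, rfl⟩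
        exact ⟨by simpa only [Set.mem_ofPred_eq, vCoord_tChart] using ne_coe_of_mem_Ioo h2,
          by simpa only [Set.mem_ofPred_eq, hCoord_tChart] using ne_coe_of_mem_Ioo h1⟩
    rw [e]
    exact (((convex_Ioo _ _).prod (convex_Ioo _ _)).isPathConnected ⟨(1 / 2, 1 / 2), by norm_num⟩).image continuous_tChart)
  refine ⟨f, hf.mono fun Q hQ => ?_⟩
  by_contra hc
  simp only [Set.mem_union, Set.mem_ofPred_eq, not_or, not_not] at hc
  exact hQ (by rw [← tChart_eq hc.2.symm hc.1.symm, tChart_eq e1.symm e2.symm])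

end SurfaceProduct

/-! ### Potentials across the walls carrying the tori `T_i` and `L_i`. -/

namespace SurfaceProduct

variable {k m : ℕ} {H : Type} [Group H]

theorem mem_band_singleton {C D : Curve k} (hs : D.sheet = C.sheet) (hh : D.height = C.height) (hf : C.floor < D.level) {Q : Surface k} :
    Q ∈ C.band {D.level} ↔ ¬ 0 < D.dist Q := by
  obtain ⟨i, s, t, h0, h1, h2, h3, rfl⟩ := exists_pt_square Q
  rw [C.pt_mem_band h0 h1 h2 h3, D.dist_pos_iff h0 h1 h2 h3, hs, hh]
  have := D.level_mem.2
  constructor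
  · rintro ⟨h, h', -⟩
    simpa [h] using h'
  · intro h
    push Not at h
    refine ⟨h.1, h.2, ?_⟩
    rw [h.2]
    exact ⟨hf, by linarith⟩

theorem xLoop_height (i : ZMod k) (τ : I) : ∃ s, 0 ≤ s ∧ s ≤ 1 ∧ xLoop i τ = pt i (s, 1 / 4) :=
  ⟨_, Int.fract_nonneg _, (Int.fract_lt_one _).le, hLoop_eq i (by norm_num) (1 / 4) τ⟩

theorem yLoop_height (i : ZMod k) (τ : I) : ∃ t, 0 ≤ t ∧ t ≤ 1 ∧ yLoop i τ = pt i (5 / 8, t) := by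
  refine ⟨Int.fract (loopParam (1 / 4) τ), Int.fract_nonneg _, (Int.fract_lt_one _).le,
    (vLoop_eq i (by norm_num) (by norm_num) τ).trans ?_⟩
  rw [vChart, max_eq_left (by norm_num)]

theorem xLoop_mem_complX (i : ZMod k) (τ : I) : xLoop i τ ∈ complX k := by
  obtain ⟨s, h0, h1, e⟩ := xLoop_height i τ
  rw [e, pt_mem_complX h0 h1] <;> norm_num

theorem yLoop_mem_complY (i : ZMod k) (τ : I) : yLoop i τ ∈ complY k := by
  obtain ⟨s, h0, h1, e⟩ := yLoop_height i τ
  rw [e, pt_mem_complY _ _ h0 h1] <;> norm_num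

theorem isPathConnected_univ_surface : IsPathConnected (Set.univ : Set (Surface k)) := by
  refine isPathConnected_of_joined (Set.mem_univ (base k)) fun i s t h0 h1 h2 h3 _ => ?_
  rw [← pt_base i]
  exact joinedIn_pt i (a := 0) (b := 1) (c := 0) (d := 1) (fun _ _ _ _ _ _ => Set.mem_univ _) (by norm_num) ⟨h0, h1, h2, h3⟩

/-- The walls along `X` and `X'` in the zeroth square of the second factor. -/
theorem Holonomy.exists_flat_walls_zero [NeZero k] {M : Set (Surface k × Surface m)} (h : Holonomy (Surface k × Surface m) M H)
    {E : Set (Surface m)} (oE : IsOpen E) (hE : (curveX (0 : ZMod m)).band (Set.Ioo (3 / 8) (7 / 8)) ⊆ E)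
    (cE : IsPathConnected (E \ (curveX (0 : ZMod m)).band (Set.Icc (1 / 2) (3 / 4))))
    (hM : ∀ P, ∀ Q ∈ E, (0 < (curveX (0 : ZMod m)).dist Q ∨ P ∈ complX k) →
      (0 < (curveX' (0 : ZMod m)).dist Q ∨ P ∈ complY k) → (P, Q) ∈ M)
    {g : Surface m} (hg : g ∈ E \ (curveX (0 : ZMod m)).band (Set.Icc (1 / 2) (3 / 4)))
    (hg1 : 0 < (curveX (0 : ZMod m)).dist g) (hg2 : 0 < (curveX' (0 : ZMod m)).dist g)
    {fG : Surface k × Surface m → H} (hfG : h.FlatOn fG ({base k} ×ˢ E))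
    (hx : ∀ i, h.left (xLoop i).toContinuousMap g = 1) (hy : ∀ i, h.left (yLoop i).toContinuousMap g = 1) :
    ∃ f : Surface k × Surface m → H, h.FlatOn f {z | z.2 ∈ E ∧ (0 < (curveX (0 : ZMod m)).dist z.2 ∨ z.1 ∈ complX k) ∧
      (0 < (curveX' (0 : ZMod m)).dist z.2 ∨ z.1 ∈ complY k)} := by
  set C := curveX (0 : ZMod m) with hC
  have b1 : ∀ {Q}, Q ∈ C.band {1 / 2} ↔ ¬ 0 < C.dist Q :=
    mem_band_singleton (D := C) rfl rfl (by norm_num [C, curveX, Curve.floor, Curve.level])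
  have b2 : ∀ {Q}, Q ∈ C.band {3 / 4} ↔ ¬ 0 < (curveX' (0 : ZMod m)).dist Q :=
    mem_band_singleton (D := curveX' (0 : ZMod m)) rfl rfl (by norm_num [C, curveX, curveX', Curve.floor, Curve.level])
  have hQM : ∀ {Q}, Q ∈ E → 0 < C.dist Q → 0 < (curveX' (0 : ZMod m)).dist Q → ∀ P, (P, Q) ∈ M :=
    fun hQ h1 h2 P => hM P _ hQ (Or.inl h1) (Or.inl h2)
  obtain ⟨fF, hfF⟩ := h.exists_flat_surface_left (hQM hg.1 hg1 hg2) hx hy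
  -- The walls are the levels of `A` and `A'`; half their distance serves as collar width, so that
  -- the two collars are disjoint and fill the band from `3 / 8` to `7 / 8` up to one level.
  obtain ⟨f, hf⟩ := h.exists_flat_bands C (w := 1 / 2) (w' := 3 / 4) (d := 1 / 8) (by norm_num)
    (by norm_num [C, curveX, Curve.floor]) (by norm_num) (by norm_num) oE
    (by norm_num; exact hE) cE isOpen_univ isOpen_complX isOpen_complY isPathConnected_univ_surface
    isPathConnected_complX isPathConnected_complY (Set.subset_univ _) (Set.subset_univ _)
    (fun P _ Q hQ h1 h2 => hM P Q hQ (or_iff_not_imp_left.2 fun h' => h1 (b1.2 h'))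
      (or_iff_not_imp_left.2 fun h' => h2 (b2.2 h')))
    base_mem_complX base_mem_complY hg hfG hfF (fun i => (xLoop i).toContinuousMap) (fun i => (yLoop i).toContinuousMap)
    xLoop_mem_complX yLoop_mem_complY (fun i => by simp) (fun i => by simp) (by
      intro Q hQ h1 h2
      refine h.exists_flat_surface_left (hQM (hE (C.band_mono (Set.Ioo_subset_Ioo (by norm_num) (by norm_num)) hQ)) ?_ ?_) h1 h2
      · by_contra hc
        have := (C.band_inter _ _).le ⟨hQ, b1.2 hc⟩
        rw [Set.inter_singleton_eq_empty.2 (by simp), C.band_empty] at this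
        exact this
      · by_contra hc
        have := (C.band_inter _ _).le ⟨hQ, b2.2 hc⟩
        rw [Set.inter_singleton_eq_empty.2 (by simp), C.band_empty] at this
        exact this)
  refine ⟨f, hf.mono ?_⟩
  rintro z ⟨hz, h1, h2⟩
  exact ⟨Set.mem_univ _, hz, fun h' => h1.resolve_left (b1.1 h'), fun h' => h2.resolve_left (b2.1 h')⟩

/-! ### Normal generation: the punctured torus -/

/-- The complement of the thin tori and of the centre of the disc. -/
def puncturedThin (k : ℕ) : Set (Surface k × Surface 1) :=
  {z | z.2 ≠ discCenter ∧ ∀ j : PuncturedIndex k, 0 < torusDist (puncturedTori j).1 (puncturedTori j).2 z}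

/-- The tori of one kind share their second factor, so the conditions for all `i` merge into one
condition on each coordinate. This is the product form needed for the wall argument. -/
theorem mem_puncturedThin {z : Surface k × Surface 1} : z ∈ puncturedThin k ↔ z.2 ≠ discCenter ∧
    (0 < (curveX (0 : ZMod 1)).dist z.2 ∨ z.1 ∈ complX k) ∧ (0 < (curveX' (0 : ZMod 1)).dist z.2 ∨ z.1 ∈ complY k) := by
  simp only [puncturedThin, Set.mem_ofPred_eq, torusDist_pos_iff, complX, complY]
  refine and_congr_right fun _ => ?_
  rw [← forall_or_left, ← forall_or_left, ← forall_and]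
  constructor
  · intro h i
    exact ⟨(h (.T i)).symm, (h (.L i)).symm⟩
  · rintro h (i | i)
    · exact (h i).1.symm
    · exact (h i).2.symm

theorem discCenter_def : discCenter = pt 0 (1 / 4, 1 / 8) := rfl

theorem pt_ne_discCenter {s t : ℝ} (h0 : 0 ≤ s) (h1 : s ≤ 1) (h2 : 0 ≤ t) (h3 : t ≤ 1) :
    pt 0 (s, t) ≠ discCenter ↔ ¬ (s = 1 / 4 ∧ t = 1 / 8) := by
  rw [← discDist_pos_iff, discDist_pt 0 (mem_square h0 h1 h2 h3), lt_min_iff]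
  simp only
  constructor
  · rintro ⟨h, -⟩ ⟨rfl, rfl⟩
    norm_num at h
  · intro h
    refine ⟨?_, by norm_num⟩
    by_contra hc
    have hs : (s - 1 / 4) ^ 2 = 0 := by nlinarith [sq_nonneg (s - 1 / 4), sq_nonneg (t - 1 / 8)]
    have ht : (t - 1 / 8) ^ 2 = 0 := by nlinarith [sq_nonneg (s - 1 / 4), sq_nonneg (t - 1 / 8)]
    exact h ⟨by nlinarith [pow_eq_zero_iff (two_ne_zero) |>.1 hs], by nlinarith [pow_eq_zero_iff (two_ne_zero) |>.1 ht]⟩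

theorem pt_mem_punctured_diff {s t : ℝ} (h0 : 0 ≤ s) (h1 : s ≤ 1) (h2 : 0 ≤ t) (h3 : t ≤ 1) :
    pt 0 (s, t) ∈ {Q | Q ≠ discCenter} \ (curveX (0 : ZMod 1)).band (Set.Icc (1 / 2) (3 / 4)) ↔
      ¬ (s = 1 / 4 ∧ t = 1 / 8) ∧ (t < 1 / 2 ∨ 3 / 4 < t) := by
  rw [Set.mem_sdiff, Set.mem_ofPred_eq, pt_ne_discCenter h0 h1 h2 h3, Curve.pt_mem_band _ h0 h1 h2 h3]
  refine and_congr_right fun _ => ?_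
  simp only [curveX, Curve.height, Curve.floor, Curve.sheet, true_and, Set.mem_inter_iff, Set.mem_Icc, Set.mem_Ioo]
  constructor
  · intro h
    by_contra! hc
    exact h ⟨hc, by linarith [hc.1], by linarith [hc.2]⟩
  · rintro (h | h) h' <;> linarith [h'.1.1, h'.1.2]

/-- Outside the strip the only obstacle is the centre. Below the strip, points to its right are
joined to the base point inside a rectangle and points to its left along horizontal segments; points
level with the centre on its left first go down to the bottom side. -/
theorem isPathConnected_punctured_diff :
    IsPathConnected ({Q | Q ≠ discCenter} \ (curveX (0 : ZMod 1)).band (Set.Icc (1 / 2) (3 / 4))) := by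
  set S := {Q : Surface 1 | Q ≠ discCenter} \ (curveX (0 : ZMod 1)).band (Set.Icc (1 / 2) (3 / 4)) with hS
  refine isPathConnected_of_joined (Q := base 1) ?_ fun i s t h0 h1 h2 h3 h => ?_
  · rw [base, pt_mem_punctured_diff] <;> norm_num
  obtain rfl : i = 0 := Subsingleton.elim _ _
  rw [hS, pt_mem_punctured_diff h0 h1 h2 h3] at h
  have right : ∀ {s t : ℝ}, 1 / 4 < s → s ≤ 1 → 0 ≤ t → t < 1 / 2 → JoinedIn S (base 1) (pt 0 (s, t)) := by
    intro s t h h1 h2 h3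
    refine joinedIn_pt 0 (a := min s (1 / 2)) (b := 1) (c := 0) (d := t) (fun s' t' a1 a2 a3 a4 => ?_)
      ⟨min_le_right _ _, by norm_num, le_rfl, h2⟩ ⟨min_le_left _ _, h1, h2, le_rfl⟩
    have : 1 / 4 < min s (1 / 2) := lt_min h (by norm_num)
    rw [hS, pt_mem_punctured_diff (by linarith) a2 a3 (by linarith)]
    exact ⟨fun hc => by linarith [hc.1], Or.inl (by linarith)⟩
  rcases h.2 with ht | ht
  · by_cases hs : 1 / 4 < s
    · exact right hs h1 h2 ht
    have hs' : s ≤ 1 / 4 := not_lt.1 hs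
    by_cases ht' : t = 1 / 8
    · have hs'' : s < 1 / 4 := lt_of_le_of_ne hs' fun e => h.1 ⟨e, ht'⟩
      refine (right (s := 1 / 2) (t := 0) (by norm_num) (by norm_num) le_rfl (by norm_num)).trans ?_
      refine JoinedIn.trans (y := pt 0 (s, 0)) (joinedIn_pt 0 (a := s) (b := 1 / 2) (c := 0) (d := 0) (fun s' t' a1 a2 a3 a4 => ?_)
        (by norm_num; linarith) ⟨le_rfl, by linarith, le_rfl, le_rfl⟩) (joinedIn_pt 0 (a := s) (b := s) (c := 0) (d := t) (fun s' t' a1 a2 a3 a4 => ?_)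
        ⟨le_rfl, le_rfl, le_rfl, h2⟩ ⟨le_rfl, le_rfl, h2, le_rfl⟩)
      · rw [hS, pt_mem_punctured_diff (by linarith) (by linarith) a3 (by linarith)]
        exact ⟨fun hc => by linarith [hc.2], Or.inl (by linarith)⟩
      · rw [hS, pt_mem_punctured_diff (by linarith) (by linarith) a3 (by linarith)]
        exact ⟨fun hc => by linarith [hc.1], Or.inl (by linarith)⟩
    · refine (right (s := 1 / 2) (t := t) (by norm_num) (by norm_num) h2 ht).trans ?_
      refine joinedIn_pt 0 (a := s) (b := 1 / 2) (c := t) (d := t) (fun s' t' a1 a2 a3 a4 => ?_)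
        ⟨by linarith, le_rfl, le_rfl, le_rfl⟩ ⟨le_rfl, by linarith, le_rfl, le_rfl⟩
      rw [hS, pt_mem_punctured_diff (by linarith) (by linarith) (by linarith) (by linarith)]
      exact ⟨fun hc => ht' (by linarith [hc.2]), Or.inl (by linarith)⟩
  · rw [← pt_base' 0]
    refine joinedIn_pt 0 (a := 0) (b := 1) (c := t) (d := 1) (fun s' t' a1 a2 a3 a4 => ?_)
      ⟨by norm_num, by norm_num, h3, le_rfl⟩ ⟨h0, h1, le_rfl, h3⟩
    rw [hS, pt_mem_punctured_diff (by linarith) (by linarith) (by linarith) (by linarith)]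
    exact ⟨fun hc => by linarith [hc.2], Or.inr (by linarith)⟩

/-- The punctured torus supplies the potential over the base point of `F`, the closed surface the
one over `g`, and the wall argument extends them. -/
theorem Holonomy.exists_flat_puncturedThin [NeZero k] (h : Holonomy (Surface k × Surface 1) (puncturedThin k) H)
    (hx : ∀ i, h.left (xLoop i).toContinuousMap (pt 0 (5 / 8, 1 / 4)) = 1)
    (hy : ∀ i, h.left (yLoop i).toContinuousMap (pt 0 (5 / 8, 1 / 4)) = 1)
    (ha : h.right (base k) (xLoop 0).toContinuousMap = 1) (hb : h.right (base k) (yLoop 0).toContinuousMap = 1) :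
    ∃ f : Surface k × Surface 1 → H, h.FlatOn f (puncturedThin k) := by
  have hm : ∀ Q ∈ {Q : Surface 1 | Q ≠ discCenter}, (base k, Q) ∈ puncturedThin k := fun Q hQ =>
    mem_puncturedThin.2 ⟨hQ, Or.inr base_mem_complX, Or.inr base_mem_complY⟩
  have da : ∀ τ, xLoop 0 τ ≠ discCenter := fun τ => by
    obtain ⟨s, h0, h1, e⟩ := xLoop_height (0 : ZMod 1) τ
    rw [e, pt_ne_discCenter h0 h1] <;> norm_num
  have db : ∀ τ, yLoop 0 τ ≠ discCenter := fun τ => by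
    obtain ⟨s, h0, h1, e⟩ := yLoop_height (0 : ZMod 1) τ
    rw [e, pt_ne_discCenter _ _ h0 h1] <;> norm_num
  obtain ⟨fG, hfG⟩ := (h.sliceRight _ _ hm).exists_flat_punctured_torus ((sliceRight_hol _ da).trans ha) ((sliceRight_hol _ db).trans hb)
  have hne : IsOpen {Q | Q ≠ discCenter} := by
    have : {Q | Q ≠ discCenter} = {Q | 0 < discDist Q} := by
      ext Q
      exact (discDist_pos_iff Q).symm
    rw [this]
    exact isOpen_lt continuous_const continuous_discDist
  obtain ⟨f, hf⟩ := h.exists_flat_walls_zero (E := {Q | Q ≠ discCenter}) hne (by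
    rintro Q hQ rfl
    rw [discCenter_def, Curve.pt_mem_band] at hQ <;> norm_num at *
    norm_num [curveX, Curve.height] at hQ) isPathConnected_punctured_diff
    (fun P Q hQ h1 h2 => mem_puncturedThin.2 ⟨hQ, h1, h2⟩) (g := pt 0 (5 / 8, 1 / 4)) (by rw [pt_mem_punctured_diff] <;> norm_num)
    (by rw [Curve.dist_pos_iff] <;> norm_num [curveX, Curve.height, Curve.level])
    (by rw [Curve.dist_pos_iff] <;> norm_num [curveX', Curve.height, Curve.level])
    (hfG.of_sliceRight subset_rfl) hx hy
  exact ⟨f, hf.mono fun z hz => mem_puncturedThin.1 hz⟩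

end SurfaceProduct

namespace SurfaceProduct

variable {k m : ℕ} {H : Type} [Group H]

/-! ### The handle in one square -/

/-- The interior of the handle which is contained in a square. -/
def handle (i : ZMod k) : Set (Surface k) := (curveX i).band Set.univ ∪ (curveY i).band Set.univ

theorem pt_mem_handle {i j : ZMod k} {s t : ℝ} (h0 : 0 ≤ s) (h1 : s ≤ 1) (h2 : 0 ≤ t) (h3 : t ≤ 1) :
    pt j (s, t) ∈ handle i ↔ j = i ∧ ((0 < t ∧ t < 1) ∨ (1 / 2 < s ∧ s < 1)) := by
  rw [handle, Set.mem_union, Curve.pt_mem_band _ h0 h1 h2 h3, Curve.pt_mem_band _ h0 h1 h2 h3]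
  simp only [curveX, curveY, Curve.sheet, Curve.height, Curve.floor, Set.univ_inter, Set.mem_Ioo]
  tauto

theorem isOpen_handle (i : ZMod k) : IsOpen (handle i) :=
  (Curve.isOpen_band _ isOpen_univ).union (Curve.isOpen_band _ isOpen_univ)

theorem hChart_mem {i : ZMod k} {x y : ℝ} (hy : y ∈ Set.Ioo (0 : ℝ) 1) : hChart i (x, y) ∈ (curveX i).band Set.univ := by
  rw [hChart, Curve.pt_mem_band _ (Int.fract_nonneg _) (Int.fract_lt_one _).le hy.1.le hy.2.le]
  exact ⟨rfl, trivial, hy⟩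

theorem vChart_mem {i : ZMod k} {x y : ℝ} (hx : x ∈ Set.Ioo (1 / 2 : ℝ) 1) : vChart i (x, y) ∈ (curveY i).band Set.univ := by
  have e : max x (1 / 2) = x := max_eq_left hx.1.le
  simp only [vChart, e]
  rw [Curve.pt_mem_band _ (by linarith [hx.1]) hx.2.le (Int.fract_nonneg _) (Int.fract_lt_one _).le]
  exact ⟨rfl, trivial, hx⟩

theorem eq_of_circle_eq {x y : ℝ} (hx : x ∈ Set.Ioo (0 : ℝ) 1) (hy : y ∈ Set.Ioo (0 : ℝ) 1) (h : (x : AddCircle (1 : ℝ)) = y) : x = y := by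
  rwa [circle_eq_iff, Int.fract_eq_self.2 ⟨hx.1.le, hx.2⟩, Int.fract_eq_self.2 ⟨hy.1.le, hy.2⟩] at h

/-- The handle is a horizontal and a vertical annulus plumbed along a rectangle, so triviality on
the two cores is enough. -/
theorem Holonomy.exists_flat_handle {i : ZMod k} (h : Holonomy (Surface k) (handle i) H)
    (ha : h.hol (xLoop i).toContinuousMap = 1) (hb : h.hol (yLoop i).toContinuousMap = 1) :
    ∃ f : Surface k → H, h.FlatOn f (handle i) := by
  obtain ⟨y, yc, yJ, yl⟩ := exists_lift_Ioo (continuous_vCoord (k := k)) 0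
  obtain ⟨x, xc, xJ, xl⟩ := exists_lift_Ioo (continuous_hCoord (k := k)) 0
  rw [zero_add] at xJ yJ
  have nz : ∀ {t : ℝ}, t ∈ Set.Ioo (0 : ℝ) 1 → (t : AddCircle (1 : ℝ)) ≠ ((0 : ℝ) : AddCircle (1 : ℝ)) :=
    fun ht => ne_coe_of_mem_Ioo (by rwa [zero_add])
  have bX : ∀ Q ∈ (curveX i).band Set.univ, ∃ s t : ℝ, 0 ≤ s ∧ s ≤ 1 ∧ t ∈ Set.Ioo (0 : ℝ) 1 ∧ Q = pt i (s, t) := by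
    intro Q hQ
    obtain ⟨j, s, t, h0, h1, h2, h3, rfl⟩ := exists_pt_square Q
    obtain ⟨rfl, -, ht⟩ := (Curve.pt_mem_band _ h0 h1 h2 h3).1 hQ
    exact ⟨s, t, h0, h1, ht, rfl⟩
  have bY : ∀ Q ∈ (curveY i).band Set.univ, ∃ s t : ℝ, s ∈ Set.Ioo (1 / 2 : ℝ) 1 ∧ 0 ≤ t ∧ t ≤ 1 ∧ Q = pt i (s, t) := by
    intro Q hQ
    obtain ⟨j, s, t, h0, h1, h2, h3, rfl⟩ := exists_pt_square Q
    obtain ⟨rfl, -, ht⟩ := (Curve.pt_mem_band _ h0 h1 h2 h3).1 hQ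
    exact ⟨s, t, ht, h2, h3, rfl⟩
  have nX : ∀ Q ∈ (curveX i).band Set.univ, vCoord Q ≠ ((0 : ℝ) : AddCircle (1 : ℝ)) := by
    intro Q hQ
    obtain ⟨s, t, h0, h1, ht, rfl⟩ := bX Q hQ
    rw [vCoord_pt i ⟨ht.1.le, ht.2.le⟩]
    exact nz ht
  have yeq : ∀ {s t : ℝ}, 0 ≤ s → s ≤ 1 → t ∈ Set.Ioo (0 : ℝ) 1 → y (pt i (s, t)) = t := by
    intro s t h0 h1 ht
    have e : vCoord (pt i (s, t)) = t := vCoord_pt i ⟨ht.1.le, ht.2.le⟩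
    exact eq_of_circle_eq (yJ _ (e ▸ nz ht)) ht ((yl _).trans e)
  have nY : ∀ Q ∈ (curveY i).band Set.univ, hCoord Q ≠ ((0 : ℝ) : AddCircle (1 : ℝ)) := by
    intro Q hQ
    obtain ⟨s, t, hs, h0, h1, rfl⟩ := bY Q hQ
    rw [hCoord_pt i ⟨by simp only; linarith [hs.1], hs.2.le⟩]
    exact nz ⟨by linarith [hs.1], hs.2⟩
  have xeq : ∀ {s t : ℝ}, s ∈ Set.Ioo (0 : ℝ) 1 → 0 ≤ t → t ≤ 1 → x (pt i (s, t)) = s := by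
    intro s t hs h0 h1
    have e : hCoord (pt i (s, t)) = s := hCoord_pt i ⟨hs.1.le, hs.2.le⟩
    exact eq_of_circle_eq (xJ _ (e ▸ nz hs)) hs ((xl _).trans e)
  obtain ⟨fa, hfa⟩ := h.exists_flat_annulus (U := (curveX i).band Set.univ) (convex_Ioo 0 1) (continuous_hChart i)
    (fun x y hy => Or.inl (hChart_mem hy)) (fun x y => by simp only [hChart, Int.fract_add_one]) continuous_hCoord
    (yc.mono nX) (fun Q hQ => yJ Q (nX Q hQ)) (fun Q hQ x hx => by
      obtain ⟨s, t, h0, h1, ht, rfl⟩ := bX Q hQ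
      rw [hCoord_pt i ⟨h0, h1⟩, circle_eq_iff] at hx
      rw [yeq h0 h1 ht, hChart]
      simp only at hx ⊢
      rw [hx, pt_fract_left i h0 h1]) (y₀ := 1 / 4) (by norm_num) (loopParam_one (5 / 8))
    (γ₀ := (xLoop i).toContinuousMap) (fun τ => hLoop_eq i (by norm_num) _ τ) ha
  obtain ⟨fb, hfb⟩ := h.exists_flat_annulus (U := (curveY i).band Set.univ) (convex_Ioo (1 / 2 : ℝ) 1)
    (e := fun x => vChart i (x.2, x.1)) (by fun_prop)
    (fun x y hy => Or.inr (vChart_mem hy)) (fun x y => by simp only [vChart, Int.fract_add_one]) continuous_vCoord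
    (xc.mono nY) (fun Q hQ => by
      obtain ⟨s, t, hs, h0, h1, rfl⟩ := bY Q hQ
      rwa [xeq ⟨by linarith [hs.1], hs.2⟩ h0 h1]) (fun Q hQ y hy => by
      obtain ⟨s, t, hs, h0, h1, rfl⟩ := bY Q hQ
      rw [vCoord_pt i ⟨h0, h1⟩, circle_eq_iff] at hy
      rw [xeq ⟨by linarith [hs.1], hs.2⟩ h0 h1]
      simp only [vChart] at hy ⊢
      rw [hy, max_eq_left hs.1.le, pt_fract_right i hs.1.le h0 h1]) (y₀ := 5 / 8) (by norm_num) (loopParam_one (1 / 4))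
    (γ₀ := (yLoop i).toContinuousMap) (fun τ => vLoop_eq i (by norm_num) (by norm_num) τ) hb
  refine hfa.union_of_isPathConnected hfb Set.subset_union_left Set.subset_union_right
    (Curve.isOpen_band _ isOpen_univ) (Curve.isOpen_band _ isOpen_univ) ?_
  have e : (curveX i).band Set.univ ∩ (curveY i).band Set.univ = pt i '' (Set.Ioo (1 / 2) 1 ×ˢ Set.Ioo 0 1) := by
    ext Q
    constructor
    · rintro ⟨h1, h2⟩
      obtain ⟨s, t, hs, h0, h3, rfl⟩ := bY Q h2
      exact ⟨(s, t), ⟨hs, ((Curve.pt_mem_band _ (by linarith [hs.1]) hs.2.le h0 h3).1 h1).2.2⟩, rfl⟩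
    · rintro ⟨⟨s, t⟩, ⟨hs, ht⟩, rfl⟩
      have a1 : 0 ≤ s := by linarith [hs.1]
      rw [Set.mem_inter_iff, Curve.pt_mem_band _ a1 hs.2.le ht.1.le ht.2.le, Curve.pt_mem_band _ a1 hs.2.le ht.1.le ht.2.le]
      exact ⟨⟨rfl, trivial, ht⟩, rfl, trivial, hs⟩
  rw [e]
  exact (((convex_Ioo _ _).prod (convex_Ioo _ _)).isPathConnected ⟨(3 / 4, 1 / 2), by norm_num⟩).image (continuous_pt i)

/-! ### Path connected regions of the surface of genus two -/

theorem zmod_two (i : ZMod 2) : i = 0 ∨ i = 1 := by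
  revert i
  decide

theorem pt_mem_distX {i j : ZMod k} {s t : ℝ} (h0 : 0 ≤ s) (h1 : s ≤ 1) (h2 : 0 ≤ t) (h3 : t ≤ 1) :
    0 < (curveX i).dist (pt j (s, t)) ↔ (j = i → t ≠ 1 / 2) := Curve.dist_pos_iff _ h0 h1 h2 h3

theorem pt_mem_distX' {i j : ZMod k} {s t : ℝ} (h0 : 0 ≤ s) (h1 : s ≤ 1) (h2 : 0 ≤ t) (h3 : t ≤ 1) :
    0 < (curveX' i).dist (pt j (s, t)) ↔ (j = i → t ≠ 3 / 4) := Curve.dist_pos_iff _ h0 h1 h2 h3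

theorem pt_mem_distY {i j : ZMod k} {s t : ℝ} (h0 : 0 ≤ s) (h1 : s ≤ 1) (h2 : 0 ≤ t) (h3 : t ≤ 1) :
    0 < (curveY i).dist (pt j (s, t)) ↔ (j = i → s ≠ 3 / 4) := Curve.dist_pos_iff _ h0 h1 h2 h3

/-- The complement of `A_2` and `B_2`. -/
def complCross : Set (Surface 2) := {Q | 0 < (curveX (1 : ZMod 2)).dist Q ∧ 0 < (curveY (1 : ZMod 2)).dist Q}

theorem isOpen_complCross : IsOpen complCross := (isOpen_dist_pos _).inter (isOpen_dist_pos _)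

theorem pt_mem_complCross {j : ZMod 2} {s t : ℝ} (h0 : 0 ≤ s) (h1 : s ≤ 1) (h2 : 0 ≤ t) (h3 : t ≤ 1) :
    pt j (s, t) ∈ complCross ↔ (j = 1 → t ≠ 1 / 2 ∧ s ≠ 3 / 4) := by
  rw [complCross, Set.mem_ofPred_eq, pt_mem_distX h0 h1 h2 h3, pt_mem_distY h0 h1 h2 h3]
  tauto

theorem pt_mem_complCross_diff {j : ZMod 2} {s t : ℝ} (h0 : 0 ≤ s) (h1 : s ≤ 1) (h2 : 0 ≤ t) (h3 : t ≤ 1) :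
    pt j (s, t) ∈ complCross \ (curveX (0 : ZMod 2)).band (Set.Icc (1 / 2) (3 / 4)) ↔
      (j = 1 → t ≠ 1 / 2 ∧ s ≠ 3 / 4) ∧ (j = 0 → t < 1 / 2 ∨ 3 / 4 < t) := by
  rw [Set.mem_sdiff, pt_mem_complCross h0 h1 h2 h3, Curve.pt_mem_band _ h0 h1 h2 h3]
  refine and_congr_right fun _ => ?_
  simp only [curveX, Curve.height, Curve.floor, Curve.sheet, Set.mem_inter_iff, Set.mem_Icc, Set.mem_Ioo]
  constructor
  · intro h hj
    by_contra! hc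
    exact h ⟨hj, hc, by linarith [hc.1], by linarith [hc.2]⟩
  · rintro h ⟨hj, h'⟩
    rcases h hj with h | h <;> linarith [h'.1.1, h'.1.2]

theorem isPathConnected_complCross_diff :
    IsPathConnected (complCross \ (curveX (0 : ZMod 2)).band (Set.Icc (1 / 2) (3 / 4))) := by
  set S := complCross \ (curveX (0 : ZMod 2)).band (Set.Icc (1 / 2) (3 / 4)) with hS
  refine isPathConnected_of_joined (Q := base 2) ?_ fun i s t h0 h1 h2 h3 h => ?_
  · rw [base, pt_mem_complCross_diff] <;> norm_num
  rw [hS, pt_mem_complCross_diff h0 h1 h2 h3] at h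
  rcases zmod_two i with rfl | rfl
  · rcases h.2 rfl with ht | ht
    · rw [← pt_base 0]
      refine joinedIn_pt 0 (a := 0) (b := 1) (c := 0) (d := t) (fun s' t' a1 a2 a3 a4 => ?_)
        ⟨by norm_num, by norm_num, le_rfl, h2⟩ ⟨h0, h1, h2, le_rfl⟩
      rw [hS, pt_mem_complCross_diff a1 a2 a3 (by linarith)]
      exact ⟨by simp, fun _ => Or.inl (by linarith)⟩
    · rw [← pt_base' 0]
      refine joinedIn_pt 0 (a := 0) (b := 1) (c := t) (d := 1) (fun s' t' a1 a2 a3 a4 => ?_)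
        ⟨by norm_num, by norm_num, h3, le_rfl⟩ ⟨h0, h1, le_rfl, h3⟩
      rw [hS, pt_mem_complCross_diff a1 a2 (by linarith) a4]
      exact ⟨by simp, fun _ => Or.inr (by linarith)⟩
  · obtain ⟨ht, hs⟩ := h.1 rfl
    have mem : ∀ {s' t' : ℝ}, 0 ≤ s' → s' ≤ 1 → 0 ≤ t' → t' ≤ 1 → t' ≠ 1 / 2 → s' ≠ 3 / 4 → pt 1 (s', t') ∈ S := by
      intro s' t' a1 a2 a3 a4 a5 a6
      rw [hS, pt_mem_complCross_diff a1 a2 a3 a4]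
      exact ⟨fun _ => ⟨a5, a6⟩, by simp⟩
    have low : ∀ {s : ℝ}, 0 ≤ s → s < 3 / 4 → JoinedIn S (base 2) (pt 1 (s, t)) := by
      intro s h0 hs
      have hm : max s (1 / 2) < 3 / 4 := max_lt hs (by norm_num)
      rcases ht.lt_or_gt with ht | ht
      · rw [← pt_base 1]
        exact joinedIn_pt 1 (a := 0) (b := max s (1 / 2)) (c := 0) (d := t) (fun s' t' a1 a2 a3 a4 =>
          mem a1 (by linarith) a3 (by linarith) (by linarith) (by linarith))
          ⟨by norm_num, le_max_right _ _, le_rfl, h2⟩ ⟨h0, le_max_left _ _, h2, le_rfl⟩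
      · rw [← pt_base' 1]
        exact joinedIn_pt 1 (a := 0) (b := max s (1 / 2)) (c := t) (d := 1) (fun s' t' a1 a2 a3 a4 =>
          mem a1 (by linarith) (by linarith) a4 (by linarith) (by linarith))
          ⟨by norm_num, le_max_right _ _, h3, le_rfl⟩ ⟨h0, le_max_left _ _, le_rfl, h3⟩
    rcases hs.lt_or_gt with hs | hs
    · exact low h0 hs
    · refine (low le_rfl (by norm_num)).trans ?_
      rw [← pt_side]
      exact joinedIn_pt 1 (a := s) (b := 1) (c := t) (d := t) (fun s' t' a1 a2 a3 a4 =>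
          mem (by linarith) a2 (by linarith) (by linarith) (fun e => ht (by linarith)) (by linarith))
          ⟨h1, le_rfl, le_rfl, le_rfl⟩ ⟨le_rfl, h1, le_rfl, le_rfl⟩

/-- A part of a handle, which contains a neighbourhood of a corner of the square, is path connected if it is a union of
products of intervals. -/
theorem isPathConnected_handle_part {i : ZMod k} {S : Set (Surface k)} {p q : ℝ → Prop}
    (hS : ∀ j s t, 0 ≤ s → s ≤ 1 → 0 ≤ t → t ≤ 1 →
      (pt j (s, t) ∈ S ↔ j = i ∧ ((0 < t ∧ t < 1) ∨ (1 / 2 < s ∧ s < 1)) ∧ p s ∧ q t))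
    (hp : ∀ s, p s → (∀ s', s' ∈ Set.uIcc (5 / 8) s → p s') ∨ (5 / 8 ≤ s ∧ ∀ s' ∈ Set.Icc s 1, p s'))
    (hp0 : ∀ s ∈ Set.Icc (0 : ℝ) (5 / 8), p s)
    (hq : ∀ t, q t → (∀ t', t' ∈ Set.uIcc (1 / 4) t → q t') ∨ (1 / 4 ≤ t ∧ ∀ t' ∈ Set.Icc t 1, q t'))
    (hq0 : ∀ t ∈ Set.Icc (0 : ℝ) (1 / 4), q t) : IsPathConnected S := by
  have mem : ∀ {s t : ℝ}, 0 ≤ s → s ≤ 1 → 0 ≤ t → t ≤ 1 → (0 < t ∧ t < 1) ∨ (1 / 2 < s ∧ s < 1) → p s → q t → pt i (s, t) ∈ S :=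
    fun h0 h1 h2 h3 h h' h'' => (hS i _ _ h0 h1 h2 h3).2 ⟨rfl, h, h', h''⟩
  refine isPathConnected_of_joined (Q := pt i (5 / 8, 1 / 4)) ?_ fun j s t h0 h1 h2 h3 h => ?_
  · exact mem (by norm_num) (by norm_num) (by norm_num) (by norm_num) (by norm_num) (hp0 _ (by norm_num)) (hq0 _ (by norm_num))
  obtain ⟨rfl, h, hps, hqt⟩ := (hS j _ _ h0 h1 h2 h3).1 h
  have horiz : ∀ {t : ℝ}, 0 < t → t < 1 → q t → JoinedIn S (pt j (5 / 8, t)) (pt j (s, t)) := by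
    intro t ht0 ht1 hqt
    rcases hp s hps with hs | ⟨hs, hs'⟩
    · refine joinedIn_pt j (a := min (5 / 8) s) (b := max (5 / 8) s) (c := t) (d := t) (fun s' t' a1 a2 a3 a4 => ?_)
        ⟨min_le_left _ _, le_max_left _ _, le_rfl, le_rfl⟩ ⟨min_le_right _ _, le_max_right _ _, le_rfl, le_rfl⟩
      obtain rfl : t' = t := le_antisymm a4 a3
      exact mem ((le_min (by norm_num) h0).trans a1) (a2.trans (max_le (by norm_num) h1)) ht0.le ht1.le (Or.inl ⟨ht0, ht1⟩) (hs s' ⟨a1, a2⟩) hqt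
    · refine JoinedIn.trans (y := pt j (0, t)) ?_ ?_
      · refine joinedIn_pt j (a := 0) (b := 5 / 8) (c := t) (d := t) (fun s' t' a1 a2 a3 a4 => ?_)
          (by norm_num) (by norm_num)
        obtain rfl : t' = t := le_antisymm a4 a3
        exact mem a1 (by linarith) ht0.le ht1.le (Or.inl ⟨ht0, ht1⟩) (hp0 s' ⟨a1, a2⟩) hqt
      · rw [← pt_side]
        refine joinedIn_pt j (a := s) (b := 1) (c := t) (d := t) (fun s' t' a1 a2 a3 a4 => ?_)
          ⟨h1, le_rfl, le_rfl, le_rfl⟩ ⟨le_rfl, h1, le_rfl, le_rfl⟩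
        obtain rfl : t' = t := le_antisymm a4 a3
        exact mem (h0.trans a1) a2 ht0.le ht1.le (Or.inl ⟨ht0, ht1⟩) (hs' s' ⟨a1, a2⟩) hqt
  have vert : ∀ {s : ℝ}, 1 / 2 < s → s < 1 → p s → JoinedIn S (pt j (s, 1 / 4)) (pt j (s, t)) := by
    intro s hs0 hs1 hps
    rcases hq t hqt with ht | ⟨ht, ht'⟩
    · refine joinedIn_pt j (a := s) (b := s) (c := min (1 / 4) t) (d := max (1 / 4) t) (fun s' t' a1 a2 a3 a4 => ?_)
        ⟨le_rfl, le_rfl, min_le_left _ _, le_max_left _ _⟩ ⟨le_rfl, le_rfl, min_le_right _ _, le_max_right _ _⟩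
      obtain rfl : s' = s := le_antisymm a2 a1
      exact mem (by linarith) hs1.le ((le_min (by norm_num) h2).trans a3) (a4.trans (max_le (by norm_num) h3)) (Or.inr ⟨hs0, hs1⟩) hps (ht t' ⟨a3, a4⟩)
    · refine JoinedIn.trans (y := pt j (s, 0)) ?_ ?_
      · refine joinedIn_pt j (a := s) (b := s) (c := 0) (d := 1 / 4) (fun s' t' a1 a2 a3 a4 => ?_)
          (by norm_num) (by norm_num)
        obtain rfl : s' = s := le_antisymm a2 a1
        exact mem (by linarith) hs1.le a3 (by linarith) (Or.inr ⟨hs0, hs1⟩) hps (hq0 t' ⟨a3, a4⟩)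
      · rw [← pt_edge j hs0.le]
        refine joinedIn_pt j (a := s) (b := s) (c := t) (d := 1) (fun s' t' a1 a2 a3 a4 => ?_)
          ⟨le_rfl, le_rfl, h3, le_rfl⟩ ⟨le_rfl, le_rfl, le_rfl, h3⟩
        obtain rfl : s' = s := le_antisymm a2 a1
        exact mem (by linarith) hs1.le (h2.trans a3) a4 (Or.inr ⟨hs0, hs1⟩) hps (ht' t' ⟨a3, a4⟩)
  -- Inside the horizontal annulus the height is adjusted first, along `s = 5 / 8`. Inside the
  -- vertical one the first coordinate is adjusted first, along `t = 1 / 4`. Either way the path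
  -- stays in the handle.
  rcases h with ht | hs
  · exact (vert (s := 5 / 8) (by norm_num) (by norm_num) (hp0 _ (by norm_num))).trans (horiz ht.1 ht.2 hqt)
  · exact (horiz (t := 1 / 4) (by norm_num) (by norm_num) (hq0 _ (by norm_num))).trans (vert hs.1 hs.2 hps)

theorem true_side {b : ℝ} (s : ℝ) (_ : True) : (∀ s', s' ∈ Set.uIcc b s → True) ∨ (b ≤ s ∧ ∀ s' ∈ Set.Icc s 1, True) :=
  Or.inl fun _ _ => trivial

/-- A coordinate beyond the removed value cannot be moved back to `b` directly, but it can be moved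
up to `1` and continued through the gluing. -/
theorem ne_side {b c : ℝ} (hbc : b < c) (s : ℝ) (hs : s ≠ c) :
    (∀ s', s' ∈ Set.uIcc b s → s' ≠ c) ∨ (b ≤ s ∧ ∀ s' ∈ Set.Icc s 1, s' ≠ c) := by
  rcases hs.lt_or_gt with h | h
  · exact Or.inl fun s' hs' => (hs'.2.trans_lt (max_lt hbc h)).ne
  · exact Or.inr ⟨by linarith, fun s' hs' => (h.trans_le hs'.1).ne'⟩

theorem isPathConnected_handle (i : ZMod k) : IsPathConnected (handle i) :=
  isPathConnected_handle_part (i := i) (p := fun _ => True) (q := fun _ => True)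
    (fun j s t h0 h1 h2 h3 => by rw [pt_mem_handle h0 h1 h2 h3]; tauto) true_side (fun _ _ => trivial) true_side fun _ _ => trivial

theorem isPathConnected_handle_distX (i : ZMod k) : IsPathConnected (handle i ∩ {Q | 0 < (curveX i).dist Q}) :=
  isPathConnected_handle_part (i := i) (p := fun _ => True) (q := fun t => t ≠ 1 / 2)
    (fun j s t h0 h1 h2 h3 => by
      rw [Set.mem_inter_iff, Set.mem_ofPred_eq, pt_mem_handle h0 h1 h2 h3, pt_mem_distX h0 h1 h2 h3]; tauto)
    true_side (fun _ _ => trivial) (ne_side (by norm_num)) fun t ht => by linarith [ht.2]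

theorem isPathConnected_handle_distY (i : ZMod k) : IsPathConnected (handle i ∩ {Q | 0 < (curveY i).dist Q}) :=
  isPathConnected_handle_part (i := i) (p := fun s => s ≠ 3 / 4) (q := fun _ => True)
    (fun j s t h0 h1 h2 h3 => by
      rw [Set.mem_inter_iff, Set.mem_ofPred_eq, pt_mem_handle h0 h1 h2 h3, pt_mem_distY h0 h1 h2 h3]; tauto)
    (ne_side (by norm_num)) (fun t ht => by linarith [ht.2]) true_side fun _ _ => trivial

theorem isPathConnected_complCross_handle : IsPathConnected (complCross ∩ handle 1) :=
  isPathConnected_handle_part (i := 1) (p := fun s => s ≠ 3 / 4) (q := fun t => t ≠ 1 / 2)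
    (fun j s t h0 h1 h2 h3 => by
      rw [Set.mem_inter_iff, pt_mem_handle h0 h1 h2 h3, pt_mem_complCross h0 h1 h2 h3]; tauto)
    (ne_side (by norm_num)) (fun t ht => by linarith [ht.2]) (ne_side (by norm_num)) fun t ht => by linarith [ht.2]

end SurfaceProduct

/-! ### Exchange of the factors and the tori over the second handle. -/

namespace SurfaceProduct

variable {k m : ℕ} {H : Type} [Group H]

namespace Holonomy

section Swap

variable {F G : Type} [TopologicalSpace F] [TopologicalSpace G] {M : Set (F × G)}

/-- Exchange of the factors. -/
noncomputable def swap (h : Holonomy (F × G) M H) : Holonomy (G × F) (Prod.swap ⁻¹' M) H :=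
  h.comapOn Prod.swap continuous_swap.continuousOn fun _ hz => hz

variable {h : Holonomy (F × G) M H}

theorem swap_right {α : C(I, F)} {Q : G} (hM : ∀ τ, (α τ, Q) ∈ M) : h.swap.right Q α = h.left α Q :=
  comapOn_hol _ _ _ _ _ _ hM fun _ => rfl

theorem flatOn_swap {f : F × G → H} {U : Set (F × G)} (hU : U ⊆ M) :
    h.swap.FlatOn (f ∘ Prod.swap) (Prod.swap ⁻¹' U) ↔ h.FlatOn f U := by
  constructor
  · intro hf γ hγ
    rw [← comapOn_hol h Prod.swap continuous_swap.continuousOn (fun _ hz => hz) ⟨fun τ => (γ τ).swap, by fun_prop⟩ γ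
      (fun τ => hU (hγ τ)) fun _ => rfl]
    exact hf ⟨fun τ => (γ τ).swap, by fun_prop⟩ hγ
  · intro hf γ hγ
    refine (comapOn_hol h Prod.swap continuous_swap.continuousOn (fun _ hz => hz) γ ⟨fun τ => (γ τ).swap, by fun_prop⟩
      (fun τ => hU (hγ τ)) fun _ => rfl).trans ?_
    exact hf ⟨fun τ => (γ τ).swap, by fun_prop⟩ hγ

end Swap

end Holonomy

/-! ### Normal generation: genus two -/

/-- The complement of the thin tori. -/
def toriThin (k : ℕ) : Set (Surface k × Surface 2) :=
  {z | ∀ j : TorusIndex k, 0 < torusDist (tori j).1 (tori j).2 z}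

theorem mem_toriThin {z : Surface k × Surface 2} : z ∈ toriThin k ↔
    ((0 < (curveX (0 : ZMod 2)).dist z.2 ∨ z.1 ∈ complX k) ∧ (0 < (curveX' (0 : ZMod 2)).dist z.2 ∨ z.1 ∈ complY k)) ∧
    (0 < (curveX (1 : ZMod 2)).dist z.2 ∨ 0 < (curveY (0 : ZMod k)).dist z.1) ∧
    (0 < (curveY (1 : ZMod 2)).dist z.2 ∨ 0 < (curveY' (0 : ZMod k)).dist z.1) := by
  simp only [toriThin, Set.mem_ofPred_eq, torusDist_pos_iff, complX, complY]
  rw [← forall_or_left, ← forall_or_left, ← forall_and]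
  constructor
  · intro h
    exact ⟨fun i => ⟨(h (.T i)).symm, (h (.L i)).symm⟩, (h .J₁).symm, (h .J₂).symm⟩
  · rintro ⟨h, h1, h2⟩ (i | i | - | -)
    · exact (h i).1.symm
    · exact (h i).2.symm
    · exact h1.symm
    · exact h2.symm

theorem mem_toriThin_of_complCross {P : Surface k} {Q : Surface 2} (hQ : Q ∈ complCross)
    (h1 : 0 < (curveX (0 : ZMod 2)).dist Q ∨ P ∈ complX k) (h2 : 0 < (curveX' (0 : ZMod 2)).dist Q ∨ P ∈ complY k) :
    (P, Q) ∈ toriThin k :=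
  mem_toriThin.2 ⟨⟨h1, h2⟩, Or.inl hQ.1, Or.inl hQ.2⟩

theorem dist_pos_of_mem_handle {Q : Surface 2} (hQ : Q ∈ handle (1 : ZMod 2)) :
    0 < (curveX (0 : ZMod 2)).dist Q ∧ 0 < (curveX' (0 : ZMod 2)).dist Q := by
  obtain ⟨i, s, t, h0, h1, h2, h3, rfl⟩ := exists_pt_square Q
  rw [pt_mem_handle h0 h1 h2 h3] at hQ
  rw [pt_mem_distX h0 h1 h2 h3, pt_mem_distX' h0 h1 h2 h3, hQ.1]
  simp

theorem isPathConnected_compl_band_Y (i : ZMod k) :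
    IsPathConnected (Set.univ \ (curveY i).band (Set.Icc (3 / 4) (7 / 8))) := by
  have mem : ∀ {j : ZMod k} {s t : ℝ}, 0 ≤ s → s ≤ 1 → 0 ≤ t → t ≤ 1 →
      (pt j (s, t) ∈ Set.univ \ (curveY i).band (Set.Icc (3 / 4) (7 / 8)) ↔ (j = i → s < 3 / 4 ∨ 7 / 8 < s)) := by
    intro j s t h0 h1 h2 h3
    simp only [Set.mem_sdiff, Set.mem_univ, true_and, Curve.pt_mem_band _ h0 h1 h2 h3, curveY, Curve.height, Curve.floor,
      Curve.sheet, Set.mem_inter_iff, Set.mem_Icc, Set.mem_Ioo]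
    constructor
    · intro h hj
      by_contra! hc
      exact h ⟨hj, hc, by linarith [hc.1], by linarith [hc.2]⟩
    · rintro h ⟨hj, h'⟩
      rcases h hj with h | h <;> linarith [h'.1.1, h'.1.2]
  refine isPathConnected_of_joined (Q := base k) ?_ fun j s t h0 h1 h2 h3 h => ?_
  · rw [base, mem] <;> norm_num
  rw [mem h0 h1 h2 h3] at h
  have low : ∀ {s : ℝ}, 0 ≤ s → s < 3 / 4 →
      JoinedIn (Set.univ \ (curveY i).band (Set.Icc (3 / 4) (7 / 8))) (base k) (pt j (s, t)) := by
    intro s h0 hs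
    have hm : max s (1 / 2) < 3 / 4 := max_lt hs (by norm_num)
    rw [← pt_base j]
    exact joinedIn_pt j (a := 0) (b := max s (1 / 2)) (c := 0) (d := t) (fun s' t' a1 a2 a3 a4 =>
      (mem a1 (by linarith) a3 (by linarith)).2 fun _ => Or.inl (by linarith))
      ⟨by norm_num, le_max_right _ _, le_rfl, h2⟩ ⟨h0, le_max_left _ _, h2, le_rfl⟩
  by_cases hs : s < 3 / 4
  · exact low h0 hs
  · refine (low le_rfl (by norm_num)).trans ?_
    rw [← pt_side]
    refine joinedIn_pt j (a := s) (b := 1) (c := t) (d := t) (fun s' t' a1 a2 a3 a4 =>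
      (mem (by linarith) a2 (by linarith) (by linarith)).2 fun hj => Or.inr ?_)
      ⟨h1, le_rfl, le_rfl, le_rfl⟩ ⟨le_rfl, h1, le_rfl, le_rfl⟩
    linarith [(h hj).resolve_left hs]

/-- `G` is covered by the complement of `A_2` and `B_2`, over which only `T_i` and `L_i` matter, and
by the open second handle, over which only `J_1` and `J_2` matter. The wall argument is applied to
each part, the second time with the factors exchanged, and the results are glued over the
intersection. -/
theorem Holonomy.exists_flat_toriThin [NeZero k] (h : Holonomy (Surface k × Surface 2) (toriThin k) H)
    (hx : ∀ i, h.left (xLoop i).toContinuousMap (base 2) = 1)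
    (hy : ∀ i, h.left (yLoop i).toContinuousMap (base 2) = 1)
    (ha : ∀ j, h.right (base k) (xLoop j).toContinuousMap = 1) (hb : ∀ j, h.right (base k) (yLoop j).toContinuousMap = 1) :
    ∃ f : Surface k × Surface 2 → H, h.FlatOn f (toriThin k) := by
  have hbase : ∀ Q, (base k, Q) ∈ toriThin k := fun Q => mem_toriThin.2
    ⟨⟨Or.inr base_mem_complX, Or.inr base_mem_complY⟩, Or.inr (by rw [Curve.dist_base]; norm_num), Or.inr (by rw [Curve.dist_base]; norm_num)⟩
  obtain ⟨fG, hfG⟩ := h.exists_flat_surface_right hbase ha hb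
  obtain ⟨fL, hfL⟩ := h.exists_flat_walls_zero isOpen_complCross (by
      intro Q hQ
      obtain ⟨i, s, t, h0, h1, h2, h3, rfl⟩ := exists_pt_square Q
      rw [Curve.pt_mem_band _ h0 h1 h2 h3] at hQ
      rw [pt_mem_complCross h0 h1 h2 h3, hQ.1]
      simp [curveX, Curve.sheet]) isPathConnected_complCross_diff
    (fun P Q hQ h1 h2 => mem_toriThin_of_complCross hQ h1 h2) (g := base 2)
    (by rw [base, pt_mem_complCross_diff] <;> norm_num) (by rw [Curve.dist_base]; norm_num) (by rw [Curve.dist_base]; norm_num)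
    (hfG.mono (Set.prod_mono_right (Set.subset_univ _))) hx hy
  have hfL' : h.FlatOn fL {z | z ∈ toriThin k ∧ z.2 ∈ complCross} := hfL.mono fun z hz => ⟨hz.2, (mem_toriThin.1 hz.1).1⟩
  -- the part over the second handle
  have hmem : ∀ {P : Surface k} {Q : Surface 2}, Q ∈ handle (1 : ZMod 2) →
      (0 < (curveX (1 : ZMod 2)).dist Q ∨ 0 < (curveY (0 : ZMod k)).dist P) →
      (0 < (curveY (1 : ZMod 2)).dist Q ∨ 0 < (curveY' (0 : ZMod k)).dist P) → (P, Q) ∈ toriThin k := fun hQ h1 h2 =>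
    mem_toriThin.2 ⟨⟨Or.inl (dist_pos_of_mem_handle hQ).1, Or.inl (dist_pos_of_mem_handle hQ).2⟩, h1, h2⟩
  set C := curveY (0 : ZMod k) with hC
  have b1 : ∀ {P}, P ∈ C.band {3 / 4} ↔ ¬ 0 < C.dist P :=
    mem_band_singleton (D := C) rfl rfl (by norm_num [C, curveY, Curve.floor, Curve.level])
  have b2 : ∀ {P}, P ∈ C.band {7 / 8} ↔ ¬ 0 < (curveY' (0 : ZMod k)).dist P :=
    mem_band_singleton (D := curveY' (0 : ZMod k)) rfl rfl (by norm_num [C, curveY, curveY', Curve.floor, Curve.level])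
  set P₀ : Surface 2 := pt 1 (5 / 8, 1 / 4) with hP₀
  have hH : P₀ ∈ handle (1 : ZMod 2) := by rw [hP₀, pt_mem_handle] <;> norm_num
  have hHX : P₀ ∈ handle (1 : ZMod 2) ∩ {Q | 0 < (curveX (1 : ZMod 2)).dist Q} :=
    ⟨hH, by rw [Set.mem_ofPred_eq, hP₀, pt_mem_distX] <;> norm_num⟩
  have hHY : P₀ ∈ handle (1 : ZMod 2) ∩ {Q | 0 < (curveY (1 : ZMod 2)).dist Q} :=
    ⟨hH, by rw [Set.mem_ofPred_eq, hP₀, pt_mem_distY] <;> norm_num⟩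
  have hPM : ∀ P, (P, P₀) ∈ toriThin k := fun P => hmem hH (Or.inl hHX.2) (Or.inl hHY.2)
  -- A path in `G` over which all of `F` is available carries triviality of the curves of `F` from
  -- the base point into the second handle.
  have hj : JoinedIn {Q | ∀ P : Surface k, (P, Q) ∈ toriThin k} (base 2) P₀ := by
    rw [← pt_base 1]
    refine joinedIn_pt 1 (a := 1 / 2) (b := 5 / 8) (c := 0) (d := 1 / 4) (fun s t a1 a2 a3 a4 P => ?_) (by norm_num) (by norm_num)
    refine mem_toriThin_of_complCross ?_ (Or.inl ?_) (Or.inl ?_)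
    · rw [pt_mem_complCross (by linarith) (by linarith) a3 (by linarith)]
      exact fun _ => ⟨by linarith, by linarith⟩
    · rw [pt_mem_distX (by linarith) (by linarith) a3 (by linarith)]
      exact fun _ => by linarith
    · rw [pt_mem_distX' (by linarith) (by linarith) a3 (by linarith)]
      exact fun _ => by linarith
  obtain ⟨fP, hfP⟩ := h.swap.exists_flat_surface_right (P := P₀) hPM
    (fun i => (swap_right fun τ => hPM _).trans (left_eq_one_of_joined (by simp) hj (fun τ q hq => hq _) (hx i)))
    (fun i => (swap_right fun τ => hPM _).trans (left_eq_one_of_joined (by simp) hj (fun τ q hq => hq _) (hy i)))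
  have hsF : h.swap.FlatOn (fG ∘ Prod.swap) (handle (1 : ZMod 2) ×ˢ {base k}) :=
    ((flatOn_swap fun z hz => by
      obtain ⟨P, Q⟩ := z
      obtain ⟨rfl, -⟩ := hz
      exact hbase Q).2 hfG).mono fun z hz => ⟨hz.2, Set.mem_univ _⟩
  have mX : ∀ τ, xLoop 1 τ ∈ handle (1 : ZMod 2) ∩ {Q | 0 < (curveX (1 : ZMod 2)).dist Q} := fun τ => by
    obtain ⟨s, h0, h1, e⟩ := xLoop_height (1 : ZMod 2) τ
    rw [e, Set.mem_inter_iff, Set.mem_ofPred_eq, pt_mem_handle h0 h1 (by norm_num) (by norm_num),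
      pt_mem_distX h0 h1 (by norm_num) (by norm_num)]
    norm_num
  have mY : ∀ τ, yLoop 1 τ ∈ handle (1 : ZMod 2) ∩ {Q | 0 < (curveY (1 : ZMod 2)).dist Q} := fun τ => by
    obtain ⟨s, h0, h1, e⟩ := yLoop_height (1 : ZMod 2) τ
    rw [e, Set.mem_inter_iff, Set.mem_ofPred_eq, pt_mem_handle (by norm_num) (by norm_num) h0 h1,
      pt_mem_distY (by norm_num) (by norm_num) h0 h1]
    norm_num
  -- The walls are now `Y_1` and `Y'_1` in `F`. Over `Y_1` the handle loses `A_2` but keeps `a_2`;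
  -- over `Y'_1` it loses `B_2` but keeps `b_2`. There is one handle, hence a single pair of curves.
  obtain ⟨fR, hfR⟩ := h.swap.exists_flat_bands C (w := 3 / 4) (w' := 7 / 8) (d := 1 / 16) (by norm_num)
    (by norm_num [C, curveY, Curve.floor]) (by norm_num) (by norm_num) isOpen_univ (Set.subset_univ _)
    (isPathConnected_compl_band_Y 0) (isOpen_handle (1 : ZMod 2)) ((isOpen_handle 1).inter (isOpen_dist_pos (curveX 1)))
    ((isOpen_handle 1).inter (isOpen_dist_pos (curveY 1))) (isPathConnected_handle 1) (isPathConnected_handle_distX 1)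
    (isPathConnected_handle_distY 1) Set.inter_subset_left Set.inter_subset_left
    (fun Q hQ P _ h1 h2 => hmem hQ (or_iff_not_imp_right.2 fun h' => (h1 (b1.2 h')).2)
      (or_iff_not_imp_right.2 fun h' => (h2 (b2.2 h')).2)) hHX hHY (g := base k)
    ⟨Set.mem_univ _, by rw [base, Curve.pt_mem_band] <;> norm_num [C, curveY, Curve.height, Curve.floor]⟩
    hfP hsF (ι := Unit) (fun _ => (xLoop 1).toContinuousMap) (fun _ => (yLoop 1).toContinuousMap) (fun _ => mX) (fun _ => mY)
    (fun _ => by simp) (fun _ => by simp) (by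
      intro P hP h1 h2
      have hA : ∀ Q ∈ handle (1 : ZMod 2), (Q, P) ∈ Prod.swap ⁻¹' toriThin k := by
        intro Q hQ
        refine hmem hQ (Or.inr ?_) (Or.inr ?_)
        · by_contra hc
          have := (C.band_inter _ _).le ⟨hP, b1.2 hc⟩
          rw [Set.inter_singleton_eq_empty.2 (by simp), C.band_empty] at this
          exact this
        · by_contra hc
          have := (C.band_inter _ _).le ⟨hP, b2.2 hc⟩
          rw [Set.inter_singleton_eq_empty.2 (by simp), C.band_empty] at this
          exact this
      -- Strictly between the walls the entire handle is present, and its two cores are the curves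
      -- just carried through.
      obtain ⟨f, hf⟩ := (h.swap.sliceLeft (handle 1) P hA).exists_flat_handle
        ((sliceLeft_hol _ fun τ => (mX τ).1).trans (h1 ())) ((sliceLeft_hol _ fun τ => (mY τ).1).trans (h2 ()))
      exact ⟨_, hf.of_sliceLeft subset_rfl⟩)
  have hfR' : h.FlatOn (fR ∘ Prod.swap) {z | z ∈ toriThin k ∧ z.2 ∈ handle (1 : ZMod 2)} := by
    rw [← flatOn_swap fun z hz => hz.1]
    refine FlatOn.mono (show h.swap.FlatOn ((fR ∘ Prod.swap) ∘ Prod.swap) _ from hfR) ?_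
    rintro ⟨Q, P⟩ ⟨hz, hQ⟩
    have := mem_toriThin.1 hz
    exact ⟨hQ, Set.mem_univ _, fun h' => ⟨hQ, this.2.1.resolve_right (b1.1 h')⟩, fun h' => ⟨hQ, this.2.2.resolve_right (b2.1 h')⟩⟩
  have oM : IsOpen (toriThin k) := by
    have : toriThin k = {z | (((0 < (curveX (0 : ZMod 2)).dist z.2 ∨ z.1 ∈ complX k) ∧ (0 < (curveX' (0 : ZMod 2)).dist z.2 ∨ z.1 ∈ complY k)) ∧
      (0 < (curveX (1 : ZMod 2)).dist z.2 ∨ 0 < (curveY (0 : ZMod k)).dist z.1)) ∧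
      (0 < (curveY (1 : ZMod 2)).dist z.2 ∨ 0 < (curveY' (0 : ZMod k)).dist z.1)} := by
      ext z
      rw [mem_toriThin, ← and_assoc]
      rfl
    rw [this]
    have l : ∀ D : Curve k, IsOpen {z : Surface k × Surface 2 | 0 < D.dist z.1} := fun D => (isOpen_dist_pos D).preimage continuous_fst
    have r : ∀ D : Curve 2, IsOpen {z : Surface k × Surface 2 | 0 < D.dist z.2} := fun D => (isOpen_dist_pos D).preimage continuous_snd
    exact ((((r _).union (isOpen_complX.preimage continuous_fst)).inter ((r _).union (isOpen_complY.preimage continuous_fst))).inter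
      ((r _).union (l _))).inter ((r _).union (l _))
  obtain ⟨f, hf⟩ := hfL'.union_of_isPathConnected hfR' (fun z hz => hz.1) (fun z hz => hz.1)
    (oM.inter (isOpen_complCross.preimage continuous_snd)) (oM.inter ((isOpen_handle _).preimage continuous_snd)) (by
      have e : {z | z ∈ toriThin k ∧ z.2 ∈ complCross} ∩ {z | z ∈ toriThin k ∧ z.2 ∈ handle (1 : ZMod 2)} =
          Set.univ ×ˢ (complCross ∩ handle (1 : ZMod 2)) := by
        ext ⟨P, Q⟩
        constructor
        · rintro ⟨hz, hz'⟩
          exact ⟨Set.mem_univ _, hz.2, hz'.2⟩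
        · rintro ⟨-, hz, hz'⟩
          have : (P, Q) ∈ toriThin k := hmem hz' (Or.inl hz.1) (Or.inl hz.2)
          exact ⟨⟨this, hz⟩, this, hz'⟩
      rw [e]
      exact isPathConnected_univ_surface.prod isPathConnected_complCross_handle)
  refine ⟨f, hf.mono fun z hz => ?_⟩
  -- The curves `A_2` and `B_2` lie in the handle, so a point outside it is off both.
  by_cases hz' : z.2 ∈ handle (1 : ZMod 2)
  · exact Or.inr ⟨hz, hz'⟩
  · refine Or.inl ⟨hz, ?_⟩
    obtain ⟨P, Q⟩ := z
    obtain ⟨i, s, t, h0, h1, h2, h3, rfl⟩ := exists_pt_square Q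
    simp only at hz' ⊢
    rw [pt_mem_handle h0 h1 h2 h3] at hz'
    rw [pt_mem_complCross h0 h1 h2 h3]
    intro hi
    refine ⟨fun e => hz' ⟨hi, Or.inl ?_⟩, fun e => hz' ⟨hi, Or.inr ?_⟩⟩ <;> rw [e] <;> norm_num

end SurfaceProduct

/-! ### From thin tori to tubes: the normal generation statements. -/

namespace SurfaceProduct

variable {k m : ℕ} {H : Type} [Group H]

namespace Holonomy

variable {F G : Type} [TopologicalSpace F] [TopologicalSpace G] {M : Set (F × G)} {h : Holonomy (F × G) M H}

theorem hol_prod_refl {P P' : F} (γ : Path P P') (Q : G) : h.hol (γ.prod (Path.refl Q)).toContinuousMap = h.left γ.toContinuousMap Q := by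
  rw [left]
  congr 1

theorem hol_refl_prod (P : F) {Q Q' : G} (γ : Path Q Q') : h.hol ((Path.refl P).prod γ).toContinuousMap = h.right P γ.toContinuousMap := by
  rw [right]
  congr 1

theorem eq_one_of_conj {x y z : H} (h : y⁻¹ * x * y = z) (hz : z = 1) : x = 1 := by
  rw [hz] at h
  have := mul_eq_one_iff_eq_inv.1 h
  exact mul_left_cancel (a := y⁻¹) (by rw [this, mul_one])

end Holonomy

open Holonomy

theorem finite_puncturedIndex [NeZero k] : Finite (PuncturedIndex k) :=
  Finite.of_injective (β := ZMod k ⊕ ZMod k) (fun j => match j with | .T i => .inl i | .L i => .inr i) (by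
    rintro (i | i) (j | j) h <;> simp_all)

theorem finite_torusIndex [NeZero k] : Finite (TorusIndex k) :=
  Finite.of_injective (β := (ZMod k ⊕ ZMod k) ⊕ Bool)
    (fun j => match j with | .T i => .inl (.inl i) | .L i => .inl (.inr i) | .J₁ => .inr true | .J₂ => .inr false) (by
    rintro (i | i | _ | _) (j | j | _ | _) h <;> simp_all)

variable {ε : ℝ}

theorem torusDist_pos_of_not_mem (hε : 0 < ε) (hε' : ε < 1 / 16) {C : Curve k} {C' : Curve m} {z : Surface k × Surface m}
    (h : z ∉ tube C C' (Set.Iio (ε ^ 2))) : 0 < torusDist C C' z := by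
  rw [mem_tube_Iio hε hε', not_lt] at h
  exact (by positivity : 0 < ε ^ 2).trans_le h

/-- Curves of the second factor that are used over the punctured torus avoid the disc. -/
theorem dist_puncturedTori_of_le (j : PuncturedIndex k) {p : ℝ × ℝ} (hp : p ∈ Set.Icc (0 : ℝ) 1 ×ˢ Set.Icc (0 : ℝ) (3 / 16)) :
    (puncturedTori j).2.dist (pt 0 p) = 1 / 16 := by
  have hp' : p ∈ Set.Icc (0 : ℝ) 1 ×ˢ Set.Icc (0 : ℝ) 1 := ⟨hp.1, hp.2.1, hp.2.2.trans (by norm_num)⟩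
  have h2 := hp.2.2
  rw [Curve.dist_pt _ _ hp']
  split_ifs
  · refine min_eq_right (le_abs.2 (Or.inr ?_))
    cases j <;> (simp only [puncturedTori, curveX, curveX', Curve.height, Curve.level]; linarith)
  · rfl

theorem dist_puncturedTori_of_mem_disc (j : PuncturedIndex k) {Q : Surface 1} (hQ : Q ∈ disc) : (puncturedTori j).2.dist Q = 1 / 16 := by
  obtain ⟨⟨s, t⟩, h, rfl⟩ := hQ
  simp only at h
  have hs : |s - 1 / 4| < 1 / 16 := abs_lt_of_sq_lt_sq (by nlinarith [sq_nonneg (t - 1 / 8)]) (by norm_num)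
  have ht : |t - 1 / 8| < 1 / 16 := abs_lt_of_sq_lt_sq (by nlinarith [sq_nonneg (s - 1 / 4)]) (by norm_num)
  rw [abs_lt] at hs ht
  exact dist_puncturedTori_of_le j ⟨⟨by linarith, by linarith⟩, by simp only; linarith, by simp only; linarith⟩

/-- Push out of the disc first and out of the tubes afterwards. The curves `A`, `A'` have distance
at least `1 / 16` from the region of the disc, so neither push undoes the other. -/
theorem exists_puncturedThin_retraction [NeZero k] (hε : 0 < ε) (hε' : ε < 1 / 16) :
    ∃ ρ : Surface k × Surface 1 → Surface k × Surface 1, ContinuousOn ρ (puncturedThin k) ∧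
      Set.MapsTo ρ (puncturedThin k) (puncturedComplement k ε) ∧ ∀ z ∈ puncturedComplement k ε, ρ z = z := by
  have := finite_puncturedIndex (k := k)
  obtain ⟨r, rc, rm, ri⟩ := exists_tube_retraction (puncturedTori (k := k)) hε hε'
    fun j j' h => disjoint_tube hε hε' (apart_puncturedTori h)
  have hm : Set.MapsTo (fun z : Surface k × Surface 1 => (z.1, discPush z.2)) (puncturedThin k)
      {z | ∀ j, 0 < torusDist (puncturedTori j).1 (puncturedTori j).2 z} := by
    intro z hz j
    obtain ⟨-, h | ⟨p, hp, -, h⟩⟩ := discPush_spec hz.1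
    · simp only [h]
      exact hz.2 j
    · rw [torusDist_pos_iff]
      simp only [h]
      rw [dist_puncturedTori_of_le j hp]
      exact Or.inr (by norm_num)
  refine ⟨fun z => r (z.1, discPush z.2), rc.comp ?_ hm, fun z hz => ?_, fun z hz => ?_⟩
  · refine continuous_fst.continuousOn.prodMk (continuousOn_discPush.comp continuous_snd.continuousOn fun z hz => hz.1)
  · obtain ⟨h1, h2⟩ := rm _ (hm hz)
    refine ⟨?_, h2⟩
    -- If the tube push moved the point, it now lies at squared distance `ε ^ 2` from a torus, which
    -- is impossible over the disc.
    rcases h1 with h1 | ⟨j, hj⟩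
    · simp only [h1]
      exact (discPush_spec hz.1).1
    · intro hd
      have e := dist_puncturedTori_of_mem_disc j hd
      rw [torusDist, e] at hj
      nlinarith [sq_nonneg ((puncturedTori j).1.dist (r (z.1, discPush z.2)).1)]
  · simp only
    rw [discPush_of_notMem hz.1, ri z hz.2]

theorem puncturedComplement_subset (hε : 0 < ε) (hε' : ε < 1 / 16) : puncturedComplement k ε ⊆ puncturedThin k := by
  rintro z ⟨h1, h2⟩
  refine ⟨?_, fun j => torusDist_pos_of_not_mem hε hε' (h2 j)⟩
  intro e
  refine h1 ((mem_disc_iff _).2 ?_)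
  rw [e]
  have := (discDist_pos_iff discCenter).not.2 (by simp)
  linarith

/-- The quotient holonomy is pulled back along the retraction to the thin complement. It vanishes on
the generators, since these lie in `N` and conjugation by the arcs `β_i` does not affect triviality,
so it has a potential. -/
theorem normalClosure_punctured (hk : 1 ≤ k) (hε : 0 < ε) (hε' : ε < 1 / 16) :
    Subgroup.normalClosure (Set.range (pX (k := k) hε hε') ∪ Set.range (pY (k := k) hε hε') ∪
      {pA k hε hε', pB k hε hε'}) = ⊤ := by
  have : NeZero k := ⟨by omega⟩
  set N := Subgroup.normalClosure (Set.range (pX (k := k) hε hε') ∪ Set.range (pY (k := k) hε hε') ∪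
      {pA k hε hε', pB k hε hε'}) with hN
  have hnormal : N.Normal := Subgroup.normalClosure_normal
  refine eq_top_of_hol fun γ hγ => ?_
  set h := (ofBase (puncturedComplement k ε) (puncturedBase k hε hε')).mapHom (QuotientGroup.mk' N) with hh
  obtain ⟨ρ, ρc, ρm, ρi⟩ := exists_puncturedThin_retraction (k := k) hε hε'
  have hcomap : ∀ γ : C(I, Surface k × Surface 1), (∀ τ, γ τ ∈ puncturedComplement k ε) →
      (h.comapOn ρ ρc ρm).hol γ = h.hol γ := fun γ hγ =>
    comapOn_hol _ _ _ _ _ _ (fun τ => puncturedComplement_subset hε hε' (hγ τ)) fun τ => (ρi _ (hγ τ)).symm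
  have hF : ∀ P : Surface k, (P, pt 0 (5 / 8, 1 / 4)) ∈ puncturedComplement k ε := mem_puncturedComplement_F hε hε'
  have hS : ∀ g ∈ Set.range (pX (k := k) hε hε') ∪ Set.range (pY (k := k) hε hε') ∪ {pA k hε hε', pB k hε hε'}, g ∈ N :=
    fun g hg => Subgroup.subset_normalClosure hg
  obtain ⟨f, hf⟩ := (h.comapOn ρ ρc ρm).exists_flat_puncturedThin
    (fun i => (hcomap _ fun τ => hF _).trans (eq_one_of_conj (left_conj (arc i) (xLoop i) (fun τ => hF _) fun τ => hF _).symm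
      ((hol_prod_refl (xTilde i) _).symm.trans (mapHom_loop (puncturedBase k hε hε') _ (fun τ => hF _) (hS _ (Or.inl (Or.inl ⟨i, rfl⟩)))))))
    (fun i => (hcomap _ fun τ => hF _).trans (eq_one_of_conj (left_conj (arc i) (yLoop i) (fun τ => hF _) fun τ => hF _).symm
      ((hol_prod_refl (yTilde i) _).symm.trans (mapHom_loop (puncturedBase k hε hε') _ (fun τ => hF _) (hS _ (Or.inl (Or.inr ⟨i, rfl⟩)))))))
    ((hcomap _ fun τ => mem_puncturedComplement_G hε hε' (xLoop_not_mem_disc τ)).trans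
      ((hol_refl_prod _ (xLoop 0)).symm.trans (mapHom_loop (puncturedBase k hε hε') _ (fun τ => mem_puncturedComplement_G hε hε' (xLoop_not_mem_disc τ))
        (hS _ (Or.inr (Or.inl rfl))))))
    ((hcomap _ fun τ => mem_puncturedComplement_G hε hε' (yLoop_not_mem_disc τ)).trans
      ((hol_refl_prod _ (yLoop 0)).symm.trans (mapHom_loop (puncturedBase k hε hε') _ (fun τ => mem_puncturedComplement_G hε hε' (yLoop_not_mem_disc τ))
        (hS _ (Or.inr (Or.inr rfl))))))
  -- A loop has equal end points, so the increment of the potential is trivial.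
  rw [← hcomap _ hγ, hf _ fun τ => puncturedComplement_subset hε hε' (hγ τ)]
  simp

theorem toriComplement_subset (hε : 0 < ε) (hε' : ε < 1 / 16) : toriComplement k ε ⊆ toriThin k :=
  fun _ h j => torusDist_pos_of_not_mem hε hε' (h j)

theorem normalClosure_tori (hk : 1 ≤ k) (hε : 0 < ε) (hε' : ε < 1 / 16) :
    Subgroup.normalClosure (Set.range (cX (k := k) hε hε') ∪ Set.range (cY (k := k) hε hε') ∪
        Set.range (cA k hε hε') ∪ Set.range (cB k hε hε')) = ⊤ := by
  have : NeZero k := ⟨by omega⟩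
  have := finite_torusIndex (k := k)
  set N := Subgroup.normalClosure (Set.range (cX (k := k) hε hε') ∪ Set.range (cY (k := k) hε hε') ∪
        Set.range (cA k hε hε') ∪ Set.range (cB k hε hε')) with hN
  have hnormal : N.Normal := Subgroup.normalClosure_normal
  refine eq_top_of_hol fun γ hγ => ?_
  set h := (ofBase (toriComplement k ε) (toriBase k hε hε')).mapHom (QuotientGroup.mk' N) with hh
  obtain ⟨ρ, ρc, rm, ri⟩ := exists_tube_retraction (tori (k := k)) hε hε'
    fun j j' h => disjoint_tube hε hε' (apart_tori h)
  have ρm : Set.MapsTo ρ (toriThin k) (toriComplement k ε) := fun z hz => (rm z hz).2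
  have ρi : ∀ z ∈ toriComplement k ε, ρ z = z := fun z hz => ri z hz
  have hcomap : ∀ γ : C(I, Surface k × Surface 2), (∀ τ, γ τ ∈ toriComplement k ε) →
      (h.comapOn ρ ρc ρm).hol γ = h.hol γ := fun γ hγ =>
    comapOn_hol _ _ _ _ _ _ (fun τ => toriComplement_subset hε hε' (hγ τ)) fun τ => (ρi _ (hγ τ)).symm
  have hF : ∀ P : Surface k, (P, base 2) ∈ toriComplement k ε := mem_toriComplement_F hε hε'
  have hG : ∀ Q : Surface 2, (base k, Q) ∈ toriComplement k ε := mem_toriComplement_G hε hε'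
  have hS : ∀ g ∈ Set.range (cX (k := k) hε hε') ∪ Set.range (cY (k := k) hε hε') ∪
        Set.range (cA k hε hε') ∪ Set.range (cB k hε hε'), g ∈ N :=
    fun g hg => Subgroup.subset_normalClosure hg
  obtain ⟨f, hf⟩ := (h.comapOn ρ ρc ρm).exists_flat_toriThin
    (fun i => (hcomap _ fun τ => hF _).trans (eq_one_of_conj (left_conj (arc i) (xLoop i) (fun τ => hF _) fun τ => hF _).symm
      ((hol_prod_refl (xTilde i) _).symm.trans (mapHom_loop (toriBase k hε hε') _ (fun τ => hF _) (hS _ (Or.inl (Or.inl (Or.inl ⟨i, rfl⟩))))))))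
    (fun i => (hcomap _ fun τ => hF _).trans (eq_one_of_conj (left_conj (arc i) (yLoop i) (fun τ => hF _) fun τ => hF _).symm
      ((hol_prod_refl (yTilde i) _).symm.trans (mapHom_loop (toriBase k hε hε') _ (fun τ => hF _) (hS _ (Or.inl (Or.inl (Or.inr ⟨i, rfl⟩))))))))
    (fun i => (hcomap _ fun τ => hG _).trans (eq_one_of_conj (right_conj (arc i) (xLoop i) (fun τ => hG _) fun τ => hG _).symm
      ((hol_refl_prod _ (xTilde i)).symm.trans (mapHom_loop (toriBase k hε hε') _ (fun τ => hG _) (hS _ (Or.inl (Or.inr ⟨i, rfl⟩)))))))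
    (fun i => (hcomap _ fun τ => hG _).trans (eq_one_of_conj (right_conj (arc i) (yLoop i) (fun τ => hG _) fun τ => hG _).symm
      ((hol_refl_prod _ (yTilde i)).symm.trans (mapHom_loop (toriBase k hε hε') _ (fun τ => hG _) (hS _ (Or.inr ⟨i, rfl⟩))))))
  rw [← hcomap _ hγ, hf _ fun τ => toriComplement_subset hε hε' (hγ τ)]
  simp

end SurfaceProduct

/-! ### Meridians as commutators in a rectangle with a hole. -/

namespace SurfaceProduct

namespace Holonomy

variable {Z H : Type} [TopologicalSpace Z] [Group H] {M : Set Z} {h : Holonomy Z M H}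

/-! ### Potentials in a chart -/

section Along

variable {E E' : Type} [TopologicalSpace E] [TopologicalSpace E']

/-- `f` is a potential of the pull-back of the holonomy along `Θ`. -/
def FlatAlong (h : Holonomy Z M H) (Θ : E → Z) (f : E → H) (S : Set E) : Prop :=
  ∀ (γ : C(I, Z)) (p : C(I, E)), (∀ τ, p τ ∈ S) → (∀ τ, γ τ = Θ (p τ)) → h.hol γ = f (p 1) * (f (p 0))⁻¹

theorem FlatAlong.mul_right {Θ : E → Z} {f : E → H} {S : Set E} (hf : h.FlatAlong Θ f S) (c : H) :
    h.FlatAlong Θ (fun x => f x * c) S := fun γ p hp hγ => by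
  rw [hf γ p hp hγ]
  group

theorem FlatAlong.mono {Θ : E → Z} {f : E → H} {S S' : Set E} (hf : h.FlatAlong Θ f S) (hS : S' ⊆ S) :
    h.FlatAlong Θ f S' := fun γ p hp hγ => hf γ p (fun τ => hS (hp τ)) hγ

theorem FlatAlong.comp {Θ : E → Z} {f : E → H} {S : Set E}
    (hf : h.FlatAlong Θ f S) {e : E' → E} (he : Continuous e) {S' : Set E'} (hS : Set.MapsTo e S' S) :
    h.FlatAlong (Θ ∘ e) (f ∘ e) S' := fun γ p hp hγ => hf γ ⟨fun τ => e (p τ), by fun_prop⟩ (fun τ => hS (hp τ)) hγ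

end Along

variable {E : Type} [NormedAddCommGroup E] [NormedSpace ℝ E]

theorem exists_flatAlong (h : Holonomy Z M H) {Θ : E → Z} {D : Set E} (hc : ContinuousOn Θ D) (hm : Set.MapsTo Θ D M) {S : Set E} (hS : Convex ℝ S)
    (hSD : S ⊆ D) : ∃ f : E → H, h.FlatAlong Θ f S := by
  obtain ⟨f, hf⟩ := h.exists_flat_convex hS (hc.mono hSD) fun x hx => hm (hSD hx)
  exact ⟨f, fun γ p hp hγ => hf γ p hp hγ⟩

theorem FlatAlong.eqOn {Θ : E → Z} {f f' : E → H} {S : Set E} (hf : h.FlatAlong Θ f S) (hf' : h.FlatAlong Θ f' S) (hc : ContinuousOn Θ S)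
    (hS : Convex ℝ S) {x : E} (hx : x ∈ S) (e : f x = f' x) : ∀ y ∈ S, f y = f' y := by
  intro y hy
  let p : C(I, E) := ⟨fun τ => AffineMap.lineMap x y (τ : ℝ), AffineMap.lineMap_continuous.comp continuous_subtype_val⟩
  have hp : ∀ τ, p τ ∈ S := fun τ => hS.lineMap_mem hx hy τ.2
  let γ : C(I, Z) := ⟨fun τ => Θ (p τ), hc.comp_continuous p.continuous hp⟩
  have h1 := hf γ p hp fun _ => rfl
  have h2 := hf' γ p hp fun _ => rfl
  rw [h1] at h2
  have p0 : p 0 = x := by simp [p]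
  have p1 : p 1 = y := by simp [p]
  rw [p0, p1, e] at h2
  exact mul_right_cancel h2

/-- The segment in a chart. -/
theorem FlatAlong.hol_seg {Θ : E → Z} {f : E → H} {S : Set E} (hf : h.FlatAlong Θ f S) (hS : Convex ℝ S) {x y : E} (hx : x ∈ S) (hy : y ∈ S)
    {γ : C(I, Z)} (hγ : ∀ τ : I, γ τ = Θ (AffineMap.lineMap x y (τ : ℝ))) : h.hol γ = f y * (f x)⁻¹ := by
  have := hf γ ⟨fun τ => AffineMap.lineMap x y (τ : ℝ), AffineMap.lineMap_continuous.comp continuous_subtype_val⟩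
    (fun τ => hS.lineMap_mem hx hy τ.2) hγ
  simpa using this

/-! ### A rectangle with a hole -/

/-- The rectangle `[a, b] × [c, d]` minus the open disc of radius `ε`. -/
def holed (a b c d ε : ℝ) : Set (ℝ × ℝ) := {x | x ∈ Set.Icc a b ×ˢ Set.Icc c d ∧ ε ^ 2 ≤ x.1 ^ 2 + x.2 ^ 2}

/-- Four convex rectangles surround the hole: bottom, right, top, left. Potentials on them can be
matched at three of the four corner overlaps; the defect `m` at the fourth is the monodromy around
the hole. -/
theorem exists_hole_potentials (h : Holonomy Z M H) {Θ : ℝ × ℝ → Z} {a b c d ε : ℝ} (hε : 0 < ε) (ha : a ≤ -(2 * ε)) (hb : 2 * ε ≤ b) (hc : c ≤ -(2 * ε))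
    (hd : 2 * ε ≤ d) (hΘ : ContinuousOn Θ (holed a b c d ε)) (hm : Set.MapsTo Θ (holed a b c d ε) M) :
    ∃ (fB fR fT fL : ℝ × ℝ → H) (m : H),
      h.FlatAlong Θ fB (Set.Icc a b ×ˢ Set.Icc c (-ε)) ∧ h.FlatAlong Θ fR (Set.Icc ε b ×ˢ Set.Icc c d) ∧
      h.FlatAlong Θ fT (Set.Icc a b ×ˢ Set.Icc ε d) ∧ h.FlatAlong Θ fL (Set.Icc a (-ε) ×ˢ Set.Icc c d) ∧
      (∀ x ∈ Set.Icc ε b ×ˢ Set.Icc c (-ε), fB x = fR x) ∧ (∀ x ∈ Set.Icc ε b ×ˢ Set.Icc ε d, fR x = fT x) ∧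
      (∀ x ∈ Set.Icc a (-ε) ×ˢ Set.Icc ε d, fT x = fL x) ∧ (∀ x ∈ Set.Icc a (-ε) ×ˢ Set.Icc c (-ε), fL x = fB x * m) ∧
      ∀ γ : C(I, Z), (∀ τ : I, γ τ = Θ (ε * Real.cos (2 * Real.pi * τ), ε * Real.sin (2 * Real.pi * τ))) →
        h.hol γ = fR (ε, 0) * m * (fR (ε, 0))⁻¹ := by
  have sB : Set.Icc a b ×ˢ Set.Icc c (-ε) ⊆ holed a b c d ε := fun x hx =>
    ⟨⟨hx.1, hx.2.1, by linarith [hx.2.2]⟩, by nlinarith [hx.2.2, sq_nonneg x.1]⟩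
  have sR : Set.Icc ε b ×ˢ Set.Icc c d ⊆ holed a b c d ε := fun x hx =>
    ⟨⟨⟨by linarith [hx.1.1], hx.1.2⟩, hx.2⟩, by nlinarith [hx.1.1, sq_nonneg x.2]⟩
  have sT : Set.Icc a b ×ˢ Set.Icc ε d ⊆ holed a b c d ε := fun x hx =>
    ⟨⟨hx.1, by linarith [hx.2.1], hx.2.2⟩, by nlinarith [hx.2.1, sq_nonneg x.1]⟩
  have sL : Set.Icc a (-ε) ×ˢ Set.Icc c d ⊆ holed a b c d ε := fun x hx =>
    ⟨⟨⟨hx.1.1, by linarith [hx.1.2]⟩, hx.2⟩, by nlinarith [hx.1.2, sq_nonneg x.2]⟩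
  have cv : ∀ a b c d : ℝ, Convex ℝ (Set.Icc a b ×ˢ Set.Icc c d) := fun a b c d => (convex_Icc a b).prod (convex_Icc c d)
  have glue : ∀ {S S' T : Set (ℝ × ℝ)} {f f' : ℝ × ℝ → H}, h.FlatAlong Θ f S → h.FlatAlong Θ f' S' → T ⊆ S → T ⊆ S' → Convex ℝ T → S ⊆ holed a b c d ε →
      ∀ {x}, x ∈ T → ∀ y ∈ T, f' y = f y * ((f x)⁻¹ * f' x) := by
    intro S S' T f f' hf hf' hT hT' cT hS x hx y hy
    exact ((hf.mono hT).mul_right ((f x)⁻¹ * f' x)).eqOn (hf'.mono hT') (hΘ.mono (hT.trans hS)) cT hx (by group) y hy |>.symm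
  obtain ⟨fB, hB⟩ := h.exists_flatAlong hΘ hm (cv _ _ _ _) sB
  obtain ⟨fR, hR⟩ := h.exists_flatAlong hΘ hm (cv _ _ _ _) sR
  obtain ⟨fT, hT⟩ := h.exists_flatAlong hΘ hm (cv _ _ _ _) sT
  obtain ⟨fL, hL⟩ := h.exists_flatAlong hΘ hm (cv _ _ _ _) sL
  have iBR := glue hB hR (T := Set.Icc ε b ×ˢ Set.Icc c (-ε)) (Set.prod_mono (Set.Icc_subset_Icc_left (by linarith)) subset_rfl)
    (Set.prod_mono subset_rfl (Set.Icc_subset_Icc_right (by linarith))) (cv _ _ _ _) sB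
    (x := (2 * ε, -(2 * ε))) ⟨⟨by simp only; linarith, hb⟩, hc, by simp only; linarith⟩
  have iRT := glue hR hT (T := Set.Icc ε b ×ˢ Set.Icc ε d) (Set.prod_mono subset_rfl (Set.Icc_subset_Icc_left (by linarith)))
    (Set.prod_mono (Set.Icc_subset_Icc_left (by linarith)) subset_rfl) (cv _ _ _ _) sR
    (x := (2 * ε, 2 * ε)) ⟨⟨by simp only; linarith, hb⟩, by simp only; linarith, hd⟩
  have iTL := glue hT hL (T := Set.Icc a (-ε) ×ˢ Set.Icc ε d) (Set.prod_mono (Set.Icc_subset_Icc_right (by linarith)) subset_rfl)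
    (Set.prod_mono subset_rfl (Set.Icc_subset_Icc_left (by linarith))) (cv _ _ _ _) sT
    (x := (-(2 * ε), 2 * ε)) ⟨⟨ha, by simp only; linarith⟩, by simp only; linarith, hd⟩
  have iLB := glue hB hL (T := Set.Icc a (-ε) ×ˢ Set.Icc c (-ε)) (Set.prod_mono (Set.Icc_subset_Icc_right (by linarith)) subset_rfl)
    (Set.prod_mono subset_rfl (Set.Icc_subset_Icc_right (by linarith))) (cv _ _ _ _) sB
    (x := (-(2 * ε), -(2 * ε))) ⟨⟨ha, by simp only; linarith⟩, hc, by simp only; linarith⟩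
  set kR := (fB (2 * ε, -(2 * ε)))⁻¹ * fR (2 * ε, -(2 * ε))
  set kT := (fR (2 * ε, 2 * ε))⁻¹ * fT (2 * ε, 2 * ε)
  set kL := (fT (-(2 * ε), 2 * ε))⁻¹ * fL (-(2 * ε), 2 * ε)
  set kB := (fB (-(2 * ε), -(2 * ε)))⁻¹ * fL (-(2 * ε), -(2 * ε))
  refine ⟨fB, fun x => fR x * kR⁻¹, fun x => fT x * (kR * kT)⁻¹, fun x => fL x * (kR * kT * kL)⁻¹, kB * (kR * kT * kL)⁻¹, hB, hR.mul_right _,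
    hT.mul_right _, hL.mul_right _, fun x hx => ?_, fun x hx => ?_, fun x hx => ?_, fun x hx => ?_, fun γ hγ => ?_⟩
  · simp only [iBR x hx]; group
  · simp only [iRT x hx]; group
  · simp only [iTL x hx]; group
  · simp only [iLB x hx]; group
  -- polar coordinates
  let e : ℝ × ℝ → ℝ × ℝ := fun x => (x.1 * Real.cos (2 * Real.pi * x.2), x.1 * Real.sin (2 * Real.pi * x.2))
  have he : Continuous e := by fun_prop
  have rad : ∀ x, (e x).1 ^ 2 + (e x).2 ^ 2 = x.1 ^ 2 := fun x => by
    simp only [e]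
    linear_combination x.1 ^ 2 * Real.cos_sq_add_sin_sq (2 * Real.pi * x.2)
  have bd : ∀ x : ℝ × ℝ, x.1 ∈ Set.Icc ε (2 * ε) → e x ∈ Set.Icc a b ×ˢ Set.Icc c d := by
    intro x hx
    have h1 := abs_le.1 (Real.abs_cos_le_one (2 * Real.pi * x.2))
    have h2 := abs_le.1 (Real.abs_sin_le_one (2 * Real.pi * x.2))
    have h0 : 0 ≤ x.1 := hε.le.trans hx.1
    refine ⟨⟨?_, ?_⟩, ?_, ?_⟩ <;> simp only [e] <;> nlinarith [hx.2]
  have sP : Set.MapsTo e (Set.Icc ε (2 * ε) ×ˢ Set.univ) (holed a b c d ε) := fun x hx =>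
    ⟨bd x hx.1, by rw [rad]; nlinarith [hx.1.1]⟩
  obtain ⟨g, hg⟩ := h.exists_flatAlong (Θ := Θ ∘ e) (hΘ.comp he.continuousOn sP) (fun x hx => hm (sP hx))
    ((convex_Icc ε (2 * ε)).prod convex_univ) subset_rfl
  have cP : ContinuousOn (Θ ∘ e) (Set.Icc ε (2 * ε) ×ˢ Set.univ) := hΘ.comp he.continuousOn sP
  have arc : ∀ {S : Set (ℝ × ℝ)} {f : ℝ × ℝ → H} {T : Set (ℝ × ℝ)}, h.FlatAlong Θ f S → Convex ℝ T → Set.MapsTo e T S →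
      T ⊆ Set.Icc ε (2 * ε) ×ˢ Set.univ → ∀ {x}, x ∈ T → ∀ {y}, y ∈ T → g y * (g x)⁻¹ = f (e y) * (f (e x))⁻¹ := by
    intro S f T hf cT heT hT x hx y hy
    have := ((hf.comp he heT).mul_right ((f (e x))⁻¹ * g x)).eqOn (hg.mono hT) (cP.mono hT) cT hx (by simp) y hy
    rw [← this]
    simp only [Function.comp_apply]
    group
  -- The circle of radius `ε` is not covered by the rectangles. The circle of radius `√2 * ε` passes
  -- through the corners `(±ε, ±ε)` of the square around the hole, and each quarter turn between two
  -- of them stays in one rectangle.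
  have quarter : ∀ {u : ℝ}, |u| ≤ 1 / 8 → √2 / 2 ≤ Real.cos (2 * Real.pi * u) := by
    intro u hu
    rw [← Real.cos_pi_div_four, ← Real.cos_abs (2 * Real.pi * u)]
    have hpi := Real.pi_pos
    refine Real.cos_le_cos_of_nonneg_of_le_pi (abs_nonneg _) (by linarith) ?_
    rw [abs_mul, abs_of_pos (by positivity)]
    nlinarith
  have s2 : √2 * √2 = 2 := Real.mul_self_sqrt (by norm_num)
  have s1 : 1 ≤ √2 := Real.one_le_sqrt.2 (by norm_num)
  have s3 : √2 ≤ 2 := by nlinarith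
  have ring' : ∀ {u v : ℝ}, ({√2 * ε} : Set ℝ) ×ˢ Set.Icc u v ⊆ Set.Icc ε (2 * ε) ×ˢ Set.univ := by
    intro u v x hx
    refine ⟨?_, Set.mem_univ _⟩
    rw [Set.mem_singleton_iff.1 hx.1]
    constructor <;> nlinarith
  have cr : ∀ u v : ℝ, Convex ℝ (({√2 * ε} : Set ℝ) ×ˢ Set.Icc u v) := fun u v => (convex_singleton _).prod (convex_Icc u v)
  have big : ∀ {u : ℝ}, |u| ≤ 1 / 8 → ε ≤ √2 * ε * Real.cos (2 * Real.pi * u) := by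
    intro u hu
    have := quarter hu
    nlinarith [mul_le_mul_of_nonneg_left this (by positivity : 0 ≤ √2 * ε)]
  have eR : Set.MapsTo e (({√2 * ε} : Set ℝ) ×ˢ Set.Icc (-(1 / 8)) (1 / 8)) (Set.Icc ε b ×ˢ Set.Icc c d) := by
    intro x hx
    have hb' := bd x (ring' hx).1
    refine ⟨⟨?_, hb'.1.2⟩, hb'.2⟩
    simp only [e]
    rw [Set.mem_singleton_iff.1 hx.1]
    exact big (abs_le.2 hx.2)
  have eT : Set.MapsTo e (({√2 * ε} : Set ℝ) ×ˢ Set.Icc (1 / 8) (3 / 8)) (Set.Icc a b ×ˢ Set.Icc ε d) := by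
    intro x hx
    have hb' := bd x (ring' hx).1
    refine ⟨hb'.1, ?_, hb'.2.2⟩
    simp only [e]
    rw [Set.mem_singleton_iff.1 hx.1]
    have := big (u := x.2 - 1 / 4) (abs_le.2 ⟨by linarith [hx.2.1], by linarith [hx.2.2]⟩)
    rwa [show 2 * Real.pi * (x.2 - 1 / 4) = 2 * Real.pi * x.2 - Real.pi / 2 by ring, Real.cos_sub_pi_div_two] at this
  have eL : Set.MapsTo e (({√2 * ε} : Set ℝ) ×ˢ Set.Icc (3 / 8) (5 / 8)) (Set.Icc a (-ε) ×ˢ Set.Icc c d) := by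
    intro x hx
    have hb' := bd x (ring' hx).1
    refine ⟨⟨hb'.1.1, ?_⟩, hb'.2⟩
    simp only [e]
    rw [Set.mem_singleton_iff.1 hx.1]
    have := big (u := x.2 - 1 / 2) (abs_le.2 ⟨by linarith [hx.2.1], by linarith [hx.2.2]⟩)
    rw [show 2 * Real.pi * (x.2 - 1 / 2) = 2 * Real.pi * x.2 - Real.pi by ring, Real.cos_sub_pi] at this
    linarith
  have eB : Set.MapsTo e (({√2 * ε} : Set ℝ) ×ˢ Set.Icc (5 / 8) (7 / 8)) (Set.Icc a b ×ˢ Set.Icc c (-ε)) := by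
    intro x hx
    have hb' := bd x (ring' hx).1
    refine ⟨hb'.1, hb'.2.1, ?_⟩
    simp only [e]
    rw [Set.mem_singleton_iff.1 hx.1]
    have := big (u := x.2 - 3 / 4) (abs_le.2 ⟨by linarith [hx.2.1], by linarith [hx.2.2]⟩)
    rw [show 2 * Real.pi * (x.2 - 3 / 4) = 2 * Real.pi * x.2 - Real.pi / 2 - Real.pi by ring, Real.cos_sub_pi, Real.cos_sub_pi_div_two] at this
    linarith
  have eR' : Set.MapsTo e (({√2 * ε} : Set ℝ) ×ˢ Set.Icc (7 / 8) 1) (Set.Icc ε b ×ˢ Set.Icc c d) := by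
    intro x hx
    have hb' := bd x (ring' hx).1
    refine ⟨⟨?_, hb'.1.2⟩, hb'.2⟩
    simp only [e]
    rw [Set.mem_singleton_iff.1 hx.1]
    have := big (u := x.2 - 1) (abs_le.2 ⟨by linarith [hx.2.1], by linarith [hx.2.2]⟩)
    rwa [show 2 * Real.pi * (x.2 - 1) = 2 * Real.pi * x.2 - 2 * Real.pi by ring, Real.cos_sub_two_pi] at this
  have per : ∀ r, e (r, 1) = (r, 0) := fun r => by simp [e]
  have per0 : ∀ r, e (r, 0) = (r, 0) := fun r => by simp [e]
  have seg : ∀ u : ℝ, u = 0 ∨ u = 1 → Set.MapsTo e (Set.Icc ε (2 * ε) ×ˢ {u}) (Set.Icc ε b ×ˢ Set.Icc c d) := by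
    rintro u hu ⟨r, v⟩ ⟨hr, hv⟩
    obtain rfl : v = u := hv
    have : e (r, v) = (r, 0) := by
      rcases hu with rfl | rfl
      · exact per0 r
      · exact per r
    rw [this]
    exact ⟨⟨hr.1, hr.2.trans hb⟩, by simp only; linarith, by simp only; linarith⟩
  -- The meridian is replaced by a radial segment outwards, one turn at radius `√2 * ε`, and the
  -- radial segment back. The turn begins and ends in the middle of the right quarter, which is
  -- therefore split in two.
  have a0 := arc hR ((convex_Icc ε (2 * ε)).prod (convex_singleton (0 : ℝ))) (seg 0 (Or.inl rfl)) (Set.prod_mono subset_rfl (Set.subset_univ _))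
    (x := (ε, 0)) ⟨⟨le_rfl, by linarith⟩, rfl⟩ (y := (√2 * ε, 0)) ⟨⟨by nlinarith, by nlinarith⟩, rfl⟩
  have a1 := arc hR (cr _ _) eR ring' (x := (√2 * ε, 0)) ⟨rfl, by norm_num⟩ (y := (√2 * ε, 1 / 8)) ⟨rfl, by norm_num⟩
  have a2 := arc hT (cr _ _) eT ring' (x := (√2 * ε, 1 / 8)) ⟨rfl, by norm_num⟩ (y := (√2 * ε, 3 / 8)) ⟨rfl, by norm_num⟩
  have a3 := arc hL (cr _ _) eL ring' (x := (√2 * ε, 3 / 8)) ⟨rfl, by norm_num⟩ (y := (√2 * ε, 5 / 8)) ⟨rfl, by norm_num⟩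
  have a4 := arc hB (cr _ _) eB ring' (x := (√2 * ε, 5 / 8)) ⟨rfl, by norm_num⟩ (y := (√2 * ε, 7 / 8)) ⟨rfl, by norm_num⟩
  have a5 := arc hR (cr _ _) eR' ring' (x := (√2 * ε, 7 / 8)) ⟨rfl, by norm_num⟩ (y := (√2 * ε, 1)) ⟨rfl, by norm_num⟩
  have a6 := arc hR ((convex_Icc ε (2 * ε)).prod (convex_singleton (1 : ℝ))) (seg 1 (Or.inr rfl)) (Set.prod_mono subset_rfl (Set.subset_univ _))
    (x := (√2 * ε, 1)) ⟨⟨by nlinarith, by nlinarith⟩, rfl⟩ (y := (ε, 1)) ⟨⟨le_rfl, by linarith⟩, rfl⟩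
  have j1 := iRT _ ⟨(eR (x := (√2 * ε, 1 / 8)) ⟨rfl, by norm_num⟩).1, (eT (x := (√2 * ε, 1 / 8)) ⟨rfl, by norm_num⟩).2⟩
  have j2 := iTL _ ⟨(eL (x := (√2 * ε, 3 / 8)) ⟨rfl, by norm_num⟩).1, (eT (x := (√2 * ε, 3 / 8)) ⟨rfl, by norm_num⟩).2⟩
  have j3 := iLB _ ⟨(eL (x := (√2 * ε, 5 / 8)) ⟨rfl, by norm_num⟩).1, (eB (x := (√2 * ε, 5 / 8)) ⟨rfl, by norm_num⟩).2⟩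
  have j4 := iBR _ ⟨(eR' (x := (√2 * ε, 7 / 8)) ⟨rfl, by norm_num⟩).1, (eB (x := (√2 * ε, 7 / 8)) ⟨rfl, by norm_num⟩).2⟩
  have tot := hg γ ⟨fun τ => (ε, (τ : ℝ)), by fun_prop⟩ (fun τ => ⟨⟨le_rfl, by simp only [ContinuousMap.coe_mk]; linarith⟩, Set.mem_univ _⟩) hγ
  simp only [ContinuousMap.coe_mk, Set.Icc.coe_zero, Set.Icc.coe_one] at tot
  have comb : g (ε, 1) * (g (ε, 0))⁻¹ = (g (ε, 1) * (g (√2 * ε, 1))⁻¹) * (g (√2 * ε, 1) * (g (√2 * ε, 7 / 8))⁻¹) *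
      (g (√2 * ε, 7 / 8) * (g (√2 * ε, 5 / 8))⁻¹) * (g (√2 * ε, 5 / 8) * (g (√2 * ε, 3 / 8))⁻¹) * (g (√2 * ε, 3 / 8) * (g (√2 * ε, 1 / 8))⁻¹) *
      (g (√2 * ε, 1 / 8) * (g (√2 * ε, 0))⁻¹) * (g (√2 * ε, 0) * (g (ε, 0))⁻¹) := by group
  rw [tot, comb, a0, a1, a2, a3, a4, a5, a6]
  rw [per, per, per0, per0, j1, j2, j3, j4]
  group

end Holonomy

end SurfaceProduct

namespace SurfaceProduct

theorem lineMap_mk (a b c d t : ℝ) : AffineMap.lineMap (a, b) (c, d) t = (AffineMap.lineMap a c t, AffineMap.lineMap b d t) := by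
  simp [AffineMap.lineMap_apply]

theorem lineMap_self (a t : ℝ) : AffineMap.lineMap a a t = a := by simp

namespace Holonomy

variable {Z H : Type} [TopologicalSpace Z] [Group H] {M : Set Z}

/-- In a rectangle with a hole, whose opposite sides are mapped to the same curves, the meridian of the hole is the
commutator of the sides, up to orientation. -/
theorem hol_meridian_eq (h : Holonomy Z M H) {Θ : ℝ × ℝ → Z} {ε r₀ r₁ q₀ q₁ : ℝ} (hε : 0 < ε)
    (hr : (r₀ ≤ -(2 * ε) ∧ 2 * ε ≤ r₁) ∨ (r₁ ≤ -(2 * ε) ∧ 2 * ε ≤ r₀))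
    (hq : (q₀ ≤ -(2 * ε) ∧ 2 * ε ≤ q₁) ∨ (q₁ ≤ -(2 * ε) ∧ 2 * ε ≤ q₀))
    (hΘ : ContinuousOn Θ {x | x ∈ Set.uIcc r₀ r₁ ×ˢ Set.uIcc q₀ q₁ ∧ ε ^ 2 ≤ x.1 ^ 2 + x.2 ^ 2})
    (hm : Set.MapsTo Θ {x | x ∈ Set.uIcc r₀ r₁ ×ˢ Set.uIcc q₀ q₁ ∧ ε ^ 2 ≤ x.1 ^ 2 + x.2 ^ 2} M)
    (pr : ∀ q, Θ (r₁, q) = Θ (r₀, q)) (pq : ∀ r, Θ (r, q₁) = Θ (r, q₀)) {α β α' β' μ : C(I, Z)}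
    (hα : ∀ τ : I, α τ = Θ (AffineMap.lineMap r₀ r₁ (τ : ℝ), q₀)) (hβ : ∀ τ : I, β τ = Θ (r₀, AffineMap.lineMap q₀ q₁ (τ : ℝ)))
    (hα' : ∀ τ : I, α' τ = Θ (AffineMap.lineMap r₀ ε (τ : ℝ), q₀)) (hβ' : ∀ τ : I, β' τ = Θ (ε, AffineMap.lineMap q₀ 0 (τ : ℝ)))
    (hμ : ∀ τ : I, μ τ = Θ (ε * Real.cos (2 * Real.pi * τ), ε * Real.sin (2 * Real.pi * τ))) :
    (0 < r₁ * q₁ → (h.hol β' * h.hol α')⁻¹ * h.hol μ * (h.hol β' * h.hol α') =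
      (h.hol β)⁻¹ * (h.hol α)⁻¹ * h.hol β * h.hol α) ∧
    (r₁ * q₁ < 0 → (h.hol β' * h.hol α')⁻¹ * h.hol μ * (h.hol β' * h.hol α') =
      ((h.hol β)⁻¹ * (h.hol α)⁻¹ * h.hol β * h.hol α)⁻¹) := by
  have cv : ∀ a b c d : ℝ, Convex ℝ (Set.Icc a b ×ˢ Set.Icc c d) := fun a b c d => (convex_Icc a b).prod (convex_Icc c d)
  have H1 : ∀ {f : ℝ × ℝ → H} {a b c d}, h.FlatAlong Θ f (Set.Icc a b ×ˢ Set.Icc c d) → ∀ {x y z w : ℝ}, x ∈ Set.Icc a b → y ∈ Set.Icc c d →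
      z ∈ Set.Icc a b → w ∈ Set.Icc c d → ∀ {γ : C(I, Z)}, (∀ τ : I, γ τ = Θ (AffineMap.lineMap x z (τ : ℝ), AffineMap.lineMap y w (τ : ℝ))) →
      h.hol γ = f (z, w) * (f (x, y))⁻¹ := by
    intro f a b c d hf x y z w h1 h2 h3 h4 γ hγ
    exact hf.hol_seg (cv _ _ _ _) (x := (x, y)) (y := (z, w)) ⟨h1, h2⟩ ⟨h3, h4⟩ fun τ => by rw [hγ, lineMap_mk]
  have hα₁ : ∀ τ : I, α τ = Θ (AffineMap.lineMap r₀ r₁ (τ : ℝ), AffineMap.lineMap q₀ q₀ (τ : ℝ)) := fun τ => by rw [hα, lineMap_self]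
  have hα₂ : ∀ τ : I, α τ = Θ (AffineMap.lineMap r₀ r₁ (τ : ℝ), AffineMap.lineMap q₁ q₁ (τ : ℝ)) := fun τ => by rw [hα, lineMap_self, pq]
  have hβ₁ : ∀ τ : I, β τ = Θ (AffineMap.lineMap r₀ r₀ (τ : ℝ), AffineMap.lineMap q₀ q₁ (τ : ℝ)) := fun τ => by rw [hβ, lineMap_self]
  have hβ₂ : ∀ τ : I, β τ = Θ (AffineMap.lineMap r₁ r₁ (τ : ℝ), AffineMap.lineMap q₀ q₁ (τ : ℝ)) := fun τ => by rw [hβ, lineMap_self, pr]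
  have hα₃ : ∀ τ : I, α' τ = Θ (AffineMap.lineMap r₀ ε (τ : ℝ), AffineMap.lineMap q₀ q₀ (τ : ℝ)) := fun τ => by rw [hα', lineMap_self]
  have hβ₃ : ∀ τ : I, β' τ = Θ (AffineMap.lineMap ε ε (τ : ℝ), AffineMap.lineMap q₀ 0 (τ : ℝ)) := fun τ => by rw [hβ', lineMap_self]
  -- Opposite sides have the same image, so each of the two curves can be evaluated along either
  -- side. In the commutator the two occurrences of a letter are evaluated along opposite sides,
  -- which describes the boundary of the rectangle.
  have comb : ∀ {a b a' b' : H}, a = a' → b = b' → b⁻¹ * a⁻¹ * b * a = b'⁻¹ * a⁻¹ * b * a' := by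
    rintro a b _ _ rfl rfl
    rfl
  -- The cases record the corner from which the boundary is traversed. The traversal is
  -- counterclockwise exactly when `r₁` and `q₁` have the same sign.
  rcases hr with ⟨hr0, hr1⟩ | ⟨hr1, hr0⟩ <;> rcases hq with ⟨hq0, hq1⟩ | ⟨hq1, hq0⟩
  · rw [Set.uIcc_of_le (by linarith), Set.uIcc_of_le (by linarith)] at hΘ hm
    obtain ⟨fB, fR, fT, fL, m, hB, hR, hT, hL, jBR, jRT, jTL, jLB, hmer⟩ := h.exists_hole_potentials hε hr0 hr1 hq0 hq1 hΘ hm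
    refine ⟨fun _ => ?_, fun hneg => by nlinarith⟩
    rw [comb (H1 hB (by constructor <;> linarith) (by constructor <;> linarith) (by constructor <;> linarith) (by constructor <;> linarith) hα₁)
      (H1 hL (by constructor <;> linarith) (by constructor <;> linarith) (by constructor <;> linarith) (by constructor <;> linarith) hβ₁),
      H1 hT (by constructor <;> linarith) (by constructor <;> linarith) (by constructor <;> linarith) (by constructor <;> linarith) hα₂,
      H1 hR (by constructor <;> linarith) (by constructor <;> linarith) (by constructor <;> linarith) (by constructor <;> linarith) hβ₂,
      H1 hB (by constructor <;> linarith) (by constructor <;> linarith) (by constructor <;> linarith) (by constructor <;> linarith) hα₃,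
      H1 hR (by constructor <;> linarith) (by constructor <;> linarith) (by constructor <;> linarith) (by constructor <;> linarith) hβ₃,
      hmer μ hμ, jLB (r₀, q₀) ⟨by constructor <;> linarith, by constructor <;> linarith⟩, jBR (r₁, q₀) ⟨by constructor <;> linarith, by constructor <;> linarith⟩,
      jBR (ε, q₀) ⟨by constructor <;> linarith, by constructor <;> linarith⟩,
      jRT (r₁, q₁) ⟨by constructor <;> linarith, by constructor <;> linarith⟩, jTL (r₀, q₁) ⟨by constructor <;> linarith, by constructor <;> linarith⟩]
    group
  · rw [Set.uIcc_of_le (by linarith), Set.uIcc_of_ge (by linarith)] at hΘ hm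
    obtain ⟨fB, fR, fT, fL, m, hB, hR, hT, hL, jBR, jRT, jTL, jLB, hmer⟩ := h.exists_hole_potentials hε hr0 hr1 hq1 hq0 hΘ hm
    refine ⟨fun hpos => by nlinarith, fun _ => ?_⟩
    rw [comb (H1 hT (by constructor <;> linarith) (by constructor <;> linarith) (by constructor <;> linarith) (by constructor <;> linarith) hα₁)
      (H1 hL (by constructor <;> linarith) (by constructor <;> linarith) (by constructor <;> linarith) (by constructor <;> linarith) hβ₁),
      H1 hB (by constructor <;> linarith) (by constructor <;> linarith) (by constructor <;> linarith) (by constructor <;> linarith) hα₂,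
      H1 hR (by constructor <;> linarith) (by constructor <;> linarith) (by constructor <;> linarith) (by constructor <;> linarith) hβ₂,
      H1 hT (by constructor <;> linarith) (by constructor <;> linarith) (by constructor <;> linarith) (by constructor <;> linarith) hα₃,
      H1 hR (by constructor <;> linarith) (by constructor <;> linarith) (by constructor <;> linarith) (by constructor <;> linarith) hβ₃,
      hmer μ hμ, jLB (r₀, q₁) ⟨by constructor <;> linarith, by constructor <;> linarith⟩, jBR (r₁, q₁) ⟨by constructor <;> linarith, by constructor <;> linarith⟩,
      jRT (ε, q₀) ⟨by constructor <;> linarith, by constructor <;> linarith⟩,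
      jRT (r₁, q₀) ⟨by constructor <;> linarith, by constructor <;> linarith⟩, jTL (r₀, q₀) ⟨by constructor <;> linarith, by constructor <;> linarith⟩]
    group
  · rw [Set.uIcc_of_ge (by linarith), Set.uIcc_of_le (by linarith)] at hΘ hm
    obtain ⟨fB, fR, fT, fL, m, hB, hR, hT, hL, jBR, jRT, jTL, jLB, hmer⟩ := h.exists_hole_potentials hε hr1 hr0 hq0 hq1 hΘ hm
    refine ⟨fun hpos => by nlinarith, fun _ => ?_⟩
    rw [comb (H1 hB (by constructor <;> linarith) (by constructor <;> linarith) (by constructor <;> linarith) (by constructor <;> linarith) hα₁)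
      (H1 hR (by constructor <;> linarith) (by constructor <;> linarith) (by constructor <;> linarith) (by constructor <;> linarith) hβ₁),
      H1 hT (by constructor <;> linarith) (by constructor <;> linarith) (by constructor <;> linarith) (by constructor <;> linarith) hα₂,
      H1 hL (by constructor <;> linarith) (by constructor <;> linarith) (by constructor <;> linarith) (by constructor <;> linarith) hβ₂,
      H1 hB (by constructor <;> linarith) (by constructor <;> linarith) (by constructor <;> linarith) (by constructor <;> linarith) hα₃,
      H1 hR (by constructor <;> linarith) (by constructor <;> linarith) (by constructor <;> linarith) (by constructor <;> linarith) hβ₃,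
      hmer μ hμ, jLB (r₁, q₀) ⟨by constructor <;> linarith, by constructor <;> linarith⟩, jBR (r₀, q₀) ⟨by constructor <;> linarith, by constructor <;> linarith⟩,
      jBR (ε, q₀) ⟨by constructor <;> linarith, by constructor <;> linarith⟩,
      jRT (r₀, q₁) ⟨by constructor <;> linarith, by constructor <;> linarith⟩, jTL (r₁, q₁) ⟨by constructor <;> linarith, by constructor <;> linarith⟩]
    group
  · rw [Set.uIcc_of_ge (by linarith), Set.uIcc_of_ge (by linarith)] at hΘ hm
    obtain ⟨fB, fR, fT, fL, m, hB, hR, hT, hL, jBR, jRT, jTL, jLB, hmer⟩ := h.exists_hole_potentials hε hr1 hr0 hq1 hq0 hΘ hm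
    refine ⟨fun _ => ?_, fun hneg => by nlinarith⟩
    rw [comb (H1 hT (by constructor <;> linarith) (by constructor <;> linarith) (by constructor <;> linarith) (by constructor <;> linarith) hα₁)
      (H1 hR (by constructor <;> linarith) (by constructor <;> linarith) (by constructor <;> linarith) (by constructor <;> linarith) hβ₁),
      H1 hB (by constructor <;> linarith) (by constructor <;> linarith) (by constructor <;> linarith) (by constructor <;> linarith) hα₂,
      H1 hL (by constructor <;> linarith) (by constructor <;> linarith) (by constructor <;> linarith) (by constructor <;> linarith) hβ₂,
      H1 hT (by constructor <;> linarith) (by constructor <;> linarith) (by constructor <;> linarith) (by constructor <;> linarith) hα₃,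
      H1 hR (by constructor <;> linarith) (by constructor <;> linarith) (by constructor <;> linarith) (by constructor <;> linarith) hβ₃,
      hmer μ hμ, jLB (r₁, q₁) ⟨by constructor <;> linarith, by constructor <;> linarith⟩, jBR (r₀, q₁) ⟨by constructor <;> linarith, by constructor <;> linarith⟩,
      jRT (ε, q₀) ⟨by constructor <;> linarith, by constructor <;> linarith⟩,
      jRT (r₀, q₀) ⟨by constructor <;> linarith, by constructor <;> linarith⟩, jTL (r₁, q₀) ⟨by constructor <;> linarith, by constructor <;> linarith⟩]
    group

end Holonomy

end SurfaceProduct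

namespace SurfaceProduct

/-! ### Periodic annular coordinates -/

variable {k m : ℕ}

theorem hChart_add_one (i : ZMod k) (s t : ℝ) : hChart i (s + 1, t) = hChart i (s, t) := by
  simp only [hChart, Int.fract_add_one]

theorem vChart_add_one (i : ZMod k) (s t : ℝ) : vChart i (s, t + 1) = vChart i (s, t) := by
  simp only [vChart, Int.fract_add_one]

theorem exists_lift_pt {c : Surface k → AddCircle (1 : ℝ)} (hc : Continuous c) :
    ∃ y : Surface k → ℝ, ContinuousOn y {Q | c Q ≠ 0} ∧ (∀ Q, (y Q : AddCircle (1 : ℝ)) = c Q) ∧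
      ∀ Q, ∀ x ∈ Set.Ioo (0 : ℝ) 1, (x : AddCircle (1 : ℝ)) = c Q → y Q = x := by
  obtain ⟨y, yc, yJ, yl⟩ := exists_lift_Ioo hc 0
  have e : ((0 : ℝ) : AddCircle (1 : ℝ)) = 0 := rfl
  rw [e] at yc yJ
  refine ⟨y, yc, yl, fun Q x hx hQ => ?_⟩
  have hne : c Q ≠ 0 := by
    rw [← hQ]
    exact ne_coe_of_mem_Ioo (a := 0) (by rwa [zero_add])
  have hy := yJ Q hne
  have := (yl Q).trans hQ.symm
  rwa [circle_eq_iff, Int.fract_eq_self.2 ⟨hy.1.le, by linarith [hy.2]⟩, Int.fract_eq_self.2 ⟨hx.1.le, hx.2⟩] at this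

namespace Curve

/-- Annular coordinates, periodic in the angular coordinate. -/
noncomputable def chart : Curve k → ℝ × ℝ → Surface k
  | horiz i c _, x => hChart i (x.1, c + x.2)
  | vert i c _, x => vChart i (c - x.2, x.1)

/-- The angular coordinate. -/
noncomputable def angle : Curve k → Surface k → AddCircle (1 : ℝ)
  | horiz _ _ _ => hCoord
  | vert _ _ _ => vCoord

@[fun_prop]
theorem continuous_chart (C : Curve k) : Continuous C.chart := by
  cases C <;> (unfold chart; fun_prop)

@[fun_prop]
theorem continuous_angle (C : Curve k) : Continuous C.angle := by
  cases C <;> (unfold angle; fun_prop)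

theorem chart_add_one (C : Curve k) (θ r : ℝ) : C.chart (θ + 1, r) = C.chart (θ, r) := by
  cases C
  · exact hChart_add_one _ _ _
  · exact vChart_add_one _ _ _

theorem angle_chart (C : Curve k) (θ r : ℝ) : C.angle (C.chart (θ, r)) = θ := by
  cases C
  · simp only [angle, chart, hChart]
    rw [hCoord_pt _ ⟨Int.fract_nonneg _, (Int.fract_lt_one _).le⟩, circle_eq_iff, Int.fract_fract]
  · simp only [angle, chart, vChart]
    rw [vCoord_pt _ ⟨Int.fract_nonneg _, (Int.fract_lt_one _).le⟩, circle_eq_iff, Int.fract_fract]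

theorem chart_congr (C : Curve k) {θ θ' : ℝ} (h : (θ : AddCircle (1 : ℝ)) = θ') (r : ℝ) : C.chart (θ, r) = C.chart (θ', r) := by
  rw [circle_eq_iff] at h
  cases C
  · simp only [chart, hChart, h]
  · simp only [chart, vChart, h]

theorem chart_eq_point (C : Curve k) {θ r : ℝ} (hθ : θ ∈ I) (hr : |r| ≤ 1 / 16) : C.chart (θ, r) = C.point θ r := by
  rw [abs_le] at hr
  cases C with
  | horiz i c h => exact pt_fract_left i hθ.1 hθ.2
  | vert i c h =>
    have := h.1
    simp only [chart, vChart, point, coord, sheet]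
    rw [max_eq_left (by linarith), pt_fract_right i (by linarith) hθ.1 hθ.2]

theorem exists_angle (C : Curve k) (θ r : ℝ) (hr : |r| ≤ 1 / 16) : ∃ θ' ∈ I, C.chart (θ, r) = C.point θ' r :=
  ⟨Int.fract θ, ⟨Int.fract_nonneg _, (Int.fract_lt_one _).le⟩, by
    rw [← C.chart_eq_point ⟨Int.fract_nonneg _, (Int.fract_lt_one _).le⟩ hr]
    exact C.chart_congr (by rw [circle_eq_iff, Int.fract_fract]) r⟩

theorem dist_chart (C : Curve k) (θ : ℝ) {r : ℝ} (hr : |r| ≤ 1 / 16) : C.dist (C.chart (θ, r)) = |r| := by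
  obtain ⟨θ', h, e⟩ := C.exists_angle θ r hr
  rw [e, C.dist_point h hr]

/-- The signed distance near the curve. `Curve.dist` forgets the side, and the sign is needed to see
a point of the tube boundary as a point of a circle. -/
theorem exists_radius (C : Curve k) : ∃ ρ : Surface k → ℝ, ContinuousOn ρ {Q | C.dist Q < 1 / 16} ∧
    (∀ θ r, |r| < 1 / 16 → ρ (C.chart (θ, r)) = r) ∧
    ∀ Q, C.dist Q < 1 / 16 → |ρ Q| = C.dist Q ∧ ∀ θ : ℝ, (θ : AddCircle (1 : ℝ)) = C.angle Q → C.chart (θ, ρ Q) = Q := by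
  have main : ∀ ρ : Surface k → ℝ, (∀ θ r, |r| < 1 / 16 → ρ (C.chart (θ, r)) = r) →
      ∀ Q, C.dist Q < 1 / 16 → |ρ Q| = C.dist Q ∧ ∀ θ : ℝ, (θ : AddCircle (1 : ℝ)) = C.angle Q → C.chart (θ, ρ Q) = Q := by
    intro ρ hρ Q hQ
    obtain ⟨θ, hθ, r, hr, rfl⟩ := C.exists_point hQ
    have hr' : |r| < 1 / 16 := hr ▸ hQ
    rw [← C.chart_eq_point hθ hr'.le, hρ _ _ hr', C.dist_chart _ hr'.le]
    refine ⟨rfl, fun θ' h => ?_⟩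
    rw [C.angle_chart] at h
    exact C.chart_congr h r
  have near : ∀ Q, C.dist Q < 1 / 16 → ∃ θ r, |r| < 1 / 16 ∧ Q = C.chart (θ, r) := by
    intro Q hQ
    obtain ⟨θ, hθ, r, hr, rfl⟩ := C.exists_point hQ
    have hr' : |r| < 1 / 16 := hr ▸ hQ
    exact ⟨θ, r, hr', (C.chart_eq_point hθ hr'.le).symm⟩
  cases C with
  | horiz i c h =>
    obtain ⟨y, yc, yl, yu⟩ := exists_lift_pt (continuous_vCoord (k := k))
    have key : ∀ θ r, |r| < 1 / 16 → c + r ∈ Set.Ioo (0 : ℝ) 1 ∧ ((c + r : ℝ) : AddCircle (1 : ℝ)) = vCoord ((horiz i c h).chart (θ, r)) := by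
      intro θ r hr
      rw [abs_lt] at hr
      have h1 : c + r ∈ Set.Ioo (0 : ℝ) 1 := ⟨by linarith [h.1], by linarith [h.2]⟩
      refine ⟨h1, ?_⟩
      simp only [chart, hChart]
      rw [vCoord_pt _ ⟨h1.1.le, h1.2.le⟩]
    have hρ : ∀ θ r, |r| < 1 / 16 → y ((horiz i c h).chart (θ, r)) - c = r := fun θ r hr => by
      rw [yu _ _ (key θ r hr).1 (key θ r hr).2]; ring
    refine ⟨fun Q => y Q - c, (yc.mono fun Q hQ => ?_).sub continuousOn_const, hρ, main _ hρ⟩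
    obtain ⟨θ, r, hr, rfl⟩ := near Q hQ
    rw [Set.mem_ofPred_eq, ← (key θ r hr).2]
    exact ne_coe_of_mem_Ioo (a := 0) (by rw [zero_add]; exact (key θ r hr).1)
  | vert i c h =>
    obtain ⟨y, yc, yl, yu⟩ := exists_lift_pt (continuous_hCoord (k := k))
    have key : ∀ θ r, |r| < 1 / 16 → c - r ∈ Set.Ioo (0 : ℝ) 1 ∧ ((c - r : ℝ) : AddCircle (1 : ℝ)) = hCoord ((vert i c h).chart (θ, r)) := by
      intro θ r hr
      rw [abs_lt] at hr
      have h1 : c - r ∈ Set.Ioo (0 : ℝ) 1 := ⟨by linarith [h.1], by linarith [h.2]⟩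
      refine ⟨h1, ?_⟩
      have := h.1
      simp only [chart, vChart]
      rw [max_eq_left (by linarith), hCoord_pt _ ⟨h1.1.le, h1.2.le⟩]
    have hρ : ∀ θ r, |r| < 1 / 16 → c - y ((vert i c h).chart (θ, r)) = r := fun θ r hr => by
      rw [yu _ _ (key θ r hr).1 (key θ r hr).2]; ring
    refine ⟨fun Q => c - y Q, continuousOn_const.sub (yc.mono fun Q hQ => ?_), hρ, main _ hρ⟩
    obtain ⟨θ, r, hr, rfl⟩ := near Q hQ
    rw [Set.mem_ofPred_eq, ← (key θ r hr).2]
    exact ne_coe_of_mem_Ioo (a := 0) (by rw [zero_add]; exact (key θ r hr).1)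

end Curve

theorem chart_mem_tube (C : Curve k) (C' : Curve m) {ε : ℝ} (hε' : ε < 1 / 16) (hε : 0 < ε) (θ φ : ℝ) {r q : ℝ} (h : r ^ 2 + q ^ 2 = ε ^ 2) :
    (C.chart (θ, r), C'.chart (φ, q)) ∈ tube C C' {ε ^ 2} := by
  obtain ⟨θ', h1, e1⟩ := C.exists_angle θ r ((abs_le_of_sq_le_sq (by nlinarith [sq_nonneg q]) hε.le).trans hε'.le)
  obtain ⟨φ', h2, e2⟩ := C'.exists_angle φ q ((abs_le_of_sq_le_sq (by nlinarith [sq_nonneg r]) hε.le).trans hε'.le)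
  exact ⟨θ', h1, φ', h2, r, q, h, by rw [e1, e2]⟩

/-- The universal covering of the boundary of the tubular neighbourhood. -/
noncomputable def tubeChart (C : Curve k) (C' : Curve m) (ε : ℝ) (x : ℝ × ℝ × ℝ) : Surface k × Surface m :=
  (C.chart (x.1, ε * Real.cos (2 * Real.pi * x.2.2)), C'.chart (x.2.1, ε * Real.sin (2 * Real.pi * x.2.2)))

@[fun_prop]
theorem continuous_tubeChart (C : Curve k) (C' : Curve m) (ε : ℝ) : Continuous (tubeChart C C' ε) := by
  unfold tubeChart; fun_prop

theorem tubeChart_mem (C : Curve k) (C' : Curve m) {ε : ℝ} (hε : 0 < ε) (hε' : ε < 1 / 16) (x : ℝ × ℝ × ℝ) :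
    tubeChart C C' ε x ∈ tube C C' {ε ^ 2} :=
  chart_mem_tube C C' hε' hε _ _ (by linear_combination ε ^ 2 * Real.cos_sq_add_sin_sq (2 * Real.pi * x.2.2))

theorem tubeChart_add (C : Curve k) (C' : Curve m) (ε : ℝ) (x : ℝ × ℝ × ℝ) :
    tubeChart C C' ε (x + (1, 0, 0)) = tubeChart C C' ε x ∧ tubeChart C C' ε (x + (0, 1, 0)) = tubeChart C C' ε x ∧
      tubeChart C C' ε (x + (0, 0, 1)) = tubeChart C C' ε x := by
  obtain ⟨θ, φ, ψ⟩ := x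
  simp only [tubeChart, Prod.mk_add_mk, add_zero, C.chart_add_one, C'.chart_add_one, mul_add, mul_one, Real.cos_add_two_pi,
    Real.sin_add_two_pi, and_self]

/-- The translated potential, divided by its value at `0`, is again a potential with value `1` at
`0`. By uniqueness it is the original one. -/
theorem Holonomy.FlatAlong.add_period {Z H E : Type} [TopologicalSpace Z] [Group H] {M : Set Z} {h : Holonomy Z M H}
    [NormedAddCommGroup E] [NormedSpace ℝ E] {Θ : E → Z} {f : E → H} (hf : h.FlatAlong Θ f Set.univ) (hc : Continuous Θ)
    (h0 : f 0 = 1) {e : E} (he : ∀ x, Θ (x + e) = Θ x) (x : E) : f (x + e) = f x * f e := by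
  have h1 : h.FlatAlong Θ (fun x => f (x + e) * (f e)⁻¹) Set.univ := by
    have := (hf.comp (e := fun x => x + e) (by fun_prop) (Set.mapsTo_univ _ Set.univ)).mul_right (f e)⁻¹
    rwa [show Θ ∘ (fun x => x + e) = Θ from funext he] at this
  have := h1.eqOn hf hc.continuousOn convex_univ (Set.mem_univ 0) (by rw [zero_add, h0, mul_inv_cancel]) x (Set.mem_univ x)
  rw [← this]
  group

theorem Holonomy.exists_tube_potential {H : Type} [Group H] {M : Set (Surface k × Surface m)} (h : Holonomy (Surface k × Surface m) M H)
    (C : Curve k) (C' : Curve m) {ε : ℝ} (hε : 0 < ε) (hε' : ε < 1 / 16) (hM : tube C C' {ε ^ 2} ⊆ M) :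
    ∃ f : ℝ × ℝ × ℝ → H, h.FlatAlong (tubeChart C C' ε) f Set.univ ∧ f 0 = 1 ∧ (∀ x, f (x + (1, 0, 0)) = f x * f (1, 0, 0)) ∧
      (∀ x, f (x + (0, 1, 0)) = f x * f (0, 1, 0)) ∧ ∀ x, f (x + (0, 0, 1)) = f x * f (0, 0, 1) := by
  obtain ⟨f, hf⟩ := h.exists_flatAlong (continuous_tubeChart C C' ε).continuousOn
    (fun x _ => hM (tubeChart_mem C C' hε hε' x)) convex_univ (subset_refl Set.univ)
  have hf' := hf.mul_right (f 0)⁻¹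
  have hc := continuous_tubeChart C C' ε
  exact ⟨_, hf', mul_inv_cancel _, hf'.add_period hc (mul_inv_cancel _) fun x => (tubeChart_add C C' ε x).1,
    hf'.add_period hc (mul_inv_cancel _) fun x => (tubeChart_add C C' ε x).2.1,
    hf'.add_period hc (mul_inv_cancel _) fun x => (tubeChart_add C C' ε x).2.2⟩

theorem meridianPath_eq (C : Curve k) (C' : Curve m) {ε : ℝ} (hε : 0 < ε) (hε' : ε < 1 / 16) (τ : I) :
    meridianPath C C' ε τ = tubeChart C C' ε (0, 0, τ) := by
  have h1 : |ε * Real.cos (2 * Real.pi * τ)| ≤ 1 / 16 := by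
    rw [abs_mul, abs_of_pos hε]
    nlinarith [Real.abs_cos_le_one (2 * Real.pi * τ)]
  have h2 : |ε * Real.sin (2 * Real.pi * τ)| ≤ 1 / 16 := by
    rw [abs_mul, abs_of_pos hε]
    nlinarith [Real.abs_sin_le_one (2 * Real.pi * τ)]
  simp only [tubeChart]
  rw [C.chart_eq_point (by simp) h1, C'.chart_eq_point (by simp) h2]
  rfl

theorem pushPathF_eq (C : Curve k) (C' : Curve m) {ε : ℝ} (hε : 0 < ε) (hε' : ε < 1 / 16) (τ : I) :
    pushPathF C C' ε hε' τ = tubeChart C C' ε (τ, 0, 0) := by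
  simp only [tubeChart, mul_zero, Real.cos_zero, Real.sin_zero, mul_one]
  rw [C.chart_eq_point τ.2 (by rw [abs_of_pos hε]; exact hε'.le), C'.chart_eq_point (by simp) (by norm_num)]
  rfl

theorem pushPathG_eq (C : Curve k) (C' : Curve m) {ε : ℝ} (hε : 0 < ε) (hε' : ε < 1 / 16) (τ : I) :
    pushPathG C C' ε τ = tubeChart C C' ε (0, τ, 0) := by
  simp only [tubeChart, mul_zero, Real.cos_zero, Real.sin_zero, mul_one]
  rw [C.chart_eq_point (by simp) (by rw [abs_of_pos hε]; exact hε'.le), C'.chart_eq_point τ.2 (by norm_num)]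
  rfl

theorem bdBase_eq (C : Curve k) (C' : Curve m) {ε : ℝ} (hε : 0 < ε) (hε' : ε < 1 / 16) :
    bdBase C C' ε = tubeChart C C' ε 0 := by
  rw [show (0 : ℝ × ℝ × ℝ) = (0, 0, ((0 : I) : ℝ)) from rfl, ← meridianPath_eq C C' hε hε', Path.source]

theorem boundary_loops_mem (C : Curve k) (C' : Curve m) {ε : ℝ} (hε : 0 < ε) (hε' : ε < 1 / 16) (τ : I) :
    meridianPath C C' ε τ ∈ tube C C' {ε ^ 2} ∧ pushPathF C C' ε hε' τ ∈ tube C C' {ε ^ 2} ∧ pushPathG C C' ε τ ∈ tube C C' {ε ^ 2} := by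
  rw [meridianPath_eq C C' hε hε', pushPathF_eq C C' hε hε', pushPathG_eq C C' hε hε']
  exact ⟨tubeChart_mem C C' hε hε' _, tubeChart_mem C C' hε hε' _, tubeChart_mem C C' hε hε' _⟩

theorem Holonomy.hol_boundary_loops {H : Type} [Group H] {M : Set (Surface k × Surface m)} {h : Holonomy (Surface k × Surface m) M H}
    {C : Curve k} {C' : Curve m} {ε : ℝ} (hε : 0 < ε) (hε' : ε < 1 / 16) {f : ℝ × ℝ × ℝ → H}
    (hf : h.FlatAlong (tubeChart C C' ε) f Set.univ) (h0 : f 0 = 1) :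
    h.hol (meridianPath C C' ε).toContinuousMap = f (0, 0, 1) ∧ h.hol (pushPathF C C' ε hε').toContinuousMap = f (1, 0, 0) ∧
      h.hol (pushPathG C C' ε).toContinuousMap = f (0, 1, 0) := by
  have h0' : f (0, 0, 0) = 1 := h0
  refine ⟨?_, ?_, ?_⟩
  · rw [hf _ ⟨fun τ => (0, 0, (τ : ℝ)), by fun_prop⟩ (fun _ => Set.mem_univ _) (meridianPath_eq C C' hε hε')]
    simp [h0']
  · rw [hf _ ⟨fun τ => ((τ : ℝ), 0, 0), by fun_prop⟩ (fun _ => Set.mem_univ _) (pushPathF_eq C C' hε hε')]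
    simp [h0']
  · rw [hf _ ⟨fun τ => (0, (τ : ℝ), 0), by fun_prop⟩ (fun _ => Set.mem_univ _) (pushPathG_eq C C' hε hε')]
    simp [h0']

/-- The boundary is a product of three circles: the two angles and the direction of `(r, q)`. Each
coordinate is lifted through the covering by the line, and a closed loop changes it by an integer.
-/
theorem exists_tube_lift (C : Curve k) (C' : Curve m) {ε : ℝ} (hε : 0 < ε) (hε' : ε < 1 / 16) (γ : C(I, Surface k × Surface m))
    (hγ : ∀ τ, γ τ ∈ tube C C' {ε ^ 2}) (h0 : γ 0 = bdBase C C' ε) (h1 : γ 1 = bdBase C C' ε) :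
    ∃ p : C(I, ℝ × ℝ × ℝ), (∀ τ, γ τ = tubeChart C C' ε (p τ)) ∧ p 0 = 0 ∧ ∃ a b c : ℤ, p 1 = ((a : ℝ), (b : ℝ), (c : ℝ)) := by
  obtain ⟨ρ, ρc, ρu, hρ⟩ := C.exists_radius
  obtain ⟨ρ', ρc', ρu', hρ'⟩ := C'.exists_radius
  have hsq : ∀ τ, C.dist (γ τ).1 ^ 2 + C'.dist (γ τ).2 ^ 2 = ε ^ 2 := fun τ => (mem_tube_singleton hε hε' _).1 (hγ τ)
  have d1 : ∀ τ, C.dist (γ τ).1 < 1 / 16 := fun τ =>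
    (abs_le_of_sq_le_sq' (by nlinarith [hsq τ, sq_nonneg (C'.dist (γ τ).2)]) hε.le).2.trans_lt hε'
  have d2 : ∀ τ, C'.dist (γ τ).2 < 1 / 16 := fun τ =>
    (abs_le_of_sq_le_sq' (by nlinarith [hsq τ, sq_nonneg (C.dist (γ τ).1)]) hε.le).2.trans_lt hε'
  have rq : ∀ τ, ρ (γ τ).1 ^ 2 + ρ' (γ τ).2 ^ 2 = ε ^ 2 := fun τ => by
    rw [← sq_abs, (hρ _ (d1 τ)).1, ← sq_abs (ρ' _), (hρ' _ (d2 τ)).1, hsq]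
  have cρ : Continuous fun τ => ρ (γ τ).1 := ρc.comp_continuous (by fun_prop) d1
  have cρ' : Continuous fun τ => ρ' (γ τ).2 := ρc'.comp_continuous (by fun_prop) d2
  have hb : bdBase C C' ε = (C.chart (0, ε), C'.chart (0, 0)) := by
    rw [bdBase_eq C C' hε hε']
    simp [tubeChart]
  have b1 : ∀ τ, γ τ = bdBase C C' ε → C.angle (γ τ).1 = ((0 : ℝ) : AddCircle (1 : ℝ)) ∧ C'.angle (γ τ).2 = ((0 : ℝ) : AddCircle (1 : ℝ)) ∧
      ρ (γ τ).1 = ε ∧ ρ' (γ τ).2 = 0 := fun τ e => by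
    rw [e, hb]
    exact ⟨C.angle_chart _ _, C'.angle_chart _ _, ρu _ _ (by rwa [abs_of_pos hε]), ρu' _ _ (by norm_num)⟩
  let w : C(I, Circle) := ⟨fun τ => ⟨⟨ρ (γ τ).1 / ε, ρ' (γ τ).2 / ε⟩, by
    refine mem_sphere_zero_iff_norm.2 ?_
    rw [← sq_eq_sq₀ (norm_nonneg _) zero_le_one, Complex.sq_norm, Complex.normSq_mk]
    field_simp
    linarith [rq τ]⟩, by
    refine Continuous.subtype_mk ?_ _
    rw [show (fun τ => (⟨ρ (γ τ).1 / ε, ρ' (γ τ).2 / ε⟩ : ℂ)) = fun τ => Complex.equivRealProdCLM.symm (ρ (γ τ).1 / ε, ρ' (γ τ).2 / ε) from rfl]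
    exact Complex.equivRealProdCLM.symm.continuous.comp ((cρ.div_const ε).prodMk (cρ'.div_const ε))⟩
  have hw : ∀ τ, γ τ = bdBase C C' ε → w τ = Circle.exp 0 := fun τ e => by
    obtain ⟨-, -, e1, e2⟩ := b1 τ e
    ext1
    have : (w τ : ℂ) = ⟨ρ (γ τ).1 / ε, ρ' (γ τ).2 / ε⟩ := rfl
    rw [this, e1, e2, div_self hε.ne', zero_div, Circle.exp_zero]
    rfl
  obtain ⟨θ, hθ, hθ0⟩ := (AddCircle.isCoveringMap_coe (1 : ℝ)).exists_path_lifts ⟨fun τ => C.angle (γ τ).1, by fun_prop⟩ 0 (b1 0 h0).1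
  obtain ⟨φ, hφ, hφ0⟩ := (AddCircle.isCoveringMap_coe (1 : ℝ)).exists_path_lifts ⟨fun τ => C'.angle (γ τ).2, by fun_prop⟩ 0 (b1 0 h0).2.1
  obtain ⟨ψ, hψ, hψ0⟩ := Circle.isCoveringMap_exp.exists_path_lifts w 0 (hw 0 h0)
  have hθ' : ∀ τ, (θ τ : AddCircle (1 : ℝ)) = C.angle (γ τ).1 := congrFun hθ
  have hφ' : ∀ τ, (φ τ : AddCircle (1 : ℝ)) = C'.angle (γ τ).2 := congrFun hφ
  have hψ' : ∀ τ, Circle.exp (ψ τ) = w τ := congrFun hψ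
  have int : ∀ x : ℝ, (x : AddCircle (1 : ℝ)) = ((0 : ℝ) : AddCircle (1 : ℝ)) → ∃ n : ℤ, x = n := fun x hx => by
    rw [circle_eq_iff, Int.fract_eq_fract] at hx
    obtain ⟨n, hn⟩ := hx
    exact ⟨n, by linarith⟩
  obtain ⟨a, ha⟩ := int _ ((hθ' 1).trans (b1 1 h1).1)
  obtain ⟨b, hb⟩ := int _ ((hφ' 1).trans (b1 1 h1).2.1)
  obtain ⟨c, hc⟩ := Circle.exp_eq_exp.1 ((hψ' 1).trans (hw 1 h1))
  have hpi := Real.pi_pos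
  refine ⟨⟨fun τ => (θ τ, φ τ, ψ τ / (2 * Real.pi)), by fun_prop⟩, fun τ => ?_, by simp [hθ0, hφ0, hψ0], a, b, c, by
    simp only [ContinuousMap.coe_mk, ha, hb, hc]
    congr 2
    field_simp
    ring⟩
  have e1 : ε * Real.cos (ψ τ) = ρ (γ τ).1 := by
    have := congrArg (fun z : Circle => (z : ℂ).re) (hψ' τ)
    simp only [Circle.coe_exp, Complex.exp_ofReal_mul_I_re] at this
    rw [this]
    exact mul_div_cancel₀ _ hε.ne'
  have e2 : ε * Real.sin (ψ τ) = ρ' (γ τ).2 := by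
    have := congrArg (fun z : Circle => (z : ℂ).im) (hψ' τ)
    simp only [Circle.coe_exp, Complex.exp_ofReal_mul_I_im] at this
    rw [this]
    exact mul_div_cancel₀ _ hε.ne'
  simp only [ContinuousMap.coe_mk, tubeChart]
  rw [mul_div_cancel₀ _ (by positivity), e1, e2, (hρ _ (d1 τ)).2 _ (hθ' τ), (hρ' _ (d2 τ)).2 _ (hφ' τ)]

/-- The fundamental group of the boundary is generated by the meridian and the push-offs. -/
theorem closure_boundary (C : Curve k) (C' : Curve m) {ε : ℝ} (hε : 0 < ε) (hε' : ε < 1 / 16) :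
    Subgroup.closure {meridian C C' ε, pushF C C' ε hε', pushG C C' ε} = ⊤ := by
  obtain ⟨f, hf, h0, p1, p2, p3⟩ := (Holonomy.ofBase (tube C C' {ε ^ 2}) ⟨_, bdBase_mem C C' ε⟩).exists_tube_potential C C' hε hε' subset_rfl
  obtain ⟨e3, e1, e2⟩ := Holonomy.hol_boundary_loops hε hε' hf h0
  have hm := boundary_loops_mem C C' hε hε'
  rw [Holonomy.ofBase_loop _ _ fun τ => (hm τ).1] at e3
  rw [Holonomy.ofBase_loop _ _ fun τ => (hm τ).2.1] at e1
  rw [Holonomy.ofBase_loop _ _ fun τ => (hm τ).2.2] at e2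
  -- Equivariance under a unit translation gives powers, so the value at an integer point, which is
  -- the class of the loop, is a product of powers of the three boundary classes.
  have zp : ∀ {v : ℝ × ℝ × ℝ}, (∀ x, f (x + v) = f x * f v) → ∀ x (n : ℤ), f (x + n • v) = f x * f v ^ n := by
    intro v hv x n
    induction n using Int.induction_on with
    | zero => simp
    | succ n ih => rw [add_zsmul, one_zsmul, ← add_assoc, hv, ih, zpow_add_one, mul_assoc]
    | pred n ih =>
      have := hv (x + (-(n : ℤ) - 1) • v)
      rw [add_assoc, ← add_one_zsmul, sub_add_cancel, ih] at this
      rw [zpow_sub_one, ← mul_assoc, this, mul_inv_cancel_right]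
  rw [eq_top_iff]
  rintro g -
  obtain ⟨p, hp⟩ := Quotient.exists_rep (FundamentalGroup.toPath g)
  have eg : loopClass (bdBase_mem C C' ε) (p.map continuous_subtype_val) (fun τ => (p τ).2) = g := by
    exact (congrArg FundamentalGroup.fromPath hp : _)
  have eg' := Holonomy.ofBase_loop (bdBase_mem C C' ε) (p.map continuous_subtype_val) (fun τ => (p τ).2)
  rw [← eg, ← eg']
  obtain ⟨P, hP, P0, a, b, c, P1⟩ := exists_tube_lift C C' hε hε' (p.map continuous_subtype_val).toContinuousMap (fun τ => (p τ).2)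
    (by simp) (by simp)
  rw [hf _ P (fun _ => Set.mem_univ _) hP, P0, h0, inv_one, mul_one, P1]
  have : ((a : ℝ), (b : ℝ), (c : ℝ)) = (0 : ℝ × ℝ × ℝ) + a • ((1, 0, 0) : ℝ × ℝ × ℝ) + b • ((0, 1, 0) : ℝ × ℝ × ℝ) + c • ((0, 0, 1) : ℝ × ℝ × ℝ) := by
    simp
  rw [this, zp p3, zp p2, zp p1, h0, one_mul, ← e1, ← e2, ← e3]
  refine mul_mem (mul_mem ?_ ?_) ?_ <;> refine zpow_mem (Subgroup.subset_closure ?_) _ <;> simp [meridian, pushF, pushG]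

end SurfaceProduct

/-! ### Transport of boundary curves to the base point. -/

namespace SurfaceProduct

namespace Holonomy

variable {Z H : Type} [TopologicalSpace Z] [Group H] {M : Set Z} {h : Holonomy Z M H}

/-- There is a path in `M` from `x` to `y` with holonomy `g`. -/
def Reaches (h : Holonomy Z M H) (x y : Z) (g : H) : Prop :=
  ∃ p : Path x y, (∀ τ, p τ ∈ M) ∧ h.hol p.toContinuousMap = g

theorem Reaches.trans {x y w : Z} {g g' : H} (hg : h.Reaches x y g) (hg' : h.Reaches y w g') : h.Reaches x w (g' * g) := by
  obtain ⟨p, hp, rfl⟩ := hg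
  obtain ⟨q, hq, rfl⟩ := hg'
  refine ⟨p.trans q, fun τ => ?_, hol_trans p q hp hq⟩
  have : (p.trans q) τ ∈ Set.range (p.trans q) := ⟨τ, rfl⟩
  rw [Path.trans_range] at this
  rcases this with ⟨υ, hυ⟩ | ⟨υ, hυ⟩
  · exact hυ ▸ hp υ
  · exact hυ ▸ hq υ

theorem reaches_of_map {x y : Z} (γ : C(I, Z)) (hγ : ∀ τ, γ τ ∈ M) (h0 : γ 0 = x) (h1 : γ 1 = y) : h.Reaches x y (h.hol γ) := by
  subst h0 h1
  exact ⟨⟨γ, rfl, rfl⟩, hγ, rfl⟩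

/-- The line is simply connected, so two parametrizations of the same piece of a curve have the same
holonomy, and opposite ones inverse holonomy. -/
theorem hol_eq_of_lift {Θ : ℝ → Z} (hc : Continuous Θ) (hM : ∀ t, Θ t ∈ M) {γ γ' : C(I, Z)} {p p' : C(I, ℝ)}
    (hγ : ∀ τ, γ τ = Θ (p τ)) (hγ' : ∀ τ, γ' τ = Θ (p' τ)) :
    (p 0 = p' 0 → p 1 = p' 1 → h.hol γ = h.hol γ') ∧ (p 0 = p' 1 → p 1 = p' 0 → h.hol γ = (h.hol γ')⁻¹) := by
  obtain ⟨f, hf⟩ := h.exists_flatAlong hc.continuousOn (fun t _ => hM t) convex_univ (subset_refl Set.univ)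
  rw [hf γ p (fun _ => Set.mem_univ _) hγ, hf γ' p' (fun _ => Set.mem_univ _) hγ']
  exact ⟨fun h0 h1 => by rw [h0, h1], fun h0 h1 => by rw [h0, h1]; group⟩

end Holonomy

/-- The part of a curve from time `a` to time `b`. -/
noncomputable def run {X : Type} [TopologicalSpace X] (α : C(ℝ, X)) (a b : ℝ) : C(I, X) :=
  ⟨fun τ => α (AffineMap.lineMap a b (τ : ℝ)), α.continuous.comp (AffineMap.lineMap_continuous.comp continuous_subtype_val)⟩

section run

variable {X : Type} [TopologicalSpace X] (α : C(ℝ, X)) (a b : ℝ)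

@[simp] theorem run_zero : run α a b 0 = α a := by simp [run]

@[simp] theorem run_one : run α a b 1 = α b := by simp [run]

theorem run_mem {α : C(ℝ, X)} {a b : ℝ} {S : Set X} (hS : ∀ x ∈ Set.uIcc a b, α x ∈ S) (τ : I) : run α a b τ ∈ S :=
  hS _ (by rw [← segment_eq_uIcc, segment_eq_image_lineMap]; exact ⟨τ, τ.2, rfl⟩)

end run

variable {k m : ℕ}

/-- The parallel copy of a curve at distance `r`, run once from the angle `θ`. -/
noncomputable def Curve.circ (C : Curve k) (θ r : ℝ) : C(I, Surface k) :=
  ⟨fun τ => C.chart (θ + τ, r), by fun_prop⟩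

theorem Curve.circ_one (C : Curve k) (θ r : ℝ) : C.circ θ r 1 = C.circ θ r 0 := by
  simp [Curve.circ, C.chart_add_one]

namespace Holonomy

theorem hol_run {Z H : Type} [TopologicalSpace Z] [Group H] {M : Set Z} {h : Holonomy Z M H} {α : C(ℝ, Z)} {S : Set ℝ} (hS : Convex ℝ S) (hM : ∀ x ∈ S, α x ∈ M) :
    ∃ f : ℝ → H, ∀ a ∈ S, ∀ b ∈ S, h.hol (run α a b) = f b * (f a)⁻¹ := by
  obtain ⟨f, hf⟩ := h.exists_flatAlong α.continuous.continuousOn (fun x hx => hM x hx) hS subset_rfl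
  exact ⟨f, fun a ha b hb => hf.hol_seg hS ha hb fun τ => rfl⟩

/-- Sweeping a closed curve through an annulus. -/
theorem hol_annulus {Z H : Type} [TopologicalSpace Z] [Group H] {M : Set Z} {h : Holonomy Z M H} {Λ : ℝ × ℝ → Z} (hΛ : Continuous Λ)
    (hper : ∀ θ r, Λ (θ + 1, r) = Λ (θ, r)) {u v θ₀ : ℝ} (hM : ∀ θ, ∀ r ∈ Set.uIcc u v, Λ (θ, r) ∈ M) {cu cv w : C(I, Z)}
    (hu : ∀ τ : I, cu τ = Λ (θ₀ + τ, u)) (hv : ∀ τ : I, cv τ = Λ (θ₀ + τ, v)) (hw : ∀ τ : I, w τ = Λ (θ₀, AffineMap.lineMap u v (τ : ℝ))) :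
    (h.hol w)⁻¹ * h.hol cv * h.hol w = h.hol cu := by
  have cvx : Convex ℝ ((Set.univ : Set ℝ) ×ˢ Set.uIcc u v) := convex_univ.prod (convex_uIcc u v)
  obtain ⟨f, hf⟩ := h.exists_flatAlong (S := (Set.univ : Set ℝ) ×ˢ Set.uIcc u v) hΛ.continuousOn (fun x hx => hM x.1 x.2 hx.2) cvx subset_rfl
  -- Translation by a period multiplies the potential on the right by one constant on the whole
  -- strip, so all parallel circles have conjugate holonomy.
  have hper' : ∀ x ∈ (Set.univ : Set ℝ) ×ˢ Set.uIcc u v, f (x + (1, 0)) = f x * ((f (θ₀, u))⁻¹ * f (θ₀ + 1, u)) := by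
    intro x hx
    have h1 : h.FlatAlong Λ (fun x => f (x + (1, 0)) * ((f (θ₀, u))⁻¹ * f (θ₀ + 1, u))⁻¹) ((Set.univ : Set ℝ) ×ˢ Set.uIcc u v) := by
      have := (hf.comp (e := fun x => x + ((1, 0) : ℝ × ℝ)) (by fun_prop) (S' := (Set.univ : Set ℝ) ×ˢ Set.uIcc u v) (fun x hx => ⟨Set.mem_univ _, by simpa using hx.2⟩)).mul_right
        ((f (θ₀, u))⁻¹ * f (θ₀ + 1, u))⁻¹
      rwa [show Λ ∘ (fun x => x + ((1, 0) : ℝ × ℝ)) = Λ from funext fun x =>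
        (congrArg Λ (by ext <;> simp)).trans (hper x.1 x.2)] at this
    rw [← h1.eqOn hf hΛ.continuousOn cvx (x := (θ₀, u)) ⟨Set.mem_univ _, Set.left_mem_uIcc⟩ (by simp) x hx]
    group
  have hl : ∀ x ∈ Set.uIcc u v, ∀ γ : C(I, Z), (∀ τ : I, γ τ = Λ (θ₀ + τ, x)) → h.hol γ = f (θ₀, x) * ((f (θ₀, u))⁻¹ * f (θ₀ + 1, u)) * (f (θ₀, x))⁻¹ := by
    intro x hx γ hγ
    rw [hf γ ⟨fun τ => (θ₀ + τ, x), by fun_prop⟩ (fun τ => ⟨Set.mem_univ _, hx⟩) hγ, ← hper' (θ₀, x) ⟨Set.mem_univ _, hx⟩]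
    simp
  rw [hl u Set.left_mem_uIcc cu hu, hl v Set.right_mem_uIcc cv hv,
    hf.hol_seg cvx (x := (θ₀, u)) (y := (θ₀, v)) ⟨Set.mem_univ _, Set.left_mem_uIcc⟩ ⟨Set.mem_univ _, Set.right_mem_uIcc⟩ fun τ => by
      rw [hw, lineMap_mk, lineMap_self]]
  group

section Product

variable {F G H : Type} [TopologicalSpace F] [TopologicalSpace G] [Group H] {M : Set (F × G)} {h : Holonomy (F × G) M H}

theorem left_run_mul {α : C(ℝ, F)} {Q : G} (hM : ∀ x, (α x, Q) ∈ M) (a b c : ℝ) :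
    h.left (run α b c) Q * h.left (run α a b) Q = h.left (run α a c) Q := by
  obtain ⟨f, hf⟩ := hol_run (h := h) (α := α.prodMk (.const ℝ Q)) convex_univ fun x _ => hM x
  have e : ∀ a b, h.left (run α a b) Q = f b * (f a)⁻¹ := fun a b => hf a (Set.mem_univ _) b (Set.mem_univ _)
  rw [e, e, e]
  group

theorem right_run_mul {β : C(ℝ, G)} {P : F} {S : Set ℝ} (hS : Convex ℝ S) (hM : ∀ x ∈ S, (P, β x) ∈ M) {a b c : ℝ}
    (ha : a ∈ S) (hb : b ∈ S) (hc : c ∈ S) :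
    h.right P (run β b c) * h.right P (run β a b) = h.right P (run β a c) := by
  obtain ⟨f, hf⟩ := hol_run (h := h) (α := (ContinuousMap.const ℝ P).prodMk β) hS fun x hx => hM x hx
  have e : ∀ a ∈ S, ∀ b ∈ S, h.right P (run β a b) = f b * (f a)⁻¹ := fun a ha b hb => hf a ha b hb
  rw [e b hb c hc, e a ha b hb, e a ha c hc]
  group

/-- Transport of the holonomy of a closed curve. -/
theorem left_transport {α : C(I, F)} (hα : α 1 = α 0) {β : C(I, G)} (hM : ∀ τ υ, (α τ, β υ) ∈ M) :
    (h.right (α 0) β)⁻¹ * h.left α (β 1) * h.right (α 0) β = h.left α (β 0) := by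
  rw [mul_assoc, left_mul_right hM, hα, inv_mul_cancel_left]

theorem right_transport {α : C(I, F)} {β : C(I, G)} (hβ : β 1 = β 0) (hM : ∀ τ υ, (α τ, β υ) ∈ M) :
    (h.left α (β 0))⁻¹ * h.right (α 1) β * h.left α (β 0) = h.right (α 0) β := by
  rw [mul_assoc, ← left_mul_right hM, hβ, inv_mul_cancel_left]

end Product

end Holonomy

theorem boundaryCurves_of_reaches {C : Curve k} {C' : Curve m} {ε : ℝ} (hε : 0 < ε) (hε' : ε < 1 / 16) {M : Set (Surface k × Surface m)} {z : M}
    (hB : tube C C' {ε ^ 2} ⊆ M) {o : ℤˣ} {μ lF lG : FundamentalGroup M z} {D : FundamentalGroup M z}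
    (hD : (Holonomy.ofBase M z).Reaches z.1 (bdBase C C' ε) D)
    (hμ : (D⁻¹ * (Holonomy.ofBase M z).hol (meridianPath C C' ε).toContinuousMap * D) ^ (o : ℤ) = μ)
    (hF : D⁻¹ * (Holonomy.ofBase M z).hol (pushPathF C C' ε hε').toContinuousMap * D = lF)
    (hG : D⁻¹ * (Holonomy.ofBase M z).hol (pushPathG C C' ε).toContinuousMap * D = lG) :
    BoundaryCurves C C' ε hε' o μ lF lG := by
  obtain ⟨p, hp, rfl⟩ := hD
  let δ : Path z (Set.inclusion hB ⟨bdBase C C' ε, bdBase_mem C C' ε⟩) :=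
    ⟨⟨fun τ => ⟨p τ, hp τ⟩, by fun_prop⟩, Subtype.ext p.source, Subtype.ext p.target⟩
  have key : ∀ (γ : Path (bdBase C C' ε) (bdBase C C' ε)) (hγ : ∀ τ, γ τ ∈ tube C C' {ε ^ 2}),
      pushHom hB δ (loopClass (bdBase_mem C C' ε) γ hγ) = ((Holonomy.ofBase M z).hol p.toContinuousMap)⁻¹ *
        (Holonomy.ofBase M z).hol γ.toContinuousMap * (Holonomy.ofBase M z).hol p.toContinuousMap := fun γ hγ =>
    Holonomy.pushHom_eq hB (bdBase_mem C C' ε) δ γ hγ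
  have hm := boundary_loops_mem C C' hε hε'
  refine ⟨closure_boundary C C' hε hε', hB, δ, ?_, ?_, ?_⟩
  · rw [map_zpow, ← hμ]
    congr 1
    exact key _ fun τ => (hm τ).1
  · rw [← hF]
    exact key _ fun τ => (hm τ).2.1
  · rw [← hG]
    exact key _ fun τ => (hm τ).2.2

/-- The classes of the boundary curves, when the neighbourhood is reached through a product of a curve `α` across `C` and a curve `β`
across `C'`. -/
theorem boundaryCurves_of_sweep {C : Curve k} {C' : Curve m} {ε : ℝ} (hε : 0 < ε) (hε' : ε < 1 / 16) {M : Set (Surface k × Surface m)} {z : M}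
    (hB : tube C C' {ε ^ 2} ⊆ M) {α : C(ℝ, Surface k)} {β : C(ℝ, Surface m)} {θ₀ φ₀ r₀ r₁ r q₀ q₁ q : ℝ}
    (hr : (r₀ ≤ -(2 * ε) ∧ 2 * ε ≤ r₁) ∨ (r₁ ≤ -(2 * ε) ∧ 2 * ε ≤ r₀))
    (hq : (q₀ ≤ -(2 * ε) ∧ 2 * ε ≤ q₁) ∨ (q₁ ≤ -(2 * ε) ∧ 2 * ε ≤ q₀))
    (hm : ∀ x ∈ Set.uIcc r₀ r₁, ∀ y ∈ Set.uIcc q₀ q₁, ε ^ 2 ≤ x ^ 2 + y ^ 2 → (α x, β y) ∈ M)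
    (pα : α r₁ = α r₀) (pβ : β q₁ = β q₀) (hqm : q ∈ Set.uIcc q₀ q₁)
    (cα : ∀ x, |x| ≤ ε ∨ x ∈ Set.uIcc r ε → α x = C.chart (θ₀, x)) (cβ : ∀ y, |y| ≤ ε ∨ y ∈ Set.uIcc q 0 → β y = C'.chart (φ₀, y))
    (hF : ∀ P, (P, β q₀) ∈ M) (h1 : ∀ θ, ∀ y ∈ Set.uIcc q₀ 0, (C.chart (θ, ε), β y) ∈ M)
    (h2 : ∀ φ, ∀ y ∈ Set.uIcc q 0, (α ε, C'.chart (φ, y)) ∈ M) (h3 : ∀ φ, ∀ x ∈ Set.uIcc r₀ ε, (α x, C'.chart (φ, q)) ∈ M)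
    (h4 : ∀ x ∈ Set.uIcc r₀ ε, ∀ y ∈ Set.uIcc q₀ q, (α x, β y) ∈ M) {E : FundamentalGroup M z}
    (hE : (Holonomy.ofBase M z).Reaches z.1 (α r₀, β q₀) E) {o κ : ℤˣ} (hκ : 0 < ((o : ℤ) : ℝ) * ((κ : ℤ) : ℝ) * (r₁ * q₁))
    {A B A' B' LF LG : FundamentalGroup M z} (hA : (Holonomy.ofBase M z).left (run α r₀ r₁) (β q₀) = A)
    (hB' : (Holonomy.ofBase M z).right (α r₀) (run β q₀ q₁) = B) (hA'' : (Holonomy.ofBase M z).left (run α r₀ r) (β q₀) = A')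
    (hB'' : (Holonomy.ofBase M z).right (α r₀) (run β q₀ q) = B') (hLF : (Holonomy.ofBase M z).left (C.circ θ₀ r) (β q₀) = LF)
    (hLG : (Holonomy.ofBase M z).right (α r₀) (C'.circ φ₀ q) = LG) :
    BoundaryCurves C C' ε hε' o (E⁻¹ * (B⁻¹ * A⁻¹ * B * A) ^ (κ : ℤ) * E) (E⁻¹ * (A'⁻¹ * LF * A') * E) (E⁻¹ * (B'⁻¹ * LG * B') * E) := by
  subst hA hB' hA'' hB'' hLF hLG
  set h := Holonomy.ofBase M z
  obtain ⟨f, hf, f0, f1, f2, f3⟩ := h.exists_tube_potential C C' hε hε' hB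
  obtain ⟨em, eF, eG⟩ := Holonomy.hol_boundary_loops hε hε' hf f0
  have iε : ∀ x ∈ Set.uIcc r₀ ε, (α x, β q₀) ∈ M := fun x _ => hF _
  have mε : ε ∈ Set.uIcc r₀ r₁ := by
    rw [Set.mem_uIcc]
    rcases hr with h | h
    · exact Or.inl ⟨by linarith, by linarith⟩
    · exact Or.inr ⟨by linarith, by linarith⟩
  have m0 : (0 : ℝ) ∈ Set.uIcc q₀ q₁ := by
    rw [Set.mem_uIcc]
    rcases hq with h | h
    · exact Or.inl ⟨by linarith, by linarith⟩
    · exact Or.inr ⟨by linarith, by linarith⟩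
  have iβ : ∀ y ∈ Set.uIcc q₀ q₁, (α ε, β y) ∈ M := fun y hy => hm ε mε y hy (by nlinarith [sq_nonneg y])
  have sβ : Set.uIcc q₀ 0 ⊆ Set.uIcc q₀ q₁ := Set.uIcc_subset_uIcc Set.left_mem_uIcc m0
  set a := h.left (run α r₀ ε) (β q₀) with ha
  set b := h.right (α ε) (run β q₀ 0) with hb
  -- the path
  have ra : h.Reaches (α r₀, β q₀) (α ε, β q₀) a := Holonomy.reaches_of_map _ (fun τ => hF _) (by simp) (by simp)
  have rb : h.Reaches (α ε, β q₀) (α ε, β 0) b :=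
    Holonomy.reaches_of_map _ (fun τ => run_mem (S := {Q | (α ε, Q) ∈ M}) (fun y hy => iβ y (sβ hy)) τ) (by simp) (by simp)
  have hε0 : |ε| ≤ ε := (abs_of_pos hε).le
  have h00 : |(0 : ℝ)| ≤ ε := by rw [abs_zero]; exact hε.le
  -- The path arrives on the boundary at the angles `θ₀`, `φ₀`. This last piece runs inside the
  -- boundary to its base point, where both angles vanish.
  let c : C(I, Surface k × Surface m) := ⟨fun τ => tubeChart C C' ε (AffineMap.lineMap (θ₀, φ₀, 0) 0 (τ : ℝ)),
    (continuous_tubeChart C C' ε).comp (AffineMap.lineMap_continuous.comp continuous_subtype_val)⟩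
  have rc : h.Reaches (α ε, β 0) (bdBase C C' ε) (h.hol c) :=
    Holonomy.reaches_of_map _ (fun τ => hB (tubeChart_mem C C' hε hε' _)) (by simp [c, tubeChart, cα ε (Or.inl hε0), cβ 0 (Or.inl h00)])
      (by simp [c, bdBase_eq C C' hε hε'])
  have ec : h.hol c = (f (θ₀, φ₀, 0))⁻¹ := by
    rw [hf.hol_seg convex_univ (Set.mem_univ (θ₀, φ₀, 0)) (Set.mem_univ 0) fun τ => rfl, f0, one_mul]
  have hD := ((hE.trans ra).trans rb).trans rc
  rw [ec] at hD
  -- the loops over the point with angles θ₀, φ₀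
  have conj : ∀ {γ : C(I, Surface k × Surface m)} {v : ℝ × ℝ × ℝ}, (∀ x, f (x + v) = f x * f v) →
      (∀ τ : I, γ τ = tubeChart C C' ε ((θ₀, φ₀, 0) + (τ : ℝ) • v)) → h.hol γ = f (θ₀, φ₀, 0) * f v * (f (θ₀, φ₀, 0))⁻¹ := by
    intro γ v hv hγ
    rw [hf γ ⟨fun τ => (θ₀, φ₀, 0) + (τ : ℝ) • v, by fun_prop⟩ (fun _ => Set.mem_univ _) hγ]
    simp [hv]
  -- The meridian over `(θ₀, φ₀)`, seen as the boundary of the hole in the torus `α × β`.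
  let M' : C(I, Surface k × Surface m) := ⟨fun τ => (α (ε * Real.cos (2 * Real.pi * τ)), β (ε * Real.sin (2 * Real.pi * τ))), by fun_prop⟩
  have eM : h.hol M' = f (θ₀, φ₀, 0) * f (0, 0, 1) * (f (θ₀, φ₀, 0))⁻¹ := conj f3 fun τ => by
    have hcos : |ε * Real.cos (2 * Real.pi * τ)| ≤ ε := by
      rw [abs_mul, abs_of_pos hε]; nlinarith [Real.abs_cos_le_one (2 * Real.pi * τ)]
    have hsin : |ε * Real.sin (2 * Real.pi * τ)| ≤ ε := by
      rw [abs_mul, abs_of_pos hε]; nlinarith [Real.abs_sin_le_one (2 * Real.pi * τ)]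
    simp only [M', ContinuousMap.coe_mk, cα _ (Or.inl hcos), cβ _ (Or.inl hsin)]
    simp [tubeChart]
  have eF' : h.left (C.circ θ₀ ε) (β 0) = f (θ₀, φ₀, 0) * f (1, 0, 0) * (f (θ₀, φ₀, 0))⁻¹ := conj f1 fun τ => by
    simp [tubeChart, Curve.circ, cβ 0 (Or.inl h00)]
  have eG' : h.right (α ε) (C'.circ φ₀ 0) = f (θ₀, φ₀, 0) * f (0, 1, 0) * (f (θ₀, φ₀, 0))⁻¹ := conj f2 fun τ => by
    simp [tubeChart, Curve.circ, cα ε (Or.inl hε0)]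
  have mer := h.hol_meridian_eq (Θ := fun x => (α x.1, β x.2)) hε hr hq (by fun_prop) (fun x hx => hm _ hx.1.1 _ hx.1.2 hx.2)
    (fun y => by simp only [pα]) (fun x => by simp only [pβ]) (α := (run α r₀ r₁).prodMk (.const I (β q₀)))
    (β := (ContinuousMap.const I (α r₀)).prodMk (run β q₀ q₁)) (α' := (run α r₀ ε).prodMk (.const I (β q₀)))
    (β' := (ContinuousMap.const I (α ε)).prodMk (run β q₀ 0)) (μ := M') (fun τ => rfl) (fun τ => rfl) (fun τ => rfl) (fun τ => rfl) (fun τ => rfl)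
  change (0 < r₁ * q₁ → (b * a)⁻¹ * h.hol M' * (b * a) = (h.right (α r₀) (run β q₀ q₁))⁻¹ * (h.left (run α r₀ r₁) (β q₀))⁻¹ *
      h.right (α r₀) (run β q₀ q₁) * h.left (run α r₀ r₁) (β q₀)) ∧ (r₁ * q₁ < 0 → (b * a)⁻¹ * h.hol M' * (b * a) =
      ((h.right (α r₀) (run β q₀ q₁))⁻¹ * (h.left (run α r₀ r₁) (β q₀))⁻¹ * h.right (α r₀) (run β q₀ q₁) * h.left (run α r₀ r₁) (β q₀))⁻¹) at mer
  rw [eM] at mer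
  refine boundaryCurves_of_reaches hε hε' hB hD ?_ ?_ ?_
  · rw [em]
    generalize (h.right (α r₀) (run β q₀ q₁))⁻¹ * (h.left (run α r₀ r₁) (β q₀))⁻¹ *
      h.right (α r₀) (run β q₀ q₁) * h.left (run α r₀ r₁) (β q₀) = K at mer ⊢
    have e : ∀ L : FundamentalGroup M z, (b * a)⁻¹ * (f (θ₀, φ₀, 0) * f (0, 0, 1) * (f (θ₀, φ₀, 0))⁻¹) * (b * a) = L →
        ((f (θ₀, φ₀, 0))⁻¹ * (b * (a * E)))⁻¹ * f (0, 0, 1) * ((f (θ₀, φ₀, 0))⁻¹ * (b * (a * E))) = E⁻¹ * L * E := by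
      rintro _ rfl
      group
    rcases Int.units_eq_one_or o with rfl | rfl <;> rcases Int.units_eq_one_or κ with rfl | rfl
    · rw [e _ (mer.1 (by simpa using hκ))]; simp
    · rw [e _ (mer.2 (by simpa using hκ))]; simp
    · rw [e _ (mer.2 (by simpa using hκ))]
      simp only [Units.val_neg, Units.val_one, zpow_neg, zpow_one]; group
    · rw [e _ (mer.1 (by simpa using hκ))]
      simp only [Units.val_neg, Units.val_one, zpow_neg, zpow_one]; group
  -- The push-off of `C` is carried back along `β` to the level of the base point, and then through
  -- the annulus to the parallel copy at distance `r`.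
  · have s1 : b⁻¹ * h.left (C.circ θ₀ ε) (β 0) * b = h.left (C.circ θ₀ ε) (β q₀) := by
      have := Holonomy.left_transport (h := h) (α := C.circ θ₀ ε) (C.circ_one _ _) (β := run β q₀ 0)
        fun τ υ => run_mem (S := {Q | (C.circ θ₀ ε τ, Q) ∈ M}) (fun y hy => h1 _ y hy) υ
      rwa [run_zero, run_one, show C.circ θ₀ ε 0 = α ε by simp [Curve.circ, cα ε (Or.inl hε0)]] at this
    have s2 : (h.left (run α r ε) (β q₀))⁻¹ * h.left (C.circ θ₀ ε) (β q₀) * h.left (run α r ε) (β q₀) = h.left (C.circ θ₀ r) (β q₀) :=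
      Holonomy.hol_annulus (h := h) (Λ := fun x => (C.chart x, β q₀)) (by fun_prop) (fun θ r => by rw [C.chart_add_one]) (u := r) (v := ε) (θ₀ := θ₀)
        (fun _ _ _ => hF _) (fun τ => rfl) (fun τ => rfl) fun τ => by
          rw [← cα _ (Or.inr (by rw [← segment_eq_uIcc, segment_eq_image_lineMap]; exact ⟨τ, τ.2, rfl⟩))]
          rfl
    have s3 := Holonomy.left_run_mul (h := h) (α := α) (Q := β q₀) (fun x => hF _) r₀ r ε
    rw [← ha] at s3
    rw [eF, ← s2, ← s1, eF', ← s3]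
    group
  -- The push-off of `C'` is first carried through the annulus to the copy at distance `q` and then
  -- back along `α`. The part of `β` between `q₀` and `q` is moved across `α` at the end and remains
  -- as a conjugating factor.
  · have s1 : (h.right (α ε) (run β q 0))⁻¹ * h.right (α ε) (C'.circ φ₀ 0) * h.right (α ε) (run β q 0) = h.right (α ε) (C'.circ φ₀ q) :=
      Holonomy.hol_annulus (h := h) (Λ := fun x => (α ε, C'.chart x)) (by fun_prop) (fun θ r => by rw [C'.chart_add_one]) (u := q) (v := 0) (θ₀ := φ₀)
        (fun φ y hy => h2 φ y hy) (fun τ => rfl) (fun τ => rfl) fun τ => by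
          rw [← cβ _ (Or.inr (by rw [← segment_eq_uIcc, segment_eq_image_lineMap]; exact ⟨τ, τ.2, rfl⟩))]
          rfl
    have s2 := Holonomy.right_run_mul (h := h) (β := β) (P := α ε) (convex_uIcc q₀ q₁) iβ (a := q₀) (b := q) (c := 0) Set.left_mem_uIcc hqm m0
    rw [← hb] at s2
    have s3 := Holonomy.right_transport (h := h) (α := run α r₀ ε) (β := C'.circ φ₀ q) (C'.circ_one _ _)
      fun τ υ => run_mem (S := {P | (P, C'.circ φ₀ q υ) ∈ M}) (fun x hx => h3 _ x hx) τ
    have s4 := Holonomy.left_mul_right (h := h) (α := run α r₀ ε) (β := run β q₀ q)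
      fun τ υ => run_mem (S := {P | (P, run β q₀ q υ) ∈ M}) (fun x hx => run_mem (S := {Q | (α x, Q) ∈ M}) (fun y hy => h4 x hx y hy) υ) τ
    rw [run_zero, run_one, show C'.circ φ₀ q 0 = β q by simp [Curve.circ, cβ q (Or.inr Set.left_mem_uIcc)]] at s3
    simp only [run_zero, run_one] at s4
    rw [← ha] at s4
    have s5 : h.right (α r₀) (run β q₀ q) = (h.left (run α r₀ ε) (β q))⁻¹ * (h.right (α ε) (run β q₀ q) * a) := by
      rw [← s4]; group
    rw [eG, ← s3, s5, ← s1, eG', ← s2]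
    group

end SurfaceProduct

namespace SurfaceProduct

variable {k m : ℕ}

/-! ### Distances in the periodic charts -/

/-- If the integer part is nonzero, the fractional part differs from `x` by at least `1`, while `x`
is within `15 / 16` of `c`; at least `1 / 16` remains. -/
theorem min_le_abs_fract_sub {x c : ℝ} (hx : |x - c| ≤ 15 / 16) {d : ℝ} (hd : d ≤ 1 / 16) (h : d ≤ |x - c|) : d ≤ |Int.fract x - c| := by
  have e : Int.fract x - c = x - c - ⌊x⌋ := by rw [Int.fract]; ring
  rw [e]
  rcases eq_or_ne ⌊x⌋ 0 with h0 | h0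
  · simpa [h0] using h
  · have h1 : (1 : ℝ) ≤ |(⌊x⌋ : ℝ)| := by exact_mod_cast Int.one_le_abs h0
    have := abs_sub_abs_le_abs_sub (⌊x⌋ : ℝ) (x - c)
    rw [abs_sub_comm (⌊x⌋ : ℝ) (x - c)] at this
    linarith

namespace Curve

theorem le_dist_pt (C : Curve k) (j : ZMod k) {p : ℝ × ℝ} (hp : p ∈ Set.Icc (0 : ℝ) 1 ×ˢ Set.Icc (0 : ℝ) 1) {d : ℝ} (hd : d ≤ 1 / 16)
    (h : j = C.sheet → d ≤ |C.height p - C.level|) : d ≤ C.dist (pt j p) := by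
  rw [C.dist_pt j hp]
  split_ifs with hj
  · exact le_min (h hj) hd
  · exact hd

theorem le_dist_of_sheet_ne (C : Curve k) {j : ZMod k} (hj : j ≠ C.sheet) {s t : ℝ} (hs : s ∈ I) (ht : t ∈ I) : 1 / 16 ≤ C.dist (pt j (s, t)) :=
  C.le_dist_pt j ⟨hs, ht⟩ le_rfl fun h => absurd h hj

variable {i j : ZMod k} {c s t d : ℝ}

theorem le_dist_horiz_hChart {hc : c ∈ Set.Icc (1 / 16 : ℝ) (15 / 16)} (hd : d ≤ 1 / 16) (ht : t ∈ I) (h : d ≤ |t - c|) :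
    d ≤ (horiz i c hc).dist (hChart j (s, t)) :=
  le_dist_pt _ _ ⟨⟨Int.fract_nonneg _, (Int.fract_lt_one _).le⟩, ht⟩ hd fun _ => h

theorem le_dist_vert_hChart {hc : c ∈ Set.Icc (9 / 16 : ℝ) (15 / 16)} (hd : d ≤ 1 / 16) (ht : t ∈ I) (hs : |s - c| ≤ 15 / 16) (h : d ≤ |s - c|) :
    d ≤ (vert i c hc).dist (hChart j (s, t)) :=
  le_dist_pt _ _ ⟨⟨Int.fract_nonneg _, (Int.fract_lt_one _).le⟩, ht⟩ hd fun _ => min_le_abs_fract_sub hs hd h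

theorem le_dist_horiz_vChart {hc : c ∈ Set.Icc (1 / 16 : ℝ) (15 / 16)} (hd : d ≤ 1 / 16) (hs : s ∈ Set.Icc (1 / 2 : ℝ) 1) (ht : |t - c| ≤ 15 / 16) (h : d ≤ |t - c|) :
    d ≤ (horiz i c hc).dist (vChart j (s, t)) :=
  le_dist_pt _ _ ⟨⟨by positivity, max_le hs.2 (by norm_num)⟩, Int.fract_nonneg _, (Int.fract_lt_one _).le⟩ hd fun _ => min_le_abs_fract_sub ht hd h

theorem le_dist_vert_vChart {hc : c ∈ Set.Icc (9 / 16 : ℝ) (15 / 16)} (hd : d ≤ 1 / 16) (hs : s ∈ Set.Icc (1 / 2 : ℝ) 1) (h : d ≤ |s - c|) :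
    d ≤ (vert i c hc).dist (vChart j (s, t)) :=
  le_dist_pt _ _ ⟨⟨by positivity, max_le hs.2 (by norm_num)⟩, Int.fract_nonneg _, (Int.fract_lt_one _).le⟩ hd fun _ => by
    simpa only [height, level, max_eq_left hs.1] using h

end Curve

theorem vChart_eq_hChart (i : ZMod k) {s t : ℝ} (hs : s ∈ Set.Icc (1 / 2 : ℝ) 1) (ht : t ∈ I) : vChart i (s, t) = hChart i (s, t) := by
  simp only [vChart, hChart]
  rw [max_eq_left hs.1, pt_fract_right i hs.1 ht.1 ht.2, pt_fract_left i (by linarith [hs.1]) hs.2]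

theorem hChart_eq_pt (i : ZMod k) {s t : ℝ} (hs : s ∈ I) : hChart i (s, t) = pt i (s, t) := pt_fract_left i hs.1 hs.2

theorem vChart_eq_pt (i : ZMod k) {s t : ℝ} (hs : s ∈ Set.Icc (1 / 2 : ℝ) 1) (ht : t ∈ I) : vChart i (s, t) = pt i (s, t) := by
  rw [vChart_eq_hChart i hs ht, hChart_eq_pt i ⟨by linarith [hs.1], hs.2⟩]

/-- Far from the torus one of the distances may be truncated, but a truncated distance already
exceeds `ε`. -/
theorem sq_le_of_min {ε r q d d' : ℝ} (hε : 0 < ε) (hε' : ε < 1 / 16) (h : ε ^ 2 ≤ r ^ 2 + q ^ 2) (hd : min |r| (1 / 16) ≤ d)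
    (hd' : min |q| (1 / 16) ≤ d') : ε ^ 2 ≤ d ^ 2 + d' ^ 2 := by
  rcases min_le_iff.1 hd with h1 | h1
  · rcases min_le_iff.1 hd' with h2 | h2
    · have h3 := pow_le_pow_left₀ (abs_nonneg r) h1 2
      have h4 := pow_le_pow_left₀ (abs_nonneg q) h2 2
      rw [sq_abs] at h3 h4
      linarith
    · nlinarith [sq_nonneg d]
  · nlinarith [sq_nonneg d']

theorem sq_le_left {ε d : ℝ} (d' : ℝ) (hε : 0 < ε) (h : ε ≤ d) : ε ^ 2 ≤ d ^ 2 + d' ^ 2 := by nlinarith [sq_nonneg d']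

theorem sq_le_right {ε d' : ℝ} (d : ℝ) (hε : 0 < ε) (h : ε ≤ d') : ε ^ 2 ≤ d ^ 2 + d' ^ 2 := by nlinarith [sq_nonneg d]

theorem bounds_of_mem_uIcc {a b x l u : ℝ} (h : x ∈ Set.uIcc a b) (hl : l ≤ a ∧ l ≤ b) (hu : a ≤ u ∧ b ≤ u) : l ≤ x ∧ x ≤ u :=
  ⟨(le_inf hl.1 hl.2).trans h.1, h.2.trans (sup_le hu.1 hu.2)⟩

/-! ### Loops in the periodic charts -/

namespace Holonomy

variable {F G H : Type} [TopologicalSpace F] [TopologicalSpace G] [Group H]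

theorem left_run_x {M : Set (Surface k × G)} {h : Holonomy (Surface k × G) M H} {Q : G} (hM : ∀ P, (P, Q) ∈ M) {i : ZMod k} {α : C(ℝ, Surface k)} (g : C(ℝ, ℝ))
    (hα : ∀ x, α x = hChart i (g x, 1 / 4)) {a b : ℝ} :
    (g a = 5 / 8 → g b = 13 / 8 → h.left (run α a b) Q = h.left (xLoop i).toContinuousMap Q) ∧
    (g a = 13 / 8 → g b = 5 / 8 → h.left (run α a b) Q = (h.left (xLoop i).toContinuousMap Q)⁻¹) := by
  have key := hol_eq_of_lift (h := h) (Θ := fun t => (hChart i (t, 1 / 4), Q)) (by fun_prop) (fun t => hM _) (γ := (run α a b).prodMk (.const I Q))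
    (γ' := (xLoop i).toContinuousMap.prodMk (.const I Q)) (p := run g a b) (p' := loopParam (5 / 8)) (fun τ => Prod.ext (hα _) rfl)
    (fun τ => Prod.ext (hLoop_eq i (by norm_num) _ τ) rfl)
  rw [loopParam_one, loopParam_zero, run_zero, run_one] at key
  exact ⟨fun h0 h1 => key.1 h0 (by rw [h1]; norm_num), fun h0 h1 => key.2 (by rw [h0]; norm_num) h1⟩

theorem left_run_y {M : Set (Surface k × G)} {h : Holonomy (Surface k × G) M H} {Q : G} (hM : ∀ P, (P, Q) ∈ M) {i : ZMod k} {α : C(ℝ, Surface k)} (g : C(ℝ, ℝ))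
    (hα : ∀ x, α x = vChart i (5 / 8, g x)) {a b : ℝ} :
    (g a = 1 / 4 → g b = 5 / 4 → h.left (run α a b) Q = h.left (yLoop i).toContinuousMap Q) ∧
    (g a = 5 / 4 → g b = 1 / 4 → h.left (run α a b) Q = (h.left (yLoop i).toContinuousMap Q)⁻¹) := by
  have key := hol_eq_of_lift (h := h) (Θ := fun t => (vChart i (5 / 8, t), Q)) (by fun_prop) (fun t => hM _) (γ := (run α a b).prodMk (.const I Q))
    (γ' := (yLoop i).toContinuousMap.prodMk (.const I Q)) (p := run g a b) (p' := loopParam (1 / 4)) (fun τ => Prod.ext (hα _) rfl)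
    (fun τ => Prod.ext (vLoop_eq i (by norm_num) (by norm_num) τ) rfl)
  rw [loopParam_one, loopParam_zero, run_zero, run_one] at key
  exact ⟨fun h0 h1 => key.1 h0 (by rw [h1]; norm_num), fun h0 h1 => key.2 (by rw [h0]; norm_num) h1⟩

theorem right_run_x {M : Set (F × Surface m)} {h : Holonomy (F × Surface m) M H} {P : F} {j : ZMod m} (hM : ∀ t, (P, hChart j (t, 1 / 4)) ∈ M) {β : C(ℝ, Surface m)} (g : C(ℝ, ℝ))
    (hβ : ∀ x, β x = hChart j (g x, 1 / 4)) {a b : ℝ} :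
    (g a = 5 / 8 → g b = 13 / 8 → h.right P (run β a b) = h.right P (xLoop j).toContinuousMap) ∧
    (g a = 13 / 8 → g b = 5 / 8 → h.right P (run β a b) = (h.right P (xLoop j).toContinuousMap)⁻¹) := by
  have key := hol_eq_of_lift (h := h) (Θ := fun t => (P, hChart j (t, 1 / 4))) (by fun_prop) hM (γ := (ContinuousMap.const I P).prodMk (run β a b))
    (γ' := (ContinuousMap.const I P).prodMk (xLoop j).toContinuousMap) (p := run g a b) (p' := loopParam (5 / 8)) (fun τ => Prod.ext rfl (hβ _))
    (fun τ => Prod.ext rfl (hLoop_eq j (by norm_num) _ τ))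
  rw [loopParam_one, loopParam_zero, run_zero, run_one] at key
  exact ⟨fun h0 h1 => key.1 h0 (by rw [h1]; norm_num), fun h0 h1 => key.2 (by rw [h0]; norm_num) h1⟩

theorem right_run_y {M : Set (F × Surface m)} {h : Holonomy (F × Surface m) M H} {P : F} {j : ZMod m} (hM : ∀ t, (P, vChart j (5 / 8, t)) ∈ M) {β : C(ℝ, Surface m)} (g : C(ℝ, ℝ))
    (hβ : ∀ x, β x = vChart j (5 / 8, g x)) {a b : ℝ} :
    (g a = 1 / 4 → g b = 5 / 4 → h.right P (run β a b) = h.right P (yLoop j).toContinuousMap) ∧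
    (g a = 5 / 4 → g b = 1 / 4 → h.right P (run β a b) = (h.right P (yLoop j).toContinuousMap)⁻¹) := by
  have key := hol_eq_of_lift (h := h) (Θ := fun t => (P, vChart j (5 / 8, t))) (by fun_prop) hM (γ := (ContinuousMap.const I P).prodMk (run β a b))
    (γ' := (ContinuousMap.const I P).prodMk (yLoop j).toContinuousMap) (p := run g a b) (p' := loopParam (1 / 4)) (fun τ => Prod.ext rfl (hβ _))
    (fun τ => Prod.ext rfl (vLoop_eq j (by norm_num) (by norm_num) τ))
  rw [loopParam_one, loopParam_zero, run_zero, run_one] at key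
  exact ⟨fun h0 h1 => key.1 h0 (by rw [h1]; norm_num), fun h0 h1 => key.2 (by rw [h0]; norm_num) h1⟩

theorem left_run_self {M : Set (F × G)} {h : Holonomy (F × G) M H} {α : C(ℝ, F)} {Q : G} (a : ℝ) (hM : (α a, Q) ∈ M) : h.left (run α a a) Q = 1 :=
  hol_const hM fun τ => by simp [run]

theorem right_run_self {M : Set (F × G)} {h : Holonomy (F × G) M H} {β : C(ℝ, G)} {P : F} (a : ℝ) (hM : (P, β a) ∈ M) : h.right P (run β a a) = 1 :=
  hol_const hM fun τ => by simp [run]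

end Holonomy

theorem Curve.circ_eq_run (C : Curve k) (θ r : ℝ) : C.circ θ r = run ⟨fun t => C.chart (θ + t, r), by fun_prop⟩ 0 1 := by
  ext τ
  simp [Curve.circ, run, AffineMap.lineMap_apply]

end SurfaceProduct

/-! ### The sweeping curves for the individual tori. -/

namespace SurfaceProduct

variable {k m : ℕ}

/-- The part of a square of the second factor that contains the curves used to reach the tori. -/
def reachRegion (j : ZMod m) : Set (Surface m) :=
  {Q | ∃ s t : ℝ, s ∈ I ∧ t ∈ I ∧ (1 / 4 ≤ t ∨ 5 / 8 ≤ s) ∧ Q = pt j (s, t)}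

theorem vChart_mem_reachRegion (j : ZMod m) {s : ℝ} (hs : s ∈ Set.Icc (5 / 8 : ℝ) 1) (t : ℝ) : vChart j (s, t) ∈ reachRegion j :=
  ⟨max s (1 / 2), Int.fract t, ⟨by positivity, max_le hs.2 (by norm_num)⟩, ⟨Int.fract_nonneg _, (Int.fract_lt_one _).le⟩,
    Or.inr (hs.1.trans (le_max_left _ _)), rfl⟩

theorem hChart_mem_reachRegion (j : ZMod m) (s : ℝ) {t : ℝ} (ht : t ∈ Set.Icc (1 / 4 : ℝ) 1) : hChart j (s, t) ∈ reachRegion j :=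
  ⟨Int.fract s, t, ⟨Int.fract_nonneg _, (Int.fract_lt_one _).le⟩, ⟨by linarith [ht.1], ht.2⟩, Or.inl ht.1, rfl⟩

section

variable {M : Set (Surface k × Surface m)} {z : M} {ε : ℝ} (hε : 0 < ε) (hε' : ε < 1 / 16) (i : ZMod k) (j : ZMod m)
  (hM : ∀ P, ∀ Q ∈ reachRegion j, (∀ i, ε ^ 2 ≤ (curveX i).dist P ^ 2 + (curveX j).dist Q ^ 2) →
    (∀ i, ε ^ 2 ≤ (curveY i).dist P ^ 2 + (curveX' j).dist Q ^ 2) → (P, Q) ∈ M)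
  {E X Y A B : FundamentalGroup M z}
  (hE : (Holonomy.ofBase M z).Reaches z.1 (pt i (5 / 8, 1 / 4), pt j (5 / 8, 1 / 4)) E)
  (hX : E⁻¹ * (Holonomy.ofBase M z).left (xLoop i).toContinuousMap (pt j (5 / 8, 1 / 4)) * E = X)
  (hY : E⁻¹ * (Holonomy.ofBase M z).left (yLoop i).toContinuousMap (pt j (5 / 8, 1 / 4)) * E = Y)
  (hA : E⁻¹ * (Holonomy.ofBase M z).right (pt i (5 / 8, 1 / 4)) (xLoop j).toContinuousMap * E = A)
  (hB : E⁻¹ * (Holonomy.ofBase M z).right (pt i (5 / 8, 1 / 4)) (yLoop j).toContinuousMap * E = B)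

include hε hε' hM

theorem mem_left_slice (P : Surface k) : (P, pt j (5 / 8, 1 / 4)) ∈ M := by
  rw [← hChart_eq_pt j (by norm_num)]
  exact hM _ _ (hChart_mem_reachRegion j _ (by norm_num))
    (fun _ => sq_le_right _ hε (hε'.le.trans (Curve.le_dist_horiz_hChart le_rfl (by norm_num) (le_abs.2 (Or.inr (by norm_num))))))
    fun _ => sq_le_right _ hε (hε'.le.trans (Curve.le_dist_horiz_hChart le_rfl (by norm_num) (le_abs.2 (Or.inr (by norm_num)))))

theorem mem_right_slice {Q : Surface m} (hQ : Q ∈ reachRegion j) : (pt i (5 / 8, 1 / 4), Q) ∈ M := by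
  rw [← hChart_eq_pt i (by norm_num)]
  exact hM _ _ hQ
    (fun _ => sq_le_left _ hε (hε'.le.trans (Curve.le_dist_horiz_hChart le_rfl (by norm_num) (le_abs.2 (Or.inr (by norm_num))))))
    fun _ => sq_le_left _ hε (hε'.le.trans (Curve.le_dist_vert_hChart le_rfl (by norm_num) (abs_le.2 (by norm_num)) (le_abs.2 (Or.inr (by norm_num)))))

include hE hX hY hA hB

/-- The crossing curves are `y_i` and `b`, both run upwards from height `1 / 4`, that is from signed
distance `-(1 / 4)`. The parallel copies at that distance are `x_i` and `a` themselves, so no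
conjugation remains. -/
theorem boundaryCurves_T (hBM : tube (curveX i) (curveX j) {ε ^ 2} ⊆ M) :
    BoundaryCurves (curveX i) (curveX j) ε hε' 1 ⁅B⁻¹, Y⁻¹⁆ X A := by
  have hl := mem_left_slice hε hε' j hM
  have hrg := fun Q (hQ : Q ∈ reachRegion j) => mem_right_slice hε hε' i j hM hQ
  have e0 : ∀ {n : ℕ} (i : ZMod n), vChart i (5 / 8, 1 / 2 + -(1 / 4)) = pt i (5 / 8, 1 / 4) := fun i => by
    rw [vChart_eq_pt i (by norm_num) (by norm_num)]; norm_num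
  have e1 : ∀ {n : ℕ} (i : ZMod n), vChart i (5 / 8, 1 / 2 + 3 / 4) = pt i (5 / 8, 1 / 4) := fun i => by
    rw [show (1 / 2 + 3 / 4 : ℝ) = 1 / 4 + 1 by norm_num, vChart_add_one, vChart_eq_pt i (by norm_num) (by norm_num)]
  have chart : ∀ {n : ℕ} (i : ZMod n) (x : ℝ), |x| ≤ ε ∨ (-(1 / 4) ≤ x ∧ x ≤ 1 / 4) → vChart i (5 / 8, 1 / 2 + x) = (curveX i).chart (5 / 8, x) := by
    intro n i x hx
    refine vChart_eq_hChart i (by norm_num) ?_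
    rcases hx with h | h
    · rw [abs_le] at h; constructor <;> linarith
    · constructor <;> linarith
  have main := boundaryCurves_of_sweep (z := z) (C := curveX i) (C' := curveX j) (α := ⟨fun x => vChart i (5 / 8, 1 / 2 + x), by fun_prop⟩)
    (β := ⟨fun y => vChart j (5 / 8, 1 / 2 + y), by fun_prop⟩) (θ₀ := 5 / 8) (φ₀ := 5 / 8) (r₀ := -(1 / 4)) (r₁ := 3 / 4) (r := -(1 / 4))
    (q₀ := -(1 / 4)) (q₁ := 3 / 4) (q := -(1 / 4)) hε hε' hBM (Or.inl ⟨by linarith, by linarith⟩) (Or.inl ⟨by linarith, by linarith⟩)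
    (fun x hx y hy hxy => by
      have bx := bounds_of_mem_uIcc hx (l := -(1 / 4)) (u := 3 / 4) (by norm_num) (by norm_num)
      have bY := bounds_of_mem_uIcc hy (l := -(1 / 4)) (u := 3 / 4) (by norm_num) (by norm_num)
      exact hM _ _ (vChart_mem_reachRegion j (by norm_num) _)
        (fun _ => sq_le_of_min hε hε' hxy
          (Curve.le_dist_horiz_vChart (min_le_right _ _) (by norm_num) (abs_le.2 ⟨by linarith, by linarith⟩) (by rw [add_sub_cancel_left]; exact min_le_left _ _))
          (Curve.le_dist_horiz_vChart (min_le_right _ _) (by norm_num) (abs_le.2 ⟨by linarith, by linarith⟩) (by rw [add_sub_cancel_left]; exact min_le_left _ _)))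
        fun _ => sq_le_left _ hε (hε'.le.trans (Curve.le_dist_vert_vChart le_rfl (by norm_num) (le_abs.2 (Or.inr (by norm_num))))))
    ((e1 i).trans (e0 i).symm) ((e1 j).trans (e0 j).symm) Set.left_mem_uIcc
    (fun x hx => chart i x (hx.imp_right fun h => bounds_of_mem_uIcc h (by constructor <;> linarith) (by constructor <;> linarith)))
    (fun x hx => chart j x (hx.imp_right fun h => bounds_of_mem_uIcc h (by norm_num) (by norm_num)))
    (fun P => by simpa only [ContinuousMap.coe_mk, e0] using hl P)
    (fun θ y hy => by
      have bY := bounds_of_mem_uIcc hy (l := -(1 / 4)) (u := 0) (by norm_num) (by norm_num)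
      exact hM _ _ (vChart_mem_reachRegion j (by norm_num) _)
        (fun _ => sq_le_left _ hε (Curve.le_dist_horiz_hChart hε'.le ⟨by linarith, by linarith⟩ (le_abs.2 (Or.inl (by linarith)))))
        fun _ => sq_le_right _ hε (hε'.le.trans (Curve.le_dist_horiz_vChart le_rfl (by norm_num) (abs_le.2 ⟨by linarith, by linarith⟩) (le_abs.2 (Or.inr (by linarith))))))
    (fun φ y hy => by
      have bY := bounds_of_mem_uIcc hy (l := -(1 / 4)) (u := 0) (by norm_num) (by norm_num)
      exact hM _ _ (hChart_mem_reachRegion j _ ⟨by linarith, by linarith⟩)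
        (fun _ => sq_le_left _ hε (Curve.le_dist_horiz_vChart hε'.le (by norm_num) (abs_le.2 ⟨by linarith, by linarith⟩) (le_abs.2 (Or.inl (by linarith)))))
        fun _ => sq_le_left _ hε (hε'.le.trans (Curve.le_dist_vert_vChart le_rfl (by norm_num) (le_abs.2 (Or.inr (by norm_num))))))
    (fun φ x _ => hM _ _ (hChart_mem_reachRegion j _ (by norm_num))
        (fun _ => sq_le_right _ hε (hε'.le.trans (Curve.le_dist_horiz_hChart le_rfl (by norm_num) (le_abs.2 (Or.inr (by norm_num))))))
        fun _ => sq_le_right _ hε (hε'.le.trans (Curve.le_dist_horiz_hChart le_rfl (by norm_num) (le_abs.2 (Or.inr (by norm_num))))))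
    (fun x _ y hy => by
      rw [Set.uIcc_self, Set.mem_singleton_iff] at hy
      rw [hy]
      simpa only [ContinuousMap.coe_mk, e0] using hl _)
    (E := E) (by simpa only [ContinuousMap.coe_mk, e0] using hE) (o := 1) (κ := 1) (by norm_num) rfl rfl rfl rfl rfl rfl
  simp only [ContinuousMap.coe_mk, e0] at main
  rw [(Holonomy.left_run_y hl (i := i) ⟨fun x => 1 / 2 + x, by fun_prop⟩ fun x => rfl).1 (by norm_num) (by norm_num),
    (Holonomy.right_run_y (fun t => hrg _ (vChart_mem_reachRegion j (by norm_num) t)) (j := j) ⟨fun x => 1 / 2 + x, by fun_prop⟩ fun x => rfl).1 (by norm_num) (by norm_num),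
    Holonomy.left_run_self _ (hl _), Holonomy.right_run_self _ (hrg _ (vChart_mem_reachRegion j (by norm_num) _)),
    Curve.circ_eq_run, Curve.circ_eq_run,
    (Holonomy.left_run_x hl (i := i) ⟨fun x => 5 / 8 + x, by fun_prop⟩ fun x => by norm_num [Curve.chart, curveX]).1 (by norm_num) (by norm_num),
    (Holonomy.right_run_x (fun t => hrg _ (hChart_mem_reachRegion j t (by norm_num))) (j := j) ⟨fun x => 5 / 8 + x, by fun_prop⟩ fun x => by norm_num [Curve.chart, curveX]).1
      (by norm_num) (by norm_num)] at main
  convert main using 1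
  · rw [← hB, ← hY, commutatorElement_def]; simp only [Units.val_one, zpow_one]; group
  · rw [← hX]; group
  · rw [← hA]; group

/-- The crossing curves are `x_i` and the reverse of `b`. The torus is approached from above,
through height `1`, because on the way up from height `1 / 4` the push-off of `Y_i` would sweep
across `T_i`. The parallel copy `a` lies on the far side, at `q = q₁`, so a full turn of `b` appears
as a conjugation. -/
theorem boundaryCurves_L (hBM : tube (curveY i) (curveX' j) {ε ^ 2} ⊆ M) :
    BoundaryCurves (curveY i) (curveX' j) ε hε' (-1) ⁅X⁻¹, B⁆ Y (B * A * B⁻¹) := by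
  have hl := mem_left_slice hε hε' j hM
  have hrg := fun Q (hQ : Q ∈ reachRegion j) => mem_right_slice hε hε' i j hM hQ
  have a0 : hChart i (3 / 4 - 1 / 8, 1 / 4) = pt i (5 / 8, 1 / 4) := by
    rw [hChart_eq_pt i (by norm_num)]; norm_num
  have a1 : hChart i (3 / 4 - -(7 / 8), 1 / 4) = pt i (5 / 8, 1 / 4) := by
    rw [show (3 / 4 - -(7 / 8) : ℝ) = 5 / 8 + 1 by norm_num, hChart_add_one, hChart_eq_pt i (by norm_num)]
  have b0 : vChart j (5 / 8, 3 / 4 + 1 / 2) = pt j (5 / 8, 1 / 4) := by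
    rw [show (3 / 4 + 1 / 2 : ℝ) = 1 / 4 + 1 by norm_num, vChart_add_one, vChart_eq_pt j (by norm_num) (by norm_num)]
  have b1 : vChart j (5 / 8, 3 / 4 + -(1 / 2)) = pt j (5 / 8, 1 / 4) := by
    rw [vChart_eq_pt j (by norm_num) (by norm_num)]; norm_num
  have main := boundaryCurves_of_sweep (z := z) (C := curveY i) (C' := curveX' j) (α := ⟨fun x => hChart i (3 / 4 - x, 1 / 4), by fun_prop⟩)
    (β := ⟨fun y => vChart j (5 / 8, 3 / 4 + y), by fun_prop⟩) (θ₀ := 1 / 4) (φ₀ := 5 / 8) (r₀ := 1 / 8) (r₁ := -(7 / 8)) (r := 1 / 8)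
    (q₀ := 1 / 2) (q₁ := -(1 / 2)) (q := -(1 / 2)) hε hε' hBM (Or.inr ⟨by linarith, by linarith⟩) (Or.inr ⟨by linarith, by linarith⟩)
    (fun x hx y hy hxy => by
      have bx := bounds_of_mem_uIcc hx (l := -(7 / 8)) (u := 1 / 8) (by norm_num) (by norm_num)
      have bY := bounds_of_mem_uIcc hy (l := -(1 / 2)) (u := 1 / 2) (by norm_num) (by norm_num)
      exact hM _ _ (vChart_mem_reachRegion j (by norm_num) _)
        (fun _ => sq_le_left _ hε (hε'.le.trans (Curve.le_dist_horiz_hChart le_rfl (by norm_num) (le_abs.2 (Or.inr (by norm_num))))))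
        fun _ => sq_le_of_min hε hε' hxy
          (Curve.le_dist_vert_hChart (min_le_right _ _) (by norm_num) (abs_le.2 ⟨by linarith, by linarith⟩) (by rw [sub_sub_cancel_left, abs_neg]; exact min_le_left _ _))
          (Curve.le_dist_horiz_vChart (min_le_right _ _) (by norm_num) (abs_le.2 ⟨by linarith, by linarith⟩) (by rw [add_sub_cancel_left]; exact min_le_left _ _)))
    (a1.trans a0.symm) (b1.trans b0.symm) Set.right_mem_uIcc
    (fun x hx => by
      refine (vChart_eq_hChart i ?_ (by norm_num)).symm
      rcases hx with h | h
      · rw [abs_le] at h; constructor <;> linarith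
      · have := bounds_of_mem_uIcc h (l := 0) (u := 1 / 4) (by constructor <;> linarith) (by constructor <;> linarith)
        constructor <;> linarith)
    (fun x hx => by
      refine vChart_eq_hChart j (by norm_num) ?_
      rcases hx with h | h
      · rw [abs_le] at h; constructor <;> linarith
      · have := bounds_of_mem_uIcc h (l := -(1 / 2)) (u := 0) (by norm_num) (by norm_num)
        constructor <;> linarith)
    (fun P => by simpa only [ContinuousMap.coe_mk, b0] using hl P)
    (fun θ y hy => by
      have bY := bounds_of_mem_uIcc hy (l := 0) (u := 1 / 2) (by norm_num) (by norm_num)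
      exact hM _ _ (vChart_mem_reachRegion j (by norm_num) _)
        (fun _ => sq_le_right _ hε (hε'.le.trans (Curve.le_dist_horiz_vChart le_rfl (by norm_num) (abs_le.2 ⟨by linarith, by linarith⟩) (le_abs.2 (Or.inl (by linarith))))))
        fun _ => sq_le_left _ hε (Curve.le_dist_vert_vChart hε'.le ⟨by linarith, by linarith⟩ (le_abs.2 (Or.inr (by linarith)))))
    (fun φ y hy => by
      have bY := bounds_of_mem_uIcc hy (l := -(1 / 2)) (u := 0) (by norm_num) (by norm_num)
      exact hM _ _ (hChart_mem_reachRegion j _ ⟨by linarith, by linarith⟩)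
        (fun _ => sq_le_left _ hε (hε'.le.trans (Curve.le_dist_horiz_hChart le_rfl (by norm_num) (le_abs.2 (Or.inr (by norm_num))))))
        fun _ => sq_le_left _ hε (Curve.le_dist_vert_hChart hε'.le (by norm_num) (abs_le.2 ⟨by linarith, by linarith⟩) (le_abs.2 (Or.inr (by linarith)))))
    (fun φ x _ => hM _ _ (hChart_mem_reachRegion j _ (by norm_num))
        (fun _ => sq_le_right _ hε (hε'.le.trans (Curve.le_dist_horiz_hChart le_rfl (by norm_num) (le_abs.2 (Or.inr (by norm_num))))))
        fun _ => sq_le_right _ hε (hε'.le.trans (Curve.le_dist_horiz_hChart le_rfl (by norm_num) (le_abs.2 (Or.inr (by norm_num))))))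
    (fun x hx y _ => by
      have bx := bounds_of_mem_uIcc hx (l := ε) (u := 1 / 8) (by constructor <;> linarith) (by constructor <;> linarith)
      exact hM _ _ (vChart_mem_reachRegion j (by norm_num) _)
        (fun _ => sq_le_left _ hε (hε'.le.trans (Curve.le_dist_horiz_hChart le_rfl (by norm_num) (le_abs.2 (Or.inr (by norm_num))))))
        fun _ => sq_le_left _ hε (Curve.le_dist_vert_hChart hε'.le (by norm_num) (abs_le.2 ⟨by linarith, by linarith⟩) (le_abs.2 (Or.inr (by linarith)))))
    (E := E) (by simpa only [ContinuousMap.coe_mk, a0, b0] using hE) (o := -1) (κ := -1) (by norm_num) rfl rfl rfl rfl rfl rfl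
  simp only [ContinuousMap.coe_mk, a0, b0] at main
  have hb := fun t => hrg _ (vChart_mem_reachRegion j (by norm_num : (5 / 8 : ℝ) ∈ Set.Icc (5 / 8 : ℝ) 1) t)
  rw [(Holonomy.left_run_x hl (i := i) ⟨fun x => 3 / 4 - x, by fun_prop⟩ fun x => rfl).1 (by norm_num) (by norm_num),
    (Holonomy.right_run_y hb ⟨fun x => 3 / 4 + x, by fun_prop⟩ fun x => rfl).2 (by norm_num) (by norm_num),
    Holonomy.left_run_self _ (hl _), Curve.circ_eq_run, Curve.circ_eq_run,
    (Holonomy.left_run_y hl (i := i) ⟨fun x => 1 / 4 + x, by fun_prop⟩ fun x => by norm_num [Curve.chart, curveY]).1 (by norm_num) (by norm_num),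
    (Holonomy.right_run_x (fun t => hrg _ (hChart_mem_reachRegion j t (by norm_num))) (j := j) ⟨fun x => 5 / 8 + x, by fun_prop⟩ fun x => by norm_num [Curve.chart, curveX']).1
      (by norm_num) (by norm_num)] at main
  convert main using 1
  · rw [← hX, ← hB, commutatorElement_def]; simp only [Units.val_neg, Units.val_one, zpow_neg, zpow_one]; group
  · rw [← hY]; group
  · rw [← hA, ← hB]; group

end

section

variable {M : Set (Surface k × Surface m)} {z : M} {ε : ℝ} (hε : 0 < ε) (hε' : ε < 1 / 16) (i : ZMod k) (j : ZMod m)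
  (hM : ∀ P, ∀ Q ∈ reachRegion j, ε ^ 2 ≤ (curveY i).dist P ^ 2 + (curveX j).dist Q ^ 2 →
    ε ^ 2 ≤ (curveY' i).dist P ^ 2 + (curveY j).dist Q ^ 2 → (P, Q) ∈ M)
  {E X Y A B : FundamentalGroup M z}
  (hE : (Holonomy.ofBase M z).Reaches z.1 (pt i (5 / 8, 1 / 4), pt j (5 / 8, 1 / 4)) E)
  (hX : E⁻¹ * (Holonomy.ofBase M z).left (xLoop i).toContinuousMap (pt j (5 / 8, 1 / 4)) * E = X)
  (hY : E⁻¹ * (Holonomy.ofBase M z).left (yLoop i).toContinuousMap (pt j (5 / 8, 1 / 4)) * E = Y)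
  (hA : E⁻¹ * (Holonomy.ofBase M z).right (pt i (5 / 8, 1 / 4)) (xLoop j).toContinuousMap * E = A)
  (hB : E⁻¹ * (Holonomy.ofBase M z).right (pt i (5 / 8, 1 / 4)) (yLoop j).toContinuousMap * E = B)

include hε hε' hM

theorem mem_left_slice' (P : Surface k) : (P, pt j (5 / 8, 1 / 4)) ∈ M := by
  rw [← hChart_eq_pt j (by norm_num)]
  exact hM _ _ (hChart_mem_reachRegion j _ (by norm_num))
    (sq_le_right _ hε (hε'.le.trans (Curve.le_dist_horiz_hChart le_rfl (by norm_num) (le_abs.2 (Or.inr (by norm_num))))))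
    (sq_le_right _ hε (hε'.le.trans (Curve.le_dist_vert_hChart le_rfl (by norm_num) (abs_le.2 (by norm_num)) (le_abs.2 (Or.inr (by norm_num))))))

theorem mem_right_slice' {Q : Surface m} (hQ : Q ∈ reachRegion j) : (pt i (5 / 8, 1 / 4), Q) ∈ M := by
  rw [← hChart_eq_pt i (by norm_num)]
  exact hM _ _ hQ
    (sq_le_left _ hε (hε'.le.trans (Curve.le_dist_vert_hChart le_rfl (by norm_num) (abs_le.2 (by norm_num)) (le_abs.2 (Or.inr (by norm_num))))))
    (sq_le_left _ hε (hε'.le.trans (Curve.le_dist_vert_hChart le_rfl (by norm_num) (abs_le.2 (by norm_num)) (le_abs.2 (Or.inr (by norm_num))))))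

include hE hX hY hA hB

/-- The crossing curves are `x_1`, run to the right from `5 / 8`, and `b_2`, run upwards. As the
radial coordinate decreases with `s`, the rectangle is traversed clockwise, whence `κ = -1` for a
counterclockwise meridian. -/
theorem boundaryCurves_J₁ (hBM : tube (curveY i) (curveX j) {ε ^ 2} ⊆ M) :
    BoundaryCurves (curveY i) (curveX j) ε hε' 1 ⁅X⁻¹, B⁻¹⁆ Y A := by
  have hl := mem_left_slice' hε hε' i j hM
  have hrg := fun Q (hQ : Q ∈ reachRegion j) => mem_right_slice' hε hε' i j hM hQ
  have a0 : hChart i (3 / 4 - 1 / 8, 1 / 4) = pt i (5 / 8, 1 / 4) := by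
    rw [hChart_eq_pt i (by norm_num)]; norm_num
  have a1 : hChart i (3 / 4 - -(7 / 8), 1 / 4) = pt i (5 / 8, 1 / 4) := by
    rw [show (3 / 4 - -(7 / 8) : ℝ) = 5 / 8 + 1 by norm_num, hChart_add_one, hChart_eq_pt i (by norm_num)]
  have b0 : vChart j (5 / 8, 1 / 2 + -(1 / 4)) = pt j (5 / 8, 1 / 4) := by
    rw [vChart_eq_pt j (by norm_num) (by norm_num)]; norm_num
  have b1 : vChart j (5 / 8, 1 / 2 + 3 / 4) = pt j (5 / 8, 1 / 4) := by
    rw [show (1 / 2 + 3 / 4 : ℝ) = 1 / 4 + 1 by norm_num, vChart_add_one, vChart_eq_pt j (by norm_num) (by norm_num)]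
  have main := boundaryCurves_of_sweep (z := z) (C := curveY i) (C' := curveX j) (α := ⟨fun x => hChart i (3 / 4 - x, 1 / 4), by fun_prop⟩)
    (β := ⟨fun y => vChart j (5 / 8, 1 / 2 + y), by fun_prop⟩) (θ₀ := 1 / 4) (φ₀ := 5 / 8) (r₀ := 1 / 8) (r₁ := -(7 / 8)) (r := 1 / 8)
    (q₀ := -(1 / 4)) (q₁ := 3 / 4) (q := -(1 / 4)) hε hε' hBM (Or.inr ⟨by linarith, by linarith⟩) (Or.inl ⟨by linarith, by linarith⟩)
    (fun x hx y hy hxy => by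
      have bx := bounds_of_mem_uIcc hx (l := -(7 / 8)) (u := 1 / 8) (by norm_num) (by norm_num)
      have bY := bounds_of_mem_uIcc hy (l := -(1 / 4)) (u := 3 / 4) (by norm_num) (by norm_num)
      exact hM _ _ (vChart_mem_reachRegion j (by norm_num) _)
        (sq_le_of_min hε hε' hxy
          (Curve.le_dist_vert_hChart (min_le_right _ _) (by norm_num) (abs_le.2 ⟨by linarith, by linarith⟩) (by rw [sub_sub_cancel_left, abs_neg]; exact min_le_left _ _))
          (Curve.le_dist_horiz_vChart (min_le_right _ _) (by norm_num) (abs_le.2 ⟨by linarith, by linarith⟩) (by rw [add_sub_cancel_left]; exact min_le_left _ _)))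
        (sq_le_right _ hε (hε'.le.trans (Curve.le_dist_vert_vChart le_rfl (by norm_num) (le_abs.2 (Or.inr (by norm_num)))))))
    (a1.trans a0.symm) (b1.trans b0.symm) Set.left_mem_uIcc
    (fun x hx => by
      refine (vChart_eq_hChart i ?_ (by norm_num)).symm
      rcases hx with h | h
      · rw [abs_le] at h; constructor <;> linarith
      · have := bounds_of_mem_uIcc h (l := 0) (u := 1 / 4) (by constructor <;> linarith) (by constructor <;> linarith)
        constructor <;> linarith)
    (fun x hx => by
      refine vChart_eq_hChart j (by norm_num) ?_
      rcases hx with h | h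
      · rw [abs_le] at h; constructor <;> linarith
      · have := bounds_of_mem_uIcc h (l := -(1 / 4)) (u := 0) (by norm_num) (by norm_num)
        constructor <;> linarith)
    (fun P => by simpa only [ContinuousMap.coe_mk, b0] using hl P)
    (fun θ y hy => hM _ _ (vChart_mem_reachRegion j (by norm_num) _)
        (sq_le_left _ hε (Curve.le_dist_vert_vChart hε'.le ⟨by linarith, by linarith⟩ (le_abs.2 (Or.inr (by linarith)))))
        (sq_le_right _ hε (hε'.le.trans (Curve.le_dist_vert_vChart le_rfl (by norm_num) (le_abs.2 (Or.inr (by norm_num)))))))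
    (fun φ y hy => by
      have bY := bounds_of_mem_uIcc hy (l := -(1 / 4)) (u := 0) (by norm_num) (by norm_num)
      exact hM _ _ (hChart_mem_reachRegion j _ ⟨by linarith, by linarith⟩)
        (sq_le_left _ hε (Curve.le_dist_vert_hChart hε'.le (by norm_num) (abs_le.2 ⟨by linarith, by linarith⟩) (le_abs.2 (Or.inr (by linarith)))))
        (sq_le_left _ hε (hε'.le.trans (Curve.le_dist_vert_hChart le_rfl (by norm_num) (abs_le.2 ⟨by linarith, by linarith⟩) (le_abs.2 (Or.inr (by linarith)))))))
    (fun φ x hx => by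
      have bx := bounds_of_mem_uIcc hx (l := ε) (u := 1 / 8) (by constructor <;> linarith) (by constructor <;> linarith)
      exact hM _ _ (hChart_mem_reachRegion j _ (by norm_num))
        (sq_le_right _ hε (hε'.le.trans (Curve.le_dist_horiz_hChart le_rfl (by norm_num) (le_abs.2 (Or.inr (by norm_num))))))
        (sq_le_left _ hε (hε'.le.trans (Curve.le_dist_vert_hChart le_rfl (by norm_num) (abs_le.2 ⟨by linarith, by linarith⟩) (le_abs.2 (Or.inr (by linarith)))))))
    (fun x _ y hy => by
      rw [Set.uIcc_self, Set.mem_singleton_iff] at hy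
      rw [hy]
      simpa only [ContinuousMap.coe_mk, b0] using hl _)
    (E := E) (by simpa only [ContinuousMap.coe_mk, a0, b0] using hE) (o := 1) (κ := -1) (by norm_num) rfl rfl rfl rfl rfl rfl
  simp only [ContinuousMap.coe_mk, a0, b0] at main
  have hb := fun t => hrg _ (vChart_mem_reachRegion j (by norm_num : (5 / 8 : ℝ) ∈ Set.Icc (5 / 8 : ℝ) 1) t)
  rw [(Holonomy.left_run_x hl (i := i) ⟨fun x => 3 / 4 - x, by fun_prop⟩ fun x => rfl).1 (by norm_num) (by norm_num),
    (Holonomy.right_run_y hb ⟨fun x => 1 / 2 + x, by fun_prop⟩ fun x => rfl).1 (by norm_num) (by norm_num),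
    Holonomy.left_run_self _ (hl _), Holonomy.right_run_self _ (hb _), Curve.circ_eq_run, Curve.circ_eq_run,
    (Holonomy.left_run_y hl (i := i) ⟨fun x => 1 / 4 + x, by fun_prop⟩ fun x => by norm_num [Curve.chart, curveY]).1 (by norm_num) (by norm_num),
    (Holonomy.right_run_x (fun t => hrg _ (hChart_mem_reachRegion j t (by norm_num))) (j := j) ⟨fun x => 5 / 8 + x, by fun_prop⟩ fun x => by norm_num [Curve.chart, curveX]).1
      (by norm_num) (by norm_num)] at main
  convert main using 1
  · rw [← hX, ← hB, commutatorElement_def]; simp only [Units.val_neg, Units.val_one, zpow_neg, zpow_one]; group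
  · rw [← hY]; group
  · rw [← hA]; group

/-- The crossing curves are the reverse of `x_1` and `a_2`. The torus is approached from the right:
from the left, the push-off of `B_2` would sweep across `J_1`, since `b_2` meets `A_2`. The parallel
copy `y_1` lies on the far side, at `r = r₁`, so it appears conjugated by `x_1`. -/
theorem boundaryCurves_J₂ (hBM : tube (curveY' i) (curveY j) {ε ^ 2} ⊆ M) :
    BoundaryCurves (curveY' i) (curveY j) ε hε' (-1) ⁅A⁻¹, X⁆ (X * Y * X⁻¹) B := by
  have hl := mem_left_slice' hε hε' i j hM
  have hrg := fun Q (hQ : Q ∈ reachRegion j) => mem_right_slice' hε hε' i j hM hQ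
  have a0 : hChart i (7 / 8 - -(3 / 4), 1 / 4) = pt i (5 / 8, 1 / 4) := by
    rw [show (7 / 8 - -(3 / 4) : ℝ) = 5 / 8 + 1 by norm_num, hChart_add_one, hChart_eq_pt i (by norm_num)]
  have a1 : hChart i (7 / 8 - 1 / 4, 1 / 4) = pt i (5 / 8, 1 / 4) := by
    rw [hChart_eq_pt i (by norm_num)]; norm_num
  have b0 : hChart j (3 / 4 - 1 / 8, 1 / 4) = pt j (5 / 8, 1 / 4) := by
    rw [hChart_eq_pt j (by norm_num)]; norm_num
  have b1 : hChart j (3 / 4 - -(7 / 8), 1 / 4) = pt j (5 / 8, 1 / 4) := by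
    rw [show (3 / 4 - -(7 / 8) : ℝ) = 5 / 8 + 1 by norm_num, hChart_add_one, hChart_eq_pt j (by norm_num)]
  have main := boundaryCurves_of_sweep (z := z) (C := curveY' i) (C' := curveY j) (α := ⟨fun x => hChart i (7 / 8 - x, 1 / 4), by fun_prop⟩)
    (β := ⟨fun y => hChart j (3 / 4 - y, 1 / 4), by fun_prop⟩) (θ₀ := 1 / 4) (φ₀ := 1 / 4) (r₀ := -(3 / 4)) (r₁ := 1 / 4) (r := 1 / 4)
    (q₀ := 1 / 8) (q₁ := -(7 / 8)) (q := 1 / 8) hε hε' hBM (Or.inl ⟨by linarith, by linarith⟩) (Or.inr ⟨by linarith, by linarith⟩)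
    (fun x hx y hy hxy => by
      have bx := bounds_of_mem_uIcc hx (l := -(3 / 4)) (u := 1 / 4) (by norm_num) (by norm_num)
      have bY := bounds_of_mem_uIcc hy (l := -(7 / 8)) (u := 1 / 8) (by norm_num) (by norm_num)
      exact hM _ _ (hChart_mem_reachRegion j _ (by norm_num))
        (sq_le_right _ hε (hε'.le.trans (Curve.le_dist_horiz_hChart le_rfl (by norm_num) (le_abs.2 (Or.inr (by norm_num))))))
        (sq_le_of_min hε hε' hxy
          (Curve.le_dist_vert_hChart (min_le_right _ _) (by norm_num) (abs_le.2 ⟨by linarith, by linarith⟩) (by rw [sub_sub_cancel_left, abs_neg]; exact min_le_left _ _))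
          (Curve.le_dist_vert_hChart (min_le_right _ _) (by norm_num) (abs_le.2 ⟨by linarith, by linarith⟩) (by rw [sub_sub_cancel_left, abs_neg]; exact min_le_left _ _))))
    (a1.trans a0.symm) (b1.trans b0.symm) Set.left_mem_uIcc
    (fun x hx => by
      refine (vChart_eq_hChart i ?_ (by norm_num)).symm
      rcases hx with h | h
      · rw [abs_le] at h; constructor <;> linarith
      · have := bounds_of_mem_uIcc h (l := 0) (u := 1 / 4) (by constructor <;> linarith) (by constructor <;> linarith)
        constructor <;> linarith)
    (fun x hx => by
      refine (vChart_eq_hChart j ?_ (by norm_num)).symm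
      rcases hx with h | h
      · rw [abs_le] at h; constructor <;> linarith
      · have := bounds_of_mem_uIcc h (l := 0) (u := 1 / 8) (by norm_num) (by norm_num)
        constructor <;> linarith)
    (fun P => by simpa only [ContinuousMap.coe_mk, b0] using hl P)
    (fun θ y hy => hM _ _ (hChart_mem_reachRegion j _ (by norm_num))
        (sq_le_right _ hε (hε'.le.trans (Curve.le_dist_horiz_hChart le_rfl (by norm_num) (le_abs.2 (Or.inr (by norm_num))))))
        (sq_le_left _ hε (Curve.le_dist_vert_vChart hε'.le ⟨by linarith, by linarith⟩ (le_abs.2 (Or.inr (by linarith))))))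
    (fun φ y hy => by
      have bY := bounds_of_mem_uIcc hy (l := 0) (u := 1 / 8) (by norm_num) (by norm_num)
      exact hM _ _ (vChart_mem_reachRegion j ⟨by linarith, by linarith⟩ _)
        (sq_le_left _ hε (hε'.le.trans (Curve.le_dist_vert_hChart le_rfl (by norm_num) (abs_le.2 ⟨by linarith, by linarith⟩) (le_abs.2 (Or.inl (by linarith))))))
        (sq_le_left _ hε (Curve.le_dist_vert_hChart hε'.le (by norm_num) (abs_le.2 ⟨by linarith, by linarith⟩) (le_abs.2 (Or.inr (by linarith))))))
    (fun φ x hx => by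
      have bx := bounds_of_mem_uIcc hx (l := -(3 / 4)) (u := ε) (by constructor <;> linarith) (by constructor <;> linarith)
      exact hM _ _ (vChart_mem_reachRegion j (by norm_num) _)
        (sq_le_left _ hε (hε'.le.trans (Curve.le_dist_vert_hChart le_rfl (by norm_num) (abs_le.2 ⟨by linarith, by linarith⟩) (le_abs.2 (Or.inl (by linarith))))))
        (sq_le_right _ hε (hε'.le.trans (Curve.le_dist_vert_vChart le_rfl (by norm_num) (le_abs.2 (Or.inr (by norm_num)))))))
    (fun x _ y hy => by
      rw [Set.uIcc_self, Set.mem_singleton_iff] at hy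
      rw [hy]
      simpa only [ContinuousMap.coe_mk, b0] using hl _)
    (E := E) (by simpa only [ContinuousMap.coe_mk, a0, b0] using hE) (o := -1) (κ := 1) (by norm_num) rfl rfl rfl rfl rfl rfl
  simp only [ContinuousMap.coe_mk, a0, b0] at main
  have ha := fun t => hrg _ (hChart_mem_reachRegion j t (by norm_num : (1 / 4 : ℝ) ∈ Set.Icc (1 / 4 : ℝ) 1))
  rw [(Holonomy.left_run_x hl (i := i) ⟨fun x => 7 / 8 - x, by fun_prop⟩ fun x => rfl).2 (by norm_num) (by norm_num),
    (Holonomy.right_run_x ha ⟨fun x => 3 / 4 - x, by fun_prop⟩ fun x => rfl).1 (by norm_num) (by norm_num),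
    Holonomy.right_run_self _ (ha _), Curve.circ_eq_run, Curve.circ_eq_run,
    (Holonomy.left_run_y hl (i := i) ⟨fun x => 1 / 4 + x, by fun_prop⟩ fun x => by norm_num [Curve.chart, curveY']).1 (by norm_num) (by norm_num),
    (Holonomy.right_run_y (fun t => hrg _ (vChart_mem_reachRegion j (by norm_num) t)) (j := j) ⟨fun x => 1 / 4 + x, by fun_prop⟩ fun x => by norm_num [Curve.chart, curveY]).1
      (by norm_num) (by norm_num)] at main
  convert main using 1
  · rw [← hX, ← hA, commutatorElement_def]; simp only [Units.val_one, zpow_one]; group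
  · rw [← hX, ← hY]; group
  · rw [← hB]; group

end

end SurfaceProduct

namespace SurfaceProduct

variable {k m : ℕ} {ε : ℝ}

/-! ### Paths from the base point to the tori -/

theorem arc_eq (i : ZMod k) (τ : I) : ∃ s t : ℝ, s ∈ Set.Icc (1 / 2 : ℝ) (5 / 8) ∧ t ∈ Set.Icc (0 : ℝ) (1 / 4) ∧ arc i τ = pt i (s, t) := by
  have := ((convex_Icc (1 / 2 : ℝ) (5 / 8)).prod (convex_Icc (0 : ℝ) (1 / 4))).lineMap_mem (x := (1 / 2, 0)) (y := (5 / 8, 1 / 4))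
    (by constructor <;> norm_num) (by constructor <;> norm_num) τ.2
  exact ⟨_, _, this.1, this.2, rfl⟩

theorem le_dist_horiz_arc (i i' : ZMod k) {c : ℝ} {hc : c ∈ Set.Icc (1 / 16 : ℝ) (15 / 16)} (h : 1 / 2 ≤ c) (τ : I) :
    1 / 16 ≤ (Curve.horiz i' c hc).dist (arc i τ) := by
  obtain ⟨s, t, hs, ht, e⟩ := arc_eq i τ
  rw [e]
  refine Curve.le_dist_pt _ _ ⟨⟨by linarith [hs.1], by linarith [hs.2]⟩, ht.1, by linarith [ht.2]⟩ le_rfl fun _ => le_abs.2 (Or.inr ?_)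
  simp only [Curve.height, Curve.level]
  linarith [ht.2]

theorem le_dist_vert_arc (i i' : ZMod k) {c : ℝ} {hc : c ∈ Set.Icc (9 / 16 : ℝ) (15 / 16)} (h : 3 / 4 ≤ c) (τ : I) :
    1 / 16 ≤ (Curve.vert i' c hc).dist (arc i τ) := by
  obtain ⟨s, t, hs, ht, e⟩ := arc_eq i τ
  rw [e]
  refine Curve.le_dist_pt _ _ ⟨⟨by linarith [hs.1], by linarith [hs.2]⟩, ht.1, by linarith [ht.2]⟩ le_rfl fun _ => le_abs.2 (Or.inr ?_)
  simp only [Curve.height, Curve.level]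
  linarith [hs.2]

theorem not_mem_tube_Iio_of_le (hε : 0 < ε) (hε' : ε < 1 / 16) {C : Curve k} {C' : Curve m} {P : Surface k} {Q : Surface m}
    (h : ε ^ 2 ≤ C.dist P ^ 2 + C'.dist Q ^ 2) : (P, Q) ∉ tube C C' (Set.Iio (ε ^ 2)) := by
  rw [mem_tube_Iio hε hε', not_lt]
  exact h

theorem tube_boundary_avoids (hε : 0 < ε) (hε' : ε < 1 / 16) {J : Type} {C : J → Curve k × Curve m}
    (hC : ∀ j j', j ≠ j' → (C j).1.Apart (C j').1 ∨ (C j).2.Apart (C j').2) (j j' : J) {z : Surface k × Surface m}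
    (hz : z ∈ tube (C j).1 (C j).2 {ε ^ 2}) : z ∉ tube (C j').1 (C j').2 (Set.Iio (ε ^ 2)) := by
  rw [mem_tube_singleton hε hε'] at hz
  rcases eq_or_ne j j' with rfl | h
  · rw [mem_tube_Iio hε hε', hz]
    exact lt_irrefl _
  · intro h'
    rw [mem_tube_Iio hε hε'] at h'
    exact Set.disjoint_left.1 (disjoint_tube hε hε' (hC j j' h)) ((mem_tube_Iic hε hε' z).2 hz.le) ((mem_tube_Iic hε hε' z).2 h'.le)

/-! #### The punctured torus -/

section Punctured

variable (hε : 0 < ε) (hε' : ε < 1 / 16) (i : ZMod k)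

include hε hε'

theorem mem_punctured_of_reach (P : Surface k) (Q : Surface 1) (hQ : Q ∈ reachRegion (0 : ZMod 1))
    (hT : ∀ i, ε ^ 2 ≤ (curveX i).dist P ^ 2 + (curveX (0 : ZMod 1)).dist Q ^ 2) (hL : ∀ i, ε ^ 2 ≤ (curveY i).dist P ^ 2 + (curveX' (0 : ZMod 1)).dist Q ^ 2) :
    (P, Q) ∈ puncturedComplement k ε := by
  obtain ⟨s, t, -, -, h, rfl⟩ := hQ
  refine ⟨pt_not_mem_disc h, ?_⟩
  rintro (i | i)
  · exact not_mem_tube_Iio_of_le hε hε' (hT i)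
  · exact not_mem_tube_Iio_of_le hε hε' (hL i)

theorem tube_subset_punctured (j : PuncturedIndex k) : tube (puncturedTori j).1 (puncturedTori j).2 {ε ^ 2} ⊆ puncturedComplement k ε := by
  intro z hz
  refine ⟨fun hd => ?_, fun j' => tube_boundary_avoids hε hε' (fun _ _ => apart_puncturedTori) j j' hz⟩
  rw [mem_tube_singleton hε hε', dist_puncturedTori_of_mem_disc j hd] at hz
  nlinarith [sq_nonneg ((puncturedTori j).1.dist z.1)]

theorem mem_punctured_arc (τ : I) {Q : Surface 1} (hQ : Q ∉ disc) : (arc i τ, Q) ∈ puncturedComplement k ε := by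
  refine ⟨hQ, ?_⟩
  rintro (i' | i')
  · exact not_mem_tube_left hε hε' (le_dist_horiz_arc i i' (by norm_num) τ) Q
  · exact not_mem_tube_left hε hε' (le_dist_vert_arc i i' (by norm_num) τ) Q

open Holonomy

/-- The holonomy in the complement of the tori, over the punctured torus. -/
theorem punctured_reach : let h := ofBase (puncturedComplement k ε) (puncturedBase k hε hε')
    ∃ E, h.Reaches (base k, pt 0 (5 / 8, 1 / 4)) (pt i (5 / 8, 1 / 4), pt 0 (5 / 8, 1 / 4)) E ∧
      E⁻¹ * h.left (xLoop i).toContinuousMap (pt 0 (5 / 8, 1 / 4)) * E = pX hε hε' i ∧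
      E⁻¹ * h.left (yLoop i).toContinuousMap (pt 0 (5 / 8, 1 / 4)) * E = pY hε hε' i ∧
      E⁻¹ * h.right (pt i (5 / 8, 1 / 4)) (xLoop 0).toContinuousMap * E = pA k hε hε' ∧
      E⁻¹ * h.right (pt i (5 / 8, 1 / 4)) (yLoop 0).toContinuousMap * E = pB k hε hε' := by
  intro h
  have hF := mem_puncturedComplement_F (k := k) hε hε'
  have ha : ∀ {Q}, Q ∉ disc → ∀ τ, (arc i τ, Q) ∈ puncturedComplement k ε := fun hQ τ => mem_punctured_arc hε hε' i τ hQ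
  refine ⟨h.left (arc i).toContinuousMap (pt 0 (5 / 8, 1 / 4)), ⟨(arc i).prod (Path.refl _), fun τ => hF _, hol_prod_refl _ _⟩, ?_, ?_, ?_, ?_⟩
  · refine (left_conj (arc i) (xLoop i) (fun τ => hF _) fun τ => hF _).symm.trans ((hol_prod_refl (xTilde i) _).symm.trans ?_)
    exact ofBase_loop _ _ _
  · refine (left_conj (arc i) (yLoop i) (fun τ => hF _) fun τ => hF _).symm.trans ((hol_prod_refl (yTilde i) _).symm.trans ?_)
    exact ofBase_loop _ _ _
  -- Over the arc in `F` no torus is met, so curves of the punctured torus can be moved along it to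
  -- the base point.
  · have := right_transport (h := h) (α := (arc i).toContinuousMap) (β := (xLoop 0).toContinuousMap) (by simp) fun τ υ => ha (xLoop_not_mem_disc υ) τ
    simp only [Path.coe_toContinuousMap, Path.source, Path.target] at this
    refine this.trans ((hol_refl_prod _ (xLoop 0)).symm.trans ?_)
    exact ofBase_loop _ _ fun τ => mem_puncturedComplement_G hε hε' (xLoop_not_mem_disc τ)
  · have := right_transport (h := h) (α := (arc i).toContinuousMap) (β := (yLoop 0).toContinuousMap) (by simp) fun τ υ => ha (yLoop_not_mem_disc υ) τ
    simp only [Path.coe_toContinuousMap, Path.source, Path.target] at this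
    refine this.trans ((hol_refl_prod _ (yLoop 0)).symm.trans ?_)
    exact ofBase_loop _ _ fun τ => mem_puncturedComplement_G hε hε' (yLoop_not_mem_disc τ)

theorem boundaryCurves_punctured_T : BoundaryCurves (curveX i) (curveX (0 : ZMod 1)) ε hε' 1
    (⁅(pB k hε hε')⁻¹, (pY hε hε' i)⁻¹⁆) (pX hε hε' i) (pA k hε hε') := by
  obtain ⟨E, hE, hX, hY, hA, hB⟩ := punctured_reach hε hε' i
  exact boundaryCurves_T hε hε' i 0 (mem_punctured_of_reach hε hε') hE hX hY hA hB (tube_subset_punctured hε hε' (.T i))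

theorem boundaryCurves_punctured_L : BoundaryCurves (curveY i) (curveX' (0 : ZMod 1)) ε hε' (-1)
    (⁅(pX hε hε' i)⁻¹, pB k hε hε'⁆) (pY hε hε' i) (pB k hε hε' * pA k hε hε' * (pB k hε hε')⁻¹) := by
  obtain ⟨E, hE, hX, hY, hA, hB⟩ := punctured_reach hε hε' i
  exact boundaryCurves_L hε hε' i 0 (mem_punctured_of_reach hε hε') hE hX hY hA hB (tube_subset_punctured hε hε' (.L i))

end Punctured

/-! #### The closed surface of genus two -/

section Closed

variable (hε : 0 < ε) (hε' : ε < 1 / 16) (i : ZMod k) (j : ZMod 2)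

include hε hε'

theorem mem_tori_of_le (P : Surface k) (Q : Surface 2)
    (hT : ∀ i, ε ^ 2 ≤ (curveX i).dist P ^ 2 + (curveX (0 : ZMod 2)).dist Q ^ 2) (hL : ∀ i, ε ^ 2 ≤ (curveY i).dist P ^ 2 + (curveX' (0 : ZMod 2)).dist Q ^ 2)
    (h₁ : ε ^ 2 ≤ (curveY (0 : ZMod k)).dist P ^ 2 + (curveX (1 : ZMod 2)).dist Q ^ 2)
    (h₂ : ε ^ 2 ≤ (curveY' (0 : ZMod k)).dist P ^ 2 + (curveY (1 : ZMod 2)).dist Q ^ 2) :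
    (P, Q) ∈ toriComplement k ε := by
  rintro (i | i | _ | _)
  · exact not_mem_tube_Iio_of_le hε hε' (hT i)
  · exact not_mem_tube_Iio_of_le hε hε' (hL i)
  · exact not_mem_tube_Iio_of_le hε hε' h₁
  · exact not_mem_tube_Iio_of_le hε hε' h₂

theorem sq_le_of_sheet {P : Surface k} {Q : Surface 2} {C : Curve k} {C' : Curve 2} {j : ZMod 2} (hj : j ≠ C'.sheet) (hQ : Q ∈ reachRegion j) :
    ε ^ 2 ≤ C.dist P ^ 2 + C'.dist Q ^ 2 := by
  obtain ⟨s, t, hs, ht, -, rfl⟩ := hQ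
  exact sq_le_right _ hε (hε'.le.trans (C'.le_dist_of_sheet_ne hj hs ht))

theorem mem_tori_of_reach₀ (P : Surface k) (Q : Surface 2) (hQ : Q ∈ reachRegion (0 : ZMod 2))
    (hT : ∀ i, ε ^ 2 ≤ (curveX i).dist P ^ 2 + (curveX (0 : ZMod 2)).dist Q ^ 2) (hL : ∀ i, ε ^ 2 ≤ (curveY i).dist P ^ 2 + (curveX' (0 : ZMod 2)).dist Q ^ 2) :
    (P, Q) ∈ toriComplement k ε :=
  mem_tori_of_le hε hε' P Q hT hL (sq_le_of_sheet hε hε' (by decide) hQ) (sq_le_of_sheet hε hε' (by decide) hQ)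

theorem mem_tori_of_reach₁ (P : Surface k) (Q : Surface 2) (hQ : Q ∈ reachRegion (1 : ZMod 2))
    (h₁ : ε ^ 2 ≤ (curveY (0 : ZMod k)).dist P ^ 2 + (curveX (1 : ZMod 2)).dist Q ^ 2)
    (h₂ : ε ^ 2 ≤ (curveY' (0 : ZMod k)).dist P ^ 2 + (curveY (1 : ZMod 2)).dist Q ^ 2) :
    (P, Q) ∈ toriComplement k ε :=
  mem_tori_of_le hε hε' P Q (fun _ => sq_le_of_sheet hε hε' (by decide) hQ) (fun _ => sq_le_of_sheet hε hε' (by decide) hQ) h₁ h₂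

theorem tube_subset_tori (j : TorusIndex k) : tube (tori j).1 (tori j).2 {ε ^ 2} ⊆ toriComplement k ε := fun _ hz j' =>
  tube_boundary_avoids hε hε' (fun _ _ => apart_tori) j j' hz

theorem mem_tori_arc_left (τ : I) (Q : Surface 2) : (arc i τ, Q) ∈ toriComplement k ε := by
  rintro (i' | i' | _ | _)
  · exact not_mem_tube_left hε hε' (le_dist_horiz_arc i i' (by norm_num) τ) Q
  · exact not_mem_tube_left hε hε' (le_dist_vert_arc i i' (by norm_num) τ) Q
  · exact not_mem_tube_left hε hε' (le_dist_vert_arc i 0 (by norm_num) τ) Q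
  · exact not_mem_tube_left hε hε' (le_dist_vert_arc i 0 (by norm_num) τ) Q

theorem mem_tori_arc_right (P : Surface k) (τ : I) : (P, arc j τ) ∈ toriComplement k ε := by
  rintro (i' | i' | _ | _)
  · exact not_mem_tube_right hε hε' P (le_dist_horiz_arc j 0 (by norm_num) τ)
  · exact not_mem_tube_right hε hε' P (le_dist_horiz_arc j 0 (by norm_num) τ)
  · exact not_mem_tube_right hε hε' P (le_dist_horiz_arc j 1 (by norm_num) τ)
  · exact not_mem_tube_right hε hε' P (le_dist_vert_arc j 1 (by norm_num) τ)

open Holonomy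

/-- The holonomy in the complement of the tori, over the closed surface of genus two. -/
theorem tori_reach : let h := ofBase (toriComplement k ε) (toriBase k hε hε')
    ∃ E, h.Reaches (base k, base 2) (pt i (5 / 8, 1 / 4), pt j (5 / 8, 1 / 4)) E ∧
      E⁻¹ * h.left (xLoop i).toContinuousMap (pt j (5 / 8, 1 / 4)) * E = cX hε hε' i ∧
      E⁻¹ * h.left (yLoop i).toContinuousMap (pt j (5 / 8, 1 / 4)) * E = cY hε hε' i ∧
      E⁻¹ * h.right (pt i (5 / 8, 1 / 4)) (xLoop j).toContinuousMap * E = cA k hε hε' j ∧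
      E⁻¹ * h.right (pt i (5 / 8, 1 / 4)) (yLoop j).toContinuousMap * E = cB k hε hε' j := by
  intro h
  have hl := mem_tori_arc_left (k := k) hε hε' i
  have hr := mem_tori_arc_right (k := k) hε hε' j
  have hF := mem_toriComplement_F (k := k) hε hε'
  have hp : ∀ Q, (pt i (5 / 8, 1 / 4), Q) ∈ toriComplement k ε := fun Q => by simpa using hl 1 Q
  have left : ∀ γ : Path (pt i (5 / 8, 1 / 4)) (pt i (5 / 8, 1 / 4)), (h.right (pt i (5 / 8, 1 / 4)) (arc j).toContinuousMap * h.left (arc i).toContinuousMap (base 2))⁻¹ *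
      h.left γ.toContinuousMap (pt j (5 / 8, 1 / 4)) * (h.right (pt i (5 / 8, 1 / 4)) (arc j).toContinuousMap * h.left (arc i).toContinuousMap (base 2)) =
      h.hol (((arc i).trans (γ.trans (arc i).symm)).prod (Path.refl (base 2))).toContinuousMap := fun γ => by
    have := left_transport (h := h) (α := γ.toContinuousMap) (β := (arc j).toContinuousMap) (by simp) fun τ υ => hr _ _
    simp only [Path.coe_toContinuousMap, Path.source, Path.target] at this
    rw [hol_prod_refl, left_conj (arc i) γ (fun τ => hF _) fun τ => hF _, ← this]
    group
  have right : ∀ γ : Path (pt j (5 / 8, 1 / 4)) (pt j (5 / 8, 1 / 4)), (h.right (pt i (5 / 8, 1 / 4)) (arc j).toContinuousMap * h.left (arc i).toContinuousMap (base 2))⁻¹ *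
      h.right (pt i (5 / 8, 1 / 4)) γ.toContinuousMap * (h.right (pt i (5 / 8, 1 / 4)) (arc j).toContinuousMap * h.left (arc i).toContinuousMap (base 2)) =
      h.hol ((Path.refl (base k)).prod ((arc j).trans (γ.trans (arc j).symm))).toContinuousMap := fun γ => by
    have := right_transport (h := h) (α := (arc i).toContinuousMap) (β := ((arc j).trans (γ.trans (arc j).symm)).toContinuousMap) (by simp) fun τ υ => hl _ _
    simp only [Path.coe_toContinuousMap, Path.source, Path.target] at this
    rw [hol_refl_prod, ← this, right_conj (arc j) γ (fun τ => hp _) fun τ => hp _]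
    group
  -- First the arc in `F`, then the arc in `G`. Every torus is avoided over either arc, whatever the
  -- other coordinate is.
  refine ⟨h.right (pt i (5 / 8, 1 / 4)) (arc j).toContinuousMap * h.left (arc i).toContinuousMap (base 2),
    Reaches.trans ⟨(arc i).prod (Path.refl _), fun τ => hF _, hol_prod_refl _ _⟩ ⟨(Path.refl _).prod (arc j), fun τ => hp _, hol_refl_prod _ _⟩, ?_, ?_, ?_, ?_⟩
  · exact (left (xLoop i)).trans (ofBase_loop _ _ _)
  · exact (left (yLoop i)).trans (ofBase_loop _ _ _)
  · exact (right (xLoop j)).trans (ofBase_loop _ _ _)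
  · exact (right (yLoop j)).trans (ofBase_loop _ _ _)

theorem boundaryCurves_tori_T : BoundaryCurves (curveX i) (curveX (0 : ZMod 2)) ε hε' 1
    (⁅(cB k hε hε' 0)⁻¹, (cY hε hε' i)⁻¹⁆) (cX hε hε' i) (cA k hε hε' 0) := by
  obtain ⟨E, hE, hX, hY, hA, hB⟩ := tori_reach hε hε' i 0
  exact boundaryCurves_T hε hε' i 0 (mem_tori_of_reach₀ hε hε') hE hX hY hA hB (tube_subset_tori hε hε' (.T i))

theorem boundaryCurves_tori_L : BoundaryCurves (curveY i) (curveX' (0 : ZMod 2)) ε hε' (-1)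
    (⁅(cX hε hε' i)⁻¹, cB k hε hε' 0⁆) (cY hε hε' i) (cB k hε hε' 0 * cA k hε hε' 0 * (cB k hε hε' 0)⁻¹) := by
  obtain ⟨E, hE, hX, hY, hA, hB⟩ := tori_reach hε hε' i 0
  exact boundaryCurves_L hε hε' i 0 (mem_tori_of_reach₀ hε hε') hE hX hY hA hB (tube_subset_tori hε hε' (.L i))

theorem boundaryCurves_tori_J₁ : BoundaryCurves (curveY (0 : ZMod k)) (curveX (1 : ZMod 2)) ε hε' 1
    (⁅(cX hε hε' (0 : ZMod k))⁻¹, (cB k hε hε' 1)⁻¹⁆) (cY hε hε' (0 : ZMod k)) (cA k hε hε' 1) := by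
  obtain ⟨E, hE, hX, hY, hA, hB⟩ := tori_reach hε hε' (0 : ZMod k) 1
  exact boundaryCurves_J₁ hε hε' 0 1 (mem_tori_of_reach₁ hε hε') hE hX hY hA hB (tube_subset_tori hε hε' .J₁)

theorem boundaryCurves_tori_J₂ : BoundaryCurves (curveY' (0 : ZMod k)) (curveY (1 : ZMod 2)) ε hε' (-1)
    (⁅(cA k hε hε' 1)⁻¹, cX hε hε' (0 : ZMod k)⁆)
    (cX hε hε' (0 : ZMod k) * cY hε hε' (0 : ZMod k) * (cX hε hε' (0 : ZMod k))⁻¹) (cB k hε hε' 1) := by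
  obtain ⟨E, hE, hX, hY, hA, hB⟩ := tori_reach hε hε' (0 : ZMod k) 1
  exact boundaryCurves_J₂ hε hε' 0 1 (mem_tori_of_reach₁ hε hε') hE hX hY hA hB (tube_subset_tori hε hε' .J₂)

/-- The product torus of `y_i` and `b_2` lies in the complement: the curve `y_i` is away from `Y_1`
and `Y'_1`, and `b_2` lies in the second square of `G`, away from `A_1` and `A'_1`. So the two
curves commute. -/
theorem commutator_cB_cY : ⁅cB k hε hε' 1, cY hε hε' i⁆ = 1 := by
  obtain ⟨E, hE, -, hY, -, hB⟩ := tori_reach hε hε' i 1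
  have key := left_mul_right (h := ofBase (toriComplement k ε) (toriBase k hε hε')) (α := (yLoop i).toContinuousMap) (β := (yLoop (1 : ZMod 2)).toContinuousMap)
    fun τ υ => by
      rw [Path.coe_toContinuousMap, Path.coe_toContinuousMap, show yLoop i τ = _ from vLoop_eq i (by norm_num) (by norm_num) τ,
        show yLoop (1 : ZMod 2) υ = _ from vLoop_eq 1 (by norm_num) (by norm_num) υ]
      exact mem_tori_of_reach₁ hε hε' _ _ (vChart_mem_reachRegion 1 (by norm_num) _)
        (sq_le_left _ hε (hε'.le.trans (Curve.le_dist_vert_vChart le_rfl (by norm_num) (le_abs.2 (Or.inr (by norm_num))))))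
        (sq_le_left _ hε (hε'.le.trans (Curve.le_dist_vert_vChart le_rfl (by norm_num) (le_abs.2 (Or.inr (by norm_num))))))
  simp only [Path.coe_toContinuousMap, Path.source, Path.target] at key
  rw [commutatorElement_eq_one_iff_mul_comm, ← hY, ← hB]
  calc _ = E⁻¹ * ((ofBase (toriComplement k ε) (toriBase k hε hε')).right (pt i (5 / 8, 1 / 4)) (yLoop 1).toContinuousMap *
        (ofBase (toriComplement k ε) (toriBase k hε hε')).left (yLoop i).toContinuousMap (pt 1 (5 / 8, 1 / 4))) * E := by group
    _ = _ := by rw [← key]; group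

end Closed

end SurfaceProduct

open SurfaceProduct in
theorem mainTheorem6 (k : ℕ) (hk : 1 ≤ k) (ε : ℝ) (hε : 0 < ε) (hε' : ε < 1 / 16) :
    -- the product of a closed surface of genus `k` with a punctured torus
    ((∀ j : PuncturedIndex k, ParallelsLagrangian (puncturedTori j).1 (puncturedTori j).2 ∧
          WeinsteinCoord (puncturedTori j).1 (puncturedTori j).2) ∧
      (∀ j j' : PuncturedIndex k, j ≠ j' →
        Disjoint (tube (puncturedTori j).1 (puncturedTori j).2 (Set.Iic (ε ^ 2)))
          (tube (puncturedTori j').1 (puncturedTori j').2 (Set.Iic (ε ^ 2)))) ∧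
      Subgroup.normalClosure (Set.range (pX (k := k) hε hε') ∪ Set.range (pY (k := k) hε hε') ∪
        {pA k hε hε', pB k hε hε'}) = ⊤ ∧
      (∀ i : ZMod k, BoundaryCurves (curveX i) (curveX (0 : ZMod 1)) ε hε' 1
        (⁅(pB k hε hε')⁻¹, (pY hε hε' i)⁻¹⁆) (pX hε hε' i) (pA k hε hε')) ∧
      (∀ i : ZMod k, BoundaryCurves (curveY i) (curveX' (0 : ZMod 1)) ε hε' (-1)
        (⁅(pX hε hε' i)⁻¹, pB k hε hε'⁆) (pY hε hε' i)
        (pB k hε hε' * pA k hε hε' * (pB k hε hε')⁻¹))) ∧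
    -- the product of a closed surface of genus `k` with a closed surface of genus two
    ((∀ j : TorusIndex k, ParallelsLagrangian (tori j).1 (tori j).2 ∧
          WeinsteinCoord (tori j).1 (tori j).2) ∧
      (∀ j j' : TorusIndex k, j ≠ j' →
        Disjoint (tube (tori j).1 (tori j).2 (Set.Iic (ε ^ 2)))
          (tube (tori j').1 (tori j').2 (Set.Iic (ε ^ 2)))) ∧
      Subgroup.normalClosure (Set.range (cX (k := k) hε hε') ∪ Set.range (cY (k := k) hε hε') ∪
        Set.range (cA k hε hε') ∪ Set.range (cB k hε hε')) = ⊤ ∧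
      (∀ i : ZMod k, BoundaryCurves (curveX i) (curveX (0 : ZMod 2)) ε hε' 1
        (⁅(cB k hε hε' 0)⁻¹, (cY hε hε' i)⁻¹⁆) (cX hε hε' i) (cA k hε hε' 0)) ∧
      (∀ i : ZMod k, BoundaryCurves (curveY i) (curveX' (0 : ZMod 2)) ε hε' (-1)
        (⁅(cX hε hε' i)⁻¹, cB k hε hε' 0⁆) (cY hε hε' i)
        (cB k hε hε' 0 * cA k hε hε' 0 * (cB k hε hε' 0)⁻¹)) ∧
      BoundaryCurves (curveY (0 : ZMod k)) (curveX (1 : ZMod 2)) ε hε' 1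
        (⁅(cX hε hε' (0 : ZMod k))⁻¹, (cB k hε hε' 1)⁻¹⁆) (cY hε hε' (0 : ZMod k)) (cA k hε hε' 1) ∧
      BoundaryCurves (curveY' (0 : ZMod k)) (curveY (1 : ZMod 2)) ε hε' (-1)
        (⁅(cA k hε hε' 1)⁻¹, cX hε hε' (0 : ZMod k)⁆)
        (cX hε hε' (0 : ZMod k) * cY hε hε' (0 : ZMod k) * (cX hε hε' (0 : ZMod k))⁻¹) (cB k hε hε' 1) ∧
      ∀ i : ZMod k, ⁅cB k hε hε' 1, cY hε hε' i⁆ = 1) := by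
  refine ⟨⟨fun j => ⟨parallelsLagrangian _ _, weinsteinCoord _ _⟩, fun j j' h => disjoint_tube hε hε' (apart_puncturedTori h),
    normalClosure_punctured hk hε hε', boundaryCurves_punctured_T hε hε', boundaryCurves_punctured_L hε hε'⟩,
    fun j => ⟨parallelsLagrangian _ _, weinsteinCoord _ _⟩, fun j j' h => disjoint_tube hε hε' (apart_tori h),
    normalClosure_tori hk hε hε', boundaryCurves_tori_T hε hε', boundaryCurves_tori_L hε hε', boundaryCurves_tori_J₁ hε hε',
    boundaryCurves_tori_J₂ hε hε', commutator_cB_cY hε hε'⟩
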